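/- Let $X$ be a compact complex manifold, let $E$ and $L$ be holomorphic vector bundles on $X$, $r=\operatorname{rk}E$, and let $\theta\in H^0(X,\mathcal End(E)\otimes L)$ satisfy $\theta\wedge\theta=0$ in $H^0(X,\mathcal End(E)\otimes\bigwedge^2L)$, i.e. $(E,L,\theta)$ is a Hitchin pair. Let $M=\bigoplus_{p,q}A_X^{0,p}(\mathcal End(E)\otimes\bigwedge^qL)$ be the differential graded Lie algebra of smooth forms, where $A_X^{0,p}(\mathcal End(E)\otimes\bigwedge^qL)$ has degree $p+q$, with $$d=\bar\partial+[\theta,-],\qquad [\omega\otimes f,\omega'\otimes f']=(-1)^{\deg\omega'\deg f}\,\omega\wedge\omega'\otimes[f,f'],\qquad [\phi\otimes h,\psi\otimes l]=[\phi,\psi]\otimes h\wedge l,$$ and let $N=\bigoplus_{k=1}^rA_X^{0,*}(\bigodot^kL)[-1]$ be the abelian differential graded Lie algebra in which $A_X^{0,p}(\bigodot^kL)$ has degree $p+1$, with differential $\bar\partial$ and zero bracket. (These are indeed differential graded Lie algebras.) A differential graded Lie algebra $V$ is regarded as an $L_\infty$-algebra with brackets $q_1(x)=-dx$, $q_2(x\odot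 y)=(-1)^{\deg x}[x,y]$ ($\deg x$ the degree in $V$) and $q_k=0$ for $k\ge3$ on $V[1]$. An $L_\infty$-morphism $V\to W$ is a sequence of degree $0$ linear maps $\bigodot^nV[1]\to W[1]$, $n\ge1$, such that the induced morphism of reduced symmetric coalgebras $\overline{S(V[1])}\to\overline{S(W[1])}$ commutes with the codifferentials induced by the brackets. For $n\ge1$ and $1\le k\le r$ there is a well-defined degree $0$ linear map $g^k_n:\bigodot^n(M[1])\to A_X^{0,*}(\bigodot^kL)$ which is zero as soon as one of the arguments lies in $A_X^{0,*}(\mathcal End(E)\otimes\bigwedge^qL)$ with $q\ne1$, and which is given for $f_i\in\mathcal End(E)\otimes L$ by $$g^k_n((\omega_1\otimes f_1)\odot\cdots\odot(\omega_n\otimes f_n))=\omega_1\wedge\cdots\wedge\omega_n\otimes\big(\text{the coefficient of }t_1\cdots t_n\text{ in }\operatorname{tr}\big((\theta+t_1f_1+\cdots+t_nf_n)^k\big)\big),$$ the powers being taken in the associative algebra $\mathcal End(E)\otimes\bigodot^*L$. Then the maps $h_n=(g^1_n,\dots,g^r_n):\bigodot^n(M[1])\to N[1]=\bigoplus_{k=1}^rA_X^{0,*}(\bigodot^kL)$,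 $n\ge1$, define an $L_\infty$-morphism $h:M\to N$. -/

import Mathlib

open scoped TensorProduct DirectSum Manifold ContDiff

noncomputable section

/-! ## Graded symmetric powers and the reduced symmetric coalgebra -/

section Symmetric

variable {V : Type*} [AddCommGroup V] [Module ℂ V]

/-- The part `I ∩ ⨂ⁿ V` in tensor degree `n` of the ideal `I` of the tensor algebra generated by
`v ⊗ w - (-1) ^ (deg v * deg w) • w ⊗ v`, with `v`, `w` homogeneous for the grading `gr`. -/
def koszulRel (gr : ℤ → Submodule ℂ V) (n : ℕ) : Submodule ℂ (⨂[ℂ]^n V) :=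
  Submodule.span ℂ {t | ∃ (v : Fin n → V) (a : Fin n → ℤ), (∀ i, v i ∈ gr (a i)) ∧
    ∃ i j : Fin n, (i : ℕ) + 1 = j ∧
      t = PiTensorProduct.tprod ℂ v -
        (a i * a j).negOnePow • PiTensorProduct.tprod ℂ (v ∘ Equiv.swap i j)}

/-- The graded symmetric power `⨀ⁿ V` of the graded vector space `V = ⨁ i, gr i`. -/
abbrev SymPow (gr : ℤ → Submodule ℂ V) (n : ℕ) : Type _ := (⨂[ℂ]^n V) ⧸ koszulRel gr n

/-- The product `v₁ ⊙ ⋯ ⊙ vₙ`. -/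
def sprod (gr : ℤ → Submodule ℂ V) {n : ℕ} (v : Fin n → V) : SymPow gr n :=
  (koszulRel gr n).mkQ (PiTensorProduct.tprod ℂ v)

/-- A multilinear map that is graded symmetric under the exchange of neighbouring homogeneous
arguments, as a linear map on `⨀ⁿ V`. -/
def SymPow.lift (gr : ℤ → Submodule ℂ V) {W : Type*} [AddCommGroup W] [Module ℂ W] {n : ℕ}
    (f : MultilinearMap ℂ (fun _ : Fin n => V) W)
    (hf : ∀ (v : Fin n → V) (a : Fin n → ℤ), (∀ i, v i ∈ gr (a i)) →
      ∀ i j : Fin n, (i : ℕ) + 1 = j →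
        f v = (a i * a j).negOnePow • f (v ∘ Equiv.swap i j)) :
    SymPow gr n →ₗ[ℂ] W :=
  (koszulRel gr n).liftQ (PiTensorProduct.lift f) (by
    refine Submodule.span_le.2 ?_
    rintro t ⟨v, a, hv, i, j, hij, rfl⟩
    have h := hf v a hv i j hij
    rcases Int.units_eq_one_or (a i * a j).negOnePow with h1 | h1 <;>
      simp [h1] at h ⊢ <;> simp [h])

/-- The underlying space `⨁ n ≥ 1, ⨀ⁿ V` of the reduced symmetric coalgebra; the summand with
index `n` is `⨀ⁿ⁺¹ V`. -/
abbrev RedSym (gr : ℤ → Submodule ℂ V) : Type _ := ⨁ n : ℕ, SymPow gr (n + 1)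

/-- The subfamily of `v` with indices in `I`, in increasing order. -/
def subfamily {n : ℕ} (v : Fin n → V) (I : Finset (Fin n)) : Fin I.card → V :=
  fun i => v (I.orderEmbOfFin rfl i)

/-- The Koszul sign of the permutation that sorts homogeneous vectors `v₁, …, vₙ` of degrees
`a₁, …, aₙ` into consecutive blocks, `vᵢ` going to block number `c i`, and that keeps the order
inside every block (an unshuffle): the product of `(-1) ^ (aᵢ * aⱼ)` over its inversions. -/
def koszulSign {n m : ℕ} (a : Fin n → ℤ) (c : Fin n → Fin m) : ℤˣ :=
  ∏ p : Fin n × Fin n with p.1 < p.2 ∧ c p.2 < c p.1, (a p.1 * a p.2).negOnePow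

/-- The unshuffle that moves the indices of `I` to the front. -/
def frontBlock {n : ℕ} (I : Finset (Fin n)) : Fin n → Fin 2 := fun i => if i ∈ I then 0 else 1

/-- `Q` is the coderivation of the reduced symmetric coalgebra induced by `q = ∑ₖ qₖ`:
`Q (v₁ ⊙ ⋯ ⊙ vₙ) = ∑ₖ ∑_σ ε(σ) qₖ(v_σ(1) ⊙ ⋯ ⊙ v_σ(k)) ⊙ v_σ(k+1) ⊙ ⋯ ⊙ v_σ(n)`, summed over
`1 ≤ k ≤ n` and the `(k, n - k)`-unshuffles `σ`, which correspond to the `k`-element subsets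
`I = {σ(1), …, σ(k)}`. -/
def IsInducedCoderivation (gr : ℤ → Submodule ℂ V) (q : ∀ k, SymPow gr k →ₗ[ℂ] V)
    (Q : RedSym gr →ₗ[ℂ] RedSym gr) : Prop :=
  ∀ (n : ℕ) (v : Fin (n + 1) → V) (a : Fin (n + 1) → ℤ), (∀ i, v i ∈ gr (a i)) →
    Q (DirectSum.lof ℂ ℕ (fun n => SymPow gr (n + 1)) n (sprod gr v)) =
      ∑ I : Finset (Fin (n + 1)) with I.Nonempty,
        koszulSign a (frontBlock I) •
          DirectSum.lof ℂ ℕ (fun n => SymPow gr (n + 1)) Iᶜ.card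
            (sprod gr (Fin.cons (q I.card (sprod gr (subfamily v I))) (subfamily v Iᶜ) :
              Fin (Iᶜ.card + 1) → V))

/-- `F` is the morphism of reduced symmetric coalgebras induced by `f = ∑ₖ fₖ`, that is
`F = ∑ₘ (1 / m!) f^{⊙ m} ∘ π ∘ Δ^{m-1}`: the iterated coproduct `Δ^{m-1}` of `v₁ ⊙ ⋯ ⊙ vₙ` is
the signed sum over all distributions of the `n` factors on `m` non-empty consecutive blocks
(`m` is written `m + 1` below). -/
def IsInducedMorphism {W : Type*} [AddCommGroup W] [Module ℂ W] (gr : ℤ → Submodule ℂ V)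
    (gr' : ℤ → Submodule ℂ W) (f : ∀ k, SymPow gr k →ₗ[ℂ] W)
    (F : RedSym gr →ₗ[ℂ] RedSym gr') : Prop :=
  ∀ (n : ℕ) (v : Fin (n + 1) → V) (a : Fin (n + 1) → ℤ), (∀ i, v i ∈ gr (a i)) →
    F (DirectSum.lof ℂ ℕ (fun n => SymPow gr (n + 1)) n (sprod gr v)) =
      ∑ m ∈ Finset.range (n + 1), ((m + 1).factorial : ℂ)⁻¹ •
        ∑ c : Fin (n + 1) → Fin (m + 1) with Function.Surjective c,
          koszulSign a c •
            DirectSum.lof ℂ ℕ (fun m => SymPow gr' (m + 1)) m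
              (sprod gr' fun j => f (Finset.univ.filter fun i => c i = j).card
                (sprod gr (subfamily v (Finset.univ.filter fun i => c i = j))))

/-- The grading of `V[1]`: `V[1]^i = V^{i+1}`. -/
def shiftGr (gr : ℤ → Submodule ℂ V) : ℤ → Submodule ℂ V := fun i => gr (i + 1)

/-- The brackets `q k : ⨀ᵏ V[1] → V[1]`, `k ≥ 1`, of degree `1` make the graded vector space
`V = ⨁ i, gr i` an `L∞`-algebra (the index `k = 0` plays no role). -/
structure IsLInftyAlgebra (gr : ℤ → Submodule ℂ V)
    (q : ∀ k, SymPow (shiftGr gr) k →ₗ[ℂ] V) : Prop where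
  isInternal : DirectSum.IsInternal gr
  degree : ∀ (k : ℕ), 1 ≤ k → ∀ (v : Fin k → V) (a : Fin k → ℤ),
    (∀ i, v i ∈ shiftGr gr (a i)) →
      q k (sprod (shiftGr gr) v) ∈ shiftGr gr (∑ i, a i + 1)
  codifferential : ∃ Q : RedSym (shiftGr gr) →ₗ[ℂ] RedSym (shiftGr gr),
    IsInducedCoderivation (shiftGr gr) q Q ∧ Q ∘ₗ Q = 0

/-- The linear maps `f k : ⨀ᵏ V[1] → W[1]`, `k ≥ 1`, of degree `0` form a morphism of
`L∞`-algebras `(V, q) → (W, q')`: the induced morphism of reduced symmetric coalgebras commutes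
with the codifferentials (the index `k = 0` plays no role). -/
structure IsLInftyMorphism {W : Type*} [AddCommGroup W] [Module ℂ W] (gr : ℤ → Submodule ℂ V)
    (q : ∀ k, SymPow (shiftGr gr) k →ₗ[ℂ] V) (gr' : ℤ → Submodule ℂ W)
    (q' : ∀ k, SymPow (shiftGr gr') k →ₗ[ℂ] W)
    (f : ∀ k, SymPow (shiftGr gr) k →ₗ[ℂ] W) : Prop where
  source : IsLInftyAlgebra gr q
  target : IsLInftyAlgebra gr' q'
  degree : ∀ (k : ℕ), 1 ≤ k → ∀ (v : Fin k → V) (a : Fin k → ℤ),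
    (∀ i, v i ∈ shiftGr gr (a i)) →
      f k (sprod (shiftGr gr) v) ∈ shiftGr gr' (∑ i, a i)
  comm : ∃ (Q : RedSym (shiftGr gr) →ₗ[ℂ] RedSym (shiftGr gr))
      (Q' : RedSym (shiftGr gr') →ₗ[ℂ] RedSym (shiftGr gr'))
      (F : RedSym (shiftGr gr) →ₗ[ℂ] RedSym (shiftGr gr')),
    IsInducedCoderivation (shiftGr gr) q Q ∧ IsInducedCoderivation (shiftGr gr') q' Q' ∧
      IsInducedMorphism (shiftGr gr) (shiftGr gr') f F ∧ F ∘ₗ Q = Q' ∘ₗ F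

/-! ## Differential graded Lie algebras -/

/-- A differential graded Lie algebra structure on the complex vector space `V`. -/
structure DGLA (V : Type*) [AddCommGroup V] [Module ℂ V] where
  /-- The homogeneous parts. -/
  gr : ℤ → Submodule ℂ V
  isInternal : DirectSum.IsInternal gr
  /-- The differential. -/
  d : V →ₗ[ℂ] V
  d_mem : ∀ i, ∀ x ∈ gr i, d x ∈ gr (i + 1)
  d_d : ∀ x, d (d x) = 0
  /-- The bracket. -/
  br : V →ₗ[ℂ] V →ₗ[ℂ] V
  br_mem : ∀ i j, ∀ x ∈ gr i, ∀ y ∈ gr j, br x y ∈ gr (i + j)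
  skew : ∀ i j, ∀ x ∈ gr i, ∀ y ∈ gr j, br x y = -((i * j).negOnePow • br y x)
  jacobi : ∀ i j k, ∀ x ∈ gr i, ∀ y ∈ gr j, ∀ z ∈ gr k,
    br x (br y z) = br (br x y) z + (i * j).negOnePow • br y (br x z)
  leibniz : ∀ i j, ∀ x ∈ gr i, ∀ y ∈ gr j,
    d (br x y) = br (d x) y + i.negOnePow • br x (d y)

namespace DGLA

variable (𝔤 : DGLA V)

/-- The linear operator `x ↦ (-1) ^ (deg x) • x`. -/
def sgn : V →ₗ[ℂ] V :=
  DirectSum.toModule ℂ ℤ V (fun i => (i.negOnePow : ℤ) • (𝔤.gr i).subtype) ∘ₗ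
    (LinearEquiv.ofBijective (DirectSum.coeLinearMap 𝔤.gr) 𝔤.isInternal).symm.toLinearMap

theorem sgn_of_mem {i : ℤ} {x : V} (hx : x ∈ 𝔤.gr i) : 𝔤.sgn x = i.negOnePow • x := by
  have h : (LinearEquiv.ofBijective (DirectSum.coeLinearMap 𝔤.gr) 𝔤.isInternal).symm x =
      DirectSum.lof ℂ ℤ (fun i => 𝔤.gr i) i ⟨x, hx⟩ := by
    rw [LinearEquiv.symm_apply_eq]
    exact (DirectSum.coeLinearMap_lof 𝔤.gr i ⟨x, hx⟩).symm
  simp only [sgn, LinearMap.comp_apply, LinearEquiv.coe_coe]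
  rw [h, DirectSum.toModule_lof]
  rfl

/-- The bilinear map `(x, y) ↦ (-1) ^ (deg x) • [x, y]`. -/
def q₂ : MultilinearMap ℂ (fun _ : Fin 2 => V) V :=
  MultilinearMap.mk' (fun v => 𝔤.br (𝔤.sgn (v 0)) (v 1))
    (by intro v i x y; fin_cases i <;> simp [Function.update])
    (by intro v i c x; fin_cases i <;> simp [Function.update])

/-- The `L∞`-brackets of a differential graded Lie algebra: `q₁ x = - d x`,
`q₂ (x ⊙ y) = (-1) ^ (deg x) • [x, y]` with `deg x` the degree in `V`, and `qₖ = 0` otherwise. -/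
def lInfty : ∀ k, SymPow (shiftGr 𝔤.gr) k →ₗ[ℂ] V
  | 1 => SymPow.lift _ (MultilinearMap.ofSubsingleton ℂ V V (0 : Fin 1) (-𝔤.d)) (by
      intro v a hv i j hij; omega)
  | 2 => SymPow.lift _ 𝔤.q₂ (by
      intro v a hv i j hij
      obtain rfl : i = 0 := by omega
      obtain rfl : j = 1 := by omega
      have h0 := hv 0
      have h1 := hv 1
      simp only [shiftGr] at h0 h1
      simp only [q₂, MultilinearMap.mk'_apply, Function.comp_apply, Equiv.swap_apply_left,
        Equiv.swap_apply_right, 𝔤.sgn_of_mem h0, 𝔤.sgn_of_mem h1]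
      rw [map_zsmul_unit, map_zsmul_unit, LinearMap.smul_apply, LinearMap.smul_apply,
        𝔤.skew _ _ _ h0 _ h1]
      have h : -((a 0 + 1).negOnePow * ((a 0 + 1) * (a 1 + 1)).negOnePow) =
          (a 0 * a 1).negOnePow * (a 1 + 1).negOnePow := by
        rw [← Int.negOnePow_add, ← Int.negOnePow_add, ← Int.negOnePow_succ,
          Int.negOnePow_eq_iff]
        exact ⟨a 0 + 1, by ring⟩
      rw [smul_neg, smul_smul, smul_smul, ← h, Units.neg_smul])
  | _ => 0

end DGLA

end Symmetric

/-! ## The pointwise algebra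

`T`, `E`, `L` stand for the fibres at a point of the holomorphic tangent bundle and of the two
vector bundles. -/

section Pointwise

/-- The space of `ℂ`-antilinear functionals on `T`, i.e. of `(0,1)`-covectors. -/
abbrev ConjDual (T : Type*) [AddCommGroup T] [Module ℂ T] : Type _ := T →ₛₗ[starRingEnd ℂ] ℂ

/-- The grading of the exterior algebra by the exterior powers. -/
abbrev extGr (M : Type*) [AddCommGroup M] [Module ℂ M] :
    ℕ → Submodule ℂ (ExteriorAlgebra ℂ M) := fun i => ⋀[ℂ]^i M

/-- The symmetric power `⨀ᵏ M` inside the symmetric algebra. -/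
abbrev symGr (M : Type*) [AddCommGroup M] [Module ℂ M] (k : ℕ) :
    Submodule ℂ (SymmetricAlgebra ℂ M) := LinearMap.range (SymmetricAlgebra.ι ℂ M) ^ k

variable (T E L : Type*) [AddCommGroup T] [Module ℂ T] [AddCommGroup E] [Module ℂ E]
  [AddCommGroup L] [Module ℂ L]

/-- The algebra of `(0,*)`-forms at a point with values in `⋀ L`, with the Koszul rule
`(η ⊗ h) (η' ⊗ h') = (-1) ^ (deg h * deg η') (η ∧ η') ⊗ (h ∧ h')`. -/
abbrev ExtFib : Type _ := extGr (ConjDual T) ᵍ⊗[ℂ] extGr L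

/-- `(0,*)`-forms at a point with values in `End E ⊗ ⋀ L`. -/
abbrev EndFib : Type _ := Module.End ℂ E ⊗[ℂ] ExtFib T L

/-- `(0,*)`-forms at a point with values in the symmetric algebra of `L`. -/
abbrev SymFib : Type _ := ExteriorAlgebra ℂ (ConjDual T) ⊗[ℂ] SymmetricAlgebra ℂ L

variable {T E L}

/-- `η ⊗ f` for a `(0,*)`-form `η` and `f ∈ End E ⊗ ⋀ L`; on `f = φ ⊗ h` it is `φ ⊗ (η ⊗ h)`. -/
def formTensor (η : ExteriorAlgebra ℂ (ConjDual T)) :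
    Module.End ℂ E ⊗[ℂ] ExteriorAlgebra ℂ L →ₗ[ℂ] EndFib T E L :=
  TensorProduct.map LinearMap.id
    ((GradedTensorProduct.of ℂ (extGr (ConjDual T)) (extGr L)).toLinearMap ∘ₗ
      TensorProduct.mk ℂ _ _ η)

/-- The bracket `[φ ⊗ c, ψ ⊗ c'] = [φ, ψ] ⊗ c c'`. Together with the Koszul rule this is
`[η ⊗ f, η' ⊗ f'] = (-1) ^ (deg η' * deg f) (η ∧ η') ⊗ [f, f']`, where
`[φ ⊗ h, ψ ⊗ l] = [φ, ψ] ⊗ (h ∧ l)` on `End E ⊗ ⋀ L`. -/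
def fibBracket : EndFib T E L →ₗ[ℂ] EndFib T E L →ₗ[ℂ] EndFib T E L :=
  TensorProduct.map₂
    (LinearMap.mul ℂ (Module.End ℂ E) - (LinearMap.mul ℂ (Module.End ℂ E)).flip)
    (LinearMap.mul ℂ (ExtFib T L))

variable (T E L) in
/-- The part of total degree `m` of `EndFib`: the span of the forms of type `(0, p)` with values
in `End E ⊗ ⋀^q L`, `p + q = m`. -/
def endFibGr (m : ℤ) : Submodule ℂ (EndFib T E L) :=
  Submodule.span ℂ {y | ∃ (p q : ℕ) (φ : Module.End ℂ E) (η : ExteriorAlgebra ℂ (ConjDual T))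
    (h : ExteriorAlgebra ℂ L), (p : ℤ) + q = m ∧ η ∈ extGr (ConjDual T) p ∧ h ∈ extGr L q ∧
      y = formTensor η (φ ⊗ₜ h)}

variable (T L) in
/-- The forms with values in `⨀ᵏ L`. -/
def symFibPow (k : ℕ) : Submodule ℂ (SymFib T L) :=
  Submodule.span ℂ {y | ∃ (η : ExteriorAlgebra ℂ (ConjDual T)) (s : SymmetricAlgebra ℂ L),
    s ∈ symGr L k ∧ y = η ⊗ₜ s}

variable (T L) in
/-- The forms of type `(0, p)`, `p = m`. -/
def symFibGr (m : ℤ) : Submodule ℂ (SymFib T L) :=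
  Submodule.span ℂ {y | ∃ (p : ℕ) (η : ExteriorAlgebra ℂ (ConjDual T))
    (s : SymmetricAlgebra ℂ L), (p : ℤ) = m ∧ η ∈ extGr (ConjDual T) p ∧ y = η ⊗ₜ s}

/-- The inclusion `End E ⊗ L → End E ⊗ ⋀ L`. -/
def toExt : Module.End ℂ E ⊗[ℂ] L →ₗ[ℂ] Module.End ℂ E ⊗[ℂ] ExteriorAlgebra ℂ L :=
  TensorProduct.map LinearMap.id (ExteriorAlgebra.ι ℂ)

/-- The projection `End E ⊗ ⋀ L → End E ⊗ L` that kills `End E ⊗ ⋀^q L` for `q ≠ 1`. -/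
def degreeOne : Module.End ℂ E ⊗[ℂ] ExteriorAlgebra ℂ L →ₗ[ℂ] Module.End ℂ E ⊗[ℂ] L :=
  TensorProduct.map LinearMap.id ExteriorAlgebra.ιInv

/-- The inclusion of `End E ⊗ L` in the associative algebra `End E ⊗ ⨀ L`. -/
def toSym : Module.End ℂ E ⊗[ℂ] L →ₗ[ℂ] Module.End ℂ E ⊗[ℂ] SymmetricAlgebra ℂ L :=
  TensorProduct.map LinearMap.id (SymmetricAlgebra.ι ℂ L)

/-- The trace `End E ⊗ ⨀ L → ⨀ L`. -/
def symTrace : Module.End ℂ E ⊗[ℂ] SymmetricAlgebra ℂ L →ₗ[ℂ] SymmetricAlgebra ℂ L :=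
  (TensorProduct.lid ℂ _).toLinearMap ∘ₗ TensorProduct.map (LinearMap.trace ℂ E) LinearMap.id

/-- The coefficient of `t₁ ⋯ tₙ` in `tr ((θ + t₁ f₁ + ⋯ + tₙ fₙ)ᵏ)`. The power is taken in the
algebra of polynomials in the commuting variables `tᵢ` with coefficients in the (noncommutative)
algebra `End E ⊗ ⨀ L`. -/
def polarCoeff (k : ℕ) {n : ℕ} (θ : Module.End ℂ E ⊗[ℂ] L)
    (f : Fin n → Module.End ℂ E ⊗[ℂ] L) : SymmetricAlgebra ℂ L :=
  symTrace (((AddMonoidAlgebra.single (0 : Fin n →₀ ℕ) (toSym θ) +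
    ∑ i, AddMonoidAlgebra.single (Finsupp.single i 1) (toSym (f i))) ^ k).coeff
      (∑ i, Finsupp.single i 1))

variable {T' E' L' : Type*} [AddCommGroup T'] [Module ℂ T'] [AddCommGroup E'] [Module ℂ E']
  [AddCommGroup L'] [Module ℂ L']

/-- Transport of `(0,1)`-covectors along an isomorphism of tangent spaces. -/
def conjDualMap (eT : T ≃ₗ[ℂ] T') : ConjDual T →ₗ[ℂ] ConjDual T' where
  toFun φ := φ.comp eT.symm.toLinearMap
  map_add' _ _ := rfl
  map_smul' _ _ := rfl

/-- Transport of `EndFib` along isomorphisms. -/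
def endFibMap (eT : T ≃ₗ[ℂ] T') (eE : E ≃ₗ[ℂ] E') (eL : L ≃ₗ[ℂ] L') :
    EndFib T E L →ₗ[ℂ] EndFib T' E' L' :=
  TensorProduct.map eE.conj.toLinearMap
    ((GradedTensorProduct.of ℂ (extGr (ConjDual T')) (extGr L')).toLinearMap ∘ₗ
      TensorProduct.map (ExteriorAlgebra.map (conjDualMap eT)).toLinearMap
        (ExteriorAlgebra.map eL.toLinearMap).toLinearMap ∘ₗ
      (GradedTensorProduct.of ℂ (extGr (ConjDual T)) (extGr L)).symm.toLinearMap)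

/-- Transport of `SymFib` along isomorphisms. -/
def symFibMap (eT : T ≃ₗ[ℂ] T') (eL : L ≃ₗ[ℂ] L') : SymFib T L →ₗ[ℂ] SymFib T' L' :=
  TensorProduct.map (ExteriorAlgebra.map (conjDualMap eT)).toLinearMap
    (SymmetricAlgebra.lift (SymmetricAlgebra.ι ℂ L' ∘ₗ eL.toLinearMap)).toLinearMap

end Pointwise

/-! ## Smooth functions and the Cauchy-Riemann operator on `ℂⁿ` -/

section Local

variable {n : ℕ} {W : Type*}

/-- Smoothness (in the real sense) on an open subset of `ℂⁿ` of a function whose values lie in a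
finite-dimensional subspace of `W`: all its coordinates are smooth. -/
def SmoothOn [AddCommGroup W] [Module ℂ W] (f : EuclideanSpace ℂ (Fin n) → W)
    (s : Set (EuclideanSpace ℂ (Fin n))) : Prop :=
  ∀ φ : W →ₗ[ℂ] ℂ, ContDiffOn ℝ ∞ (fun z => φ (f z)) s

/-- Holomorphy on an open subset of `ℂⁿ`, coordinatewise. -/
def HolomorphicOn [AddCommGroup W] [Module ℂ W] (f : EuclideanSpace ℂ (Fin n) → W)
    (s : Set (EuclideanSpace ℂ (Fin n))) : Prop :=
  ∀ φ : W →ₗ[ℂ] ℂ, DifferentiableOn ℂ (fun z => φ (f z)) s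

open Classical in
/-- The Wirtinger derivative `∂f/∂z̄_j = (∂f/∂x_j + i ∂f/∂y_j) / 2` of a vector-valued function,
defined coordinatewise. -/
def wirtingerBar [AddCommGroup W] [Module ℂ W] (f : EuclideanSpace ℂ (Fin n) → W) (j : Fin n)
    (z : EuclideanSpace ℂ (Fin n)) : W :=
  if h : ∃ w : W, ∀ φ : W →ₗ[ℂ] ℂ, φ w = (1 / 2 : ℂ) *
      (fderiv ℝ (fun y => φ (f y)) z (EuclideanSpace.single j 1) +
        Complex.I * fderiv ℝ (fun y => φ (f y)) z (EuclideanSpace.single j Complex.I))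
  then h.choose else 0

/-- The antilinear functional `dz̄_j` on `ℂⁿ`. -/
def dzBar (j : Fin n) : ConjDual (EuclideanSpace ℂ (Fin n)) where
  toFun v := starRingEnd ℂ (v j)
  map_add' _ _ := by simp
  map_smul' _ _ := by simp

/-- `∂̄ f = ∑ⱼ dz̄ⱼ ∧ ∂f/∂z̄ⱼ`, where `ε j` is `dz̄ⱼ` as an element of the algebra `W`. -/
def dbarLocal [Ring W] [Algebra ℂ W] (ε : Fin n → W) (f : EuclideanSpace ℂ (Fin n) → W)
    (z : EuclideanSpace ℂ (Fin n)) : W :=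
  ∑ j, ε j * wirtingerBar f j z

end Local

/-! ## Forms on a complex manifold with values in holomorphic bundles -/

section Manifold

open Classical in
/-- The isomorphism `B x ≃ F` given by the preferred trivialization of `B` at `x₀` if `x` lies in
its domain (for other `x` the trivialization at `x` itself is used). -/
def triv {X : Type*} [TopologicalSpace X] (F : Type*) [NormedAddCommGroup F] [NormedSpace ℂ F]
    (B : X → Type*) [∀ x, AddCommGroup (B x)] [∀ x, Module ℂ (B x)]
    [TopologicalSpace (Bundle.TotalSpace F B)] [∀ x, TopologicalSpace (B x)] [FiberBundle F B]
    [VectorBundle ℂ F B] (x₀ x : X) : B x ≃ₗ[ℂ] F :=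
  if h : x ∈ (trivializationAt F B x₀).baseSet then (trivializationAt F B x₀).linearEquivAt ℂ x h
  else (trivializationAt F B x).linearEquivAt ℂ x
    (FiberBundle.mem_baseSet_trivializationAt F B x)

variable {n : ℕ} {X : Type*} [TopologicalSpace X] [ChartedSpace (EuclideanSpace ℂ (Fin n)) X]
  [IsManifold 𝓘(ℂ, EuclideanSpace ℂ (Fin n)) ω X]
variable (FE : Type*) [NormedAddCommGroup FE] [NormedSpace ℂ FE]
  (E : X → Type*) [∀ x, AddCommGroup (E x)] [∀ x, Module ℂ (E x)]
  [TopologicalSpace (Bundle.TotalSpace FE E)] [∀ x, TopologicalSpace (E x)] [FiberBundle FE E]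
  [VectorBundle ℂ FE E]
variable (FL : Type*) [NormedAddCommGroup FL] [NormedSpace ℂ FL]
  (L : X → Type*) [∀ x, AddCommGroup (L x)] [∀ x, Module ℂ (L x)]
  [TopologicalSpace (Bundle.TotalSpace FL L)] [∀ x, TopologicalSpace (L x)] [FiberBundle FL L]
  [VectorBundle ℂ FL L]

/-- The holomorphic tangent space at `x`. -/
abbrev TSpace (n : ℕ) {X : Type*} [TopologicalSpace X]
    [ChartedSpace (EuclideanSpace ℂ (Fin n)) X] (x : X) : Type :=
  TangentSpace 𝓘(ℂ, EuclideanSpace ℂ (Fin n)) x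

/-- The identification `T_x X ≃ ℂⁿ` by the chart at `x₀`. -/
abbrev trivT (n : ℕ) {X : Type*} [TopologicalSpace X]
    [ChartedSpace (EuclideanSpace ℂ (Fin n)) X]
    [IsManifold 𝓘(ℂ, EuclideanSpace ℂ (Fin n)) ω X] (x₀ x : X) :
    TSpace n x ≃ₗ[ℂ] EuclideanSpace ℂ (Fin n) :=
  triv (EuclideanSpace ℂ (Fin n)) (TangentSpace 𝓘(ℂ, EuclideanSpace ℂ (Fin n)) : X → Type _) x₀ x

variable (n) in
/-- The open subset of `ℂⁿ` on which the chart at `x₀` and the trivialization of `B` at `x₀` are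
both available. -/
def localDomain {X : Type*} [TopologicalSpace X] [ChartedSpace (EuclideanSpace ℂ (Fin n)) X]
    (F : Type*) [NormedAddCommGroup F] [NormedSpace ℂ F]
    (B : X → Type*) [TopologicalSpace (Bundle.TotalSpace F B)] [∀ x, TopologicalSpace (B x)]
    [FiberBundle F B] (x₀ : X) : Set (EuclideanSpace ℂ (Fin n)) :=
  (chartAt (EuclideanSpace ℂ (Fin n)) x₀).target ∩
    (chartAt (EuclideanSpace ℂ (Fin n)) x₀).symm ⁻¹' (trivializationAt F B x₀).baseSet

/-- The point of `X` with coordinates `z` in the chart at `x₀`. -/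
abbrev pt (n : ℕ) {X : Type*} [TopologicalSpace X]
    [ChartedSpace (EuclideanSpace ℂ (Fin n)) X] (x₀ : X) (z : EuclideanSpace ℂ (Fin n)) : X :=
  (chartAt (EuclideanSpace ℂ (Fin n)) x₀).symm z

variable {E} in
/-- The local expression near `x₀` of a section `α` of `Λ T*^{0,1} ⊗ End E ⊗ ⋀ L`. -/
def endLocal (α : ∀ x, EndFib (TSpace n x) (E x) (L x)) (x₀ : X)
    (z : EuclideanSpace ℂ (Fin n)) : EndFib (EuclideanSpace ℂ (Fin n)) FE FL :=
  endFibMap (trivT n x₀ (pt n x₀ z)) (triv FE E x₀ (pt n x₀ z)) (triv FL L x₀ (pt n x₀ z))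
    (α (pt n x₀ z))

variable {L} in
/-- The local expression near `x₀` of a section `β` of `Λ T*^{0,1} ⊗ ⨀ L`. -/
def symLocal (β : ∀ x, SymFib (TSpace n x) (L x)) (x₀ : X)
    (z : EuclideanSpace ℂ (Fin n)) : SymFib (EuclideanSpace ℂ (Fin n)) FL :=
  symFibMap (trivT n x₀ (pt n x₀ z)) (triv FL L x₀ (pt n x₀ z)) (β (pt n x₀ z))

/-- The smooth sections of `Λ T*^{0,1} ⊗ End E ⊗ ⋀ L`, as a subspace of all sections. -/
def endFormsSubmodule : Submodule ℂ (∀ x, EndFib (TSpace n x) (E x) (L x)) where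
  carrier := {α | ∀ x₀, SmoothOn (endLocal FE FL L α x₀)
    (localDomain n FE E x₀ ∩ localDomain n FL L x₀)}
  add_mem' hα hβ x₀ φ := by
    simpa only [endLocal, Pi.add_apply, map_add] using (hα x₀ φ).add (hβ x₀ φ)
  zero_mem' x₀ φ := by
    simpa only [endLocal, Pi.zero_apply, map_zero] using contDiffOn_const
  smul_mem' c α hα x₀ φ := by
    simpa only [endLocal, Pi.smul_apply, map_smul] using (hα x₀ φ).const_smul c

/-- The space of global smooth forms `⨁_{p,q} A^{0,p}(End E ⊗ ⋀^q L)` on `X`. -/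
def EndForms : Type _ := endFormsSubmodule (n := n) FE E FL L

instance : AddCommGroup (EndForms (n := n) FE E FL L) :=
  inferInstanceAs (AddCommGroup (endFormsSubmodule (n := n) FE E FL L))

instance : Module ℂ (EndForms (n := n) FE E FL L) :=
  inferInstanceAs (Module ℂ (endFormsSubmodule (n := n) FE E FL L))

/-- The smooth sections of `Λ T*^{0,1} ⊗ ⨀ᵏ L`, as a subspace of all sections of
`Λ T*^{0,1} ⊗ ⨀ L`. -/
def symFormsSubmodule (k : ℕ) : Submodule ℂ (∀ x, SymFib (TSpace n x) (L x)) where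
  carrier := {β | (∀ x, β x ∈ symFibPow (TSpace n x) (L x) k) ∧
    ∀ x₀, SmoothOn (symLocal FL β x₀) (localDomain n FL L x₀)}
  add_mem' hα hβ := ⟨fun x => add_mem (hα.1 x) (hβ.1 x), fun x₀ φ => by
    simpa only [symLocal, Pi.add_apply, map_add] using (hα.2 x₀ φ).add (hβ.2 x₀ φ)⟩
  zero_mem' := ⟨fun _ => zero_mem _, fun x₀ φ => by
    simpa only [symLocal, Pi.zero_apply, map_zero] using contDiffOn_const⟩
  smul_mem' c α hα := ⟨fun x => Submodule.smul_mem _ c (hα.1 x), fun x₀ φ => by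
    simpa only [symLocal, Pi.smul_apply, map_smul] using (hα.2 x₀ φ).const_smul c⟩

/-- The space `A^{0,*}(⨀ᵏ L)` of global smooth forms on `X`. -/
def SymForms (k : ℕ) : Type _ := symFormsSubmodule (n := n) FL L k

instance (k : ℕ) : AddCommGroup (SymForms (n := n) FL L k) :=
  inferInstanceAs (AddCommGroup (symFormsSubmodule (n := n) FL L k))

instance (k : ℕ) : Module ℂ (SymForms (n := n) FL L k) :=
  inferInstanceAs (Module ℂ (symFormsSubmodule (n := n) FL L k))

variable {E L}

/-- The Dolbeault operator on forms with values in `End E ⊗ ⋀ L`, at the point `x`: the local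
operator applied to the expression of `α` in the holomorphic chart and frames at `x`. -/
def dbarEnd (α : ∀ x, EndFib (TSpace n x) (E x) (L x)) (x : X) :
    EndFib (TSpace n x) (E x) (L x) :=
  endFibMap (trivT n x x).symm (triv FE E x x).symm (triv FL L x x).symm
    (dbarLocal (fun j => 1 ⊗ₜ[ℂ] (ExteriorAlgebra.ι ℂ (dzBar j) ᵍ⊗ₜ[ℂ] 1))
      (endLocal FE FL L α x) (chartAt (EuclideanSpace ℂ (Fin n)) x x))

/-- The Dolbeault operator on forms with values in `⨀ L`, at the point `x`. -/
def dbarSym (β : ∀ x, SymFib (TSpace n x) (L x)) (x : X) : SymFib (TSpace n x) (L x) :=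
  symFibMap (trivT n x x).symm (triv FL L x x).symm
    (dbarLocal (fun j => ExteriorAlgebra.ι ℂ (dzBar j) ⊗ₜ[ℂ] 1)
      (symLocal FL β x) (chartAt (EuclideanSpace ℂ (Fin n)) x x))

variable (n) in
/-- `(E, L, θ)` is a Hitchin pair: `θ` is a holomorphic section of `End E ⊗ L` with
`θ ∧ θ = 0` in `End E ⊗ ⋀² L`. -/
structure IsHitchinPair {X : Type*} [TopologicalSpace X]
    [ChartedSpace (EuclideanSpace ℂ (Fin n)) X]
    (FE : Type*) [NormedAddCommGroup FE] [NormedSpace ℂ FE]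
    {E : X → Type*} [∀ x, AddCommGroup (E x)] [∀ x, Module ℂ (E x)]
    [TopologicalSpace (Bundle.TotalSpace FE E)] [∀ x, TopologicalSpace (E x)]
    [FiberBundle FE E] [VectorBundle ℂ FE E]
    (FL : Type*) [NormedAddCommGroup FL] [NormedSpace ℂ FL]
    {L : X → Type*} [∀ x, AddCommGroup (L x)] [∀ x, Module ℂ (L x)]
    [TopologicalSpace (Bundle.TotalSpace FL L)] [∀ x, TopologicalSpace (L x)]
    [FiberBundle FL L] [VectorBundle ℂ FL L]
    (θ : ∀ x, Module.End ℂ (E x) ⊗[ℂ] L x) : Prop where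
  holomorphic : ∀ x₀ : X, HolomorphicOn
    (fun z => TensorProduct.map (triv FE E x₀ (pt n x₀ z)).conj.toLinearMap
      (triv FL L x₀ (pt n x₀ z)).toLinearMap (θ (pt n x₀ z)))
    (localDomain n FE E x₀ ∩ localDomain n FL L x₀)
  wedge : ∀ x, toExt (θ x) * toExt (θ x) = 0

/-- The differential graded Lie algebra `⨁_{p+q=*} A^{0,p}(End E ⊗ ⋀^q L)` of the Hitchin pair
`(E, L, θ)`, with differential `∂̄ + [θ, -]`, that is
`d (ω ⊗ f) = ∂̄ω ⊗ f + (-1) ^ (deg ω) ω ⊗ [θ, f]` for holomorphic `f`. All data are determined. -/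
structure IsHitchinDGLA (θ : ∀ x, Module.End ℂ (E x) ⊗[ℂ] L x)
    (𝔐 : DGLA (EndForms (n := n) FE E FL L)) : Prop where
  mem_gr : ∀ (m : ℤ) (α : EndForms (n := n) FE E FL L),
    α ∈ 𝔐.gr m ↔ ∀ x, α.1 x ∈ endFibGr (TSpace n x) (E x) (L x) m
  d_apply : ∀ (α : EndForms (n := n) FE E FL L) (x : X),
    (𝔐.d α).1 x = dbarEnd FE FL α.1 x + fibBracket (formTensor 1 (toExt (θ x))) (α.1 x)
  br_apply : ∀ (α β : EndForms (n := n) FE E FL L) (x : X),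
    (𝔐.br α β).1 x = fibBracket (α.1 x) (β.1 x)

variable (L) in
/-- The space `⨁_{k=1}^r A^{0,*}(⨀ᵏ L)`; the summand with index `k : Fin r` is
`A^{0,*}(⨀^{k+1} L)`. -/
abbrev SumSymForms (n : ℕ) {X : Type*} [TopologicalSpace X]
    [ChartedSpace (EuclideanSpace ℂ (Fin n)) X]
    [IsManifold 𝓘(ℂ, EuclideanSpace ℂ (Fin n)) ω X]
    (FL : Type*) [NormedAddCommGroup FL] [NormedSpace ℂ FL]
    (L : X → Type*) [∀ x, AddCommGroup (L x)] [∀ x, Module ℂ (L x)]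
    [TopologicalSpace (Bundle.TotalSpace FL L)] [∀ x, TopologicalSpace (L x)] [FiberBundle FL L]
    [VectorBundle ℂ FL L] (r : ℕ) : Type _ :=
  ∀ k : Fin r, SymForms (n := n) FL L (k + 1)

/-- The abelian differential graded Lie algebra `⨁_{k=1}^r A^{0,*}(⨀ᵏ L)[-1]`: its part of degree
`m` consists of the forms of type `(0, m - 1)`, its differential is `∂̄` and its bracket is zero.
All data are determined. -/
structure IsAbelianTargetDGLA (r : ℕ) (𝔑 : DGLA (SumSymForms n FL L r)) : Prop where
  mem_gr : ∀ (m : ℤ) (β : SumSymForms n FL L r),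
    β ∈ 𝔑.gr m ↔ ∀ k x, (β k).1 x ∈ symFibGr (TSpace n x) (L x) (m - 1)
  d_apply : ∀ (β : SumSymForms n FL L r) (k : Fin r) (x : X),
    (𝔑.d β k).1 x = dbarSym FL (β k).1 x
  abelian : 𝔑.br = 0

/-- The maps `h_N = (g^1_N, …, g^r_N)`, `N ≥ 1`: if at the point `x` one has `yᵢ = ωᵢ ⊗ fᵢ`, then
`g^k_N (y₁ ⊙ ⋯ ⊙ y_N) = (ω₁ ∧ ⋯ ∧ ω_N) ⊗ (coefficient of t₁ ⋯ t_N in tr (θ + ∑ tᵢ fᵢ)ᵏ)` at `x`,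
where only the components of the `fᵢ` in `End E ⊗ L` are taken: `g^k_N` vanishes as soon as one of
its arguments lies in `A^{0,*}(End E ⊗ ⋀^q L)` with `q ≠ 1`. As the fibres are spanned by the
`ω ⊗ f`, this determines the `h_N`. -/
def IsHitchinMaps (θ : ∀ x, Module.End ℂ (E x) ⊗[ℂ] L x) (r : ℕ)
    (gr : ℤ → Submodule ℂ (EndForms (n := n) FE E FL L))
    (h : ∀ N : ℕ, SymPow gr N →ₗ[ℂ] SumSymForms n FL L r) : Prop :=
  ∀ (N : ℕ), 1 ≤ N → ∀ (y : Fin N → EndForms (n := n) FE E FL L) (x : X)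
    (η : Fin N → ExteriorAlgebra ℂ (ConjDual (TSpace n x)))
    (f : Fin N → Module.End ℂ (E x) ⊗[ℂ] ExteriorAlgebra ℂ (L x)),
    (∀ i, (y i).1 x = formTensor (η i) (f i)) → ∀ k : Fin r,
      (h N (sprod gr y) k).1 x =
        (List.ofFn η).prod ⊗ₜ[ℂ] polarCoeff (k + 1) (θ x) (fun i => degreeOne (f i))

end Manifold

end

/-! The maps `h_N` are the polarizations of `x ↦ tr ((θ + x)ᵏ)`, in which only the part of `x` in
`End E ⊗ L` enters. On words of homogeneous letters of `M[1]` they have an algebraic description.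
Functions on words with values in forms with coefficients in `End E ⊗ ⨀ L` multiply by convolution,
the signed sum over all unshuffles of a word into two subwords. Let `m` be `θ` on the empty word,
the part of `x` in `End E ⊗ L` on a letter `x`, and zero on longer words. The `k`-th component of
`h` is the trace of the `k`-th convolution power of `m`. Indeed a form of type `(0, p)` with values
in `End E ⊗ L` has degree `p` in `M[1]`, so the product of the forms absorbs the Koszul signs
(`conv_formSym`), and what remains is the coefficient of a squarefree monomial
(`coeff_pow_wordExponent`, `endSymTrace_convPow`).

As the target is abelian, its codifferential is the derivation extending `-∂̄`, and compatibility
reduces to one identity: the signed sum of `h (q u ⊙ v)` over the unshuffles `(u, v)` of a word `w`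
is `-∂̄ (h w)` (`DGLA.isLInftyMorphism_of_abelian`). Let `a` be, up to sign, the part in `End E` of
a single letter, and zero on all other words. Inserting the brackets into `m` gives `-∂̄ m` plus the
graded commutator of `a` and `m` (`conv_shortWord`). Only words of length at most two matter. Length
zero says `∂̄ θ = 0`; lengths one and two say that the part in `End E ⊗ L` of a bracket comes from
the products of a part in `End E` with a part in `End E ⊗ L` (`linPart_fibBracket`). Insertion of
the brackets, `∂̄` and the commutator with `a` are odd derivations of the convolution product, so
the identity passes to all powers of `m` (`conv_convPow`), and the trace kills graded commutators
(`conv_trace_convPow`).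

The rest makes these objects global. The Dolbeault operator is defined at each point through the
chart and frames attached to that point. It does not depend on them: holomorphic frames are
annihilated by `∂̄`, and the conjugate Jacobian of a holomorphic change of coordinates is the
`∂̄`-gradient of the conjugate coordinates (`dbarLocal_coordChange`). Then `∂̄² = 0` and the Leibniz
rules are local computations, and `θ ∧ θ = 0` gives `[θ, [θ, -]] = 0`, so that `∂̄ + [θ, -]` has
square zero. The formula for `h_N` on forms that need not be homogeneous follows by expanding into
the finitely many homogeneous components (`hitchinMaps_isHitchinMaps`). -/

noncomputable section

/-! ### Signed sums over unshuffles: the convolution calculus on words. -/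

section Words

variable {α β Z Z' : Type*} [AddCommGroup Z] [AddCommGroup Z'] (d : α → ℤ)

/-- The total degree of a word. -/
def wdeg (w : List α) : ℤ := (w.map d).sum

@[simp] theorem wdeg_nil : wdeg d [] = 0 := rfl

@[simp] theorem wdeg_cons (x : α) (w : List α) : wdeg d (x :: w) = d x + wdeg d w := by
  simp [wdeg]

@[simp] theorem wdeg_append (u w : List α) : wdeg d (u ++ w) = wdeg d u + wdeg d w := by
  simp [wdeg]

/-- The signed sum of `Φ` over all unshuffles of a word into two subwords. -/
def conv (Φ : List α → List α → Z) : List α → Z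
  | [] => Φ [] []
  | x :: w => conv (fun u v => Φ (x :: u) v + (d x * wdeg d u).negOnePow • Φ u (x :: v)) w
termination_by w => w.length

variable {d}

@[simp] theorem conv_nil (Φ : List α → List α → Z) : conv d Φ [] = Φ [] [] := by
  rw [conv]

theorem conv_cons' (Φ : List α → List α → Z) (x : α) (w : List α) :
    conv d Φ (x :: w) =
      conv d (fun u v => Φ (x :: u) v + (d x * wdeg d u).negOnePow • Φ u (x :: v)) w := by
  rw [conv]

/-- The recursion only ever evaluates `Φ` at complementary subwords. Their lengths and degrees add
up to those of the word, and this is what later sign computations and length bounds need to know. -/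
theorem conv_congr {Φ Ψ : List α → List α → Z} {w : List α}
    (h : ∀ u v, u.length + v.length = w.length → wdeg d u + wdeg d v = wdeg d w →
      Φ u v = Ψ u v) : conv d Φ w = conv d Ψ w := by
  induction w generalizing Φ Ψ with
  | nil => simpa using h [] []
  | cons x w ih =>
    rw [conv_cons', conv_cons']
    refine ih fun u v hl hd => ?_
    rw [h (x :: u) v (by simp; omega) (by simp; omega),
      h u (x :: v) (by simp; omega) (by simp; omega)]

theorem conv_add (Φ Ψ : List α → List α → Z) (w : List α) :
    conv d (fun u v => Φ u v + Ψ u v) w = conv d Φ w + conv d Ψ w := by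
  induction w generalizing Φ Ψ with
  | nil => simp
  | cons x w ih =>
    simp only [conv_cons']
    rw [← ih]
    congr 1
    funext u v
    rw [smul_add]
    abel

theorem map_conv {F : Type*} [FunLike F Z Z'] [AddMonoidHomClass F Z Z'] (f : F)
    (Φ : List α → List α → Z) (w : List α) :
    f (conv d Φ w) = conv d (fun u v => f (Φ u v)) w := by
  induction w generalizing Φ with
  | nil => simp
  | cons x w ih =>
    simp only [conv_cons']
    rw [ih]
    congr 1
    funext u v
    rw [map_add, Units.smul_def, Units.smul_def, map_zsmul]

theorem conv_smul {R : Type*} [Monoid R] [DistribMulAction R Z] (c : R)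
    (Φ : List α → List α → Z) (w : List α) :
    conv d (fun u v => c • Φ u v) w = c • conv d Φ w :=
  (map_conv (DistribSMul.toAddMonoidHom Z c) Φ w).symm

theorem conv_neg (Φ : List α → List α → Z) (w : List α) :
    conv d (fun u v => - Φ u v) w = - conv d Φ w :=
  (map_conv (negAddMonoidHom (α := Z)) Φ w).symm

theorem conv_sub (Φ Ψ : List α → List α → Z) (w : List α) :
    conv d (fun u v => Φ u v - Ψ u v) w = conv d Φ w - conv d Ψ w := by
  simp only [sub_eq_add_neg, conv_add, conv_neg]

theorem conv_zero (w : List α) : conv d (fun _ _ => (0 : Z)) w = 0 := by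
  simpa using (map_conv (d := d) (0 : Z →+ Z) (fun _ _ => 0) w).symm

theorem conv_eq_zero {Φ : List α → List α → Z} {w : List α}
    (h : ∀ u v, u.length + v.length = w.length → wdeg d u + wdeg d v = wdeg d w →
      Φ u v = 0) : conv d Φ w = 0 := by
  rw [conv_congr h, conv_zero]

theorem conv_finset_sum {ι : Type*} (s : Finset ι) (Φ : ι → List α → List α → Z) (w : List α) :
    conv d (fun u v => ∑ i ∈ s, Φ i u v) w = ∑ i ∈ s, conv d (Φ i) w := by
  classical
  induction s using Finset.induction_on with
  | empty => simp [conv_zero]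
  | insert i s hi ih => simp only [Finset.sum_insert hi, conv_add, ih]

theorem conv_cons (Φ : List α → List α → Z) (x : α) (w : List α) :
    conv d Φ (x :: w) = conv d (fun u v => Φ (x :: u) v) w +
      conv d (fun u v => (d x * wdeg d u).negOnePow • Φ u (x :: v)) w := by
  rw [conv_cons', conv_add]

theorem negOnePow_smul_congr {a b : ℤ} (h : Even (a - b)) (z : Z) :
    a.negOnePow • z = b.negOnePow • z := by
  rw [(Int.negOnePow_eq_iff a b).2 h]

theorem negOnePow_smul_smul (a b : ℤ) (z : Z) :
    a.negOnePow • b.negOnePow • z = (a + b).negOnePow • z := by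
  rw [smul_smul, ← Int.negOnePow_add]

/-- Coassociativity of the unshuffle coproduct: either side sums over the distributions on three
blocks. Letting the first letter enter each of the three blocks yields the same three-term function
on the tail, so induction with `Φ` general applies. -/
theorem conv_assoc (Φ : List α → List α → List α → Z) (w : List α) :
    conv d (fun u z => conv d (fun x y => Φ x y z) u) w =
      conv d (fun x v => conv d (fun y z => Φ x y z) v) w := by
  induction w generalizing Φ with
  | nil => simp
  | cons a w ih =>
    have h1 : conv d (fun u z => conv d (fun x y => Φ x y z) u) (a :: w) =
        conv d (fun u z => conv d (fun x y => Φ (a :: x) y z + (d a * wdeg d x).negOnePow •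
          Φ x (a :: y) z + (d a * (wdeg d x + wdeg d y)).negOnePow • Φ x y (a :: z)) u) w := by
      rw [conv_cons']
      congr 1
      funext u z
      rw [conv_cons', ← conv_smul, ← conv_add]
      -- The sign for putting `a` into the third block involves the degree of `u`, which is the sum
      -- of the degrees of `x` and `y`.
      exact conv_congr fun x y _ h => by rw [h]
    rw [h1, ih, conv_cons']
    congr 1
    funext x v
    rw [conv_cons', ← conv_smul, ← conv_add]
    congr 1
    funext y z
    rw [smul_add, negOnePow_smul_smul, ← mul_add]
    abel

/-- Graded cocommutativity of the unshuffle coproduct; the first letter contributes two terms, which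
trade places with matching signs. -/
theorem conv_comm (Φ : List α → List α → Z) (w : List α) :
    conv d Φ w = conv d (fun u v => (wdeg d u * wdeg d v).negOnePow • Φ v u) w := by
  induction w generalizing Φ with
  | nil => simp
  | cons a w ih =>
    rw [conv_cons', ih, conv_cons']
    congr 1
    funext u v
    rw [smul_add, negOnePow_smul_smul, negOnePow_smul_smul, add_comm]
    congr 1
    · exact negOnePow_smul_congr (by simp; ring_nf; simp) _
    · refine negOnePow_smul_congr ?_ _
      simp only [wdeg_cons]
      exact ⟨- (d a * wdeg d u), by ring⟩

theorem conv_left_comm (Φ : List α → List α → List α → Z) (w : List α) :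
    conv d (fun u v => conv d (fun x y => Φ u x y) v) w =
      conv d (fun x v => conv d (fun u y => (wdeg d u * wdeg d x).negOnePow • Φ u x y) v) w := by
  rw [← conv_assoc, ← conv_assoc]
  congr 1
  funext u z
  rw [conv_comm]
  congr 1
  funext x y
  rw [mul_comm]

/-- A coderivation of odd degree applied to a convolution. -/
theorem conv_leibniz (op : List α → α) (hop : ∀ u, d (op u) = wdeg d u + 1)
    (Φ : List α → List α → Z) (w : List α) :
    conv d (fun u v => conv d Φ (op u :: v)) w =
      conv d (fun z y => conv d (fun u x => Φ (op u :: x) y) z) w +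
      conv d (fun x z => (wdeg d x).negOnePow • conv d (fun u y => Φ x (op u :: y)) z) w := by
  simp only [conv_cons, conv_add]
  rw [conv_assoc (fun u x y => Φ (op u :: x) y)]
  congr 1
  -- The new letter `op u` goes to the second block here. Passing `x` costs the degree of `u` plus
  -- one, times that of `x`; moving `u` out in front of `x` gives back the even part and leaves the
  -- sign of `x`.
  rw [conv_left_comm]
  congr 1
  funext x z
  rw [← conv_smul]
  congr 1
  funext u y
  rw [negOnePow_smul_smul, hop]
  exact negOnePow_smul_congr ⟨wdeg d u * wdeg d x, by ring⟩ _

variable (d) in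
/-- The compatibility of a function on words with the exchange of neighbouring letters. -/
def SwapRule (G : List α → Z) : Prop :=
  ∀ (l : List α) (x y : α) (r : List α),
    G (l ++ x :: y :: r) = (d x * d y).negOnePow • G (l ++ y :: x :: r)

theorem SwapRule.cons {G : List α → Z} (h : SwapRule d G) (a : α) :
    SwapRule d (fun u => G (a :: u)) := fun l x y r => h (a :: l) x y r

/-- There are four ways to place two neighbouring letters on two blocks. If they share a block, the
rule for `Φ` applies; the two mixed placements are interchanged. Letters in front of the pair are
moved into `Φ` by the recursion. -/
theorem SwapRule.conv {Φ : List α → List α → Z} (h1 : ∀ v, SwapRule d (fun u => Φ u v))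
    (h2 : ∀ u, SwapRule d (Φ u)) : SwapRule d (conv d Φ) := by
  have key : ∀ (l r : List α) (x y : α) (Φ : List α → List α → Z)
      (_ : ∀ v, SwapRule d (fun u => Φ u v)) (_ : ∀ u, SwapRule d (Φ u)),
      _root_.conv d Φ (l ++ x :: y :: r) =
        (d x * d y).negOnePow • _root_.conv d Φ (l ++ y :: x :: r) := by
    intro l r x y
    induction l with
    | nil =>
      intro Φ h1 h2
      simp only [List.nil_append, conv_cons' _ _ (_ :: _)]
      rw [conv_cons', conv_cons', ← conv_smul]
      congr 1
      funext u v
      have e1 := h1 v [] x y u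
      have e2 := h2 u [] x y v
      simp only [List.nil_append] at e1 e2
      rw [e1, e2]
      simp only [smul_add, negOnePow_smul_smul]
      rw [add_assoc, add_assoc]
      congr 1
      conv_rhs => rw [add_left_comm]
      simp only [wdeg_cons]
      refine congrArg₂ _ ?_ (congrArg₂ _ ?_ ?_) <;> refine negOnePow_smul_congr ?_ _
      · exact ⟨0, by ring⟩
      · exact ⟨- (d x * d y), by ring⟩
      · exact ⟨0, by ring⟩
    | cons a l ih =>
      intro Φ h1 h2
      simp only [List.cons_append, conv_cons]
      rw [ih _ (fun v => (h1 v).cons a) (fun u => h2 (a :: u)), ih _ _ _, smul_add]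
      · intro v l x y r
        have e1 := h1 (a :: v) l x y r
        simp only at e1 ⊢
        rw [e1, negOnePow_smul_smul, negOnePow_smul_smul]
        simp only [wdeg_append, wdeg_cons]
        exact negOnePow_smul_congr ⟨0, by ring⟩ _
      · intro u l x y r
        have e2 := h2 u (a :: l) x y r
        simp only [List.cons_append] at e2 ⊢
        rw [e2, negOnePow_smul_smul, negOnePow_smul_smul, add_comm]
  exact fun l x y r => key l r x y Φ h1 h2

/-! ### Distributions of a word on several blocks, with a map applied to every block. -/

section Powers

variable {e : β → ℤ}

variable (d) in
/-- The signed sum, over all distributions of the letters of a word on `m` blocks, of the values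
of `Φ` on the words obtained by applying `f` to the blocks. -/
def wpow (f : List α → β) : ℕ → (List β → Z) → List α → Z
  | 0, Φ, w => if w = [] then Φ [] else 0
  | m + 1, Φ, w => conv d (fun u v => wpow f m (fun t => Φ (f u :: t)) v) w

theorem wpow_add (f : List α → β) (m : ℕ) (Φ Ψ : List β → Z) (w : List α) :
    wpow d f m (fun t => Φ t + Ψ t) w = wpow d f m Φ w + wpow d f m Ψ w := by
  induction m generalizing Φ Ψ w with
  | zero => simp only [wpow]; split_ifs <;> simp
  | succ m ih => simp only [wpow, ih, conv_add]

theorem map_wpow (g : Z →+ Z') (f : List α → β) (m : ℕ) (Φ : List β → Z) (w : List α) :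
    g (wpow d f m Φ w) = wpow d f m (fun t => g (Φ t)) w := by
  induction m generalizing Φ w with
  | zero => simp only [wpow]; split_ifs <;> simp
  | succ m ih => simp only [wpow, map_conv, ih]

theorem wpow_smul {R : Type*} [Monoid R] [DistribMulAction R Z] (c : R) (f : List α → β) (m : ℕ)
    (Φ : List β → Z) (w : List α) :
    wpow d f m (fun t => c • Φ t) w = c • wpow d f m Φ w :=
  (map_wpow (DistribSMul.toAddMonoidHom Z c) f m Φ w).symm

/-- With more blocks than letters some block is empty. This makes the sums defining an induced
morphism independent of their upper bound. -/
theorem wpow_eq_zero_of_lt {f : List α → β} (m : ℕ) {Φ : List β → Z}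
    (hΦ : ∀ s t, Φ (s ++ f [] :: t) = 0) (w : List α) (hm : w.length < m) :
    wpow d f m Φ w = 0 := by
  induction m generalizing Φ w with
  | zero => simp at hm
  | succ m ih =>
    refine conv_eq_zero fun u v hl _ => ?_
    rcases u with _ | ⟨a, u⟩
    · have : (fun t => Φ (f [] :: t)) = fun _ => 0 := funext fun t => hΦ [] t
      rw [this]
      have := wpow_smul (d := d) (0 : ℤ) f m (fun _ => (0 : Z)) v
      simpa using this
    · refine ih (fun s t => hΦ (_ :: s) t) v ?_
      simp at hl
      omega

/-- An interchange of finite sums: `wpow` is additive in its function argument, so it commutes with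
a convolution taking values in the group of functions `List β → Z`. -/
theorem conv_wpow {γ : Type*} {d' : γ → ℤ} (f : List α → β) (m : ℕ)
    (Ψ : List γ → List γ → List β → Z) (y : List α) (z : List γ) :
    conv d' (fun u x => wpow d f m (Ψ u x) y) z =
      wpow d f m (fun t => conv d' (fun u x => Ψ u x t) z) y := by
  let g : (List β → Z) →+ Z :=
    { toFun := fun Φ => wpow d f m Φ y
      map_zero' := by
        have := wpow_smul (d := d) (0 : ℤ) f m (0 : List β → Z) y
        simp only [zero_smul] at this
        exact this
      map_add' := fun Φ Ψ => wpow_add f m Φ Ψ y }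
  have h : (fun t => conv d' (fun u x => Ψ u x t) z) = conv d' Ψ z :=
    funext fun t => (map_conv (Pi.evalAddMonoidHom (fun _ : List β => Z) t) Ψ z).symm
  rw [h]
  exact (map_conv g Ψ z).symm

/-- A coderivation of odd degree followed by a power of `f`. -/
theorem wpow_coderivation {f : List α → β} (hf : ∀ u, e (f u) = wdeg d u) (op : List α → α) (hop : ∀ u, d (op u) = wdeg d u + 1) (fop : List α → β)
    (hfop : ∀ u, e (fop u) = wdeg d u + 1) (m : ℕ) (Φ : List β → Z) (hΦ : SwapRule e Φ)
    (hlin : ∀ s t w, conv d (fun u v => Φ (s ++ f (op u :: v) :: t)) w = Φ (s ++ fop w :: t))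
    (w : List α) :
    conv d (fun u v => wpow d f (m + 1) Φ (op u :: v)) w =
      (m + 1) • conv d (fun u v => wpow d f m (fun t => Φ (fop u :: t)) v) w := by
  induction m generalizing Φ w with
  | zero =>
    simp only [wpow]
    rw [conv_leibniz op hop]
    have : conv d (fun x z => (wdeg d x).negOnePow • conv d (fun u y =>
        if op u :: y = [] then Φ [f x] else 0) z) w = 0 :=
      conv_eq_zero fun x z _ _ => by
        rw [conv_eq_zero, smul_zero]
        intro u v _ _
        simp
    rw [this, zero_add, one_smul, add_zero]
    congr 1
    funext z y
    split_ifs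
    · exact hlin [] [] z
    · exact conv_zero _
  | succ m ih =>
    -- The letter `op u` lies in the first block or, by induction, in one of the other `m + 1`. The
    -- swap rule for `Φ` brings its block to the front, so every block contributes equally; this is
    -- the source of the factor.
    rw [show wpow d f (m + 1 + 1) Φ =
      conv d (fun u v => wpow d f (m + 1) (fun t => Φ (f u :: t)) v) from rfl,
      conv_leibniz op hop, add_smul, one_smul, add_comm]
    congr 1
    · have h1 : ∀ x z, conv d (fun u y => wpow d f (m + 1) (fun t => Φ (f x :: t)) (op u :: y)) z =
          (m + 1) • conv d (fun u v => wpow d f m (fun t => Φ (f x :: fop u :: t)) v) z :=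
        fun x z => ih _ (hΦ.cons _) (fun s t w => hlin (_ :: s) t w) z
      simp only [h1]
      have h2 := conv_left_comm (d := d) (fun x u v => (wdeg d x).negOnePow •
        wpow d f m (fun t => Φ (f x :: fop u :: t)) v) w
      have h3 : ∀ x z, (wdeg d x).negOnePow • (m + 1) •
          conv d (fun u v => wpow d f m (fun t => Φ (f x :: fop u :: t)) v) z = (m + 1) •
          conv d (fun u v => (wdeg d x).negOnePow •
            wpow d f m (fun t => Φ (f x :: fop u :: t)) v) z := by
        intro x z
        rw [conv_smul, smul_comm]
      simp only [h3]
      rw [conv_smul, h2]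
      congr 2
      funext u z
      rw [wpow]
      congr 1
      funext x v
      have : (fun t => Φ (f x :: fop u :: t)) = fun t =>
          (wdeg d x * (wdeg d u + 1)).negOnePow • Φ (fop u :: f x :: t) := funext fun t => by
        rw [← hf, ← hfop]
        exact hΦ [] (f x) (fop u) t
      rw [this, wpow_smul, negOnePow_smul_smul, negOnePow_smul_smul]
      -- The signs from the Leibniz rule, from the exchange of the subwords and from the swap inside
      -- `Φ` multiply to one.
      conv_rhs => rw [← one_smul ℤˣ (wpow d f m _ v), ← Int.negOnePow_zero]
      exact negOnePow_smul_congr ⟨wdeg d x * wdeg d u + wdeg d x, by ring⟩ _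
    · congr 1
      funext z y
      rw [conv_wpow]
      congr 1
      funext t
      exact hlin [] t z

end Powers

end Words

/-! ### Comparison with sums over subsets and block functions carrying Koszul signs. -/

section Unshuffles

variable {α Z : Type*} [AddCommGroup Z] {d : α → ℤ}

variable (d) in
/-- The signed sum of `Ψ` over all distributions of the letters of a word on `m` blocks. -/
def multiconv (m : ℕ) (Ψ : (Fin m → List α) → Z) : List α → Z
  | [] => Ψ fun _ => []
  | x :: w => multiconv m (fun ws => ∑ j, (d x * ∑ i with i < j, wdeg d (ws i)).negOnePow •
      Ψ (Function.update ws j (x :: ws j))) w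
termination_by w => w.length

theorem multiconv_nil (m : ℕ) (Ψ : (Fin m → List α) → Z) :
    multiconv d m Ψ [] = Ψ fun _ => [] := by rw [multiconv]

theorem multiconv_cons (m : ℕ) (Ψ : (Fin m → List α) → Z) (x : α) (w : List α) :
    multiconv d m Ψ (x :: w) = multiconv d m (fun ws =>
      ∑ j, (d x * ∑ i with i < j, wdeg d (ws i)).negOnePow •
        Ψ (Function.update ws j (x :: ws j))) w := by
  rw [multiconv]

theorem multiconv_add (m : ℕ) (Ψ Ψ' : (Fin m → List α) → Z) (w : List α) :
    multiconv d m (fun ws => Ψ ws + Ψ' ws) w = multiconv d m Ψ w + multiconv d m Ψ' w := by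
  induction w generalizing Ψ Ψ' with
  | nil => simp [multiconv_nil]
  | cons x w ih => simp only [multiconv_cons, smul_add, Finset.sum_add_distrib, ih]

theorem multiconv_smul (c : ℤˣ) (m : ℕ) (Ψ : (Fin m → List α) → Z) (w : List α) :
    multiconv d m (fun ws => c • Ψ ws) w = c • multiconv d m Ψ w := by
  induction w generalizing Ψ with
  | nil => simp [multiconv_nil]
  | cons x w ih =>
    simp only [multiconv_cons, ← ih, Finset.smul_sum]
    congr 1
    funext ws
    exact Finset.sum_congr rfl fun j _ => smul_comm _ _ _

theorem multiconv_succ (m : ℕ) (Ψ : (Fin (m + 1) → List α) → Z) (w : List α) :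
    multiconv d (m + 1) Ψ w =
      conv d (fun u v => multiconv d m (fun ws => Ψ (Fin.cons u ws)) v) w := by
  induction w generalizing Ψ with
  | nil =>
    rw [conv_nil, multiconv_nil, multiconv_nil]
    congr 1
    funext i
    refine Fin.cases rfl (fun _ => rfl) i
  | cons x w ih =>
    rw [multiconv_cons, ih, conv_cons']
    congr 1
    funext u v
    rw [multiconv_cons, ← multiconv_smul, ← multiconv_add]
    congr 1
    funext ws
    rw [Fin.sum_univ_succ, Finset.smul_sum]
    congr 1
    · simp [Fin.update_cons_zero]
    · refine Finset.sum_congr rfl fun j _ => ?_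
      rw [negOnePow_smul_smul, ← mul_add, Fin.cons_succ, ← Fin.cons_update]
      congr 3
      rw [Finset.sum_filter, Fin.sum_univ_succ, Finset.sum_filter]
      simp [Fin.succ_pos]

/-- The subword formed by the letters with positions satisfying `p`. -/
def subword {n : ℕ} (x : Fin n → α) (p : Fin n → Prop) [DecidablePred p] : List α :=
  ((List.finRange n).filter fun i => p i).map x

theorem subword_congr {n : ℕ} (x : Fin n → α) {p q : Fin n → Prop} [DecidablePred p]
    [DecidablePred q] (h : ∀ i, p i ↔ q i) : subword x p = subword x q := by
  simp [subword, h]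

theorem subword_succ {n : ℕ} (x : Fin (n + 1) → α) (p : Fin (n + 1) → Prop) [DecidablePred p] :
    subword x p = (if p 0 then [x 0] else []) ++
      subword (fun i => x i.succ) (fun i => p i.succ) := by
  rw [subword, List.finRange_succ, List.filter_cons]
  split_ifs with h1 h2 h2 <;>
    simp_all [subword, List.filter_map, Function.comp_def]

/-- The first letter forms an inversion exactly with the letters sent to a block before `j`; all
other inversions are those of `c`. -/
theorem koszulSign_cons {n m : ℕ} (a : Fin (n + 1) → ℤ) (j : Fin m) (c : Fin n → Fin m) :
    koszulSign a (Fin.cons j c : Fin (n + 1) → Fin m) =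
      (∏ i with c i < j, (a 0 * a i.succ).negOnePow) * koszulSign (fun i => a i.succ) c := by
  rw [koszulSign, koszulSign, Finset.prod_filter, Fintype.prod_prod_type, Fin.prod_univ_succ,
    Fin.prod_univ_succ]
  simp only [Fin.prod_univ_succ, Finset.prod_filter, Fintype.prod_prod_type]
  simp [Fin.succ_pos]

theorem wdeg_subword {n : ℕ} (x : Fin n → α) (p : Fin n → Prop) [DecidablePred p] :
    wdeg d (subword x p) = ∑ i with p i, d (x i) := by
  induction n with
  | zero => simp [subword]
  | succ n ih =>
    rw [subword_succ, wdeg_append, ih, Finset.sum_filter, Finset.sum_filter, Fin.sum_univ_succ]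
    split_ifs <;> simp

theorem negOnePow_sum {ι : Type*} (s : Finset ι) (f : ι → ℤ) :
    (∑ i ∈ s, f i).negOnePow = ∏ i ∈ s, (f i).negOnePow := by
  classical
  induction s using Finset.induction_on with
  | empty => simp
  | insert i s hi ih => rw [Finset.sum_insert hi, Finset.prod_insert hi, Int.negOnePow_add, ih]

/-- This links the recursion, convenient in proofs, with the explicit sums in the definitions of
induced coderivations and morphisms. Inserting the first letter into block `j` adds the sign
recorded by `koszulSign_cons`. -/
theorem multiconv_ofFn {n m : ℕ} (Ψ : (Fin m → List α) → Z) (x : Fin n → α) :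
    multiconv d m Ψ (List.ofFn x) = ∑ c : Fin n → Fin m,
      koszulSign (fun i => d (x i)) c • Ψ (fun j => subword x (fun i => c i = j)) := by
  induction n generalizing Ψ with
  | zero =>
    simp only [List.ofFn_zero, multiconv_nil, Fintype.sum_unique]
    simp [koszulSign, subword]
  | succ n ih =>
    rw [List.ofFn_succ, multiconv_cons, ih, ← (Fin.consEquiv fun _ => Fin m).sum_comp,
      Fintype.sum_prod_type, Finset.sum_comm]
    refine Finset.sum_congr rfl fun c _ => ?_
    rw [Finset.smul_sum]
    refine Finset.sum_congr rfl fun j _ => ?_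
    rw [show (Fin.consEquiv fun _ => Fin m) (j, c) = (Fin.cons j c : Fin (n + 1) → Fin m) from rfl,
      koszulSign_cons, smul_smul, mul_comm]
    congr 2
    · rw [Finset.mul_sum, negOnePow_sum]
      simp only [wdeg_subword, Finset.mul_sum, negOnePow_sum]
      -- Inversions with the new letter are grouped by the block containing the other letter.
      rw [← Finset.prod_fiberwise_of_maps_to (s := Finset.univ.filter fun i => c i < j)
        (t := Finset.univ.filter fun i => i < j) (g := c) (by simp)]
      refine Finset.prod_congr rfl fun i hi => Finset.prod_congr ?_ fun _ _ => rfl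
      ext k
      simp only [Finset.mem_filter, Finset.mem_univ, true_and] at hi ⊢
      exact ⟨fun h => ⟨h ▸ hi, h⟩, fun h => h.2⟩
    · funext j'
      rw [subword_succ]
      rcases eq_or_ne j' j with rfl | h
      · simp
      · simp [h, h.symm]

theorem multiconv_zero (m : ℕ) (w : List α) : multiconv d m (fun _ => (0 : Z)) w = 0 := by
  induction w with
  | nil => rw [multiconv_nil]
  | cons x w ih => simpa [multiconv_cons] using ih

theorem conv_eq_multiconv (Φ : List α → List α → Z) (w : List α) :
    conv d Φ w = multiconv d 2 (fun ws => Φ (ws 0) (ws 1)) w := by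
  induction w generalizing Φ with
  | nil => rw [conv_nil, multiconv_nil]
  | cons x w ih =>
    rw [conv_cons', ih, multiconv_cons]
    congr 1
    funext ws
    have h0 : (Finset.univ.filter fun i : Fin 2 => i < 0) = ∅ := by decide
    have h1 : (Finset.univ.filter fun i : Fin 2 => i < 1) = {0} := by decide
    rw [Fin.sum_univ_two, h0, h1]
    simp

theorem wpow_eq_multiconv {β : Type*} (f : List α → β) (m : ℕ) (Φ : List β → Z) (w : List α) :
    wpow d f m Φ w = multiconv d m (fun ws => Φ (List.ofFn fun i => f (ws i))) w := by
  induction m generalizing Φ w with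
  | zero =>
    rcases w with _ | ⟨x, w⟩
    · simp [wpow, multiconv_nil]
    · simp [wpow, multiconv_cons, multiconv_zero]
  | succ m ih =>
    rw [multiconv_succ, wpow]
    congr 1
    funext u v
    rw [ih]
    simp [List.ofFn_succ]

/-- A distribution on two blocks is determined by its first block, and `frontBlock` is the resulting
bijection between subsets and maps to `Fin 2`. -/
theorem conv_ofFn {n : ℕ} (Φ : List α → List α → Z) (x : Fin n → α) :
    conv d Φ (List.ofFn x) = ∑ I : Finset (Fin n),
      koszulSign (fun i => d (x i)) (frontBlock I) •
        Φ (subword x (· ∈ I)) (subword x (· ∈ Iᶜ)) := by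
  rw [conv_eq_multiconv, multiconv_ofFn]
  symm
  refine Fintype.sum_bijective frontBlock ⟨?_, ?_⟩ _ _ ?_
  · intro I J h
    ext i
    have := congrFun h i
    simp only [frontBlock] at this
    split_ifs at this <;> simp_all
  · intro c
    refine ⟨Finset.univ.filter fun i => c i = 0, ?_⟩
    funext i
    simp only [frontBlock, Finset.mem_filter, Finset.mem_univ, true_and]
    split_ifs <;> omega
  · intro I
    have h0 : subword x (fun i => frontBlock I i = 0) = subword x (· ∈ I) :=
      subword_congr x fun i => by simp [frontBlock]
    have h1 : subword x (fun i => frontBlock I i = 1) = subword x (· ∈ Iᶜ) :=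
      subword_congr x fun i => by simp [frontBlock]
    simp only [h0, h1]

theorem sort_eq_filter {n : ℕ} (I : Finset (Fin n)) :
    I.sort = (List.finRange n).filter (· ∈ I) := by
  refine I.sortedLT_sort.eq_of_mem_iff ?_ (by simp)
  exact ((List.sortedLT_finRange n).pairwise.filter _).sortedLT

theorem ofFn_subfamily {V : Type*} {n : ℕ} (v : Fin n → V) (I : Finset (Fin n)) :
    List.ofFn (subfamily v I) = subword v (· ∈ I) := by
  rw [List.ofFn_eq_map, subword, ← sort_eq_filter, ← Finset.listMap_orderEmbOfFin_finRange I rfl,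
    List.map_map]
  rfl

end Unshuffles

/-! ### Updates and neighbour transpositions of tuples, read as lists. -/

section OfFn

variable {α : Type*}

theorem List.ofFn_update {n : ℕ} (x : Fin n → α) (i : Fin n) (y : α) :
    List.ofFn (Function.update x i y) =
      (List.ofFn x).take i ++ y :: (List.ofFn x).drop (i + 1) := by
  refine List.ext_getElem (by simp; omega) fun k h1 h2 => ?_
  simp only [List.getElem_ofFn, Function.update_apply, Fin.ext_iff, List.getElem_append,
    List.getElem_cons, List.length_take, List.length_ofFn, List.getElem_take, List.getElem_drop]
  have : min (i : ℕ) n = i := by omega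
  simp only [this]
  split_ifs <;> first | rfl | omega | (congr 2; omega)

theorem List.ofFn_swap {n : ℕ} (x : Fin n → α) (i j : Fin n) (hij : (i : ℕ) + 1 = j) :
    List.ofFn x = (List.ofFn x).take i ++ x i :: x j :: (List.ofFn x).drop (i + 2) ∧
      List.ofFn (x ∘ Equiv.swap i j) =
        (List.ofFn x).take i ++ x j :: x i :: (List.ofFn x).drop (i + 2) := by
  have hj := j.2
  have key : ∀ y z : α, (List.ofFn (Function.update (Function.update x i y) j z)) =
      (List.ofFn x).take i ++ y :: z :: (List.ofFn x).drop (i + 2) := by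
    intro y z
    refine List.ext_getElem (by simp; omega) fun k h1 h2 => ?_
    simp only [List.getElem_ofFn, Function.update_apply, Fin.ext_iff, List.getElem_append,
      List.getElem_cons, List.length_take, List.length_ofFn, List.getElem_take, List.getElem_drop]
    have : min (i : ℕ) n = i := by omega
    simp only [this]
    split_ifs <;> first | rfl | omega | (congr 2; omega)
  refine ⟨?_, ?_⟩
  · simpa using key (x i) (x j)
  · rw [← key]
    congr 1
    funext k
    simp only [Function.comp_apply, Function.update_apply, Equiv.swap_apply_def]
    split_ifs <;> simp_all

end OfFn

/-! ### Graded symmetric functions on words as linear maps on symmetric powers. -/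

section SymWords

variable {V W Z : Type*} [AddCommGroup V] [Module ℂ V] [AddCommGroup W] [Module ℂ W]
  [AddCommGroup Z] [Module ℂ Z]

/-- A homogeneous element together with its degree. -/
abbrev Letter (gr : ℤ → Submodule ℂ V) : Type _ := Σ a : ℤ, gr a

/-- The degree of a letter. -/
abbrev ldeg (gr : ℤ → Submodule ℂ V) : Letter gr → ℤ := Sigma.fst

/-- The vector underlying a letter. -/
abbrev lval {gr : ℤ → Submodule ℂ V} (x : Letter gr) : V := x.2

theorem Letter.ext {gr : ℤ → Submodule ℂ V} {x y : Letter gr} (h : x.1 = y.1)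
    (h' : lval x = lval y) : x = y := by
  obtain ⟨a, x⟩ := x
  obtain ⟨b, y⟩ := y
  obtain rfl : a = b := h
  congr
  exact Subtype.ext h'

variable {gr : ℤ → Submodule ℂ V}

/-- Functions on words of homogeneous vectors that are linear in every letter of fixed degree and
graded symmetric. -/
structure IsSymWordFun (G : List (Letter gr) → Z) : Prop where
  add : ∀ (l r : List (Letter gr)) (x y z : Letter gr), x.1 = z.1 → y.1 = z.1 →
    lval z = lval x + lval y → G (l ++ z :: r) = G (l ++ x :: r) + G (l ++ y :: r)
  smul : ∀ (l r : List (Letter gr)) (c : ℂ) (x z : Letter gr), x.1 = z.1 →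
    lval z = c • lval x → G (l ++ z :: r) = c • G (l ++ x :: r)
  swap : SwapRule (ldeg gr) G

theorem IsSymWordFun.eq_zero {G : List (Letter gr) → Z} (hG : IsSymWordFun G)
    {l r : List (Letter gr)} {z : Letter gr} (hz : lval z = 0) : G (l ++ z :: r) = 0 := by
  rw [hG.smul l r 0 z z rfl (by simp [hz]), zero_smul]

theorem IsSymWordFun.prepend {G : List (Letter gr) → Z} (hG : IsSymWordFun G) (s : List (Letter gr)) :
    IsSymWordFun (fun w => G (s ++ w)) where
  add l r x y z h1 h2 h := by
    simpa using hG.add (s ++ l) r x y z h1 h2 h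
  smul l r c x z h1 h := by
    simpa using hG.smul (s ++ l) r c x z h1 h
  swap l x y r := by
    simpa using hG.swap (s ++ l) x y r

/-- For each tuple of degrees `G` is multilinear in the homogeneous arguments; decomposing every
argument along the internal grading extends it to all of `V`, and the swap rule is precisely what
the Koszul relations require. -/
theorem exists_linearMap_symPow (hgr : DirectSum.IsInternal gr) {G : List (Letter gr) → Z}
    (hG : IsSymWordFun G) (n : ℕ) : ∃ T : SymPow gr n →ₗ[ℂ] Z,
      ∀ x : Fin n → Letter gr, T (sprod gr fun i => lval (x i)) = G (List.ofFn x) := by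
  classical
  let e := LinearEquiv.ofBijective (DirectSum.coeLinearMap gr) hgr
  have he : ∀ x : Letter gr, e.symm (lval x) = DirectSum.lof ℂ ℤ (fun i => gr i) x.1 x.2 := by
    intro x
    rw [LinearEquiv.symm_apply_eq]
    exact (DirectSum.coeLinearMap_lof gr x.1 x.2).symm
  have hupd : ∀ (p : Fin n → ℤ) (u : ∀ i, gr (p i)) (i : Fin n) (y : gr (p i)),
      (fun k => (⟨p k, Function.update u i y k⟩ : Letter gr)) =
        Function.update (fun k => ⟨p k, u k⟩) i ⟨p i, y⟩ := by
    intro p u i y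
    funext k
    rcases eq_or_ne k i with rfl | h
    · simp
    · simp [h]
  let M : ∀ p : Fin n → ℤ, MultilinearMap ℂ (fun i => gr (p i)) Z := fun p =>
    MultilinearMap.mk' (fun u => G (List.ofFn fun i => ⟨p i, u i⟩))
      (by
        intro u i y z
        simp only [hupd, List.ofFn_update]
        exact hG.add _ _ _ _ _ rfl rfl rfl)
      (by
        intro u i c z
        simp only [hupd, List.ofFn_update]
        exact hG.smul _ _ _ _ _ rfl rfl)
  -- The multilinear maps `M p`, one for each tuple `p` of degrees, assemble to one on the direct
  -- sum, which is then pulled back to `V`.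
  let T := ((MultilinearMap.fromDirectSumEquiv (R := ℂ) (κ := fun _ : Fin n => ℤ)
    (M := fun _ j => gr j) (M' := Z)) M).compLinearMap (fun _ => e.symm.toLinearMap)
  have hT : ∀ x : Fin n → Letter gr, T (fun i => lval (x i)) = G (List.ofFn x) := by
    intro x
    simp only [T, MultilinearMap.compLinearMap_apply, LinearEquiv.coe_coe, he]
    rw [MultilinearMap.fromDirectSumEquiv_lof]
    rfl
  refine ⟨SymPow.lift gr T ?_, ?_⟩
  · intro v a hv i j hij
    let x : Fin n → Letter gr := fun i => ⟨a i, v i, hv i⟩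
    obtain ⟨h1, h2⟩ := List.ofFn_swap x i j hij
    have e1 := hT x
    have e2 := hT (x ∘ Equiv.swap i j)
    rw [h1] at e1
    rw [h2] at e2
    exact e1.trans ((hG.swap _ (x i) (x j) _).trans (congrArg _ e2.symm))
  · intro x
    rw [← hT]
    exact (Submodule.liftQ_apply _ _ _).trans (PiTensorProduct.lift.tprod _)

variable (gr) in
/-- The element of the reduced symmetric coalgebra given by a non-empty word. -/
def symWord (w : List (Letter gr)) : RedSym gr :=
  match w with
  | [] => 0
  | x :: w => DirectSum.lof ℂ ℕ (fun n => SymPow gr (n + 1)) w.length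
      (sprod gr fun i => lval ((x :: w).get i))

theorem symWord_ofFn {n : ℕ} (x : Fin (n + 1) → Letter gr) :
    symWord gr (List.ofFn x) =
      DirectSum.lof ℂ ℕ (fun n => SymPow gr (n + 1)) n (sprod gr fun i => lval (x i)) := by
  have key : ∀ (w : List (Letter gr)) (h : w.length = n + 1), symWord gr w =
      DirectSum.lof ℂ ℕ (fun n => SymPow gr (n + 1)) n
        (sprod gr fun i => lval (w.get (i.cast h.symm))) := by
    intro w h
    rcases w with _ | ⟨a, w⟩
    · simp at h
    · obtain rfl : w.length = n := by simpa using h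
      rfl
  rw [key _ (by simp)]
  simp [-List.ofFn_succ]

/-- The value of a family of linear maps on a word. -/
def evalWord (f : ∀ k, SymPow gr k →ₗ[ℂ] Z) (w : List (Letter gr)) : Z :=
  f w.length (sprod gr fun i => lval (w.get i))

theorem evalWord_ofFn (f : ∀ k, SymPow gr k →ₗ[ℂ] Z) {n : ℕ} (x : Fin n → Letter gr) :
    evalWord f (List.ofFn x) = f n (sprod gr fun i => lval (x i)) := by
  have key : ∀ (w : List (Letter gr)) (h : w.length = n), evalWord f w =
      f n (sprod gr fun i => lval (w.get (i.cast h.symm))) := by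
    rintro w rfl
    rfl
  rw [key _ (by simp)]
  simp

theorem sprod_swap {n : ℕ} (x : Fin n → Letter gr) (i j : Fin n) (hij : (i : ℕ) + 1 = j) :
    sprod gr (fun k => lval (x k)) = ((x i).1 * (x j).1).negOnePow •
      sprod gr (fun k => lval ((x ∘ Equiv.swap i j) k)) := by
  have h : PiTensorProduct.tprod ℂ (fun k => lval (x k)) - ((x i).1 * (x j).1).negOnePow •
      PiTensorProduct.tprod ℂ (fun k => lval ((x ∘ Equiv.swap i j) k)) ∈ koszulRel gr n :=
    Submodule.subset_span ⟨fun k => lval (x k), fun k => (x k).1, fun k => (x k).2.2, i, j, hij,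
      rfl⟩
  have h' := (Submodule.Quotient.mk_eq_zero _).2 h
  rw [Submodule.Quotient.mk_sub, sub_eq_zero] at h'
  refine h'.trans ?_
  rcases Int.units_eq_one_or ((x i).1 * (x j).1).negOnePow with h1 | h1 <;> rw [h1]
  · simp only [one_smul]; rfl
  · simp only [Units.neg_smul, one_smul]; rfl

/-- Linearity in a letter is multilinearity of the pure tensor, once a word with one variable letter
is written as an updated tuple of fixed length; the swap rule is a generator of the Koszul
relations. -/
theorem isSymWordFun_evalWord (f : ∀ k, SymPow gr k →ₗ[ℂ] Z) : IsSymWordFun (evalWord f) := by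
  have key : ∀ (l r : List (Letter gr)) (x : Letter gr), ∃ (n : ℕ) (i : Fin n) (u : Fin n → V),
      ∀ z, evalWord f (l ++ z :: r) =
        f n ((koszulRel gr n).mkQ (PiTensorProduct.tprod ℂ (Function.update u i (lval z)))) := by
    intro l r x
    let g := (l ++ x :: r).get
    let i : Fin (l ++ x :: r).length := ⟨l.length, by simp⟩
    refine ⟨_, i, fun k => lval (g k), fun z => ?_⟩
    have h1 : l ++ z :: r = List.ofFn (Function.update g i z) := by
      rw [List.ofFn_update, List.ofFn_get]
      simp [i]
    have h2 : (fun k => lval (Function.update g i z k)) =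
        Function.update (fun k => lval (g k)) i (lval z) := by
      funext k
      rcases eq_or_ne k i with rfl | h
      · simp
      · simp [h]
    rw [h1, evalWord_ofFn, h2]
    rfl
  refine ⟨?_, ?_, ?_⟩
  · intro l r x y z h1 h2 h
    obtain ⟨n, i, u, hu⟩ := key l r x
    rw [hu, hu, hu, h, MultilinearMap.map_update_add, map_add, map_add]
  · intro l r c x z h1 h
    obtain ⟨n, i, u, hu⟩ := key l r x
    rw [hu, hu, h, MultilinearMap.map_update_smul, map_smul, map_smul]
  · intro l x y r
    let g := (l ++ x :: y :: r).get
    let i : Fin (l ++ x :: y :: r).length := ⟨l.length, by simp⟩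
    let j : Fin (l ++ x :: y :: r).length := ⟨l.length + 1, by simp⟩
    have hi : g i = x := by simp [g, i]
    have hj : g j = y := by simp [g, j]
    obtain ⟨-, h2⟩ := List.ofFn_swap g i j rfl
    have h3 : List.ofFn (g ∘ Equiv.swap i j) = l ++ y :: x :: r := by
      rw [h2, List.ofFn_get, hi, hj]
      simp [i]
    have h4 : evalWord f (l ++ x :: y :: r) = f _ (sprod gr fun k => lval (g k)) := by
      rw [← evalWord_ofFn, List.ofFn_get]
    rw [← h3, evalWord_ofFn, h4,
      sprod_swap g i j rfl, hi, hj, Units.smul_def, Units.smul_def, map_zsmul]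

theorem isSymWordFun_symWord : IsSymWordFun (symWord gr) := by
  let f : ∀ k, SymPow gr k →ₗ[ℂ] RedSym gr := fun k => match k with
    | 0 => 0
    | n + 1 => DirectSum.lof ℂ ℕ (fun n => SymPow gr (n + 1)) n
  have : symWord gr = evalWord f := by
    funext w
    rcases w with _ | ⟨x, w⟩
    · rfl
    · rfl
  rw [this]
  exact isSymWordFun_evalWord (Z := RedSym gr) f

/-- Linear maps on the reduced symmetric coalgebra from graded symmetric functions on words. -/
theorem exists_linearMap_redSym (hgr : DirectSum.IsInternal gr) {G : List (Letter gr) → Z}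
    (hG : IsSymWordFun G) : ∃ T : RedSym gr →ₗ[ℂ] Z,
      ∀ w, w ≠ [] → T (symWord gr w) = G w := by
  choose T hT using exists_linearMap_symPow hgr hG
  refine ⟨DirectSum.toModule ℂ ℕ Z fun n => T (n + 1), fun w hw => ?_⟩
  rcases w with _ | ⟨x, w⟩
  · exact absurd rfl hw
  · rw [symWord, DirectSum.toModule_lof, hT, List.ofFn_get]

/-- A linear map on a symmetric power is determined by the multilinear map it induces, and that one
by its values on tuples of homogeneous vectors, since these span `V`. -/
theorem redSym_hom_ext (hgr : DirectSum.IsInternal gr) {T T' : RedSym gr →ₗ[ℂ] Z}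
    (h : ∀ w, w ≠ [] → T (symWord gr w) = T' (symWord gr w)) : T = T' := by
  refine DirectSum.linearMap_ext ℂ fun n => ?_
  refine Submodule.linearMap_qext _ (PiTensorProduct.ext ?_)
  let e := LinearEquiv.ofBijective (DirectSum.coeLinearMap gr) hgr
  have key : ∀ f g : MultilinearMap ℂ (fun _ : Fin (n + 1) => V) Z,
      (∀ x : Fin (n + 1) → Letter gr, f (fun i => lval (x i)) = g (fun i => lval (x i))) →
      f = g := by
    intro f g hfg
    have h1 : f.compLinearMap (fun _ => e.toLinearMap) =
        g.compLinearMap (fun _ => e.toLinearMap) := by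
      refine MultilinearMap.directSum_ext fun p => MultilinearMap.ext fun u => ?_
      simp only [MultilinearMap.compLinearMap_apply, LinearEquiv.coe_coe]
      have he : ∀ i, e (DirectSum.lof ℂ ℤ (fun i => gr i) (p i) (u i)) = u i := fun i =>
        DirectSum.coeLinearMap_lof gr (p i) (u i)
      simp only [he]
      exact hfg fun i => ⟨p i, u i⟩
    ext v
    have := congrArg (fun k => k fun i => e.symm (v i)) h1
    simpa using this
  refine key _ _ fun x => ?_
  have := h (List.ofFn x) (by simp)
  rw [symWord_ofFn] at this
  exact this

end SymWords

/-! ### Induced coderivations and induced morphisms of the symmetric coalgebra. -/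

section WordMaps

variable {V W Z : Type*} [AddCommGroup V] [Module ℂ V] [AddCommGroup W] [Module ℂ W]
  [AddCommGroup Z] [Module ℂ Z] {gr : ℤ → Submodule ℂ V} {gr' : ℤ → Submodule ℂ W}

theorem units_smul_comm (u : ℤˣ) (c : ℂ) (z : Z) : u • c • z = c • u • z := by
  rw [Units.smul_def, Units.smul_def, smul_comm]

theorem isSymWordFun_zero : IsSymWordFun (fun _ : List (Letter gr) => (0 : Z)) where
  add _ _ _ _ _ _ _ _ := by simp
  smul _ _ _ _ _ _ _ := by simp
  swap _ _ _ _ := by simp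

theorem IsSymWordFun.add_fun {G H : List (Letter gr) → Z} (hG : IsSymWordFun G)
    (hH : IsSymWordFun H) : IsSymWordFun fun u => G u + H u where
  add l r x y z hx hy h := by
    rw [hG.add l r x y z hx hy h, hH.add l r x y z hx hy h]
    abel
  smul l r c x z hx h := by rw [hG.smul l r c x z hx h, hH.smul l r c x z hx h, smul_add]
  swap l x y r := by
    simp only
    rw [hG.swap l x y r, hH.swap l x y r, smul_add]

/-- A sign depending only on the length and total degree of the word is unaffected by swaps and by
replacing a letter with one of equal degree. The signs in `conv` are of this kind. -/
theorem IsSymWordFun.units_smul {G : List (Letter gr) → Z} (hG : IsSymWordFun G)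
    (s : List (Letter gr) → ℤˣ) (hs : ∀ u v, u.length = v.length →
      wdeg (ldeg gr) u = wdeg (ldeg gr) v → s u = s v) :
    IsSymWordFun fun u => s u • G u where
  add l r x y z hx hy h := by
    rw [hG.add l r x y z hx hy h, smul_add, hs (l ++ z :: r) (l ++ x :: r) (by simp) (by simp [hx]),
      hs (l ++ x :: r) (l ++ y :: r) (by simp) (by simp [hx, hy])]
  smul l r c x z hx h := by
    rw [hG.smul l r c x z hx h, units_smul_comm,
      hs (l ++ z :: r) (l ++ x :: r) (by simp) (by simp [hx])]
  swap l x y r := by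
    simp only
    rw [hG.swap l x y r, smul_comm,
      hs (l ++ x :: y :: r) (l ++ y :: x :: r) (by simp) (by simp; ring)]

theorem IsSymWordFun.map {G : List (Letter gr) → W} (hG : IsSymWordFun G) (f : W →ₗ[ℂ] Z) :
    IsSymWordFun fun u => f (G u) where
  add l r x y z hx hy h := by rw [hG.add l r x y z hx hy h, map_add]
  smul l r c x z hx h := by rw [hG.smul l r c x z hx h, map_smul]
  swap l x y r := by
    simp only
    rw [hG.swap l x y r, Units.smul_def, Units.smul_def, map_zsmul]

theorem IsSymWordFun.const_smul {G : List (Letter gr) → Z} (hG : IsSymWordFun G) (c : ℂ) :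
    IsSymWordFun fun u => c • G u where
  add l r x y z hx hy h := by rw [hG.add l r x y z hx hy h, smul_add]
  smul l r a x z hx h := by rw [hG.smul l r a x z hx h, smul_comm]
  swap l x y r := by
    simp only
    rw [hG.swap l x y r, units_smul_comm]

theorem IsSymWordFun.sum {ι : Type*} (s : Finset ι) {G : ι → List (Letter gr) → Z}
    (hG : ∀ i, IsSymWordFun (G i)) : IsSymWordFun fun u => ∑ i ∈ s, G i u := by
  classical
  induction s using Finset.induction_on with
  | empty => simpa using isSymWordFun_zero
  | insert i s hi ih =>
    simp only [Finset.sum_insert hi]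
    exact (hG i).add_fun ih

theorem IsSymWordFun.of_length {G : ℕ → List (Letter gr) → Z} (hG : ∀ n, IsSymWordFun (G n)) :
    IsSymWordFun fun u => G u.length u where
  add l r x y z hx hy h := by
    have e1 : (l ++ x :: r).length = (l ++ z :: r).length := by simp
    have e2 : (l ++ y :: r).length = (l ++ z :: r).length := by simp
    rw [e1, e2, (hG _).add l r x y z hx hy h]
  smul l r c x z hx h := by
    have e1 : (l ++ x :: r).length = (l ++ z :: r).length := by simp
    rw [e1, (hG _).smul l r c x z hx h]
  swap l x y r := by
    have e1 : (l ++ x :: y :: r).length = (l ++ y :: x :: r).length := by simp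
    simp only
    rw [e1, (hG _).swap l x y r]

/-- The recursion pushes the leading letters into `Φ`, and `h1'`, `h2'` show that the new function
stays in the class. It then suffices to treat a variable letter standing first, which enters one of
the two blocks linearly. -/
theorem IsSymWordFun.conv {Φ : List (Letter gr) → List (Letter gr) → Z}
    (h1 : ∀ v, IsSymWordFun fun u => Φ u v) (h2 : ∀ u, IsSymWordFun (Φ u)) :
    IsSymWordFun (conv (ldeg gr) Φ) := by
  have h1' : ∀ {Φ : List (Letter gr) → List (Letter gr) → Z} (_ : ∀ v, IsSymWordFun fun u => Φ u v)
      (a : Letter gr) (v : List (Letter gr)), IsSymWordFun fun u => Φ (a :: u) v +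
        (ldeg gr a * wdeg (ldeg gr) u).negOnePow • Φ u (a :: v) := fun h1 a v =>
    ((h1 v).prepend [a]).add_fun ((h1 (a :: v)).units_smul _ fun u v _ h => by rw [h])
  have h2' : ∀ {Φ : List (Letter gr) → List (Letter gr) → Z} (_ : ∀ u, IsSymWordFun (Φ u))
      (a : Letter gr) (u : List (Letter gr)), IsSymWordFun fun v => Φ (a :: u) v +
        (ldeg gr a * wdeg (ldeg gr) u).negOnePow • Φ u (a :: v) := fun h2 a u =>
    (h2 (a :: u)).add_fun (((h2 u).prepend [a]).units_smul _ fun u v _ h => rfl)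
  refine ⟨?_, ?_, SwapRule.conv (fun v => (h1 v).swap) (fun u => (h2 u).swap)⟩
  · intro l r x y z hx hy h
    induction l generalizing Φ with
    | nil =>
      simp only [List.nil_append, conv_cons']
      rw [← conv_add]
      refine conv_congr fun u v _ _ => ?_
      have e1 := (h1 v).add [] u x y z hx hy h
      have e2 := (h2 u).add [] v x y z hx hy h
      simp only [List.nil_append] at e1 e2
      simp only [ldeg, e1, e2, hx, hy, smul_add]
      abel
    | cons a l ih =>
      simp only [List.cons_append, conv_cons']
      exact ih (h1' h1 a) (h2' h2 a)
  · intro l r c x z hx h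
    induction l generalizing Φ with
    | nil =>
      simp only [List.nil_append, conv_cons']
      rw [← conv_smul]
      refine conv_congr fun u v _ _ => ?_
      have e1 := (h1 v).smul [] u c x z hx h
      have e2 := (h2 u).smul [] v c x z hx h
      simp only [List.nil_append] at e1 e2
      simp only [ldeg, e1, e2, hx, smul_add, units_smul_comm]
    | cons a l ih =>
      simp only [List.cons_append, conv_cons']
      exact ih (h1' h1 a) (h2' h2 a)

/-- The letter given by a word function of degree `e`. -/
def opLetter (q : List (Letter gr) → W) (e : ℤ)
    (hq : ∀ w, q w ∈ gr' (wdeg (ldeg gr) w + e)) (w : List (Letter gr)) : Letter gr' :=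
  ⟨wdeg (ldeg gr) w + e, q w, hq w⟩

theorem lval_opLetter (q : List (Letter gr) → W) (e : ℤ)
    (hq : ∀ w, q w ∈ gr' (wdeg (ldeg gr) w + e)) (w : List (Letter gr)) :
    lval (opLetter q e hq w) = q w := rfl

theorem IsSymWordFun.comp_opLetter {q : List (Letter gr) → W} (hs : IsSymWordFun q) {e : ℤ}
    {hq : ∀ w, q w ∈ gr' (wdeg (ldeg gr) w + e)} {Φ : List (Letter gr') → Z}
    (hΦ : IsSymWordFun Φ) (s t : List (Letter gr')) :
    IsSymWordFun fun w => Φ (s ++ opLetter q e hq w :: t) where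
  add l r x y z hx hy h := hΦ.add _ _ _ _ _ (by simp [opLetter, hx]) (by simp [opLetter, hy])
    (hs.add l r x y z hx hy h)
  smul l r c x z hx h := hΦ.smul _ _ _ _ _ (by simp [opLetter, hx]) (hs.smul l r c x z hx h)
  swap l x y r := by
    have h : lval (opLetter q e hq (l ++ x :: y :: r)) =
        (((ldeg gr x * ldeg gr y).negOnePow : ℤ) : ℂ) •
          lval (opLetter q e hq (l ++ y :: x :: r)) := by
      rw [lval_opLetter, lval_opLetter, hs.swap l x y r, Units.smul_def, Int.cast_smul_eq_zsmul]
    simp only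
    rw [hΦ.smul _ _ _ _ _ ?_ h, Units.smul_def, Int.cast_smul_eq_zsmul]
    simp [opLetter]
    ring

/-- Letters carry a degree and cannot be added. But all `L u v` have the degree of `y`, so they live
in the single space `gr y.1`, on which `Φ` is linear in this position, and a linear map commutes
with `conv`. -/
theorem conv_letter {α : Type*} {d : α → ℤ} {Φ : List (Letter gr) → Z} (hΦ : IsSymWordFun Φ)
    (s t : List (Letter gr)) (L : List α → List α → Letter gr) (w : List α) (y : Letter gr)
    (hL : ∀ u v, wdeg d u + wdeg d v = wdeg d w → (L u v).1 = y.1)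
    (hy : lval y = conv d (fun u v => lval (L u v)) w) :
    conv d (fun u v => Φ (s ++ L u v :: t)) w = Φ (s ++ y :: t) := by
  classical
  let T : gr y.1 →ₗ[ℂ] Z :=
    { toFun := fun z => Φ (s ++ ⟨y.1, z⟩ :: t)
      map_add' := fun a b => hΦ.add _ _ _ _ _ rfl rfl rfl
      map_smul' := fun c a => hΦ.smul _ _ _ _ _ rfl rfl }
  -- The default `0` is never met for complementary subwords of `w`, by `hL`.
  let c : List α → List α → gr y.1 := fun u v =>
    if h : (L u v).1 = y.1 then ⟨lval (L u v), h ▸ (L u v).2.2⟩ else 0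
  have h1 : conv d (fun u v => Φ (s ++ L u v :: t)) w = conv d (fun u v => T (c u v)) w := by
    refine conv_congr fun u v _ h => ?_
    have h' := hL u v h
    simp only [T, c, h', dif_pos, LinearMap.coe_mk, AddHom.coe_mk]
    congr 3
    exact Letter.ext h' rfl
  have h2 : ((conv d c w : gr y.1) : V) = lval y := by
    rw [hy, ← Submodule.subtype_apply, map_conv]
    refine conv_congr fun u v _ h => ?_
    simp [c, hL u v h]
  rw [h1, ← map_conv]
  simp only [T, LinearMap.coe_mk, AddHom.coe_mk]
  congr 3
  exact Letter.ext rfl h2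

theorem IsSymWordFun.wpow {q : List (Letter gr) → W} (hs : IsSymWordFun q) {e : ℤ}
    {hq : ∀ w, q w ∈ gr' (wdeg (ldeg gr) w + e)} (m : ℕ) {Φ : List (Letter gr') → Z}
    (hΦ : IsSymWordFun Φ) : IsSymWordFun (wpow (ldeg gr) (opLetter q e hq) m Φ) := by
  induction m generalizing Φ with
  | zero =>
    simp only [_root_.wpow]
    exact ⟨fun _ _ _ _ _ _ _ _ => by simp, fun _ _ _ _ _ _ _ => by simp,
      fun _ _ _ _ => by simp⟩
  | succ m ih =>
    refine IsSymWordFun.conv (fun v => ?_) fun u => ih (hΦ.prepend [_])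
    have key : ∀ t, IsSymWordFun fun u => Φ (opLetter q e hq u :: t) := fun t =>
      hs.comp_opLetter hΦ [] t
    refine ⟨?_, ?_, ?_⟩
    · intro l r x y z hx hy h
      rw [← wpow_add]
      congr 1
      exact funext fun t => (key t).add l r x y z hx hy h
    · intro l r c x z hx h
      rw [← wpow_smul]
      congr 1
      exact funext fun t => (key t).smul l r c x z hx h
    · intro l x y r
      simp only
      rw [← wpow_smul]
      congr 1
      exact funext fun t => (key t).swap l x y r

theorem wdeg_ofFn {n : ℕ} (x : Fin n → Letter gr) :
    wdeg (ldeg gr) (List.ofFn x) = ∑ i, (x i).1 := by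
  simp [wdeg, List.sum_ofFn, List.map_ofFn]

/-- The value of a family of linear maps on a word, with value `0` on the empty word. -/
def evalWord₀ (f : ∀ k, SymPow gr k →ₗ[ℂ] Z) (w : List (Letter gr)) : Z :=
  if w = [] then 0 else evalWord f w

@[simp] theorem evalWord₀_nil (f : ∀ k, SymPow gr k →ₗ[ℂ] Z) : evalWord₀ f [] = 0 := if_pos rfl

theorem isSymWordFun_evalWord₀ (f : ∀ k, SymPow gr k →ₗ[ℂ] Z) : IsSymWordFun (evalWord₀ f) := by
  have h := isSymWordFun_evalWord f
  have key : ∀ l r (x : Letter gr), evalWord₀ f (l ++ x :: r) = evalWord f (l ++ x :: r) :=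
    fun l r x => if_neg (by simp)
  refine ⟨?_, ?_, ?_⟩
  · intro l r x y z hx hy hz
    rw [key, key, key, h.add l r x y z hx hy hz]
  · intro l r c x z hx hz
    rw [key, key, h.smul l r c x z hx hz]
  · intro l x y r
    rw [key, key, h.swap]

theorem subfamily_eq {α : Type*} {n : ℕ} (x : Fin n → α) (I : Finset (Fin n)) :
    subword x (· ∈ I) = List.ofFn (subfamily x I) := (ofFn_subfamily x I).symm

theorem evalWord₀_ofFn (f : ∀ k, SymPow gr k →ₗ[ℂ] Z) {n : ℕ} (hn : n ≠ 0)
    (x : Fin n → Letter gr) :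
    evalWord₀ f (List.ofFn x) = f n (sprod gr fun i => lval (x i)) := by
  rw [evalWord₀, if_neg (by simpa using hn), evalWord_ofFn]

/-- The convolution formula is a graded symmetric function of the word, hence descends to the
coalgebra; rewritten over subsets it is the formula defining an induced coderivation. -/
theorem exists_inducedCoderivation (hgr : DirectSum.IsInternal gr)
    (q : ∀ k, SymPow gr k →ₗ[ℂ] V)
    (hq : ∀ w, evalWord₀ q w ∈ gr (wdeg (ldeg gr) w + 1)) :
    ∃ Q : RedSym gr →ₗ[ℂ] RedSym gr, IsInducedCoderivation gr q Q ∧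
      ∀ w, w ≠ [] → Q (symWord gr w) =
        conv (ldeg gr) (fun u v => symWord gr (opLetter (evalWord₀ q) 1 hq u :: v)) w := by
  obtain ⟨Q, hQ⟩ := exists_linearMap_redSym (Z := RedSym gr) hgr
    (G := conv (ldeg gr) (fun u v => symWord gr (opLetter (evalWord₀ q) 1 hq u :: v)))
    (IsSymWordFun.conv (fun v => (isSymWordFun_evalWord₀ q).comp_opLetter isSymWordFun_symWord [] v)
      fun u => isSymWordFun_symWord.prepend [_])
  refine ⟨Q, ?_, hQ⟩
  intro n v a hv
  let x : Fin (n + 1) → Letter gr := fun i => ⟨a i, v i, hv i⟩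
  have h1 := hQ (List.ofFn x) (by simp)
  rw [symWord_ofFn, conv_ofFn] at h1
  refine h1.trans ?_
  rw [Finset.sum_filter]
  refine Finset.sum_congr rfl fun I _ => ?_
  split_ifs with hI
  · congr 1
    rw [subfamily_eq, subfamily_eq, ← List.ofFn_cons, symWord_ofFn]
    congr 2
    funext i
    refine Fin.cases ?_ (fun i => ?_) i
    · rw [Fin.cons_zero, Fin.cons_zero, lval_opLetter, evalWord₀_ofFn]
      · rfl
      · simpa using hI.ne_empty
    · simp only [Fin.cons_succ]
      rfl
  -- The convolution also runs over the empty first subword; that term vanishes because `evalWord₀`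
  -- is zero there.
  · obtain rfl := Finset.not_nonempty_iff_eq_empty.1 hI
    have h0 : subword x (· ∈ (∅ : Finset (Fin (n + 1)))) = [] := by simp [subword]
    have h2 : symWord gr ([] ++ opLetter (evalWord₀ q) 1 hq [] ::
        subword x (· ∈ (∅ : Finset (Fin (n + 1)))ᶜ)) = 0 :=
      isSymWordFun_symWord.eq_zero (evalWord₀_nil q)
    rw [h0, ← List.nil_append (_ :: _), h2, smul_zero]

/-- Every power of `f` is graded symmetric in the word. The bound of the sum depends on the word
only through its length, so `IsSymWordFun.of_length` applies. -/
theorem exists_inducedMorphism (hgr : DirectSum.IsInternal gr)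
    (f : ∀ k, SymPow gr k →ₗ[ℂ] W) (hf : ∀ w, evalWord₀ f w ∈ gr' (wdeg (ldeg gr) w + 0)) :
    ∃ F : RedSym gr →ₗ[ℂ] RedSym gr', IsInducedMorphism gr gr' f F ∧
      ∀ w, w ≠ [] → F (symWord gr w) =
        ∑ m ∈ Finset.range w.length, ((m + 1).factorial : ℂ)⁻¹ •
          wpow (ldeg gr) (opLetter (evalWord₀ f) 0 hf) (m + 1) (symWord gr') w := by
  obtain ⟨F, hF⟩ := exists_linearMap_redSym (Z := RedSym gr') hgr
    (G := fun w => ∑ m ∈ Finset.range w.length, ((m + 1).factorial : ℂ)⁻¹ •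
      wpow (ldeg gr) (opLetter (evalWord₀ f) 0 hf) (m + 1) (symWord gr') w)
    (IsSymWordFun.of_length (G := fun n w => ∑ m ∈ Finset.range n, ((m + 1).factorial : ℂ)⁻¹ •
      wpow (ldeg gr) (opLetter (evalWord₀ f) 0 hf) (m + 1) (symWord gr') w) fun n =>
      IsSymWordFun.sum _ fun m => ((isSymWordFun_evalWord₀ f).wpow (m + 1) isSymWordFun_symWord).const_smul _)
  refine ⟨F, ?_, hF⟩
  intro n v a hv
  let x : Fin (n + 1) → Letter gr := fun i => ⟨a i, v i, hv i⟩
  have h1 := hF (List.ofFn x) (by simp)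
  rw [symWord_ofFn, List.length_ofFn] at h1
  refine h1.trans (Finset.sum_congr rfl fun m _ => ?_)
  congr 1
  rw [wpow_eq_multiconv, multiconv_ofFn, Finset.sum_filter]
  refine Finset.sum_congr rfl fun c _ => ?_
  split_ifs with hc
  · congr 1
    rw [symWord_ofFn]
    congr 2
    funext j
    have h2 : subword x (fun i => c i = j) =
        List.ofFn (subfamily x (Finset.univ.filter fun i => c i = j)) := by
      rw [← subfamily_eq]
      exact subword_congr x (by simp)
    rw [lval_opLetter]
    simp only [h2]
    rw [evalWord₀_ofFn]
    · rfl
    · obtain ⟨i, hi⟩ := hc j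
      exact Finset.card_ne_zero_of_mem (a := i) (by simpa using hi)
  -- A non-surjective distribution has an empty block, on which `f` is zero by convention.
  · obtain ⟨j, hj⟩ := not_forall.1 hc
    have h2 : subword x (fun i => c i = j) = [] := by
      have h3 : ∀ i, ¬ c i = j := fun i hi => hj ⟨i, hi⟩
      simp [subword, h3]
    obtain ⟨l, r, hlr⟩ := List.append_of_mem (a := opLetter (evalWord₀ f) 0 hf [])
      (l := List.ofFn fun i => opLetter (evalWord₀ f) 0 hf (subword x (fun k => c k = i)))
      (by rw [List.mem_ofFn]; exact ⟨j, by rw [h2]⟩)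
    rw [hlr, isSymWordFun_symWord.eq_zero (evalWord₀_nil f), smul_zero]

end WordMaps

/-! ### Odd derivations of words. -/

section Derivation

variable {α β Z : Type*} [AddCommGroup Z] {d : α → ℤ} {e : β → ℤ}

variable (e) in
/-- The odd derivation of words induced by the map `D` on letters. -/
def derWord (D : β → β) (Φ : List β → Z) : List β → Z
  | [] => 0
  | y :: t => Φ (D y :: t) + (e y).negOnePow • derWord D (fun s => Φ (y :: s)) t

theorem conv_ite_nil (Ψ : List α → Z) (w : List α) :
    conv d (fun u v => if u = [] then Ψ v else 0) w = Ψ w := by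
  induction w generalizing Ψ with
  | nil => simp
  | cons x w ih =>
    rw [conv_cons']
    simp only [List.cons_ne_nil, if_false, zero_add]
    rw [← ih fun v => Ψ (x :: v)]
    congr 1
    funext u v
    split_ifs with h
    · simp [h]
    · simp

/-- An odd derivation preceded by a power of `f`. -/
theorem wpow_derWord {f : List α → β} (hf : ∀ u, e (f u) = wdeg d u) (D : β → β)
    (hD : ∀ y, e (D y) = e y + 1) (m : ℕ) (Φ : List β → Z) (hΦ : SwapRule e Φ) (w : List α) :
    wpow d f (m + 1) (derWord e D Φ) w =
      (m + 1) • conv d (fun u v => wpow d f m (fun t => Φ (D (f u) :: t)) v) w := by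
  induction m generalizing Φ w with
  | zero =>
    simp [wpow, derWord]
  | succ m ih =>
    -- The derivation hits the first block or, by induction, one of the others; the swap rule moves
    -- the differentiated letter to the front each time, which accounts for the factor.
    rw [wpow]
    simp only [derWord, wpow_add, wpow_smul, conv_add]
    rw [add_smul, one_smul, add_comm]
    congr 1
    have h1 : ∀ x v, wpow d f (m + 1) (derWord e D fun s => Φ (f x :: s)) v =
        (m + 1) • conv d (fun u v => wpow d f m (fun t => Φ (f x :: D (f u) :: t)) v) v :=
      fun x v => ih _ (hΦ.cons _) v
    simp only [h1]
    have h2 := conv_left_comm (d := d) (fun x u v => (e (f x)).negOnePow •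
      wpow d f m (fun t => Φ (f x :: D (f u) :: t)) v) w
    have h3 : ∀ x z, (e (f x)).negOnePow • (m + 1) •
        conv d (fun u v => wpow d f m (fun t => Φ (f x :: D (f u) :: t)) v) z = (m + 1) •
        conv d (fun u v => (e (f x)).negOnePow •
          wpow d f m (fun t => Φ (f x :: D (f u) :: t)) v) z := by
      intro x z
      rw [conv_smul, smul_comm]
    simp only [h3]
    rw [conv_smul, h2]
    congr 2
    funext u z
    rw [wpow]
    congr 1
    funext x v
    have : (fun t => Φ (f x :: D (f u) :: t)) = fun t =>
        (wdeg d x * (wdeg d u + 1)).negOnePow • Φ (D (f u) :: f x :: t) := funext fun t => by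
      rw [← hf, ← hf, ← hD]
      exact hΦ [] (f x) (D (f u)) t
    rw [this, wpow_smul, negOnePow_smul_smul, negOnePow_smul_smul, hf]
    conv_rhs => rw [← one_smul ℤˣ (wpow d f m _ v), ← Int.negOnePow_zero]
    exact negOnePow_smul_congr ⟨wdeg d x * wdeg d u + wdeg d x, by ring⟩ _

end Derivation

/-! ### `L∞`-structures of differential graded Lie algebras and morphisms to abelian ones. -/

section LInfinity

variable {V W Z : Type*} [AddCommGroup V] [Module ℂ V] [AddCommGroup W] [Module ℂ W]
  [AddCommGroup Z] [Module ℂ Z] {gr : ℤ → Submodule ℂ V} {gr' : ℤ → Submodule ℂ W}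

theorem eq_zero_of_eq_neg_self {z : Z} (h : z = -z) : z = 0 := by
  have h2 : (2 : ℂ) • z = 0 := by
    rw [two_smul]
    nth_rewrite 2 [h]
    simp
  exact (smul_eq_zero.1 h2).resolve_left two_ne_zero

/-- Applying the coderivation twice either nests the two brackets or applies them to disjoint
subwords. The nested terms vanish by `hqq`; the disjoint ones cancel in pairs, since the brackets
are odd. -/
theorem coderivation_sq_eq_zero (hgr : DirectSum.IsInternal gr)
    {q : ∀ k, SymPow gr k →ₗ[ℂ] V} {hq : ∀ w, evalWord₀ q w ∈ gr (wdeg (ldeg gr) w + 1)}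
    {Q : RedSym gr →ₗ[ℂ] RedSym gr} (hQ : ∀ w, w ≠ [] → Q (symWord gr w) =
      conv (ldeg gr) (fun u v => symWord gr (opLetter (evalWord₀ q) 1 hq u :: v)) w)
    (hqq : ∀ w, conv (ldeg gr) (fun u v => evalWord₀ q (opLetter (evalWord₀ q) 1 hq u :: v)) w = 0) :
    Q ∘ₗ Q = 0 := by
  refine redSym_hom_ext (Z := RedSym gr) hgr fun w hw => ?_
  set op := opLetter (evalWord₀ q) 1 hq
  have hop : ∀ u, ldeg gr (op u) = wdeg (ldeg gr) u + 1 := fun u => rfl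
  have hs : IsSymWordFun (symWord gr) := isSymWordFun_symWord
  rw [LinearMap.comp_apply, hQ w hw, map_conv, LinearMap.zero_apply]
  have h1 : ∀ u v, Q (symWord gr (op u :: v)) =
      conv (ldeg gr) (fun x y => symWord gr (op x :: y)) (op u :: v) := fun u v => hQ _ (by simp)
  simp only [h1]
  rw [conv_leibniz op hop]
  have h2 : ∀ z y, conv (ldeg gr) (fun u x => symWord gr (op (op u :: x) :: y)) z = 0 := by
    intro z y
    have := conv_letter (d := ldeg gr) hs [] y (fun u x => op (op u :: x)) z
      ⟨wdeg (ldeg gr) z + 2, 0⟩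
      (fun u v h => by simp only [hop, wdeg_cons]; rw [← h]; ring) (hqq z).symm
    refine this.trans (hs.eq_zero rfl)
  rw [conv_eq_zero fun u v _ _ => h2 u v, zero_add]
  -- Exchanging the subwords `x` and `u` and then the letters `op x` and `op u` turns the sum of
  -- disjoint terms into its negative.
  refine eq_zero_of_eq_neg_self (Z := RedSym gr) ?_
  simp only [← conv_smul]
  conv_lhs => rw [conv_left_comm]
  rw [← conv_neg]
  congr 1
  funext x z
  rw [← conv_neg]
  congr 1
  funext u y
  have h3 := hs.swap [] (op u) (op x) y
  simp only [List.nil_append, hop] at h3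
  rw [h3, negOnePow_smul_smul, negOnePow_smul_smul, ← Units.neg_smul, ← Int.negOnePow_succ]
  exact negOnePow_smul_congr ⟨wdeg (ldeg gr) u * wdeg (ldeg gr) x + wdeg (ldeg gr) u, by ring⟩ _

namespace DGLA

variable (𝔤 : DGLA V)

theorem evalWord₀_lInfty_one (x : Letter (shiftGr 𝔤.gr)) :
    evalWord₀ 𝔤.lInfty [x] = - 𝔤.d (lval x) := by
  rw [evalWord₀, if_neg (by simp)]
  exact (Submodule.liftQ_apply _ _ _).trans (PiTensorProduct.lift.tprod _)

theorem evalWord₀_lInfty_two (x y : Letter (shiftGr 𝔤.gr)) :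
    evalWord₀ 𝔤.lInfty [x, y] = (x.1 + 1).negOnePow • 𝔤.br (lval x) (lval y) := by
  rw [evalWord₀, if_neg (by simp)]
  refine ((Submodule.liftQ_apply _ _ _).trans (PiTensorProduct.lift.tprod _)).trans ?_
  simp only [q₂, MultilinearMap.mk'_apply]
  have h : 𝔤.sgn (lval ([x, y].get 0)) = (x.1 + 1).negOnePow • lval x :=
    𝔤.sgn_of_mem (i := x.1 + 1) x.2.2
  rw [h, Units.smul_def, map_zsmul, LinearMap.smul_apply,
    Units.smul_def]
  rfl

theorem evalWord₀_lInfty_of_three_le (w : List (Letter (shiftGr 𝔤.gr))) (hw : 3 ≤ w.length) :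
    evalWord₀ 𝔤.lInfty w = 0 := by
  match w, hw with
  | x :: y :: z :: w, _ =>
    rw [evalWord₀, if_neg (by simp)]
    rfl

/-- In either parity of `a` the sign of a product with `a` simplifies to `1` or to the sign of the
other factor; the Lie algebra identities below are verified case by case in this form. -/
theorem negOnePow_cases (a : ℤ) :
    (a.negOnePow = 1 ∧ ∀ b : ℤ, (a * b).negOnePow = 1 ∧ (b * a).negOnePow = 1) ∨
    (a.negOnePow = -1 ∧ ∀ b : ℤ, (a * b).negOnePow = b.negOnePow ∧
      (b * a).negOnePow = b.negOnePow) := by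
  rcases Int.even_or_odd a with h | h
  · exact Or.inl ⟨Int.negOnePow_even _ h, fun b => ⟨Int.negOnePow_even _ (h.mul_right b),
      Int.negOnePow_even _ (h.mul_left b)⟩⟩
  · refine Or.inr ⟨Int.negOnePow_odd _ h, fun b => ?_⟩
    obtain ⟨k, rfl⟩ := h
    constructor <;> rw [Int.negOnePow_eq_iff] <;> exact ⟨k * b, by ring⟩

theorem units_smul_mem {p : Submodule ℂ V} (u : ℤˣ) {x : V} (hx : x ∈ p) : u • x ∈ p := by
  rcases Int.units_eq_one_or u with rfl | rfl
  · simpa using hx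
  · simpa using hx

theorem evalWord₀_lInfty_mem (w : List (Letter (shiftGr 𝔤.gr))) :
    evalWord₀ 𝔤.lInfty w ∈ shiftGr 𝔤.gr (wdeg (ldeg (shiftGr 𝔤.gr)) w + 1) := by
  match w with
  | [] => simp
  | [x] =>
    rw [evalWord₀_lInfty_one]
    have h := 𝔤.d_mem _ _ x.2.2
    simpa [shiftGr] using h
  | [x, y] =>
    rw [evalWord₀_lInfty_two]
    refine units_smul_mem _ ?_
    have h := 𝔤.br_mem _ _ _ x.2.2 _ y.2.2
    have h2 : wdeg (ldeg (shiftGr 𝔤.gr)) [x, y] + 1 + 1 = x.1 + 1 + (y.1 + 1) := by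
      simp only [wdeg_cons, wdeg_nil]
      ring
    rw [← h2] at h
    exact h
  | _ :: _ :: _ :: _ =>
    rw [evalWord₀_lInfty_of_three_le _ _ (by simp)]
    exact zero_mem _

theorem degree_of_evalWord₀ {f : ∀ k, SymPow gr k →ₗ[ℂ] W} {e : ℤ}
    (h : ∀ w, evalWord₀ f w ∈ gr' (wdeg (ldeg gr) w + e)) (k : ℕ) (hk : 1 ≤ k) (v : Fin k → V)
    (a : Fin k → ℤ) (hv : ∀ i, v i ∈ gr (a i)) : f k (sprod gr v) ∈ gr' (∑ i, a i + e) := by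
  let x : Fin k → Letter gr := fun i => ⟨a i, v i, hv i⟩
  have h' := h (List.ofFn x)
  rw [evalWord₀_ofFn _ (by omega), wdeg_ofFn] at h'
  exact h'

theorem isInternal_shiftGr {gr : ℤ → Submodule ℂ V} (h : DirectSum.IsInternal gr) :
    DirectSum.IsInternal (shiftGr gr) := by
  rw [DirectSum.isInternal_submodule_iff_iSupIndep_and_iSup_eq_top] at h ⊢
  refine ⟨h.1.comp (add_left_injective 1), ?_⟩
  rw [← h.2]
  exact (Equiv.addRight (1 : ℤ)).iSup_comp (g := gr)

/-- Sorted by the length of the word: one letter gives `d² = 0`, two the Leibniz rule, three the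
Jacobi identity. With four or more letters the inner or the outer bracket has at least three
arguments and vanishes. -/
theorem conv_lInfty_eq_zero (w : List (Letter (shiftGr 𝔤.gr))) :
    conv (ldeg (shiftGr 𝔤.gr)) (fun u v => evalWord₀ 𝔤.lInfty
      (opLetter (evalWord₀ 𝔤.lInfty) 1 𝔤.evalWord₀_lInfty_mem u :: v)) w = 0 := by
  set op := opLetter (evalWord₀ 𝔤.lInfty) 1 𝔤.evalWord₀_lInfty_mem with hop
  have hs := isSymWordFun_evalWord₀ 𝔤.lInfty
  have hnil : ∀ v, evalWord₀ 𝔤.lInfty (op [] :: v) = 0 := fun v =>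
    hs.eq_zero (l := []) (z := op []) (evalWord₀_nil 𝔤.lInfty)
  have hone : ∀ x, lval (op [x]) = - 𝔤.d (lval x) := 𝔤.evalWord₀_lInfty_one
  have htwo : ∀ x y, lval (op [x, y]) = (x.1 + 1).negOnePow • 𝔤.br (lval x) (lval y) :=
    𝔤.evalWord₀_lInfty_two
  have hdeg : ∀ u, (op u).1 = wdeg (ldeg (shiftGr 𝔤.gr)) u + 1 := fun u => rfl
  have hthree : ∀ x y z, lval (op [x, y, z]) = 0 := fun x y z =>
    𝔤.evalWord₀_lInfty_of_three_le [x, y, z] (by simp)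
  have hthree' : ∀ x y z, evalWord₀ 𝔤.lInfty [x, y, z] = 0 := fun x y z =>
    𝔤.evalWord₀_lInfty_of_three_le [x, y, z] (by simp)
  match w with
  | [] => simpa using hnil []
  | [x] =>
    simp only [conv_cons', conv_nil, hnil, evalWord₀_lInfty_one, hone]
    simp [𝔤.d_d]
  | [x, y] =>
    simp only [conv_cons', conv_nil, hnil, evalWord₀_lInfty_one, evalWord₀_lInfty_two, hone, htwo,
      hdeg]
    simp only [wdeg_cons, wdeg_nil, add_zero, ldeg]
    have hl := 𝔤.leibniz _ _ _ x.2.2 _ y.2.2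
    -- The unshuffle putting `y` first yields `[d y, x]`, whereas the Leibniz rule is stated with
    -- `[x, d y]`.
    have hsk := 𝔤.skew _ _ _ (𝔤.d_mem _ _ y.2.2) _ x.2.2
    rcases negOnePow_cases x.1 with ⟨hx, hx'⟩ | ⟨hx, hx'⟩ <;>
    rcases negOnePow_cases y.1 with ⟨hy, hy'⟩ | ⟨hy, hy'⟩ <;>
    simp [Int.negOnePow_add, mul_add, add_mul, hx, hx', hy, hl, hsk] at hl hsk ⊢
  | [x, y, z] =>
    simp only [conv_cons', conv_nil, hnil, evalWord₀_lInfty_one, evalWord₀_lInfty_two, htwo,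
      hdeg, hthree, hthree']
    simp only [wdeg_cons, wdeg_nil, add_zero, ldeg]
    have hj := 𝔤.jacobi _ _ _ (lval x) x.2.2 (lval y) y.2.2 (lval z) z.2.2
    -- The unshuffles produce `[[x, y], z]`, `[[x, z], y]` and `[[y, z], x]`; skew symmetry puts the
    -- Jacobi identity into these terms.
    have h1 := 𝔤.skew _ _ (lval x) x.2.2 _ (𝔤.br_mem _ _ (lval y) y.2.2 (lval z) z.2.2)
    have h2 := 𝔤.skew _ _ (lval y) y.2.2 _ (𝔤.br_mem _ _ (lval x) x.2.2 (lval z) z.2.2)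
    rcases negOnePow_cases x.1 with ⟨hx, hx'⟩ | ⟨hx, hx'⟩ <;>
    rcases negOnePow_cases y.1 with ⟨hy, hy'⟩ | ⟨hy, hy'⟩ <;>
    rcases negOnePow_cases z.1 with ⟨hz, hz'⟩ | ⟨hz, hz'⟩ <;>
    simp [Int.negOnePow_add, mul_add, add_mul, hx, hx', hy, hy', hz] at hj h1 h2 ⊢ <;>
    rw [h1, h2] at hj <;>
    first
      | linear_combination (norm := module) (1 : ℤ) • hj
      | linear_combination (norm := module) (-1 : ℤ) • hj
  | x :: y :: z :: t :: w =>
    refine conv_eq_zero fun u v hl _ => ?_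
    rcases Nat.lt_or_ge u.length 3 with h | h
    · refine 𝔤.evalWord₀_lInfty_of_three_le _ ?_
      simp at hl ⊢
      omega
    · exact hs.eq_zero (l := []) (𝔤.evalWord₀_lInfty_of_three_le _ h)

theorem isLInftyAlgebra : IsLInftyAlgebra 𝔤.gr 𝔤.lInfty where
  isInternal := 𝔤.isInternal
  degree := degree_of_evalWord₀ 𝔤.evalWord₀_lInfty_mem
  codifferential := by
    obtain ⟨Q, hQ, hQ'⟩ := exists_inducedCoderivation (isInternal_shiftGr 𝔤.isInternal) 𝔤.lInfty
      𝔤.evalWord₀_lInfty_mem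
    exact ⟨Q, hQ, coderivation_sq_eq_zero (isInternal_shiftGr 𝔤.isInternal) hQ'
      𝔤.conv_lInfty_eq_zero⟩

/-- For an abelian target the compatibility with the codifferentials reduces to one identity for
the components. -/
theorem isLInftyMorphism_of_abelian (𝔥 : DGLA W) (hab : 𝔥.br = 0)
    (f : ∀ k, SymPow (shiftGr 𝔤.gr) k →ₗ[ℂ] W)
    (hf : ∀ w, evalWord₀ f w ∈ shiftGr 𝔥.gr (wdeg (ldeg (shiftGr 𝔤.gr)) w + 0))
    (hcomm : ∀ w, conv (ldeg (shiftGr 𝔤.gr)) (fun u v => evalWord₀ f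
      (opLetter (evalWord₀ 𝔤.lInfty) 1 𝔤.evalWord₀_lInfty_mem u :: v)) w =
        - 𝔥.d (evalWord₀ f w)) :
    IsLInftyMorphism 𝔤.gr 𝔤.lInfty 𝔥.gr 𝔥.lInfty f := by
  obtain ⟨Q, hQ, hQ'⟩ := exists_inducedCoderivation (isInternal_shiftGr 𝔤.isInternal) 𝔤.lInfty
    𝔤.evalWord₀_lInfty_mem
  obtain ⟨R, hR, hR'⟩ := exists_inducedCoderivation (isInternal_shiftGr 𝔥.isInternal) 𝔥.lInfty
    𝔥.evalWord₀_lInfty_mem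
  obtain ⟨F, hF, hF'⟩ := exists_inducedMorphism (isInternal_shiftGr 𝔤.isInternal) f hf
  refine ⟨𝔤.isLInftyAlgebra, 𝔥.isLInftyAlgebra, ?_, Q, R, F, hQ, hR, hF, ?_⟩
  · intro k hk v a hv
    have := degree_of_evalWord₀ hf k hk v a hv
    simpa using this
  refine redSym_hom_ext (Z := RedSym (shiftGr 𝔥.gr)) (isInternal_shiftGr 𝔤.isInternal)
    fun w hw => ?_
  set d := ldeg (shiftGr 𝔤.gr)
  set e := ldeg (shiftGr 𝔥.gr)
  set op := opLetter (evalWord₀ 𝔤.lInfty) 1 𝔤.evalWord₀_lInfty_mem with hop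
  set op' := opLetter (evalWord₀ 𝔥.lInfty) 1 𝔥.evalWord₀_lInfty_mem with hop'
  set fl := opLetter (evalWord₀ f) 0 hf with hfl
  have hs : IsSymWordFun (symWord (shiftGr 𝔥.gr)) := isSymWordFun_symWord
  have hs' : IsSymWordFun (symWord (shiftGr 𝔤.gr)) := isSymWordFun_symWord
  let D : Letter (shiftGr 𝔥.gr) → Letter (shiftGr 𝔥.gr) := fun y =>
    ⟨y.1 + 1, - 𝔥.d (lval y), by
      have := 𝔥.d_mem _ _ y.2.2
      exact neg_mem this⟩
  have hDop : ∀ y, op' [y] = D y := by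
    intro y
    refine Letter.ext ?_ ?_
    · simp [op', opLetter, D]
    · exact 𝔥.evalWord₀_lInfty_one y
  -- The unary bracket is the only one left in an abelian target.
  have hop0 : ∀ u, u.length ≠ 1 → lval (op' u) = 0 := by
    intro u hu
    match u with
    | [] => exact evalWord₀_nil 𝔥.lInfty
    | [x] => simp at hu
    | [x, y] =>
      refine (𝔥.evalWord₀_lInfty_two x y).trans ?_
      simp [hab]
    | x :: y :: z :: t => exact 𝔥.evalWord₀_lInfty_of_three_le (x :: y :: z :: t) (by simp)
  -- Hence the coderivation of the target is the derivation of words induced by `D`. The prefix `s`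
  -- collects the letters already passed in the induction.
  have hder : ∀ (t : List (Letter (shiftGr 𝔥.gr))) (s : List (Letter (shiftGr 𝔥.gr))),
      conv e (fun u v => symWord (shiftGr 𝔥.gr) (s ++ op' u :: v)) t =
        derWord e D (fun v => symWord (shiftGr 𝔥.gr) (s ++ v)) t := by
    intro t
    induction t with
    | nil =>
      intro s
      rw [conv_nil, derWord]
      exact hs.eq_zero (hop0 [] (by simp))
    | cons y t ih =>
      intro s
      rw [conv_cons, derWord]
      congr 1
      · rw [← conv_ite_nil (d := e) (fun v => symWord (shiftGr 𝔥.gr) (s ++ D y :: v)) t]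
        refine conv_congr fun u v _ _ => ?_
        split_ifs with hu
        · rw [hu, hDop]
        · exact hs.eq_zero (hop0 _ (by simpa using hu))
      · have := ih (s ++ [y])
        simp only [List.append_assoc, List.singleton_append] at this
        rw [← this, ← conv_smul]
        congr 1
        funext u v
        rw [hs.swap s (op' u) y v, negOnePow_smul_smul]
        refine negOnePow_smul_congr ⟨e y * wdeg e u, ?_⟩ _
        simp only [op', opLetter, e, ldeg]
        ring
  have hR'' : ∀ t, R (symWord (shiftGr 𝔥.gr) t) = derWord e D (symWord (shiftGr 𝔥.gr)) t := by
    intro t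
    by_cases ht : t = []
    · subst ht
      simp [symWord, derWord]
    · rw [hR' t ht]
      exact hder t []
  have hfl0 : lval (fl []) = 0 := evalWord₀_nil f
  -- The words `op u :: v` have varying lengths, at most one more than that of `w` (when `u` is
  -- empty). A common bound allows the two sides to be compared summand by summand.
  have hfB : ∀ (B : ℕ) (w : List (Letter (shiftGr 𝔤.gr))), w ≠ [] → w.length ≤ B →
      F (symWord (shiftGr 𝔤.gr) w) = ∑ m ∈ Finset.range B, ((m + 1).factorial : ℂ)⁻¹ •
        wpow d fl (m + 1) (symWord (shiftGr 𝔥.gr)) w := by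
    intro B w hw hB
    rw [hF' w hw]
    refine Finset.sum_subset (by simpa using hB) fun m _ hm => ?_
    rw [wpow_eq_zero_of_lt (m + 1) (fun s t => hs.eq_zero hfl0) w, smul_zero]
    simp at hm
    omega
  rw [LinearMap.comp_apply, LinearMap.comp_apply, hQ' w hw, map_conv, hfB _ w hw (Nat.le_succ _),
    map_sum]
  have h1 : conv d (fun u v => F (symWord (shiftGr 𝔤.gr) (op u :: v))) w =
      conv d (fun u v => ∑ m ∈ Finset.range w.length.succ, ((m + 1).factorial : ℂ)⁻¹ •
        wpow d fl (m + 1) (symWord (shiftGr 𝔥.gr)) (op u :: v)) w := by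
    refine conv_congr fun u v hl _ => hfB _ _ (by simp) ?_
    simp
    omega
  rw [h1, conv_finset_sum]
  refine Finset.sum_congr rfl fun m _ => ?_
  rw [conv_smul, map_smul]
  congr 1
  have hfd : ∀ u, e (fl u) = wdeg d u := fun u => add_zero _
  have h2 := map_wpow (Z := RedSym (shiftGr 𝔥.gr)) (Z' := RedSym (shiftGr 𝔥.gr))
    R.toAddMonoidHom fl (d := d) (m + 1) (symWord (shiftGr 𝔥.gr)) w
  simp only [LinearMap.toAddMonoidHom_coe, hR''] at h2
  rw [h2, wpow_derWord hfd D (fun y => rfl) m _ hs.swap]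
  -- Both sides are now `m + 1` times the sum with one differentiated block in front; on a single
  -- block the agreement is `hcomm`.
  refine wpow_coderivation hfd op (fun u => rfl) (fun u => D (fl u)) (fun u => ?_) m _ hs.swap ?_ w
  · show wdeg d u + 0 + 1 = _
    rw [add_zero]
  · intro s t w
    refine conv_letter hs s t (fun u v => fl (op u :: v)) w (D (fl w)) (fun u v h => ?_)
      (hcomm w).symm
    simp only [D, fl, op, opLetter, wdeg_cons, ldeg]
    rw [← h]
    simp only [d, ldeg]
    ring

end DGLA

end LInfinity

/-! ### Units of the convolution and membership in subgroups. -/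

section ConvUnits

variable {α Z : Type*} [AddCommGroup Z] {d : α → ℤ}

theorem conv_right_unit (Φ : List α → Z) (w : List α) :
    conv d (fun u v => if v = [] then Φ u else 0) w = Φ w := by
  induction w generalizing Φ with
  | nil => simp
  | cons a w ih =>
    rw [conv_cons, ih]
    simp [conv_zero]

theorem conv_left_unit (Φ : List α → Z) (w : List α) :
    conv d (fun u v => if u = [] then Φ v else 0) w = Φ w := by
  induction w generalizing Φ with
  | nil => simp
  | cons a w ih =>
    rw [conv_cons]
    simp only [List.cons_ne_nil, if_false, conv_zero, zero_add]
    rw [← ih (fun v => Φ (a :: v))]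
    congr 1
    funext u v
    split_ifs with h
    · simp [h]
    · simp

theorem conv_mem {S : Type*} [SetLike S Z] [AddSubgroupClass S Z] (s : S) {Φ : List α → List α → Z}
    {w : List α} (h : ∀ u v, u.length + v.length = w.length → wdeg d u + wdeg d v = wdeg d w →
      Φ u v ∈ s) : conv d Φ w ∈ s := by
  induction w generalizing Φ with
  | nil => simpa using h [] []
  | cons x w ih =>
    rw [conv_cons']
    refine ih fun u v hl hd => add_mem (h _ _ (by simp; omega) (by simp; omega)) ?_
    have := h u (x :: v) (by simp; omega) (by simp; omega)
    rcases Int.units_eq_one_or (d x * wdeg d u).negOnePow with h1 | h1 <;> rw [h1] <;> simpa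

end ConvUnits

/-! ### Convolution powers in an associative ring and their traces. -/

section WordPowers

variable {α B C : Type*} [Ring B] [AddCommGroup C]

/-- The function on words with value `t` on the empty word and `M` on letters. -/
def shortWord {Z : Type*} [Zero Z] (t : Z) (M : α → Z) : List α → Z
  | [] => t
  | [x] => M x
  | _ => 0

variable (d : α → ℤ)

/-- The convolution powers of a function on words. -/
def convPow (m : List α → B) : ℕ → List α → B
  | 0, w => if w = [] then 1 else 0
  | k + 1, w => conv d (fun u v => m u * convPow m k v) w

variable {d} (gr : ℤ → AddSubgroup B) {m a : List α → B}

theorem convPow_mem (h1 : (1 : B) ∈ gr 0) (hmul : ∀ i j, ∀ x ∈ gr i, ∀ y ∈ gr j, x * y ∈ gr (i + j))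
    (hm : ∀ w, m w ∈ gr (wdeg d w)) (k : ℕ) (w : List α) : convPow d m k w ∈ gr (wdeg d w) := by
  induction k generalizing w with
  | zero =>
    rw [convPow]
    split_ifs with h
    · simpa [h]
    · exact zero_mem _
  | succ k ih => exact conv_mem _ fun u v _ h => h ▸ hmul _ _ _ (hm u) _ (ih v)

theorem map_convPow {B' : Type*} [Ring B'] (f : B →+* B') (k : ℕ) (w : List α) :
    f (convPow d m k w) = convPow d (fun u => f (m u)) k w := by
  induction k generalizing w with
  | zero => simp only [convPow]; split_ifs <;> simp
  | succ k ih => simp only [convPow, map_conv, map_mul, ih]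

/-- Insertion of `op`, the operator `δ` and the graded commutator with `a` all satisfy the odd
Leibniz rule for the convolution product. A relation between them on `m` therefore propagates to all
powers, by induction on the exponent. -/
theorem conv_convPow (δ : B →+ B) (op : List α → α) (hop : ∀ u, d (op u) = wdeg d u + 1)
    (h1 : (1 : B) ∈ gr 0) (hm : ∀ w, m w ∈ gr (wdeg d w))
    (hδ : ∀ i, ∀ x ∈ gr i, ∀ y, δ (x * y) = δ x * y + i.negOnePow • (x * δ y))
    (hbase : ∀ w, conv d (fun u v => m (op u :: v)) w = - δ (m w) +
      conv d (fun x y => a x * m y) w - conv d (fun x y => (wdeg d x).negOnePow • (m x * a y)) w)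
    (k : ℕ) (w : List α) :
    conv d (fun u v => convPow d m k (op u :: v)) w = - δ (convPow d m k w) +
      conv d (fun x y => a x * convPow d m k y) w -
      conv d (fun x y => (wdeg d x).negOnePow • (convPow d m k x * a y)) w := by
  have hδ1 : δ 1 = 0 := by simpa using hδ 0 1 h1 1
  induction k generalizing w with
  | zero =>
    simp only [convPow, List.cons_ne_nil, if_false, conv_zero, mul_ite, mul_one, mul_zero]
    rw [conv_right_unit]
    have : (fun x y : List α => (wdeg d x).negOnePow • ((if x = [] then 1 else 0) * a y)) =
        fun x y => if x = [] then a y else 0 := by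
      funext x y
      split_ifs with h
      · simp [h]
      · simp
    rw [this, conv_left_unit]
    split_ifs <;> simp [hδ1]
  | succ k ih =>
    set N := convPow d m k with hN
    have hN1 : ∀ w, convPow d m (k + 1) w = conv d (fun u v => m u * N v) w := fun w => rfl
    have e1 : conv d (fun z y => conv d (fun u x => m (op u :: x) * N y) z) w =
        conv d (fun z y => - (δ (m z) * N y)) w +
        conv d (fun z y => conv d (fun x t => a x * m t * N y) z) w -
        conv d (fun z y => conv d (fun x t => (wdeg d x).negOnePow • (m x * a t * N y)) z) w := by
      rw [← conv_add, ← conv_sub]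
      congr 1
      funext z y
      have := congrArg (AddMonoidHom.mulRight (N y)) (hbase z)
      rw [map_sub, map_add, map_neg, map_conv, map_conv, map_conv] at this
      simpa [smul_mul_assoc] using this
    have e2 : conv d (fun x z => (wdeg d x).negOnePow • conv d (fun u y => m x * N (op u :: y)) z) w =
        conv d (fun x z => - ((wdeg d x).negOnePow • (m x * δ (N z)))) w +
        conv d (fun x z => conv d (fun t y => (wdeg d x).negOnePow • (m x * a t * N y)) z) w -
        conv d (fun x z => conv d (fun p q => (wdeg d x + wdeg d p).negOnePow •
          (m x * N p * a q)) z) w := by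
      rw [← conv_add, ← conv_sub]
      congr 1
      funext x z
      have := congrArg (AddMonoidHom.mulLeft (m x)) (ih z)
      rw [map_sub, map_add, map_neg, map_conv, map_conv, map_conv] at this
      simp only [AddMonoidHom.coe_mulLeft, mul_smul_comm, ← mul_assoc] at this
      rw [this, smul_sub, smul_add, ← conv_smul, ← conv_smul, smul_neg]
      simp only [negOnePow_smul_smul]
    have e3 : δ (convPow d m (k + 1) w) = conv d (fun z y => δ (m z) * N y) w +
        conv d (fun x z => (wdeg d x).negOnePow • (m x * δ (N z))) w := by
      rw [hN1, map_conv, ← conv_add]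
      congr 1
      funext x y
      exact hδ _ _ (hm x) _
    have e4 : conv d (fun x y => a x * convPow d m (k + 1) y) w =
        conv d (fun z y => conv d (fun x t => a x * m t * N y) z) w := by
      rw [conv_assoc (fun x t y => a x * m t * N y)]
      congr 1
      funext x y
      rw [hN1, ← AddMonoidHom.coe_mulLeft, map_conv]
      simp [mul_assoc]
    have e5 : conv d (fun x y => (wdeg d x).negOnePow • (convPow d m (k + 1) x * a y)) w =
        conv d (fun x z => conv d (fun p q => (wdeg d x + wdeg d p).negOnePow •
          (m x * N p * a q)) z) w := by
      rw [← conv_assoc (fun x p q => (wdeg d x + wdeg d p).negOnePow • (m x * N p * a q))]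
      congr 1
      funext x y
      rw [hN1]
      change (wdeg d x).negOnePow • AddMonoidHom.mulRight (a y) (conv d (fun u v => m u * N v) x) = _
      rw [map_conv, ← conv_smul]
      exact conv_congr fun u v _ h => by rw [h]; rfl
    -- The term with `a` to the right of `m` in `e1` and the one with `a` to the left of the
    -- remaining power in `e2` are equal after reassociation and cancel. The outer terms form the
    -- new commutator.
    rw [show convPow d m (k + 1) = conv d (fun u v => m u * N v) from rfl, conv_leibniz op hop,
      e1, e2, conv_assoc (fun x t y => (wdeg d x).negOnePow • (m x * a t * N y))]
    rw [show (conv d fun u v => m u * N v) = convPow d m (k + 1) from rfl, e3, e4, e5, conv_neg,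
      conv_neg]
    abel

/-- The commutator term of `conv_convPow` disappears under the trace: `conv_comm` exchanges the two
subwords, `htr` exchanges the two factors, and the signs agree because `a` has degree one. -/
theorem conv_trace_convPow (δ : B →+ B) (op : List α → α) (hop : ∀ u, d (op u) = wdeg d u + 1)
    (h1 : (1 : B) ∈ gr 0) (hmul : ∀ i j, ∀ x ∈ gr i, ∀ y ∈ gr j, x * y ∈ gr (i + j))
    (hm : ∀ w, m w ∈ gr (wdeg d w)) (ha : ∀ w, a w ∈ gr (wdeg d w + 1))
    (hδ : ∀ i, ∀ x ∈ gr i, ∀ y, δ (x * y) = δ x * y + i.negOnePow • (x * δ y))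
    (hbase : ∀ w, conv d (fun u v => m (op u :: v)) w = - δ (m w) +
      conv d (fun x y => a x * m y) w - conv d (fun x y => (wdeg d x).negOnePow • (m x * a y)) w)
    (tr : B →+ C) (htr : ∀ i j, ∀ x ∈ gr i, ∀ y ∈ gr j, tr (x * y) = (i * j).negOnePow • tr (y * x))
    (k : ℕ) (w : List α) :
    conv d (fun u v => tr (convPow d m k (op u :: v))) w = - tr (δ (convPow d m k w)) := by
  rw [← map_conv, conv_convPow gr δ op hop h1 hm hδ hbase, map_sub, map_add, map_neg, map_conv,
    map_conv, conv_comm]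
  rw [conv_congr (Ψ := fun x y => tr ((wdeg d x).negOnePow • (convPow d m k x * a y)))]
  · abel
  · intro u v _ _
    rw [htr _ _ _ (ha v) _ (convPow_mem gr h1 hmul hm k u), negOnePow_smul_smul,
      Units.smul_def, Units.smul_def, map_zsmul, ← Units.smul_def, ← Units.smul_def]
    exact negOnePow_smul_congr ⟨wdeg d u * wdeg d v, by ring⟩ _

/-- The commutation relation of `conv_convPow` in length one. -/
theorem conv_shortWord (δ : B →+ B) (op : List α → α) (t : B) (M A : α → B) (hδt : δ t = 0)
    (hop0 : M (op []) = 0) (hop1 : ∀ x, M (op [x]) = - δ (M x) + A x * t - t * A x)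
    (hop2 : ∀ x y, M (op [x, y]) = A x * M y + (d x * d y).negOnePow • (A y * M x) -
      (d x).negOnePow • (M x * A y) - (d x * d y + d y).negOnePow • (M y * A x))
    (hop3 : ∀ x y z w, M (op (x :: y :: z :: w)) = 0) (w : List α) :
    conv d (fun u v => shortWord t M (op u :: v)) w = - δ (shortWord t M w) +
      conv d (fun x y => shortWord 0 A x * shortWord t M y) w -
      conv d (fun x y => (wdeg d x).negOnePow • (shortWord t M x * shortWord 0 A y)) w := by
  have e : conv d (fun u v => shortWord t M (op u :: v)) w = M (op w) := by
    rw [← conv_right_unit (d := d) (fun u => M (op u))]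
    congr 1
    funext u v
    rcases v with _ | ⟨b, v⟩ <;> simp [shortWord]
  rw [e]
  -- Lengths zero, one and two are the hypotheses on `op`. On longer words a product of two
  -- functions supported in length at most one is zero.
  rcases w with _ | ⟨x, _ | ⟨y, _ | ⟨z, w⟩⟩⟩
  · simp [shortWord, hop0, hδt]
  · simp [shortWord, conv_cons, hop1]
  · simp [shortWord, conv_cons, hop2, negOnePow_smul_smul, mul_comm (d y)]
    abel
  · rw [hop3]
    have hs : ∀ (s t : B) (M A : α → B) (u v : List α),
        u.length + v.length = (x :: y :: z :: w).length → shortWord s M u * shortWord t A v = 0 := by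
      intro s t M A u v h
      rcases u with _ | ⟨x, _ | ⟨y, u⟩⟩ <;> rcases v with _ | ⟨x', _ | ⟨y', v⟩⟩ <;>
        simp [shortWord] at h ⊢
    rw [conv_eq_zero fun u v h _ => hs _ _ _ _ u v h,
      conv_eq_zero fun u v h _ => by rw [hs _ _ _ _ u v h, smul_zero]]
    simp [shortWord]

end WordPowers

/-! ### Graded symmetry of convolution powers. -/

section SymWordPowers

variable {V B : Type*} [AddCommGroup V] [Module ℂ V] [Ring B] [Algebra ℂ B] {gr : ℤ → Submodule ℂ V}

theorem isSymWordFun_shortWord {Z : Type*} [AddCommGroup Z] [Module ℂ Z] (t : Z) (μ : V →ₗ[ℂ] Z) :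
    IsSymWordFun (shortWord t fun x : Letter gr => μ (lval x)) where
  add l r x y z hx hy h := by
    rcases l with _ | ⟨b, _ | ⟨c, l⟩⟩ <;> rcases r with _ | ⟨e, r⟩ <;> simp [shortWord, h]
  smul l r c x z hx h := by
    rcases l with _ | ⟨b, _ | ⟨c, l⟩⟩ <;> rcases r with _ | ⟨e, r⟩ <;> simp [shortWord, h]
  swap l x y r := by
    rcases l with _ | ⟨b, _ | ⟨c, l⟩⟩ <;> rcases r with _ | ⟨e, r⟩ <;> simp [shortWord]

theorem IsSymWordFun.convPow {m : List (Letter gr) → B} (hm : IsSymWordFun m) (k : ℕ) :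
    IsSymWordFun (convPow (ldeg gr) m k) := by
  induction k with
  | zero =>
    exact ⟨fun _ _ _ _ _ _ _ _ => by simp [_root_.convPow],
      fun _ _ _ _ _ _ _ => by simp [_root_.convPow], fun _ _ _ _ => by simp [_root_.convPow]⟩
  | succ k ih =>
    exact IsSymWordFun.conv (fun v => hm.map (LinearMap.mulRight ℂ _))
      (fun u => ih.map (LinearMap.mulLeft ℂ _))

end SymWordPowers

set_option maxSynthPendingDepth 3

section LinearLemmas

theorem bilin_eqOn_span {V W Z : Type*} [AddCommGroup V] [Module ℂ V] [AddCommGroup W] [Module ℂ W]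
    [AddCommGroup Z] [Module ℂ Z] (B B' : V →ₗ[ℂ] W →ₗ[ℂ] Z) {S : Set V} {T : Set W}
    (h : ∀ s ∈ S, ∀ t ∈ T, B s t = B' s t) {x : V} {y : W} (hx : x ∈ Submodule.span ℂ S)
    (hy : y ∈ Submodule.span ℂ T) : B x y = B' x y := by
  have h1 : ∀ s ∈ S, B s y = B' s y := fun s hs => LinearMap.eqOn_span (h s hs) hy
  exact LinearMap.eqOn_span (f := B.flip y) (g := B'.flip y) h1 hx

theorem negOnePow_smul_eq_cast {Z : Type*} [AddCommGroup Z] [Module ℂ Z] (i : ℤ) (z : Z) :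
    i.negOnePow • z = (((i.negOnePow : ℤˣ) : ℤ) : ℂ) • z := by
  rw [Units.smul_def, Int.cast_smul_eq_zsmul]

end LinearLemmas

/-! ### Graded commutativity of the exterior algebra and its parts of degree zero and one. -/

section ExteriorPowers

variable {M N : Type*} [AddCommGroup M] [Module ℂ M] [AddCommGroup N] [Module ℂ N]

theorem extGr_mul_mem {i j : ℕ} {x y : ExteriorAlgebra ℂ M} (hx : x ∈ extGr M i)
    (hy : y ∈ extGr M j) : x * y ∈ extGr M (i + j) :=
  SetLike.GradedMul.mul_mem (A := extGr M) hx hy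

theorem ι_mem_extGr (v : M) : ExteriorAlgebra.ι ℂ v ∈ extGr M 1 := by
  change _ ∈ LinearMap.range (ExteriorAlgebra.ι ℂ) ^ 1
  rw [pow_one]
  exact ⟨v, rfl⟩

theorem one_mem_extGr : (1 : ExteriorAlgebra ℂ M) ∈ extGr M 0 :=
  SetLike.GradedOne.one_mem (A := extGr M)

/-- Induction on the exterior powers. -/
theorem extGr_induction {C : ℕ → ExteriorAlgebra ℂ M → Prop}
    (scalar : ∀ c : ℂ, C 0 (algebraMap ℂ _ c)) (add : ∀ i x y, C i x → C i y → C i (x + y))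
    (mul : ∀ v i x, x ∈ extGr M i → C i x → C (i + 1) (ExteriorAlgebra.ι ℂ v * x)) {i : ℕ}
    {x : ExteriorAlgebra ℂ M} (hx : x ∈ extGr M i) : C i x := by
  refine Submodule.pow_induction_on_left' (M := LinearMap.range (ExteriorAlgebra.ι ℂ (M := M)))
    (C := fun i x _ => C i x) (fun c => scalar c) (fun x y i _ _ h h' => add i x y h h') ?_ hx
  rintro _ ⟨v, rfl⟩ i x hx h
  exact mul v i x hx h

theorem ι_mul_extGr (v : M) {j : ℕ} {y : ExteriorAlgebra ℂ M} (hy : y ∈ extGr M j) :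
    ExteriorAlgebra.ι ℂ v * y = (j : ℤ).negOnePow • (y * ExteriorAlgebra.ι ℂ v) := by
  refine extGr_induction (C := fun j y => ExteriorAlgebra.ι ℂ v * y =
    (j : ℤ).negOnePow • (y * ExteriorAlgebra.ι ℂ v)) ?_ ?_ ?_ hy
  · intro c
    simp [Algebra.commutes c (ExteriorAlgebra.ι ℂ v)]
  · intro i x y hx hy
    rw [mul_add, hx, hy, add_mul, smul_add]
  · intro w i x _ h
    have e : ExteriorAlgebra.ι ℂ v * ExteriorAlgebra.ι ℂ w =
        - (ExteriorAlgebra.ι ℂ w * ExteriorAlgebra.ι ℂ v) :=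
      eq_neg_of_add_eq_zero_left (ExteriorAlgebra.ι_add_mul_swap v w)
    rw [← mul_assoc, e, neg_mul, mul_assoc, h, mul_smul_comm, mul_assoc, Nat.cast_succ,
      Int.negOnePow_succ, Units.neg_smul]

/-- The exterior algebra is graded commutative. -/
theorem extGr_mul_comm {i j : ℕ} {x y : ExteriorAlgebra ℂ M} (hx : x ∈ extGr M i)
    (hy : y ∈ extGr M j) : x * y = ((i : ℤ) * j).negOnePow • (y * x) := by
  refine extGr_induction (C := fun i x => x * y = ((i : ℤ) * j).negOnePow • (y * x)) ?_ ?_ ?_ hx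
  · intro c
    simp [Algebra.commutes c y]
  · intro i x z hx hz
    rw [add_mul, hx, hz, mul_add, smul_add]
  · intro v i x _ h
    rw [mul_assoc, h, mul_smul_comm, ← mul_assoc, ι_mul_extGr v hy, smul_mul_assoc,
      negOnePow_smul_smul, mul_assoc]
    exact negOnePow_smul_congr ⟨0, by push_cast; ring⟩ _

theorem map_mem_extGr (f : M →ₗ[ℂ] N) {i : ℕ} {x : ExteriorAlgebra ℂ M} (hx : x ∈ extGr M i) :
    ExteriorAlgebra.map f x ∈ extGr N i := by
  refine extGr_induction (C := fun i x => ExteriorAlgebra.map f x ∈ extGr N i) ?_ ?_ ?_ hx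
  · intro c
    rw [AlgHom.commutes, Algebra.algebraMap_eq_smul_one]
    exact Submodule.smul_mem _ _ one_mem_extGr
  · intro i x y hx hy
    rw [map_add]
    exact add_mem hx hy
  · intro v i x _ h
    rw [map_mul, ExteriorAlgebra.map_apply_ι, add_comm]
    exact extGr_mul_mem (ι_mem_extGr _) h

/-- The augmentation and `ιInv` are the two components of an algebra homomorphism to the trivial
square-zero extension of `ℂ` by `M`, whose multiplication rule is this formula. The extension needs
a right action on `M`, taken to be the left one. -/
theorem ιInv_mul (x y : ExteriorAlgebra ℂ M) :
    ExteriorAlgebra.ιInv (x * y) = ExteriorAlgebra.algebraMapInv x • ExteriorAlgebra.ιInv y +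
      ExteriorAlgebra.algebraMapInv y • ExteriorAlgebra.ιInv x := by
  let : Module ℂᵐᵒᵖ M := Module.compHom _ ((RingHom.id ℂ).fromOpposite mul_comm)
  have : IsCentralScalar ℂ M := ⟨fun r m => rfl⟩
  have e : ∀ x : ExteriorAlgebra ℂ M, ExteriorAlgebra.algebraMapInv x =
      (ExteriorAlgebra.toTrivSqZeroExt x).fst := by
    intro x
    have : ExteriorAlgebra.algebraMapInv (R := ℂ) (M := M) =
        (TrivSqZeroExt.fstHom ℂ ℂ M).comp ExteriorAlgebra.toTrivSqZeroExt := by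
      ext v
      simp [ExteriorAlgebra.algebraMapInv]
    rw [this]
    rfl
  have e2 : ∀ x : ExteriorAlgebra ℂ M, ExteriorAlgebra.ιInv x =
      (ExteriorAlgebra.toTrivSqZeroExt x).snd := fun x => rfl
  rw [e, e, e2, e2, e2, map_mul, TrivSqZeroExt.snd_mul, op_smul_eq_smul]

theorem algebraMapInv_of_mem {i : ℕ} (hi : i ≠ 0) {x : ExteriorAlgebra ℂ M}
    (hx : x ∈ extGr M i) : ExteriorAlgebra.algebraMapInv x = 0 := by
  refine extGr_induction (C := fun i x => i ≠ 0 → ExteriorAlgebra.algebraMapInv x = 0)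
    ?_ ?_ ?_ hx hi
  · intro c h
    exact absurd rfl h
  · intro i x y hx hy h
    rw [map_add, hx h, hy h, add_zero]
  · intro v i x _ _ _
    rw [map_mul]
    simp [ExteriorAlgebra.algebraMapInv]

/-- The product rule for `1 * 1` counts the value at `1` twice, so that value is zero. -/
theorem ιInv_algebraMap (c : ℂ) : ExteriorAlgebra.ιInv (algebraMap ℂ (ExteriorAlgebra ℂ M) c) = 0 := by
  have h := ιInv_mul (1 : ExteriorAlgebra ℂ M) 1
  rw [one_mul, map_one (ExteriorAlgebra.algebraMapInv (R := ℂ) (M := M)), one_smul,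
    left_eq_add] at h
  rw [Algebra.algebraMap_eq_smul_one, map_smul, h, smul_zero]

theorem ιInv_of_mem {i : ℕ} (hi : i ≠ 1) {x : ExteriorAlgebra ℂ M}
    (hx : x ∈ extGr M i) : ExteriorAlgebra.ιInv x = 0 := by
  refine extGr_induction (C := fun i x => i ≠ 1 → ExteriorAlgebra.ιInv x = 0)
    ?_ ?_ ?_ hx hi
  · intro c _
    exact ιInv_algebraMap c
  · intro i x y hx hy h
    rw [map_add, hx h, hy h, add_zero]
  · intro v i x hx _ h
    rw [ιInv_mul, algebraMapInv_of_mem one_ne_zero (ι_mem_extGr v),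
      algebraMapInv_of_mem (by omega) hx, zero_smul, zero_smul, add_zero]

theorem ιInv_map (f : M →ₗ[ℂ] N) (x : ExteriorAlgebra ℂ M) :
    ExteriorAlgebra.ιInv (ExteriorAlgebra.map f x) = f (ExteriorAlgebra.ιInv x) :=
  LinearMap.congr_fun (ExteriorAlgebra.ιInv_comp_map f) x

end ExteriorPowers

/-! ### The fibre algebra `EndFib` and its bracket as a graded commutator. -/

section EndFib

variable {T E L : Type*} [AddCommGroup T] [Module ℂ T] [AddCommGroup E] [Module ℂ E]
  [AddCommGroup L] [Module ℂ L]

theorem formTensor_tmul (η : ExteriorAlgebra ℂ (ConjDual T)) (φ : Module.End ℂ E)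
    (h : ExteriorAlgebra ℂ L) :
    formTensor (T := T) η (φ ⊗ₜ[ℂ] h) = φ ⊗ₜ[ℂ] (η ᵍ⊗ₜ[ℂ] h) := rfl

theorem extFib_tmul_mul {p q : ℕ} (η η' : ExteriorAlgebra ℂ (ConjDual T))
    (h h' : ExteriorAlgebra ℂ L) (hη' : η' ∈ extGr (ConjDual T) p) (hh : h ∈ extGr L q) :
    ((η ᵍ⊗ₜ[ℂ] h) * (η' ᵍ⊗ₜ[ℂ] h') : ExtFib T L) =
      ((q : ℤ) * p).negOnePow • ((η * η') ᵍ⊗ₜ[ℂ] (h * h')) := by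
  have := GradedTensorProduct.tmul_coe_mul_coe_tmul (R := ℂ) (extGr (ConjDual T)) (extGr L) η
    ⟨h, hh⟩ ⟨η', hη'⟩ h'
  rw [this]
  congr 1

theorem formTensor_mul {p q : ℕ} (η η' : ExteriorAlgebra ℂ (ConjDual T)) (φ φ' : Module.End ℂ E)
    (h h' : ExteriorAlgebra ℂ L) (hη' : η' ∈ extGr (ConjDual T) p) (hh : h ∈ extGr L q) :
    (formTensor η (φ ⊗ₜ[ℂ] h) * formTensor η' (φ' ⊗ₜ[ℂ] h') : EndFib T E L) =
      ((q : ℤ) * p).negOnePow • formTensor (η * η') ((φ * φ') ⊗ₜ[ℂ] (h * h')) := by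
  rw [formTensor_tmul, formTensor_tmul, formTensor_tmul, Algebra.TensorProduct.tmul_mul_tmul,
    extFib_tmul_mul _ _ _ _ hη' hh, Units.smul_def, Units.smul_def, TensorProduct.tmul_smul]

theorem fibBracket_formTensor {p q : ℕ} (η η' : ExteriorAlgebra ℂ (ConjDual T))
    (φ φ' : Module.End ℂ E) (h h' : ExteriorAlgebra ℂ L) (hη' : η' ∈ extGr (ConjDual T) p)
    (hh : h ∈ extGr L q) :
    fibBracket (formTensor (T := T) η (φ ⊗ₜ[ℂ] h)) (formTensor η' (φ' ⊗ₜ[ℂ] h')) =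
      ((q : ℤ) * p).negOnePow • formTensor (η * η') ((φ * φ' - φ' * φ) ⊗ₜ[ℂ] (h * h')) := by
  rw [formTensor_tmul, formTensor_tmul, formTensor_tmul]
  change (φ * φ' - φ' * φ) ⊗ₜ[ℂ] ((η ᵍ⊗ₜ[ℂ] h) * (η' ᵍ⊗ₜ[ℂ] h') : ExtFib T L) = _
  rw [extFib_tmul_mul _ _ _ _ hη' hh, Units.smul_def, Units.smul_def, TensorProduct.tmul_smul]

/-- Elements with both exterior factors homogeneous generate the fibre additively, and on them the
Koszul sign of the product is explicit. -/
theorem endFib_induction {C : EndFib T E L → Prop}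
    (gen : ∀ (p q : ℕ) (φ : Module.End ℂ E) (η : ExteriorAlgebra ℂ (ConjDual T))
      (h : ExteriorAlgebra ℂ L), η ∈ extGr (ConjDual T) p → h ∈ extGr L q →
      C (formTensor η (φ ⊗ₜ h)))
    (add : ∀ x y, C x → C y → C (x + y)) (y : EndFib T E L) : C y := by
  have h0 : C 0 := by
    have := gen 0 0 0 1 1 one_mem_extGr one_mem_extGr
    rwa [TensorProduct.zero_tmul, map_zero] at this
  induction y using TensorProduct.induction_on with
  | zero => exact h0
  | add x y hx hy => exact add x y hx hy
  | tmul φ c =>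
    obtain ⟨c, rfl⟩ := (GradedTensorProduct.of ℂ (extGr (ConjDual T)) (extGr L)).surjective c
    induction c using TensorProduct.induction_on with
    | zero => rw [map_zero, TensorProduct.tmul_zero]; exact h0
    | add x y hx hy => rw [map_add, TensorProduct.tmul_add]; exact add _ _ hx hy
    | tmul η h =>
      change C (formTensor η (φ ⊗ₜ h))
      induction η using DirectSum.Decomposition.inductionOn (extGr (ConjDual T)) with
      | zero => simpa [formTensor_tmul, GradedTensorProduct.tmul] using h0
      | add a b ha hb =>
        have e : formTensor (a + b) (φ ⊗ₜ h) = formTensor (T := T) a (φ ⊗ₜ h) +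
            formTensor b (φ ⊗ₜ h) := by
          simp [formTensor_tmul, GradedTensorProduct.tmul, TensorProduct.add_tmul,
            TensorProduct.tmul_add]
        rw [e]
        exact add _ _ ha hb
      | homogeneous a =>
        induction h using DirectSum.Decomposition.inductionOn (extGr L) with
        | zero => simpa using h0
        | add a b ha hb => rw [TensorProduct.tmul_add, map_add]; exact add _ _ ha hb
        | homogeneous b => exact gen _ _ _ _ _ a.2 b.2

theorem formTensor_mem_endFibGr {p q : ℕ} {m : ℤ} (hm : (p : ℤ) + q = m) (φ : Module.End ℂ E)
    {η : ExteriorAlgebra ℂ (ConjDual T)} {h : ExteriorAlgebra ℂ L}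
    (hη : η ∈ extGr (ConjDual T) p) (hh : h ∈ extGr L q) :
    formTensor η (φ ⊗ₜ h) ∈ endFibGr T E L m :=
  Submodule.subset_span ⟨p, q, φ, η, h, hm, hη, hh, rfl⟩

theorem endFibGr_mul_mem (i j : ℤ) (x : EndFib T E L) (hx : x ∈ endFibGr T E L i)
    (y : EndFib T E L) (hy : y ∈ endFibGr T E L j) : x * y ∈ endFibGr T E L (i + j) := by
  refine Submodule.span_induction₂ (R := ℂ) (p := fun x y _ _ => x * y ∈ endFibGr T E L (i + j))
    ?_ ?_ ?_ ?_ ?_ ?_ ?_ hx hy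
  · rintro _ _ ⟨p, q, φ, η, h, rfl, hη, hh, rfl⟩ ⟨p', q', φ', η', h', rfl, hη', hh', rfl⟩
    rw [formTensor_mul _ _ _ _ _ _ hη' hh, negOnePow_smul_eq_cast]
    exact Submodule.smul_mem _ _ (formTensor_mem_endFibGr (by push_cast; ring) _
      (extGr_mul_mem hη hη') (extGr_mul_mem hh hh'))
  · intro y _; rw [zero_mul]; exact zero_mem _
  · intro y _; rw [mul_zero]; exact zero_mem _
  · intro x y z _ _ _ h h'; rw [add_mul]; exact add_mem h h'
  · intro x y z _ _ _ h h'; rw [mul_add]; exact add_mem h h'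
  · intro c x y _ _ h; rw [smul_mul_assoc]; exact Submodule.smul_mem _ _ h
  · intro c x y _ _ h; rw [mul_smul_comm]; exact Submodule.smul_mem _ _ h

/-- On homogeneous elements the bracket is the graded commutator. -/
theorem fibBracket_eq (i j : ℤ) {x y : EndFib T E L} (hx : x ∈ endFibGr T E L i)
    (hy : y ∈ endFibGr T E L j) :
    fibBracket x y = x * y - (i * j).negOnePow • (y * x) := by
  rw [negOnePow_smul_eq_cast]
  refine bilin_eqOn_span fibBracket (LinearMap.mul ℂ (EndFib T E L) -
    ((((i * j).negOnePow : ℤˣ) : ℤ) : ℂ) • (LinearMap.mul ℂ (EndFib T E L)).flip) ?_ hx hy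
  rintro _ ⟨p, q, φ, η, h, rfl, hη, hh, rfl⟩ _ ⟨p', q', φ', η', h', rfl, hη', hh', rfl⟩
  rw [fibBracket_formTensor _ _ _ _ _ _ hη' hh]
  simp only [LinearMap.sub_apply, LinearMap.smul_apply, LinearMap.flip_apply, LinearMap.mul_apply']
  rw [formTensor_mul _ _ _ _ _ _ hη' hh, formTensor_mul _ _ _ _ _ _ hη hh',
    extGr_mul_comm hη' hη, extGr_mul_comm hh' hh, TensorProduct.sub_tmul, map_sub, smul_sub,
    ← negOnePow_smul_eq_cast]
  congr 1
  have e1 : ∀ (s : ℤˣ) (a : ExteriorAlgebra ℂ (ConjDual T)) (f : Module.End ℂ E ⊗[ℂ] ExteriorAlgebra ℂ L),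
      formTensor (s • a) f = s • formTensor a f := by
    intro s a f
    rcases Int.units_eq_one_or s with rfl | rfl
    · simp
    · induction f using TensorProduct.induction_on with
      | zero => simp
      | add x y hx hy => rw [map_add, hx, hy, map_add, smul_add]
      | tmul φ h => simp [formTensor_tmul, GradedTensorProduct.tmul, TensorProduct.neg_tmul,
          TensorProduct.tmul_neg]
  have e2 : ∀ (s : ℤˣ) (a : Module.End ℂ E) (f : ExteriorAlgebra ℂ L),
      a ⊗ₜ[ℂ] (s • f) = s • (a ⊗ₜ[ℂ] f) := by
    intro s a f
    rw [Units.smul_def, Units.smul_def, TensorProduct.tmul_smul]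
  rw [e1, e2, map_zsmul_unit, negOnePow_smul_smul, negOnePow_smul_smul, negOnePow_smul_smul]
  exact negOnePow_smul_congr ⟨-(p * p' + q * q' + p * q'), by ring⟩ _

end EndFib

/-! ### Identities of signed commutators. -/

section Supercommutator

variable {A : Type*} [Ring A]

theorem supercommutator_skew (i j : ℤ) (x y : A) :
    x * y - (i * j).negOnePow • (y * x) =
      -((i * j).negOnePow • (y * x - (j * i).negOnePow • (x * y))) := by
  rw [smul_sub, negOnePow_smul_smul, mul_comm j i]
  rw [negOnePow_smul_congr (a := i * j + i * j) (b := 0) ⟨i * j, by ring⟩, Int.negOnePow_zero,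
    one_smul]
  abel

/-- The integers need not be degrees in any grading: after expansion, the signs in front of each
monomial agree by parity alone. -/
theorem supercommutator_jacobi (i j k : ℤ) (x y z : A) :
    x * (y * z - (j * k).negOnePow • (z * y)) -
        (i * (j + k)).negOnePow • ((y * z - (j * k).negOnePow • (z * y)) * x) =
      ((x * y - (i * j).negOnePow • (y * x)) * z -
        ((i + j) * k).negOnePow • (z * (x * y - (i * j).negOnePow • (y * x)))) +
      (i * j).negOnePow • (y * (x * z - (i * k).negOnePow • (z * x)) -
        (j * (i + k)).negOnePow • ((x * z - (i * k).negOnePow • (z * x)) * y)) := by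
  simp only [mul_sub, sub_mul, smul_sub, mul_smul_comm, smul_mul_assoc, negOnePow_smul_smul,
    mul_assoc]
  have e1 : (i * j + j * (i + k)).negOnePow = (j * k).negOnePow :=
    (Int.negOnePow_eq_iff _ _).2 ⟨i * j, by ring⟩
  have e2 : (i * j + (j * (i + k) + i * k)).negOnePow = ((i + j) * k).negOnePow :=
    (Int.negOnePow_eq_iff _ _).2 ⟨i * j, by ring⟩
  have e3 : (i * (j + k) + j * k).negOnePow = ((i + j) * k + i * j).negOnePow :=
    (Int.negOnePow_eq_iff _ _).2 ⟨0, by ring⟩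
  have e4 : (i * j + i * k).negOnePow = (i * (j + k)).negOnePow := by rw [mul_add]
  simp only [e1, e2, e3, e4]
  abel

end Supercommutator

/-! ### The fibrewise graded Lie algebra. -/

section FibBracket

variable {T E L : Type*} [AddCommGroup T] [Module ℂ T] [AddCommGroup E] [Module ℂ E]
  [AddCommGroup L] [Module ℂ L]

theorem negOnePow_smul_mem {V : Type*} [AddCommGroup V] [Module ℂ V] (S : Submodule ℂ V) (i : ℤ)
    {x : V} (hx : x ∈ S) : i.negOnePow • x ∈ S := by
  rw [negOnePow_smul_eq_cast]
  exact S.smul_mem _ hx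

theorem fibBracket_mem (i j : ℤ) {x y : EndFib T E L} (hx : x ∈ endFibGr T E L i)
    (hy : y ∈ endFibGr T E L j) : fibBracket x y ∈ endFibGr T E L (i + j) := by
  rw [fibBracket_eq i j hx hy]
  refine sub_mem (endFibGr_mul_mem _ _ _ hx _ hy) (negOnePow_smul_mem _ _ ?_)
  rw [add_comm]
  exact endFibGr_mul_mem _ _ _ hy _ hx

theorem fibBracket_skew (i j : ℤ) {x y : EndFib T E L} (hx : x ∈ endFibGr T E L i)
    (hy : y ∈ endFibGr T E L j) :
    fibBracket x y = -((i * j).negOnePow • fibBracket y x) := by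
  rw [fibBracket_eq i j hx hy, fibBracket_eq j i hy hx]
  exact supercommutator_skew i j x y

theorem fibBracket_jacobi (i j k : ℤ) {x y z : EndFib T E L} (hx : x ∈ endFibGr T E L i)
    (hy : y ∈ endFibGr T E L j) (hz : z ∈ endFibGr T E L k) :
    fibBracket x (fibBracket y z) = fibBracket (fibBracket x y) z +
      (i * j).negOnePow • fibBracket y (fibBracket x z) := by
  rw [fibBracket_eq i (j + k) hx (fibBracket_mem j k hy hz),
    fibBracket_eq (i + j) k (fibBracket_mem i j hx hy) hz,
    fibBracket_eq j (i + k) hy (fibBracket_mem i k hx hz), fibBracket_eq j k hy hz,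
    fibBracket_eq i j hx hy, fibBracket_eq i k hx hz]
  exact supercommutator_jacobi i j k x y z

end FibBracket

/-! ### Covectors as odd elements of the fibre algebras. -/

section OddCovectors

variable {T E L : Type*} [AddCommGroup T] [Module ℂ T] [AddCommGroup E] [Module ℂ E]
  [AddCommGroup L] [Module ℂ L]

variable (E L) in
/-- A covector as an element of the algebra `EndFib`. -/
def endCovector (v : ConjDual T) : EndFib T E L :=
  1 ⊗ₜ[ℂ] (ExteriorAlgebra.ι ℂ v ᵍ⊗ₜ[ℂ] 1)

variable (L) in
/-- A covector as an element of the algebra `SymFib`. -/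
def symCovector (v : ConjDual T) : SymFib T L := ExteriorAlgebra.ι ℂ v ⊗ₜ[ℂ] 1

theorem endCovector_eq (v : ConjDual T) :
    endCovector E L v = formTensor (ExteriorAlgebra.ι ℂ v) (1 ⊗ₜ 1) := rfl

theorem endCovector_mem (v : ConjDual T) : endCovector E L v ∈ endFibGr T E L 1 :=
  formTensor_mem_endFibGr (p := 1) (q := 0) (by simp) _ (ι_mem_extGr v) one_mem_extGr

theorem endCovector_mul_formTensor (v : ConjDual T) (η : ExteriorAlgebra ℂ (ConjDual T))
    (φ : Module.End ℂ E) (h : ExteriorAlgebra ℂ L) {p : ℕ} (hη : η ∈ extGr (ConjDual T) p) :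
    endCovector E L v * formTensor η (φ ⊗ₜ h) =
      formTensor (ExteriorAlgebra.ι ℂ v * η) (φ ⊗ₜ h) := by
  rw [endCovector_eq, formTensor_mul _ _ _ _ _ _ hη (one_mem_extGr (M := L))]
  simp

theorem formTensor_smul_left (c : ℂ) (η : ExteriorAlgebra ℂ (ConjDual T))
    (f : Module.End ℂ E ⊗[ℂ] ExteriorAlgebra ℂ L) :
    formTensor (c • η) f = c • formTensor η f := by
  induction f using TensorProduct.induction_on with
  | zero => simp
  | add x y hx hy => rw [map_add, hx, hy, map_add, smul_add]
  | tmul φ h => rw [formTensor_tmul, formTensor_tmul, ← TensorProduct.tmul_smul]; rfl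

theorem formTensor_add_left (η η' : ExteriorAlgebra ℂ (ConjDual T))
    (f : Module.End ℂ E ⊗[ℂ] ExteriorAlgebra ℂ L) :
    formTensor (η + η') f = formTensor η f + formTensor η' f := by
  induction f using TensorProduct.induction_on with
  | zero => simp
  | add x y hx hy => rw [map_add, hx, hy, map_add, map_add]; abel
  | tmul φ h => simp [formTensor_tmul, GradedTensorProduct.tmul, TensorProduct.add_tmul,
      TensorProduct.tmul_add]

/-- On type `(0, p)` with values in `⋀^q L`, the degree `p` comes from commuting `v` past the form
and `q` from the Koszul rule in the product on the right; the endomorphism part of a covector is the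
identity. -/
theorem endCovector_mul_comm (v : ConjDual T) {m : ℤ} {y : EndFib T E L}
    (hy : y ∈ endFibGr T E L m) :
    endCovector E L v * y = m.negOnePow • (y * endCovector E L v) := by
  rw [negOnePow_smul_eq_cast]
  refine LinearMap.eqOn_span (f := LinearMap.mulLeft ℂ (endCovector E L v))
    (g := (((m.negOnePow : ℤˣ) : ℤ) : ℂ) • LinearMap.mulRight ℂ (endCovector E L v)) ?_ hy
  rintro _ ⟨p, q, φ, η, h, rfl, hη, hh, rfl⟩
  simp only [LinearMap.mulLeft_apply, LinearMap.smul_apply, LinearMap.mulRight_apply]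
  rw [endCovector_mul_formTensor v η φ h hη, endCovector_eq,
    formTensor_mul _ _ _ _ _ _ (ι_mem_extGr v) hh, mul_one, mul_one, ι_mul_extGr v hη,
    ← negOnePow_smul_eq_cast, negOnePow_smul_smul, negOnePow_smul_eq_cast, formTensor_smul_left,
    ← negOnePow_smul_eq_cast]
  exact negOnePow_smul_congr ⟨-q, by push_cast; ring⟩ _

theorem endCovector_anticomm (v w : ConjDual T) :
    endCovector E L v * endCovector E L w = -(endCovector E L w * endCovector E L v) := by
  rw [endCovector_mul_comm v (endCovector_mem w), Int.negOnePow_one, Units.neg_smul, one_smul]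

theorem endCovector_add (v w : ConjDual T) :
    endCovector E L (v + w) = endCovector E L v + endCovector E L w := by
  rw [endCovector_eq, map_add, formTensor_add_left]; rfl

theorem endCovector_smul (c : ℂ) (v : ConjDual T) :
    endCovector E L (c • v) = c • endCovector E L v := by
  rw [endCovector_eq, map_smul, formTensor_smul_left]; rfl

theorem symCovector_add (v w : ConjDual T) :
    symCovector L (v + w) = symCovector L v + symCovector L w := by
  simp [symCovector, TensorProduct.add_tmul]

theorem symCovector_smul (c : ℂ) (v : ConjDual T) :
    symCovector L (c • v) = c • symCovector L v := by
  simp [symCovector, TensorProduct.smul_tmul']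

theorem symCovector_anticomm (v w : ConjDual T) :
    symCovector L v * symCovector L w = -(symCovector L w * symCovector L v) := by
  rw [symCovector, symCovector, Algebra.TensorProduct.tmul_mul_tmul,
    Algebra.TensorProduct.tmul_mul_tmul, ← TensorProduct.neg_tmul]
  congr 1
  exact eq_neg_of_add_eq_zero_left (ExteriorAlgebra.ι_add_mul_swap v w)

end OddCovectors

/-! ### Forms with values in `End E ⊗ ⨀ L`: linear part, constant part and trace. -/

section SymAlgebra

variable {T E L : Type*} [AddCommGroup T] [Module ℂ T] [AddCommGroup E] [Module ℂ E]
  [AddCommGroup L] [Module ℂ L]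

variable (T E L) in
/-- `(0,*)`-forms at a point with values in `End E ⊗ ⨀ L`. -/
abbrev EndSym : Type _ := Module.End ℂ E ⊗[ℂ] SymFib T L

variable (T E L) in
/-- The forms of type `(0, p)`, `p = m`, with values in `End E ⊗ ⨀ L`. -/
def endSymGr (m : ℤ) : Submodule ℂ (EndSym T E L) :=
  Submodule.span ℂ {y | ∃ (p : ℕ) (φ : Module.End ℂ E) (η : ExteriorAlgebra ℂ (ConjDual T))
    (s : SymmetricAlgebra ℂ L), (p : ℤ) = m ∧ η ∈ extGr (ConjDual T) p ∧ y = φ ⊗ₜ (η ⊗ₜ s)}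

theorem endSym_tmul_mem {p : ℕ} {m : ℤ} (hm : (p : ℤ) = m) (φ : Module.End ℂ E)
    {η : ExteriorAlgebra ℂ (ConjDual T)} (hη : η ∈ extGr (ConjDual T) p)
    (s : SymmetricAlgebra ℂ L) : φ ⊗ₜ (η ⊗ₜ s) ∈ endSymGr T E L m :=
  Submodule.subset_span ⟨p, φ, η, s, hm, hη, rfl⟩

theorem endSymGr_one_mem : (1 : EndSym T E L) ∈ endSymGr T E L 0 :=
  endSym_tmul_mem (p := 0) (by simp) 1 one_mem_extGr 1

theorem endSymGr_mul_mem (i j : ℤ) (x : EndSym T E L) (hx : x ∈ endSymGr T E L i)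
    (y : EndSym T E L) (hy : y ∈ endSymGr T E L j) : x * y ∈ endSymGr T E L (i + j) := by
  refine Submodule.span_induction₂ (R := ℂ) (p := fun x y _ _ => x * y ∈ endSymGr T E L (i + j))
    ?_ ?_ ?_ ?_ ?_ ?_ ?_ hx hy
  · rintro _ _ ⟨p, φ, η, s, rfl, hη, rfl⟩ ⟨p', φ', η', s', rfl, hη', rfl⟩
    rw [Algebra.TensorProduct.tmul_mul_tmul, Algebra.TensorProduct.tmul_mul_tmul]
    exact endSym_tmul_mem (by push_cast; ring) _ (extGr_mul_mem hη hη') _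
  · intro y _; rw [zero_mul]; exact zero_mem _
  · intro y _; rw [mul_zero]; exact zero_mem _
  · intro x y z _ _ _ h h'; rw [add_mul]; exact add_mem h h'
  · intro x y z _ _ _ h h'; rw [mul_add]; exact add_mem h h'
  · intro c x y _ _ h; rw [smul_mul_assoc]; exact Submodule.smul_mem _ _ h
  · intro c x y _ _ h; rw [mul_smul_comm]; exact Submodule.smul_mem _ _ h

/-- The component of a form in `End E ⊗ L`, as a form with values in `End E ⊗ ⨀ L`. -/
def linPart : EndFib T E L →ₗ[ℂ] EndSym T E L :=
  TensorProduct.map LinearMap.id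
    (TensorProduct.map LinearMap.id (SymmetricAlgebra.ι ℂ L ∘ₗ ExteriorAlgebra.ιInv) ∘ₗ
      (GradedTensorProduct.of ℂ (extGr (ConjDual T)) (extGr L)).symm.toLinearMap)

/-- The component of a form in `End E`, as a form with values in `End E ⊗ ⨀ L`. -/
def constPart : EndFib T E L →ₗ[ℂ] EndSym T E L :=
  TensorProduct.map LinearMap.id
    (TensorProduct.map LinearMap.id (Algebra.linearMap ℂ (SymmetricAlgebra ℂ L) ∘ₗ
      ExteriorAlgebra.algebraMapInv.toLinearMap) ∘ₗ
      (GradedTensorProduct.of ℂ (extGr (ConjDual T)) (extGr L)).symm.toLinearMap)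

theorem linPart_formTensor (η : ExteriorAlgebra ℂ (ConjDual T)) (φ : Module.End ℂ E)
    (h : ExteriorAlgebra ℂ L) : linPart (formTensor η (φ ⊗ₜ h)) =
      φ ⊗ₜ (η ⊗ₜ SymmetricAlgebra.ι ℂ L (ExteriorAlgebra.ιInv h)) := rfl

theorem constPart_formTensor (η : ExteriorAlgebra ℂ (ConjDual T)) (φ : Module.End ℂ E)
    (h : ExteriorAlgebra ℂ L) : constPart (formTensor η (φ ⊗ₜ h)) =
      φ ⊗ₜ (η ⊗ₜ algebraMap ℂ _ (ExteriorAlgebra.algebraMapInv h)) := rfl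

/-- Only `q = 1` survives, and the factor in `L` has no degree in the target. The loss of one degree
is the shift from `M` to `M[1]`. -/
theorem linPart_mem {m : ℤ} {y : EndFib T E L} (hy : y ∈ endFibGr T E L m) :
    linPart y ∈ endSymGr T E L (m - 1) := by
  refine Submodule.span_induction (p := fun y _ => linPart y ∈ endSymGr T E L (m - 1))
    ?_ ?_ ?_ ?_ hy
  · rintro _ ⟨p, q, φ, η, h, rfl, hη, hh, rfl⟩
    rw [linPart_formTensor]
    by_cases hq : q = 1
    · exact endSym_tmul_mem (by simp [hq]) _ hη _
    · rw [ιInv_of_mem hq hh]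
      simp
  · rw [map_zero]; exact zero_mem _
  · intro x y _ _ h h'; rw [map_add]; exact add_mem h h'
  · intro c x _ h; rw [map_smul]; exact Submodule.smul_mem _ _ h

theorem constPart_mem {m : ℤ} {y : EndFib T E L} (hy : y ∈ endFibGr T E L m) :
    constPart y ∈ endSymGr T E L m := by
  refine Submodule.span_induction (p := fun y _ => constPart y ∈ endSymGr T E L m)
    ?_ ?_ ?_ ?_ hy
  · rintro _ ⟨p, q, φ, η, h, rfl, hη, hh, rfl⟩
    rw [constPart_formTensor]
    by_cases hq : q = 0
    · exact endSym_tmul_mem (by simp [hq]) _ hη _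
    · rw [algebraMapInv_of_mem hq hh]
      simp
  · rw [map_zero]; exact zero_mem _
  · intro x y _ _ h h'; rw [map_add]; exact add_mem h h'
  · intro c x _ h; rw [map_smul]; exact Submodule.smul_mem _ _ h

/-- A product has `L`-degree one only when the factors have degrees zero and one, in one order or
the other. The Koszul rule gives a sign only when `x` carries the factor in `L`, which has to pass
the form part of `y`, then of degree `m'`. -/
theorem linPart_mul {m m' : ℤ} {x y : EndFib T E L} (hx : x ∈ endFibGr T E L m)
    (hy : y ∈ endFibGr T E L m') :
    linPart (x * y) = constPart x * linPart y + m'.negOnePow • (linPart x * constPart y) := by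
  rw [negOnePow_smul_eq_cast]
  refine bilin_eqOn_span ((LinearMap.mul ℂ (EndFib T E L)).compr₂ linPart)
    ((LinearMap.mul ℂ (EndSym T E L)).compl₁₂ constPart linPart +
      (((m'.negOnePow : ℤˣ) : ℤ) : ℂ) • (LinearMap.mul ℂ (EndSym T E L)).compl₁₂ linPart constPart)
    ?_ hx hy
  rintro _ ⟨p, q, φ, η, h, rfl, hη, hh, rfl⟩ _ ⟨p', q', φ', η', h', rfl, hη', hh', rfl⟩
  simp only [LinearMap.compr₂_apply, LinearMap.add_apply, LinearMap.smul_apply,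
    LinearMap.compl₁₂_apply, LinearMap.mul_apply']
  rw [formTensor_mul _ _ _ _ _ _ hη' hh, negOnePow_smul_eq_cast, map_smul,
    ← negOnePow_smul_eq_cast, ← negOnePow_smul_eq_cast]
  simp only [linPart_formTensor, constPart_formTensor, Algebra.TensorProduct.tmul_mul_tmul,
    ιInv_mul]
  have e : ∀ (c : ℂ) (v : L), SymmetricAlgebra.ι ℂ L (c • v) =
      algebraMap ℂ _ c * SymmetricAlgebra.ι ℂ L v := by
    intro c v
    rw [map_smul, Algebra.smul_def]
  rw [map_add, e, e, TensorProduct.tmul_add, TensorProduct.tmul_add, smul_add]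
  congr 1
  · by_cases hq : q = 0
    · simp [hq]
    · simp [algebraMapInv_of_mem hq hh]
  · rw [mul_comm (algebraMap ℂ (SymmetricAlgebra ℂ L) _)]
    by_cases hq : q = 1
    · by_cases hq' : q' = 0
      · simp [hq, hq']
      · simp [algebraMapInv_of_mem hq' hh']
    · simp [ιInv_of_mem hq hh]

theorem linPart_covector_mul (v : ConjDual T) (y : EndFib T E L) :
    linPart (endCovector E L v * y) = (1 ⊗ₜ symCovector L v) * linPart y := by
  refine endFib_induction (C := fun y => linPart (endCovector E L v * y) =
    (1 ⊗ₜ symCovector L v) * linPart y) ?_ ?_ y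
  · intro p q φ η h hη hh
    rw [endCovector_mul_formTensor v η φ h hη, linPart_formTensor, linPart_formTensor, symCovector,
      Algebra.TensorProduct.tmul_mul_tmul, Algebra.TensorProduct.tmul_mul_tmul, one_mul, one_mul]
  · intro x y hx hy
    rw [mul_add, map_add, hx, hy, map_add, mul_add]

/-- The identity behind the compatibility with the brackets. -/
theorem linPart_fibBracket (a b : ℤ) {x y : EndFib T E L} (hx : x ∈ endFibGr T E L (a + 1))
    (hy : y ∈ endFibGr T E L (b + 1)) :
    (a + 1).negOnePow • linPart (fibBracket x y) =
      ((a + 1).negOnePow • constPart x) * linPart y +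
        (a * b).negOnePow • (((b + 1).negOnePow • constPart y) * linPart x) -
        a.negOnePow • (linPart x * ((b + 1).negOnePow • constPart y)) -
        (a * b + b).negOnePow • (linPart y * ((a + 1).negOnePow • constPart x)) := by
  rw [fibBracket_eq _ _ hx hy, map_sub, linPart_mul hx hy]
  rw [show linPart (((a + 1) * (b + 1)).negOnePow • (y * x)) =
    ((a + 1) * (b + 1)).negOnePow • linPart (y * x) by
      rw [negOnePow_smul_eq_cast, negOnePow_smul_eq_cast, map_smul], linPart_mul hy hx]
  simp only [smul_sub, smul_add, mul_smul_comm, smul_mul_assoc, negOnePow_smul_smul]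
  have e1 : ∀ z : EndSym T E L, (a + 1 + (b + 1)).negOnePow • z = -((a + (b + 1)).negOnePow • z) := by
    intro z
    rw [← Units.neg_smul, ← Int.negOnePow_succ]
    congr 2; ring
  have e2 : ∀ z : EndSym T E L, (a + 1 + (a + 1) * (b + 1)).negOnePow • z =
      -((a * b + (b + 1)).negOnePow • z) := by
    intro z
    rw [← Units.neg_smul, ← Int.negOnePow_succ]
    exact negOnePow_smul_congr ⟨a, by ring⟩ _
  have e3 : ∀ z : EndSym T E L, (a + 1 + ((a + 1) * (b + 1) + (a + 1))).negOnePow • z =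
      (a * b + b + (a + 1)).negOnePow • z := by
    intro z
    exact negOnePow_smul_congr ⟨a + 1, by ring⟩ _
  simp only [e1, e2, e3]
  abel

/-- The trace of the endomorphism part. -/
def endSymTrace : EndSym T E L →ₗ[ℂ] SymFib T L :=
  (TensorProduct.lid ℂ _).toLinearMap ∘ₗ TensorProduct.map (LinearMap.trace ℂ E) LinearMap.id

theorem endSymTrace_tmul (φ : Module.End ℂ E) (c : SymFib T L) :
    endSymTrace (φ ⊗ₜ c) = LinearMap.trace ℂ E φ • c := rfl

/-- The trace of endomorphisms is cyclic, the symmetric algebra is commutative and the forms are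
graded commutative; only the latter produce a sign. -/
theorem endSymTrace_mul_comm (i j : ℤ) {x y : EndSym T E L} (hx : x ∈ endSymGr T E L i)
    (hy : y ∈ endSymGr T E L j) :
    endSymTrace (x * y) = (i * j).negOnePow • endSymTrace (y * x) := by
  rw [negOnePow_smul_eq_cast]
  refine bilin_eqOn_span ((LinearMap.mul ℂ (EndSym T E L)).compr₂ endSymTrace)
    (((((i * j).negOnePow : ℤˣ) : ℤ) : ℂ) •
      ((LinearMap.mul ℂ (EndSym T E L)).compr₂ endSymTrace).flip) ?_ hx hy
  · rintro _ ⟨p, φ, η, s, rfl, hη, rfl⟩ _ ⟨p', φ', η', s', rfl, hη', rfl⟩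
    simp only [LinearMap.compr₂_apply, LinearMap.smul_apply, LinearMap.flip_apply,
      LinearMap.mul_apply', Algebra.TensorProduct.tmul_mul_tmul, endSymTrace_tmul]
    rw [LinearMap.trace_mul_comm, extGr_mul_comm hη hη', mul_comm s s', Units.smul_def,
      ← TensorProduct.smul_tmul', smul_comm, Int.cast_smul_eq_zsmul]

theorem endSymTrace_covector_mul (v : ConjDual T) (y : EndSym T E L) :
    endSymTrace ((1 ⊗ₜ symCovector L v) * y) = symCovector L v * endSymTrace y := by
  induction y using TensorProduct.induction_on with
  | zero => rw [mul_zero, map_zero, mul_zero]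
  | add x y hx hy => rw [mul_add, map_add, hx, hy, map_add, mul_add]
  | tmul φ c => rw [Algebra.TensorProduct.tmul_mul_tmul, one_mul, endSymTrace_tmul,
      endSymTrace_tmul, mul_smul_comm]

theorem endSymTrace_mem {m : ℤ} {y : EndSym T E L} (hy : y ∈ endSymGr T E L m) :
    endSymTrace y ∈ symFibGr T L m := by
  refine Submodule.span_induction (p := fun y _ => endSymTrace y ∈ symFibGr T L m)
    ?_ ?_ ?_ ?_ hy
  · rintro _ ⟨p, φ, η, s, rfl, hη, rfl⟩
    have h : η ⊗ₜ s ∈ symFibGr T L p := Submodule.subset_span ⟨p, η, s, rfl, hη, rfl⟩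
    exact Submodule.smul_mem _ _ h
  · rw [map_zero]; exact zero_mem _
  · intro x y _ _ h h'; rw [map_add]; exact add_mem h h'
  · intro c x _ h; rw [map_smul]; exact Submodule.smul_mem _ _ h

/-- Left multiplication by a covector. -/
theorem endSym_covector_mul_comm (v : ConjDual T) {m : ℤ} {y : EndSym T E L}
    (hy : y ∈ endSymGr T E L m) :
    (1 ⊗ₜ symCovector L v) * y = m.negOnePow • (y * (1 ⊗ₜ symCovector L v)) := by
  rw [negOnePow_smul_eq_cast]
  refine LinearMap.eqOn_span (f := LinearMap.mulLeft ℂ (1 ⊗ₜ symCovector L v : EndSym T E L))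
    (g := (((m.negOnePow : ℤˣ) : ℤ) : ℂ) •
      LinearMap.mulRight ℂ (1 ⊗ₜ symCovector L v : EndSym T E L)) ?_ hy
  rintro _ ⟨p, φ, η, s, rfl, hη, rfl⟩
  simp only [LinearMap.mulLeft_apply, LinearMap.smul_apply, LinearMap.mulRight_apply, symCovector,
    Algebra.TensorProduct.tmul_mul_tmul, one_mul, mul_one]
  rw [ι_mul_extGr v hη, Units.smul_def, Int.cast_smul_eq_zsmul, ← TensorProduct.smul_tmul',
    TensorProduct.tmul_smul]

end SymAlgebra

/-! ### Functoriality of the fibre constructions under isomorphisms. -/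

section Transport

variable {T E L T' E' L' T'' E'' L'' : Type*} [AddCommGroup T] [Module ℂ T] [AddCommGroup E]
  [Module ℂ E] [AddCommGroup L] [Module ℂ L] [AddCommGroup T'] [Module ℂ T'] [AddCommGroup E']
  [Module ℂ E'] [AddCommGroup L'] [Module ℂ L'] [AddCommGroup T''] [Module ℂ T'']
  [AddCommGroup E''] [Module ℂ E''] [AddCommGroup L''] [Module ℂ L'']
  (eT : T ≃ₗ[ℂ] T') (eE : E ≃ₗ[ℂ] E') (eL : L ≃ₗ[ℂ] L')
  (eT' : T' ≃ₗ[ℂ] T'') (eE' : E' ≃ₗ[ℂ] E'') (eL' : L' ≃ₗ[ℂ] L'')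

theorem endFibMap_formTensor (η : ExteriorAlgebra ℂ (ConjDual T)) (φ : Module.End ℂ E)
    (h : ExteriorAlgebra ℂ L) :
    endFibMap eT eE eL (formTensor η (φ ⊗ₜ h)) =
      formTensor (ExteriorAlgebra.map (conjDualMap eT) η)
        (eE.conj φ ⊗ₜ ExteriorAlgebra.map eL.toLinearMap h) := rfl

theorem endFibMap_mul (x y : EndFib T E L) :
    endFibMap eT eE eL (x * y) = endFibMap eT eE eL x * endFibMap eT eE eL y := by
  refine endFib_induction (C := fun x => endFibMap eT eE eL (x * y) =
    endFibMap eT eE eL x * endFibMap eT eE eL y) ?_ ?_ x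
  · intro p q φ η h hη hh
    refine endFib_induction (C := fun y => endFibMap eT eE eL (formTensor η (φ ⊗ₜ h) * y) =
      endFibMap eT eE eL (formTensor η (φ ⊗ₜ h)) * endFibMap eT eE eL y) ?_ ?_ y
    · intro p' q' φ' η' h' hη' hh'
      rw [formTensor_mul _ _ _ _ _ _ hη' hh, negOnePow_smul_eq_cast, map_smul,
        endFibMap_formTensor, endFibMap_formTensor, endFibMap_formTensor,
        formTensor_mul _ _ _ _ _ _ (map_mem_extGr _ hη') (map_mem_extGr _ hh),
        negOnePow_smul_eq_cast, map_mul (ExteriorAlgebra.map (conjDualMap eT)),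
        map_mul (ExteriorAlgebra.map eL.toLinearMap)]
      rw [show eE.conj (φ * φ') = eE.conj φ * eE.conj φ' from eE.conj_comp φ' φ]
    · intro a b ha hb
      rw [mul_add, map_add, ha, hb, map_add, mul_add]
  · intro a b ha hb
    rw [add_mul, map_add, ha, hb, map_add, add_mul]

theorem endFibMap_fibBracket (x y : EndFib T E L) :
    endFibMap eT eE eL (fibBracket x y) =
      fibBracket (endFibMap eT eE eL x) (endFibMap eT eE eL y) := by
  refine endFib_induction (C := fun x => endFibMap eT eE eL (fibBracket x y) =
    fibBracket (endFibMap eT eE eL x) (endFibMap eT eE eL y)) ?_ ?_ x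
  · intro p q φ η h hη hh
    refine endFib_induction (C := fun y => endFibMap eT eE eL (fibBracket (formTensor η (φ ⊗ₜ h)) y) =
      fibBracket (endFibMap eT eE eL (formTensor η (φ ⊗ₜ h))) (endFibMap eT eE eL y)) ?_ ?_ y
    · intro p' q' φ' η' h' hη' hh'
      rw [fibBracket_formTensor _ _ _ _ _ _ hη' hh, negOnePow_smul_eq_cast, map_smul,
        endFibMap_formTensor, endFibMap_formTensor, endFibMap_formTensor,
        fibBracket_formTensor _ _ _ _ _ _ (map_mem_extGr _ hη') (map_mem_extGr _ hh),
        negOnePow_smul_eq_cast, map_mul (ExteriorAlgebra.map (conjDualMap eT)),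
        map_mul (ExteriorAlgebra.map eL.toLinearMap), map_sub]
      rw [show eE.conj (φ * φ') = eE.conj φ * eE.conj φ' from eE.conj_comp φ' φ,
        show eE.conj (φ' * φ) = eE.conj φ' * eE.conj φ from eE.conj_comp φ φ']
    · intro a b ha hb
      rw [map_add, map_add, ha, hb, map_add, map_add]
  · intro a b ha hb
    simp only [map_add, LinearMap.add_apply, ha, hb]

theorem exteriorMap_comp {M N P : Type*} [AddCommGroup M] [Module ℂ M] [AddCommGroup N] [Module ℂ N]
    [AddCommGroup P] [Module ℂ P] (f : M →ₗ[ℂ] N) (g : N →ₗ[ℂ] P) (x : ExteriorAlgebra ℂ M) :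
    ExteriorAlgebra.map g (ExteriorAlgebra.map f x) = ExteriorAlgebra.map (g ∘ₗ f) x :=
  DFunLike.congr_fun (ExteriorAlgebra.map_comp_map f g) x

theorem endFibMap_trans (y : EndFib T E L) :
    endFibMap eT' eE' eL' (endFibMap eT eE eL y) =
      endFibMap (eT.trans eT') (eE.trans eE') (eL.trans eL') y := by
  refine endFib_induction (C := fun y => endFibMap eT' eE' eL' (endFibMap eT eE eL y) =
      endFibMap (eT.trans eT') (eE.trans eE') (eL.trans eL') y) ?_ ?_ y
  · intro p q φ η h _ _
    rw [endFibMap_formTensor, endFibMap_formTensor, endFibMap_formTensor, exteriorMap_comp,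
      exteriorMap_comp, ← LinearEquiv.conj_trans]
    rfl
  · intro a b ha hb
    rw [map_add, map_add, ha, hb, map_add]

theorem conjDualMap_refl : conjDualMap (LinearEquiv.refl ℂ T) = LinearMap.id := rfl

theorem endFibMap_refl (y : EndFib T E L) :
    endFibMap (LinearEquiv.refl ℂ T) (LinearEquiv.refl ℂ E) (LinearEquiv.refl ℂ L) y = y := by
  refine endFib_induction (C := fun y => endFibMap (LinearEquiv.refl ℂ T) (LinearEquiv.refl ℂ E)
    (LinearEquiv.refl ℂ L) y = y) ?_ ?_ y
  · intro p q φ η h _ _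
    rw [endFibMap_formTensor, conjDualMap_refl, ExteriorAlgebra.map_id,
      show (LinearEquiv.refl ℂ L).toLinearMap = LinearMap.id from rfl, ExteriorAlgebra.map_id]
    rfl
  · intro a b ha hb
    rw [map_add, ha, hb]

theorem endFibMap_symm_apply' (y : EndFib T E L) :
    endFibMap eT.symm eE.symm eL.symm (endFibMap eT eE eL y) = y := by
  rw [endFibMap_trans, LinearEquiv.self_trans_symm, LinearEquiv.self_trans_symm,
    LinearEquiv.self_trans_symm, endFibMap_refl]

theorem endFibMap_mem {m : ℤ} {y : EndFib T E L} (hy : y ∈ endFibGr T E L m) :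
    endFibMap eT eE eL y ∈ endFibGr T' E' L' m := by
  refine Submodule.span_induction (p := fun y _ => endFibMap eT eE eL y ∈ endFibGr T' E' L' m)
    ?_ ?_ ?_ ?_ hy
  · rintro _ ⟨p, q, φ, η, h, rfl, hη, hh, rfl⟩
    rw [endFibMap_formTensor]
    exact formTensor_mem_endFibGr rfl _ (map_mem_extGr _ hη) (map_mem_extGr _ hh)
  · rw [map_zero]; exact zero_mem _
  · intro x y _ _ h h'; rw [map_add]; exact add_mem h h'
  · intro c x _ h; rw [map_smul]; exact Submodule.smul_mem _ _ h

theorem endFibMap_covector (v : ConjDual T) :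
    endFibMap eT eE eL (endCovector E L v) = endCovector E' L' (conjDualMap eT v) := by
  rw [endCovector_eq, endFibMap_formTensor, ExteriorAlgebra.map_apply_ι, map_one (ExteriorAlgebra.map eL.toLinearMap),
    show eE.conj 1 = 1 from eE.conj_id, endCovector_eq]

/-- Transport on the symmetric algebra. -/
def symMap : SymmetricAlgebra ℂ L →ₐ[ℂ] SymmetricAlgebra ℂ L' :=
  SymmetricAlgebra.lift (SymmetricAlgebra.ι ℂ L' ∘ₗ eL.toLinearMap)

theorem symMap_ι (v : L) : symMap eL (SymmetricAlgebra.ι ℂ L v) = SymmetricAlgebra.ι ℂ L' (eL v) := by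
  simp [symMap]

theorem symMap_comp (s : SymmetricAlgebra ℂ L) :
    symMap eL' (symMap eL s) = symMap (eL.trans eL') s := by
  have : (symMap eL').comp (symMap eL) = symMap (eL.trans eL') := by
    ext v
    simp [symMap]
  exact DFunLike.congr_fun this s

theorem symMap_refl (s : SymmetricAlgebra ℂ L) : symMap (LinearEquiv.refl ℂ L) s = s := by
  have : symMap (LinearEquiv.refl ℂ L) = AlgHom.id ℂ _ := by
    ext v
    simp [symMap]
  exact DFunLike.congr_fun this s

theorem symMap_mem {k : ℕ} {s : SymmetricAlgebra ℂ L} (hs : s ∈ symGr L k) :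
    symMap eL s ∈ symGr L' k := by
  refine Submodule.pow_induction_on_left' (M := LinearMap.range (SymmetricAlgebra.ι ℂ L))
    (C := fun k s _ => symMap eL s ∈ symGr L' k) ?_ ?_ ?_ hs
  · intro c
    rw [AlgHom.commutes]
    exact (Submodule.algebraMap_mem c)
  · intro x y i _ _ hx hy
    rw [map_add]
    exact add_mem hx hy
  · rintro _ ⟨v, rfl⟩ i x _ h
    rw [map_mul, symMap_ι, Nat.succ_eq_add_one, symGr, pow_succ']
    exact Submodule.mul_mem_mul ⟨_, rfl⟩ h

theorem symFibMap_tmul (η : ExteriorAlgebra ℂ (ConjDual T)) (s : SymmetricAlgebra ℂ L) :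
    symFibMap eT eL (η ⊗ₜ s) = ExteriorAlgebra.map (conjDualMap eT) η ⊗ₜ symMap eL s := rfl

/-- `symFibMap` as an algebra homomorphism. -/
def symFibMapHom : SymFib T L →ₐ[ℂ] SymFib T' L' :=
  Algebra.TensorProduct.map (ExteriorAlgebra.map (conjDualMap eT)) (symMap eL)

theorem symFibMap_mul (x y : SymFib T L) :
    symFibMap eT eL (x * y) = symFibMap eT eL x * symFibMap eT eL y :=
  map_mul (symFibMapHom eT eL) x y

theorem symFibMap_trans (y : SymFib T L) :
    symFibMap eT' eL' (symFibMap eT eL y) = symFibMap (eT.trans eT') (eL.trans eL') y := by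
  induction y using TensorProduct.induction_on with
  | zero => simp
  | add x y hx hy => rw [map_add, map_add, hx, hy, map_add]
  | tmul η s =>
    rw [symFibMap_tmul, symFibMap_tmul, symFibMap_tmul, exteriorMap_comp, symMap_comp]
    rfl

theorem symFibMap_refl (y : SymFib T L) :
    symFibMap (LinearEquiv.refl ℂ T) (LinearEquiv.refl ℂ L) y = y := by
  induction y using TensorProduct.induction_on with
  | zero => simp
  | add x y hx hy => rw [map_add, hx, hy]
  | tmul η s =>
    rw [symFibMap_tmul, symMap_refl, conjDualMap_refl, ExteriorAlgebra.map_id]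
    rfl

theorem symFibMap_symm_apply' (y : SymFib T L) :
    symFibMap eT.symm eL.symm (symFibMap eT eL y) = y := by
  rw [symFibMap_trans, LinearEquiv.self_trans_symm, LinearEquiv.self_trans_symm, symFibMap_refl]

theorem symFibMap_mem_gr {m : ℤ} {y : SymFib T L} (hy : y ∈ symFibGr T L m) :
    symFibMap eT eL y ∈ symFibGr T' L' m := by
  refine Submodule.span_induction (p := fun y _ => symFibMap eT eL y ∈ symFibGr T' L' m)
    ?_ ?_ ?_ ?_ hy
  · rintro _ ⟨p, η, s, rfl, hη, rfl⟩
    exact Submodule.subset_span ⟨p, _, _, rfl, map_mem_extGr _ hη, rfl⟩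
  · rw [map_zero]; exact zero_mem _
  · intro x y _ _ h h'; rw [map_add]; exact add_mem h h'
  · intro c x _ h; rw [map_smul]; exact Submodule.smul_mem _ _ h

theorem symFibMap_mem_pow {k : ℕ} {y : SymFib T L} (hy : y ∈ symFibPow T L k) :
    symFibMap eT eL y ∈ symFibPow T' L' k := by
  refine Submodule.span_induction (p := fun y _ => symFibMap eT eL y ∈ symFibPow T' L' k)
    ?_ ?_ ?_ ?_ hy
  · rintro _ ⟨η, s, hs, rfl⟩
    exact Submodule.subset_span ⟨_, _, symMap_mem eL hs, rfl⟩
  · rw [map_zero]; exact zero_mem _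
  · intro x y _ _ h h'; rw [map_add]; exact add_mem h h'
  · intro c x _ h; rw [map_smul]; exact Submodule.smul_mem _ _ h

theorem symFibMap_covector (v : ConjDual T) :
    symFibMap eT eL (symCovector L v) = symCovector L' (conjDualMap eT v) := by
  rw [symCovector, symFibMap_tmul, ExteriorAlgebra.map_apply_ι, map_one, symCovector]

/-- Transport of `EndSym` along isomorphisms. -/
def endSymMap : EndSym T E L →ₐ[ℂ] EndSym T' E' L' :=
  Algebra.TensorProduct.map
    (AlgHom.ofLinearMap eE.conj.toLinearMap eE.conj_id fun φ φ' => eE.conj_comp φ' φ)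
    (symFibMapHom eT eL)

theorem endSymMap_tmul (φ : Module.End ℂ E) (c : SymFib T L) :
    endSymMap eT eE eL (φ ⊗ₜ c) = eE.conj φ ⊗ₜ symFibMap eT eL c := rfl

theorem linPart_endFibMap (y : EndFib T E L) :
    linPart (endFibMap eT eE eL y) = endSymMap eT eE eL (linPart y) := by
  refine endFib_induction (C := fun y => linPart (endFibMap eT eE eL y) =
    endSymMap eT eE eL (linPart y)) ?_ ?_ y
  · intro p q φ η h _ _
    rw [endFibMap_formTensor, linPart_formTensor, linPart_formTensor, endSymMap_tmul,
      symFibMap_tmul, symMap_ι, ιInv_map]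
    rfl
  · intro a b ha hb
    rw [map_add, map_add, ha, hb, map_add, map_add]

theorem endSymTrace_endSymMap (y : EndSym T E L) :
    endSymTrace (endSymMap eT eE eL y) = symFibMap eT eL (endSymTrace y) := by
  induction y using TensorProduct.induction_on with
  | zero => rw [map_zero, map_zero, map_zero, map_zero]
  | add x y hx hy => rw [map_add, map_add, hx, hy, map_add, map_add]
  | tmul φ c => rw [endSymMap_tmul, endSymTrace_tmul, endSymTrace_tmul, map_smul,
      LinearMap.trace_conj']

theorem endFibMap_one_toExt (t : Module.End ℂ E ⊗[ℂ] L) :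
    endFibMap eT eE eL (formTensor 1 (toExt t)) =
      formTensor 1 (toExt (TensorProduct.map eE.conj.toLinearMap eL.toLinearMap t)) := by
  induction t using TensorProduct.induction_on with
  | zero => simp
  | add x y hx hy => simp only [map_add, hx, hy]
  | tmul φ l =>
    rw [TensorProduct.map_tmul, toExt, toExt, TensorProduct.map_tmul, TensorProduct.map_tmul,
      endFibMap_formTensor, map_one, ExteriorAlgebra.map_apply_ι]
    rfl

end Transport

/-! ### Internal gradings and their projections. -/

section Gradings

/-- The projections of an internally graded space. -/
def gradedProj {V : Type*} [AddCommGroup V] [Module ℂ V] {gr : ℤ → Submodule ℂ V}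
    (h : DirectSum.IsInternal gr) (m : ℤ) : V →ₗ[ℂ] V :=
  (gr m).subtype ∘ₗ DirectSum.component ℂ ℤ (fun i => gr i) m ∘ₗ
    (LinearEquiv.ofBijective (DirectSum.coeLinearMap gr) h).symm.toLinearMap

variable {V W : Type*} [AddCommGroup V] [Module ℂ V] [AddCommGroup W] [Module ℂ W]
  {gr : ℤ → Submodule ℂ V} {gr' : ℤ → Submodule ℂ W}
  (h : DirectSum.IsInternal gr) (h' : DirectSum.IsInternal gr')

theorem gradedProj_mem (m : ℤ) (x : V) : gradedProj h m x ∈ gr m := Subtype.property _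

theorem ofBijective_symm_of_mem {m : ℤ} {x : V} (hx : x ∈ gr m) :
    (LinearEquiv.ofBijective (DirectSum.coeLinearMap gr) h).symm x =
      DirectSum.lof ℂ ℤ (fun i => gr i) m ⟨x, hx⟩ := by
  rw [LinearEquiv.symm_apply_eq]
  exact (DirectSum.coeLinearMap_lof gr m ⟨x, hx⟩).symm

theorem gradedProj_of_mem {m : ℤ} {x : V} (hx : x ∈ gr m) : gradedProj h m x = x := by
  simp only [gradedProj, LinearMap.comp_apply, LinearEquiv.coe_coe]
  rw [ofBijective_symm_of_mem h hx, DirectSum.component.lof_self]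
  rfl

theorem gradedProj_of_mem_ne {m m' : ℤ} (hm : m ≠ m') {x : V} (hx : x ∈ gr m') :
    gradedProj h m x = 0 := by
  simp only [gradedProj, LinearMap.comp_apply, LinearEquiv.coe_coe]
  rw [ofBijective_symm_of_mem h hx, DirectSum.component.of, dif_neg hm.symm]
  rfl

theorem graded_induction (h : DirectSum.IsInternal gr) {C : V → Prop} (mem : ∀ m, ∀ x ∈ gr m, C x) (add : ∀ x y, C x → C y → C (x + y))
    (x : V) : C x := by
  have hx : x ∈ iSup gr := by rw [h.submodule_iSup_eq_top]; trivial
  exact Submodule.iSup_induction gr (motive := C) hx mem (mem 0 0 (zero_mem _)) add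

theorem map_gradedProj (f : V →ₗ[ℂ] W) (hf : ∀ m, ∀ x ∈ gr m, f x ∈ gr' m) (m : ℤ) (x : V) :
    f (gradedProj h m x) = gradedProj h' m (f x) := by
  refine graded_induction h (C := fun x => f (gradedProj h m x) = gradedProj h' m (f x)) ?_ ?_ x
  · intro m' x hx
    by_cases hm : m = m'
    · subst hm
      rw [gradedProj_of_mem h hx, gradedProj_of_mem h' (hf _ _ hx)]
    · rw [gradedProj_of_mem_ne h hm hx, gradedProj_of_mem_ne h' hm (hf _ _ hx), map_zero]
  · intro x y hx hy
    simp only [map_add, hx, hy]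

theorem sum_gradedProj {s : Finset ℤ} (hs : ∀ m ∉ s, gr m = ⊥) (x : V) :
    ∑ m ∈ s, gradedProj h m x = x := by
  refine graded_induction h (C := fun x => ∑ m ∈ s, gradedProj h m x = x) ?_ ?_ x
  · intro m' x hx
    by_cases hm : m' ∈ s
    · rw [Finset.sum_eq_single m' (fun m _ hne => gradedProj_of_mem_ne h hne hx)
        (fun h => absurd hm h), gradedProj_of_mem h hx]
    · rw [hs m' hm, Submodule.mem_bot] at hx
      simp [hx]
  · intro x y hx hy
    simp only [map_add, Finset.sum_add_distrib, hx, hy]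

/-- A space with projections to submodules is graded by them. -/
theorem isInternal_of_proj (P : ℤ → V → V) (hadd : ∀ m x y, P m (x + y) = P m x + P m y)
    (hmem : ∀ m x, P m x ∈ gr m)
    (hself : ∀ m, ∀ x ∈ gr m, P m x = x) (hne : ∀ m m', m ≠ m' → ∀ x ∈ gr m', P m x = 0)
    (s : Finset ℤ) (hs : ∀ x, ∑ m ∈ s, P m x = x) : DirectSum.IsInternal gr := by
  have h0 : ∀ m, P m 0 = 0 := fun m => hself m 0 (zero_mem _)
  have key : ∀ (f : ⨁ i, gr i) (m : ℤ), P m (DirectSum.coeAddMonoidHom gr f) = f m := by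
    intro f m
    induction f using DirectSum.induction_on with
    | zero => simp [h0]
    | of i x =>
      rw [DirectSum.coeAddMonoidHom_of]
      by_cases hm : m = i
      · subst hm
        rw [hself _ _ x.2, DirectSum.of_eq_same]
      · rw [hne m i hm _ x.2, DirectSum.of_eq_of_ne _ _ _ hm]
        rfl
    | add f g hf hg => rw [map_add, hadd, hf, hg]; rfl
  refine ⟨(injective_iff_map_eq_zero _).2 fun f hf => ?_, fun x => ?_⟩
  · ext m
    rw [← key f m, hf, h0]
    rfl
  · refine ⟨∑ m ∈ s, DirectSum.of (fun i => gr i) m ⟨P m x, hmem m x⟩, ?_⟩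
    rw [map_sum]
    simp only [DirectSum.coeAddMonoidHom_of]
    exact hs x

/-- Eigenspaces for distinct eigenvalues are independent, and the integer powers of `2` are
distinct. -/
theorem isInternal_of_eigen (S : Module.End ℂ V) (hS : ∀ m, ∀ x ∈ gr m, S x = (2 : ℂ) ^ m • x)
    (htop : iSup gr = ⊤) : DirectSum.IsInternal gr := by
  refine DirectSum.isInternal_submodule_of_iSupIndep_of_iSup_eq_top ?_ htop
  have hinj : Function.Injective fun m : ℤ => (2 : ℂ) ^ m := by
    intro a b hab
    have h2 : ((2 : ℝ) : ℂ) ^ a = ((2 : ℝ) : ℂ) ^ b := by simpa using hab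
    rw [← Complex.ofReal_zpow, ← Complex.ofReal_zpow, Complex.ofReal_inj] at h2
    exact zpow_right_injective₀ (by norm_num) (by norm_num) h2
  refine ((Module.End.eigenspaces_iSupIndep S).comp hinj).mono fun m x hx => ?_
  exact Module.End.mem_eigenspace_iff.2 (hS m x hx)

/-- Scaling by `2` on the exterior algebra. -/
theorem map_two_of_mem {M : Type*} [AddCommGroup M] [Module ℂ M] {i : ℕ} {x : ExteriorAlgebra ℂ M}
    (hx : x ∈ extGr M i) :
    ExteriorAlgebra.map ((2 : ℂ) • LinearMap.id) x = (2 : ℂ) ^ i • x := by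
  refine extGr_induction (C := fun i x => ExteriorAlgebra.map ((2 : ℂ) • LinearMap.id) x =
    (2 : ℂ) ^ i • x) ?_ ?_ ?_ hx
  · intro c
    simp
  · intro i x y hx hy
    rw [map_add, hx, hy, smul_add]
  · intro v i x _ h
    rw [map_mul, h, ExteriorAlgebra.map_apply_ι, LinearMap.smul_apply, map_smul,
      smul_mul_smul_comm, pow_succ']
    rfl

/-- Scaling covectors and `L` by `2` acts on type `(0, p)` with values in `⋀^q L` as `2 ^ (p + q)`,
so the total degree is read off from an eigenvalue. -/
theorem endFibGr_isInternal (T E L : Type*) [AddCommGroup T] [Module ℂ T] [AddCommGroup E]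
    [Module ℂ E] [AddCommGroup L] [Module ℂ L] : DirectSum.IsInternal (endFibGr T E L) := by
  let S : Module.End ℂ (EndFib T E L) := TensorProduct.map LinearMap.id
    ((GradedTensorProduct.of ℂ (extGr (ConjDual T)) (extGr L)).toLinearMap ∘ₗ
      TensorProduct.map (ExteriorAlgebra.map ((2 : ℂ) • LinearMap.id)).toLinearMap
        (ExteriorAlgebra.map ((2 : ℂ) • LinearMap.id)).toLinearMap ∘ₗ
      (GradedTensorProduct.of ℂ (extGr (ConjDual T)) (extGr L)).symm.toLinearMap)
  have hS : ∀ η φ h, S (formTensor η (φ ⊗ₜ h)) =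
      formTensor (ExteriorAlgebra.map ((2 : ℂ) • LinearMap.id) η)
        (φ ⊗ₜ ExteriorAlgebra.map ((2 : ℂ) • LinearMap.id) h) := fun _ _ _ => rfl
  refine isInternal_of_eigen S ?_ ?_
  · intro m x hx
    refine LinearMap.eqOn_span (f := S) (g := (2 : ℂ) ^ m • LinearMap.id) ?_ hx
    rintro _ ⟨p, q, φ, η, h, rfl, hη, hh, rfl⟩
    rw [hS, map_two_of_mem hη, map_two_of_mem hh, formTensor_smul_left, TensorProduct.tmul_smul,
      map_smul, smul_smul, LinearMap.smul_apply, zpow_add₀ two_ne_zero]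
    rfl
  · rw [eq_top_iff]
    intro y _
    refine endFib_induction (C := fun y => y ∈ iSup (endFibGr T E L)) ?_
      (fun x y hx hy => add_mem hx hy) y
    intro p q φ η h hη hh
    exact Submodule.mem_iSup_of_mem _ (formTensor_mem_endFibGr rfl φ hη hh)

/-- Here only the covectors are scaled, since `⨀ L` does not count towards the degree. -/
theorem symFibGr_isInternal (T L : Type*) [AddCommGroup T] [Module ℂ T] [AddCommGroup L]
    [Module ℂ L] : DirectSum.IsInternal (symFibGr T L) := by
  let S : Module.End ℂ (SymFib T L) :=
    TensorProduct.map (ExteriorAlgebra.map ((2 : ℂ) • LinearMap.id)).toLinearMap LinearMap.id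
  have hS : ∀ η h, S (η ⊗ₜ h) = ExteriorAlgebra.map ((2 : ℂ) • LinearMap.id) η ⊗ₜ h :=
    fun _ _ => rfl
  refine isInternal_of_eigen S ?_ ?_
  · intro m x hx
    refine LinearMap.eqOn_span (f := S) (g := (2 : ℂ) ^ m • LinearMap.id) ?_ hx
    rintro _ ⟨p, η, s, rfl, hη, rfl⟩
    rw [hS, map_two_of_mem hη, LinearMap.smul_apply, zpow_natCast, ← TensorProduct.smul_tmul']
    rfl
  · rw [eq_top_iff]
    rintro y -
    induction y using TensorProduct.induction_on with
    | zero => exact zero_mem _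
    | add x y hx hy => exact add_mem hx hy
    | tmul η s =>
      induction η using DirectSum.Decomposition.inductionOn (extGr (ConjDual T)) with
      | zero => simp
      | add a b ha hb => rw [TensorProduct.add_tmul]; exact add_mem ha hb
      | homogeneous a =>
        exact Submodule.mem_iSup_of_mem _ (Submodule.subset_span ⟨_, _, _, rfl, a.2, rfl⟩)

theorem symFibMul_mem_pow {T L : Type*} [AddCommGroup T] [Module ℂ T] [AddCommGroup L]
    [Module ℂ L] (η : ExteriorAlgebra ℂ (ConjDual T)) {k : ℕ} {y : SymFib T L}
    (hy : y ∈ symFibPow T L k) : (η ⊗ₜ 1) * y ∈ symFibPow T L k := by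
  refine Submodule.span_induction (p := fun y _ => (η ⊗ₜ 1) * y ∈ symFibPow T L k)
    ?_ ?_ ?_ ?_ hy
  · rintro _ ⟨η', s, hs, rfl⟩
    rw [Algebra.TensorProduct.tmul_mul_tmul, one_mul]
    exact Submodule.subset_span ⟨_, _, hs, rfl⟩
  · rw [mul_zero]; exact zero_mem _
  · intro x y _ _ h h'; rw [mul_add]; exact add_mem h h'
  · intro c x _ h; rw [mul_smul_comm]; exact Submodule.smul_mem _ _ h

/-- The projections respect the forms with values in a symmetric power. -/
theorem gradedProj_mem_symFibPow {T L : Type*} [AddCommGroup T] [Module ℂ T] [AddCommGroup L]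
    [Module ℂ L] (m : ℤ) {k : ℕ} {y : SymFib T L} (hy : y ∈ symFibPow T L k) :
    gradedProj (symFibGr_isInternal T L) m y ∈ symFibPow T L k := by
  refine Submodule.span_induction
    (p := fun y _ => gradedProj (symFibGr_isInternal T L) m y ∈ symFibPow T L k) ?_ ?_ ?_ ?_ hy
  · rintro _ ⟨η, s, hs, rfl⟩
    induction η using DirectSum.Decomposition.inductionOn (extGr (ConjDual T)) with
    | zero => simp
    | add a b ha hb => rw [TensorProduct.add_tmul, map_add]; exact add_mem ha hb
    | @homogeneous i a =>
      have h1 : (a : ExteriorAlgebra ℂ (ConjDual T)) ⊗ₜ[ℂ] s ∈ symFibGr T L i :=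
        Submodule.subset_span ⟨_, _, _, rfl, a.2, rfl⟩
      by_cases hm : m = i
      · subst hm
        rw [gradedProj_of_mem _ h1]
        exact Submodule.subset_span ⟨_, _, hs, rfl⟩
      · rw [gradedProj_of_mem_ne _ hm h1]
        exact zero_mem _
  · rw [map_zero]; exact zero_mem _
  · intro x y _ _ h h'; rw [map_add]; exact add_mem h h'
  · intro c x _ h; rw [map_smul]; exact Submodule.smul_mem _ _ h

end Gradings

/-! ### Coefficients of squarefree monomials as unsigned convolution powers. -/

section Unsigned

variable {α β B Z : Type*} [AddCommGroup Z] [Ring B]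

theorem conv_map_word {d : β → ℤ} (g : α → β) (Φ : List β → List β → Z) (w : List α) :
    conv d Φ (w.map g) = conv (fun a => d (g a)) (fun u v => Φ (u.map g) (v.map g)) w := by
  induction w generalizing Φ with
  | nil => simp
  | cons x w ih =>
    rw [List.map_cons, conv_cons', conv_cons', ih]
    congr 1
    funext u v
    simp [wdeg, Function.comp_def]

theorem convPow_map_word {d : β → ℤ} (g : α → β) (m : List β → B) (k : ℕ) (w : List α) :
    convPow d m k (w.map g) = convPow (fun a => d (g a)) (fun u => m (u.map g)) k w := by
  induction k generalizing w with
  | zero => simp [convPow]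
  | succ k ih => simp only [convPow, conv_map_word, ih]

theorem shortWord_map {Z : Type*} [Zero Z] (t : Z) (M : β → Z) (g : α → β) (u : List α) :
    shortWord t M (u.map g) = shortWord t (fun a => M (g a)) u := by
  rcases u with _ | ⟨x, _ | ⟨y, u⟩⟩ <;> rfl

/-- The unsigned convolution with a function supported on words of length at most one. -/
theorem conv_shortWord_mul [DecidableEq α] (a : B) (b : α → B) (N : List α → B) {w : List α}
    (hw : w.Nodup) : conv (fun _ => 0) (fun u v => shortWord a b u * N v) w =
      a * N w + ∑ i ∈ w.toFinset, b i * N (w.erase i) := by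
  induction w generalizing N with
  | nil => simp [shortWord]
  | cons x w ih =>
    have hx : x ∉ w := (List.nodup_cons.1 hw).1
    rw [conv_cons]
    have e1 : (fun u v : List α => shortWord a b (x :: u) * N v) =
        fun u v => if u = [] then b x * N v else 0 := by
      funext u v
      rcases u with _ | ⟨y, u⟩ <;> simp [shortWord]
    rw [e1, conv_left_unit]
    simp only [zero_mul, Int.negOnePow_zero, one_smul]
    rw [ih (fun v => N (x :: v)) (List.nodup_cons.1 hw).2, List.toFinset_cons,
      Finset.sum_insert (by simpa using hx), List.erase_cons_head]
    have e2 : ∑ i ∈ w.toFinset, b i * N (x :: w.erase i) =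
        ∑ i ∈ w.toFinset, b i * N ((x :: w).erase i) := by
      refine Finset.sum_congr rfl fun i hi => ?_
      have : x ≠ i := fun h => hx (h ▸ List.mem_toFinset.1 hi)
      rw [List.erase_cons_tail (by simpa using this)]
    rw [e2]
    abel

/-- The exponent of the squarefree monomial given by a word. -/
def wordExponent [DecidableEq α] (w : List α) : α →₀ ℕ := ∑ i ∈ w.toFinset, Finsupp.single i 1

theorem wordExponent_apply [DecidableEq α] (w : List α) (i : α) :
    wordExponent w i = if i ∈ w then 1 else 0 := by
  simp [wordExponent, Finsupp.finsetSum_apply, Finsupp.single_apply]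

/-- Both sides obey the same recursion in `k`: the leftmost factor contributes either the constant
`a` or one variable, whose letter is then erased from the word. Without repetitions in the word each
variable occurs at most once. -/
theorem coeff_pow_wordExponent [Fintype α] [DecidableEq α] (a : B) (b : α → B) (k : ℕ)
    {w : List α} (hw : w.Nodup) :
    ((AddMonoidAlgebra.single (0 : α →₀ ℕ) a +
      ∑ i, AddMonoidAlgebra.single (Finsupp.single i 1) (b i)) ^ k).coeff (wordExponent w) =
      convPow (fun _ => 0) (shortWord a b) k w := by
  induction k generalizing w with
  | zero =>
    rw [pow_zero, AddMonoidAlgebra.one_def, AddMonoidAlgebra.coeff_single, convPow,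
      Finsupp.single_apply]
    congr 1
    rw [eq_iff_iff]
    constructor
    · intro h
      rw [List.eq_nil_iff_forall_not_mem]
      intro i hi
      have := DFunLike.congr_fun h i
      rw [wordExponent_apply, if_pos hi] at this
      simp at this
    · rintro rfl
      simp [wordExponent]
  | succ k ih =>
    rw [pow_succ', convPow, conv_shortWord_mul a b _ hw, add_mul, AddMonoidAlgebra.coeff_add,
      Finsupp.add_apply, Finset.sum_mul, AddMonoidAlgebra.coeff_sum, Finsupp.finsetSum_apply]
    congr 1
    · have := AddMonoidAlgebra.coeff_single_mul_add ((AddMonoidAlgebra.single (0 : α →₀ ℕ) a +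
        ∑ i, AddMonoidAlgebra.single (Finsupp.single i 1) (b i)) ^ k) a 0 (wordExponent w)
      rw [zero_add] at this
      rw [this, ih hw]
    -- A variable outside the word has exponent zero in the monomial and cannot contribute.
    · rw [← Finset.sum_subset (Finset.subset_univ w.toFinset)]
      · refine Finset.sum_congr rfl fun i hi => ?_
        have hi' := List.mem_toFinset.1 hi
        have e : wordExponent w = Finsupp.single i 1 + wordExponent (w.erase i) := by
          ext j
          rw [Finsupp.add_apply, wordExponent_apply, wordExponent_apply, Finsupp.single_apply]
          simp only [hw.mem_erase_iff]
          by_cases hj : i = j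
          · subst hj; simp [hi']
          · simp [hj, Ne.symm hj]
        rw [e, AddMonoidAlgebra.coeff_single_mul_add, ih (hw.erase i)]
      · intro i _ hi
        refine AddMonoidAlgebra.coeff_single_mul_of_forall_add_ne _ _ fun m h => ?_
        have := DFunLike.congr_fun h i
        rw [Finsupp.add_apply, wordExponent_apply, if_neg (by simpa using hi)] at this
        simp at this

end Unsigned

/-! ### The polarized trace as a signed convolution power. -/

section Polar

variable {T E L : Type*} [AddCommGroup T] [Module ℂ T] [AddCommGroup E] [Module ℂ E]
  [AddCommGroup L] [Module ℂ L]

/-- `η ⊗ b` for a form `η` and `b ∈ End E ⊗ ⨀ L`. -/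
def formSym (η : ExteriorAlgebra ℂ (ConjDual T)) :
    Module.End ℂ E ⊗[ℂ] SymmetricAlgebra ℂ L →ₗ[ℂ] EndSym T E L :=
  TensorProduct.map LinearMap.id (TensorProduct.mk ℂ _ _ η)

theorem formSym_tmul (η : ExteriorAlgebra ℂ (ConjDual T)) (φ : Module.End ℂ E)
    (s : SymmetricAlgebra ℂ L) : formSym (T := T) η (φ ⊗ₜ s) = φ ⊗ₜ (η ⊗ₜ s) := rfl

theorem formSym_mul (η η' : ExteriorAlgebra ℂ (ConjDual T))
    (b b' : Module.End ℂ E ⊗[ℂ] SymmetricAlgebra ℂ L) :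
    formSym η b * formSym η' b' = formSym (η * η') (b * b') := by
  induction b using TensorProduct.induction_on with
  | zero => rw [zero_mul, map_zero, map_zero, zero_mul]
  | add x y hx hy => rw [map_add, add_mul, hx, hy, add_mul, map_add]
  | tmul φ s =>
    induction b' using TensorProduct.induction_on with
    | zero => rw [mul_zero, map_zero, map_zero, mul_zero]
    | add x y hx hy => rw [map_add, mul_add, hx, hy, mul_add, map_add]
    | tmul φ' s' => simp only [formSym_tmul, Algebra.TensorProduct.tmul_mul_tmul]

theorem formSym_units_smul (u : ℤˣ) (η : ExteriorAlgebra ℂ (ConjDual T))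
    (b : Module.End ℂ E ⊗[ℂ] SymmetricAlgebra ℂ L) : formSym (u • η) b = u • formSym η b := by
  induction b using TensorProduct.induction_on with
  | zero => simp
  | add x y hx hy => rw [map_add, hx, hy, map_add, smul_add]
  | tmul φ s =>
    rcases Int.units_eq_one_or u with rfl | rfl <;>
      simp [formSym_tmul, TensorProduct.neg_tmul, TensorProduct.tmul_neg]

theorem formSym_one_one : formSym (T := T) (E := E) (L := L) 1 1 = 1 := rfl

theorem endSymTrace_formSym (η : ExteriorAlgebra ℂ (ConjDual T))
    (b : Module.End ℂ E ⊗[ℂ] SymmetricAlgebra ℂ L) :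
    endSymTrace (formSym η b) = η ⊗ₜ symTrace b := by
  induction b using TensorProduct.induction_on with
  | zero => simp
  | add x y hx hy => rw [map_add, map_add, hx, hy, map_add, TensorProduct.tmul_add]
  | tmul φ s =>
    rw [formSym_tmul, endSymTrace_tmul, ← TensorProduct.tmul_smul]
    rfl

variable {α : Type*} {d : α → ℤ} (η : α → ExteriorAlgebra ℂ (ConjDual T))

theorem prod_map_mem_extGr {p : α → ℕ} (hη : ∀ i, η i ∈ extGr (ConjDual T) (p i)) (u : List α) :
    (u.map η).prod ∈ extGr (ConjDual T) (u.map p).sum := by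
  induction u with
  | nil => exact one_mem_extGr
  | cons x u ih =>
    rw [List.map_cons, List.map_cons, List.prod_cons, List.sum_cons]
    exact extGr_mul_mem (hη x) ih

/-- The sign of the unshuffle equals the sign of commuting `η x` past the product. Only parities
enter, so the form degrees `p i` have to agree with the letter degrees `d i` merely modulo two. -/
theorem mul_prod_map {p : α → ℕ} (hη : ∀ i, η i ∈ extGr (ConjDual T) (p i)) (hp : ∀ i, Even ((p i : ℤ) - d i))
    (x : α) (u : List α) :
    (d x * wdeg d u).negOnePow • ((u.map η).prod * η x) = η x * (u.map η).prod := by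
  have h := extGr_mul_comm (hη x) (prod_map_mem_extGr η hη u)
  have e : Even ((((u.map p).sum : ℕ) : ℤ) - wdeg d u) := by
    induction u with
    | nil => simp
    | cons y u ih =>
      obtain ⟨a, ha⟩ := ih (extGr_mul_comm (hη x) (prod_map_mem_extGr η hη u))
      obtain ⟨b, hb⟩ := hp y
      refine ⟨a + b, ?_⟩
      rw [List.map_cons, List.sum_cons, wdeg_cons]
      push_cast at ha ⊢
      linarith
  rw [h]
  obtain ⟨a, ha⟩ := e
  obtain ⟨b, hb⟩ := hp x
  refine negOnePow_smul_congr ⟨-(b * wdeg d u) - p x * a, ?_⟩ _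
  have h1 : (((u.map p).sum : ℕ) : ℤ) = wdeg d u + (a + a) := by linarith
  have h2 : d x = p x - (b + b) := by linarith
  rw [h1, h2]
  ring

/-- The Koszul signs of an unshuffle are absorbed by the product of forms. -/
theorem conv_formSym {p : α → ℕ} (hη : ∀ i, η i ∈ extGr (ConjDual T) (p i))
    (hp : ∀ i, Even ((p i : ℤ) - d i)) (ξ : ExteriorAlgebra ℂ (ConjDual T))
    (Ψ : List α → List α → Module.End ℂ E ⊗[ℂ] SymmetricAlgebra ℂ L) (w : List α) :
    conv d (fun u v => formSym (ξ * ((u.map η).prod * (v.map η).prod)) (Ψ u v)) w =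
      formSym (ξ * (w.map η).prod) (conv (fun _ => 0) Ψ w) := by
  induction w generalizing ξ Ψ with
  | nil => simp
  | cons x w ih =>
    rw [conv_cons', conv_cons']
    simp only [zero_mul, Int.negOnePow_zero, one_smul]
    rw [List.map_cons, List.prod_cons, ← mul_assoc, ← ih]
    congr 1
    funext u v
    rw [← formSym_units_smul, map_add, List.map_cons, List.map_cons, List.prod_cons,
      List.prod_cons]
    congr 2
    · congr 1
      simp only [mul_assoc]
    · rw [← mul_assoc (u.map η).prod, ← mul_smul_comm, ← smul_mul_assoc, mul_prod_map η hη hp]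
      simp only [mul_assoc]

theorem convPow_formSym {p : α → ℕ} (hη : ∀ i, η i ∈ extGr (ConjDual T) (p i))
    (hp : ∀ i, Even ((p i : ℤ) - d i)) (a : Module.End ℂ E ⊗[ℂ] SymmetricAlgebra ℂ L)
    (b : α → Module.End ℂ E ⊗[ℂ] SymmetricAlgebra ℂ L) (k : ℕ) (w : List α) :
    convPow d (shortWord (formSym 1 a) fun i => formSym (η i) (b i)) k w =
      formSym (w.map η).prod (convPow (fun _ => 0) (shortWord a b) k w) := by
  induction k generalizing w with
  | zero =>
    rw [convPow, convPow]
    split_ifs with h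
    · subst h
      exact formSym_one_one.symm
    · rw [map_zero]
  | succ k ih =>
    have h := conv_formSym η hη hp 1 (fun u v => shortWord a b u *
      convPow (fun _ => 0) (shortWord a b) k v) w
    simp only [one_mul] at h
    rw [convPow, convPow, ← h]
    congr 1
    funext u v
    rw [← formSym_mul, ih]
    congr 1
    rcases u with _ | ⟨x, _ | ⟨y, u⟩⟩
    · simp [shortWord]
    · simp [shortWord]
    · simp [shortWord]

/-- The forms are split off with all Koszul signs, and the unsigned power left over is the
coefficient of the monomial in all the variables, since the word runs once through all indices. -/
theorem endSymTrace_convPow {N : ℕ} {d : Fin N → ℤ} (η : Fin N → ExteriorAlgebra ℂ (ConjDual T))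
    {p : Fin N → ℕ} (hη : ∀ i, η i ∈ extGr (ConjDual T) (p i)) (hp : ∀ i, Even ((p i : ℤ) - d i))
    (θ : Module.End ℂ E ⊗[ℂ] L) (f : Fin N → Module.End ℂ E ⊗[ℂ] L) (k : ℕ) :
    endSymTrace (convPow d (shortWord (formSym 1 (toSym θ)) fun i => formSym (η i) (toSym (f i))) k
      (List.ofFn id)) = (List.ofFn η).prod ⊗ₜ polarCoeff k θ f := by
  rw [convPow_formSym η hη hp, endSymTrace_formSym, List.map_ofFn, polarCoeff,
    ← coeff_pow_wordExponent _ _ _ (List.nodup_ofFn.2 Function.injective_id)]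
  congr 4
  rw [wordExponent]
  congr 1
  ext i
  simp

end Polar

/-! ### Homogeneous components of forms at a point. -/

section Components

variable {T E L : Type*} [AddCommGroup T] [Module ℂ T] [AddCommGroup E] [Module ℂ E]
  [AddCommGroup L] [Module ℂ L]

/-- The component of degree `m : ℤ` of a form. -/
def extComponent (m : ℤ) (η : ExteriorAlgebra ℂ (ConjDual T)) : ExteriorAlgebra ℂ (ConjDual T) :=
  if 0 ≤ m then DirectSum.decompose (extGr (ConjDual T)) η m.toNat else 0

theorem extComponent_add (m : ℤ) (η η' : ExteriorAlgebra ℂ (ConjDual T)) :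
    extComponent m (η + η') = extComponent m η + extComponent m η' := by
  unfold extComponent
  split_ifs
  · rw [DirectSum.decompose_add]; rfl
  · rw [add_zero]

theorem extComponent_of_mem {p : ℕ} {η : ExteriorAlgebra ℂ (ConjDual T)}
    (hη : η ∈ extGr (ConjDual T) p) (m : ℤ) : extComponent m η = if m = p then η else 0 := by
  unfold extComponent
  split_ifs with h1 h2 h2
  · subst h2
    exact DirectSum.decompose_of_mem_same _ hη
  · exact DirectSum.decompose_of_mem_ne _ hη (by omega)
  · omega
  · rfl

theorem formSym_add_left (η η' : ExteriorAlgebra ℂ (ConjDual T))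
    (b : Module.End ℂ E ⊗[ℂ] SymmetricAlgebra ℂ L) :
    formSym (η + η') b = formSym η b + formSym η' b := by
  induction b using TensorProduct.induction_on with
  | zero => simp
  | add x y hx hy => rw [map_add, hx, hy, map_add, map_add]; abel
  | tmul φ s => simp [formSym_tmul, TensorProduct.add_tmul, TensorProduct.tmul_add]

theorem formSym_zero_left (b : Module.End ℂ E ⊗[ℂ] SymmetricAlgebra ℂ L) :
    formSym (0 : ExteriorAlgebra ℂ (ConjDual T)) b = 0 := by
  simpa using formSym_add_left (T := T) 0 0 b

/-- The part in `End E ⊗ L` of the homogeneous components of `η ⊗ f`. -/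
theorem linPart_gradedProj (m : ℤ) (η : ExteriorAlgebra ℂ (ConjDual T))
    (f : Module.End ℂ E ⊗[ℂ] ExteriorAlgebra ℂ L) :
    linPart (gradedProj (endFibGr_isInternal T E L) m (formTensor η f)) =
      formSym (extComponent (m - 1) η) (toSym (degreeOne f)) := by
  induction f using TensorProduct.induction_on with
  | zero => simp
  | add x y hx hy => simp only [map_add, hx, hy]
  | tmul φ h =>
    induction η using DirectSum.Decomposition.inductionOn (extGr (ConjDual T)) with
    | zero =>
      rw [show formTensor (0 : ExteriorAlgebra ℂ (ConjDual T)) (φ ⊗ₜ h) = 0 by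
        simpa using formTensor_smul_left (T := T) 0 0 (φ ⊗ₜ[ℂ] h), map_zero, map_zero]
      have : extComponent (m - 1) (0 : ExteriorAlgebra ℂ (ConjDual T)) = 0 := by
        simpa using extComponent_add (T := T) (m - 1) 0 0
      rw [this, formSym_zero_left]
    | add a b ha hb =>
      rw [formTensor_add_left, map_add, map_add, ha, hb, extComponent_add, formSym_add_left]
    | @homogeneous p a =>
      induction h using DirectSum.Decomposition.inductionOn (extGr L) with
      | zero => simp
      | add a b ha hb => simp only [TensorProduct.tmul_add, map_add, ha, hb]
      | @homogeneous q b =>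
        have hmem := formTensor_mem_endFibGr (T := T) (m := p + q) rfl φ a.2 b.2
        have hd : toSym (degreeOne (φ ⊗ₜ[ℂ] (b : ExteriorAlgebra ℂ L))) =
          φ ⊗ₜ SymmetricAlgebra.ι ℂ L (ExteriorAlgebra.ιInv (b : ExteriorAlgebra ℂ L)) := rfl
        rw [hd, extComponent_of_mem a.2]
        by_cases hq : q = 1
        · by_cases hm : m = p + q
          · rw [hm, gradedProj_of_mem _ hmem, if_pos (by omega)]
            rfl
          · rw [gradedProj_of_mem_ne _ hm hmem, if_neg (by omega), map_zero, formSym_zero_left]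
        · rw [ιInv_of_mem hq b.2]
          by_cases hm : m = p + q
          · rw [hm, gradedProj_of_mem _ hmem, linPart_formTensor, ιInv_of_mem hq b.2]
            simp
          · rw [gradedProj_of_mem_ne _ hm hmem]
            simp

theorem extComponent_mem (m : ℤ) (η : ExteriorAlgebra ℂ (ConjDual T)) :
    extComponent m η ∈ extGr (ConjDual T) m.natAbs := by
  unfold extComponent
  split_ifs with h
  · rw [show m.toNat = m.natAbs by omega]
    exact Subtype.property _
  · exact zero_mem _

theorem sum_extComponent {s : Finset ℤ} (hs : ∀ p : ℕ, (p : ℤ) ∉ s → extGr (ConjDual T) p = ⊥)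
    (η : ExteriorAlgebra ℂ (ConjDual T)) : ∑ m ∈ s, extComponent m η = η := by
  induction η using DirectSum.Decomposition.inductionOn (extGr (ConjDual T)) with
  | zero =>
    have : ∀ m, extComponent m (0 : ExteriorAlgebra ℂ (ConjDual T)) = 0 := fun m => by
      simpa using extComponent_add (T := T) m 0 0
    simp [this]
  | add a b ha hb => simp only [extComponent_add, Finset.sum_add_distrib, ha, hb]
  | @homogeneous p a =>
    simp only [extComponent_of_mem a.2]
    rw [Finset.sum_ite_eq' s (p : ℤ)]
    split_ifs with h
    · rfl
    · exact ((Submodule.eq_bot_iff _).1 (hs p h) a a.2).symm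

end Components

/-! ### Holomorphic functions of several variables are smooth. -/

section SeveralVariables

open MeasureTheory Metric

variable {V : Type*} [NormedAddCommGroup V] [NormedSpace ℂ V]

theorem hasDerivAt_line {f : V → ℂ} {z v : V} {ζ : ℂ} (hf : DifferentiableAt ℂ f (z + ζ • v)) :
    HasDerivAt (fun ζ : ℂ => f (z + ζ • v)) (fderiv ℂ f (z + ζ • v) v) ζ := by
  have h1 : HasDerivAt (fun ζ : ℂ => z + ζ • v) v ζ := by
    simpa using ((hasDerivAt_id ζ).smul_const v).const_add z
  exact hf.hasFDerivAt.comp_hasDerivAt ζ h1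

/-- Cauchy's estimate for the derivative. -/
theorem norm_fderiv_le_of_bound {f : V → ℂ} {z : V} {R C : ℝ} (hR : 0 < R) (hC : 0 ≤ C)
    (hf : ∀ y ∈ closedBall z R, DifferentiableAt ℂ f y) (hb : ∀ y ∈ closedBall z R, ‖f y‖ ≤ C) :
    ‖fderiv ℂ f z‖ ≤ C / R := by
  refine ContinuousLinearMap.opNorm_le_bound _ (by positivity) fun v => ?_
  by_cases hv : v = 0
  · simp [hv]
  have hv' : 0 < ‖v‖ := norm_pos_iff.2 hv
  have hmem : ∀ ζ ∈ closedBall (0 : ℂ) (R / ‖v‖), z + ζ • v ∈ closedBall z R := by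
    intro ζ hζ
    rw [mem_closedBall_zero_iff, le_div_iff₀ hv'] at hζ
    rw [mem_closedBall, dist_self_add_left, norm_smul]
    exact hζ
  have h1 := Complex.norm_deriv_le_of_forall_mem_sphere_norm_le (c := 0) (R := R / ‖v‖) (C := C)
    (f := fun ζ : ℂ => f (z + ζ • v)) (by positivity) (by
      refine DifferentiableOn.diffContOnCl ?_
      intro ζ hζ
      have := hmem ζ (closure_ball_subset_closedBall hζ)
      exact (hasDerivAt_line (hf _ this)).differentiableAt.differentiableWithinAt)
    (fun ζ hζ => hb _ (hmem ζ (sphere_subset_closedBall hζ)))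
  rw [(hasDerivAt_line (v := v) (ζ := 0) (by simpa using hf z (mem_closedBall_self hR.le))).deriv] at h1
  simp only [zero_smul, add_zero] at h1
  rw [div_div_eq_mul_div] at h1
  rw [div_mul_eq_mul_div]
  exact h1

/-- Cauchy's formula on small circles in the direction `v` writes the directional derivative as an
integral of values of `f`. Differentiation under the integral sign is justified by Cauchy's estimate
for the derivative of `f`. -/
theorem differentiableOn_fderiv_apply [FiniteDimensional ℂ V] {f : V → ℂ} {U : Set V} (hU : IsOpen U)
    (hf : DifferentiableOn ℂ f U) (v : V) : DifferentiableOn ℂ (fun z => fderiv ℂ f z v) U := by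
  intro z₀ hz₀
  refine DifferentiableAt.differentiableWithinAt ?_
  have : ProperSpace V := FiniteDimensional.proper ℂ V
  borelize V
  obtain ⟨R, hR, hRU⟩ := Metric.isOpen_iff.1 hU z₀ hz₀
  have hfd : ∀ y ∈ ball z₀ R, DifferentiableAt ℂ f y := fun y hy =>
    hf.differentiableAt (hU.mem_nhds (hRU hy))
  obtain ⟨C, hC⟩ : ∃ C, ∀ y ∈ closedBall z₀ (R / 2), ‖f y‖ ≤ C :=
    (isCompact_closedBall z₀ (R / 2)).exists_bound_of_continuousOn fun y hy =>
      (hfd y (closedBall_subset_ball (by linarith) hy)).continuousAt.continuousWithinAt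
  have hC0 : 0 ≤ C := (norm_nonneg _).trans (hC z₀ (mem_closedBall_self (by positivity)))
  -- Balls of radius `R / 4` around these points stay in the ball of radius `R / 2` on which `f` is
  -- bounded.
  have hfb : ∀ y ∈ closedBall z₀ (R / 4), ‖fderiv ℂ f y‖ ≤ C / (R / 4) := by
    intro y hy
    have hsub : closedBall y (R / 4) ⊆ closedBall z₀ (R / 2) := by
      refine closedBall_subset_closedBall' ?_
      rw [mem_closedBall] at hy
      linarith
    refine norm_fderiv_le_of_bound (by positivity) hC0 (fun w hw => hfd w ?_) fun w hw => hC w (hsub hw)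
    exact closedBall_subset_ball (by linarith) (hsub hw)
  -- Chosen so that points within `R / 8` of `z₀`, moved by at most `δ` times `v`, remain within `R
  -- / 4`; the summand `1` covers `v = 0`.
  set δ : ℝ := R / (8 * (1 + ‖v‖)) with hδ
  have hv0 : 0 ≤ ‖v‖ := norm_nonneg v
  have hδ0 : 0 < δ := by positivity
  have hδv : δ * ‖v‖ ≤ R / 8 := by
    rw [hδ, div_mul_eq_mul_div, div_le_div_iff₀ (by positivity) (by positivity)]
    nlinarith
  have hmem : ∀ z ∈ ball z₀ (R / 8), ∀ ζ ∈ closedBall (0 : ℂ) δ, z + ζ • v ∈ closedBall z₀ (R / 4) := by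
    intro z hz ζ hζ
    rw [mem_closedBall_zero_iff] at hζ
    rw [mem_ball] at hz
    rw [mem_closedBall]
    calc dist (z + ζ • v) z₀ ≤ dist (z + ζ • v) z + dist z z₀ := dist_triangle _ _ _
      _ ≤ δ * ‖v‖ + R / 8 := by
          rw [dist_self_add_left, norm_smul]
          gcongr
      _ ≤ R / 4 := by linarith
  have hmem' : ∀ z ∈ ball z₀ (R / 8), ∀ ζ ∈ closedBall (0 : ℂ) δ, DifferentiableAt ℂ f (z + ζ • v) :=
    fun z hz ζ hζ => hfd _ (closedBall_subset_ball (by linarith) (hmem z hz ζ hζ))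
  have hcirc : ∀ t, circleMap 0 δ t ∈ closedBall (0 : ℂ) δ := fun t =>
    circleMap_mem_closedBall 0 hδ0.le t
  let s : ℝ → ℂ := fun t => deriv (circleMap 0 δ) t * ((circleMap 0 δ t - 0) ^ 2)⁻¹
  have hs : Continuous s := by
    have h0 : ∀ t, (circleMap 0 δ t - 0) ^ 2 ≠ 0 := fun t => by
      rw [sub_zero]
      exact pow_ne_zero 2 (circleMap_ne_center hδ0.ne')
    refine Continuous.mul ?_ (Continuous.inv₀ (by fun_prop) h0)
    rw [show deriv (circleMap 0 δ) = fun t => circleMap 0 δ t * Complex.I from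
      funext fun t => deriv_circleMap 0 δ t]
    fun_prop
  have key : ∀ z ∈ ball z₀ (R / 8), fderiv ℂ f z v =
      (2 * ↑Real.pi * Complex.I)⁻¹ * ∫ t in (0 : ℝ)..2 * Real.pi, s t * f (z + circleMap 0 δ t • v) := by
    intro z hz
    have hd : DifferentiableAt ℂ f (z + (0 : ℂ) • v) := hmem' z hz 0 (mem_closedBall_self hδ0.le)
    have h1 := (hasDerivAt_line hd).deriv
    let W : Set ℂ := (fun ζ : ℂ => z + ζ • v) ⁻¹' ball z₀ R
    have hW : IsOpen W := isOpen_ball.preimage (by fun_prop)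
    have h2 := Complex.two_pi_I_inv_smul_circleIntegral_sub_sq_inv_smul_of_differentiable hW
      (c := 0) (w₀ := 0) (R := δ) (f := fun ζ : ℂ => f (z + ζ • v))
      (fun ζ hζ => closedBall_subset_ball (by linarith) (hmem z hz ζ hζ))
      (fun ζ hζ => (hasDerivAt_line (hfd _ hζ)).differentiableAt.differentiableWithinAt)
      (mem_ball_self hδ0)
    rw [h1] at h2
    simp only [zero_smul, add_zero] at h2
    rw [← h2, circleIntegral, smul_eq_mul]
    simp only [smul_eq_mul, s, mul_assoc]
  have hev : (fun z => fderiv ℂ f z v) =ᶠ[nhds z₀] fun z => (2 * ↑Real.pi * Complex.I)⁻¹ *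
      ∫ t in (0 : ℝ)..2 * Real.pi, s t * f (z + circleMap 0 δ t • v) :=
    Filter.eventually_of_mem (ball_mem_nhds z₀ (by positivity)) key
  refine DifferentiableAt.congr_of_eventuallyEq ?_ hev
  refine DifferentiableAt.const_mul ?_ _
  have hz₀' : z₀ ∈ ball z₀ (R / 8) := mem_ball_self (by positivity)
  have hcont : ∀ z ∈ ball z₀ (R / 8), Continuous fun t => s t * f (z + circleMap 0 δ t • v) := by
    intro z hz
    refine hs.mul ?_
    rw [continuous_iff_continuousAt]
    intro t
    have h1 : ContinuousAt (fun t => z + circleMap 0 δ t • v) t := by fun_prop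
    exact ContinuousAt.comp (f := fun t => z + circleMap 0 δ t • v) (g := f)
      (hmem' z hz _ (hcirc t)).continuousAt h1
  refine (intervalIntegral.hasFDerivAt_integral_of_dominated_of_fderiv_le
    (F' := fun z t => s t • fderiv ℂ f (z + circleMap 0 δ t • v))
    (bound := fun t => ‖s t‖ * (C / (R / 4))) (ball_mem_nhds z₀ (by positivity : 0 < R / 8))
    ?_ ?_ ?_ ?_ ?_ ?_).differentiableAt
  · filter_upwards [ball_mem_nhds z₀ (by positivity : 0 < R / 8)] with z hz
    exact (hcont z hz).aestronglyMeasurable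
  · exact (hcont z₀ hz₀').intervalIntegrable _ _
  · have h1 : Measurable fun t => fderiv ℂ f (z₀ + circleMap 0 δ t • v) := by
      refine (measurable_fderiv ℂ f).comp ?_
      exact (by fun_prop : Continuous fun t => z₀ + circleMap 0 δ t • v).measurable
    exact (hs.measurable.smul h1).aestronglyMeasurable
  · refine Filter.Eventually.of_forall fun t _ z hz => ?_
    rw [norm_smul]
    exact mul_le_mul_of_nonneg_left (hfb _ (hmem z hz _ (hcirc t))) (norm_nonneg _)
  · exact (hs.norm.mul continuous_const).intervalIntegrable _ _
  · refine Filter.Eventually.of_forall fun t _ z hz => ?_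
    have h1 : HasFDerivAt (fun z => f (z + circleMap 0 δ t • v))
        (fderiv ℂ f (z + circleMap 0 δ t • v)) z := by
      have := (hmem' z hz _ (hcirc t)).hasFDerivAt.comp z ((hasFDerivAt_id z).add_const (circleMap 0 δ t • v))
      simpa [Function.comp_def] using this
    exact h1.const_mul (s t)

/-- Complex differentiable functions of several variables are smooth. -/
theorem contDiffOn_of_differentiableOn_complex [FiniteDimensional ℂ V] {f : V → ℂ} {U : Set V}
    (hU : IsOpen U) (hf : DifferentiableOn ℂ f U) : ContDiffOn ℂ ∞ f U := by
  rw [contDiffOn_infty]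
  intro k
  induction k generalizing f with
  | zero => exact contDiffOn_zero.2 hf.continuousOn
  | succ k ih =>
    rw [Nat.cast_succ, contDiffOn_succ_iff_fderiv_of_isOpen hU]
    refine ⟨hf, fun h => ?_, ?_⟩
    · exact absurd h (by simp)
    · exact contDiffOn_clm_apply.2 fun v => ih (differentiableOn_fderiv_apply hU hf v)

theorem contDiffOn_real_of_differentiableOn [FiniteDimensional ℂ V] {f : V → ℂ} {U : Set V}
    (hU : IsOpen U) (hf : DifferentiableOn ℂ f U) : ContDiffOn ℝ ∞ f U :=
  (contDiffOn_of_differentiableOn_complex hU hf).restrict_scalars ℝ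

end SeveralVariables

/-! ### Finite sums of scalar functions times constant vectors, in spaces without a topology. -/

section FinSpan

/-- Functions that are on `U` finite sums of functions `z ↦ c z • w` with `P c`. -/
inductive FinSpan {V W : Type*} [AddCommGroup W] [Module ℂ W] (P : (V → ℂ) → Prop) (U : Set V) :
    (V → W) → Prop
  | smul (c : V → ℂ) (w : W) : P c → FinSpan P U (fun z => c z • w)
  | add (f g : V → W) : FinSpan P U f → FinSpan P U g → FinSpan P U (fun z => f z + g z)
  | congr (f g : V → W) : FinSpan P U f → (∀ z ∈ U, g z = f z) → FinSpan P U g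

variable {V V' W W' W'' : Type*} [AddCommGroup W] [Module ℂ W] [AddCommGroup W'] [Module ℂ W']
  [AddCommGroup W''] [Module ℂ W''] {P : (V → ℂ) → Prop} {U : Set V}

namespace FinSpan

theorem const (hP : P fun _ => 1) (w : W) : FinSpan P U fun _ => w :=
  (FinSpan.smul _ w hP).congr _ _ fun z _ => by simp

theorem zero (hP : P fun _ => 1) : FinSpan P U fun _ => (0 : W) := const hP 0

theorem map {f : V → W} (hf : FinSpan P U f) (T : W →ₗ[ℂ] W') : FinSpan P U fun z => T (f z) := by
  induction hf with
  | smul c w hc => exact (FinSpan.smul c (T w) hc).congr _ _ fun z _ => by simp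
  | add f g _ _ hf hg => exact (hf.add _ _ hg).congr _ _ fun z _ => by simp
  | congr f g _ h hf => exact hf.congr _ _ fun z hz => by rw [h z hz]

theorem map₂ (hmul : ∀ c c', P c → P c' → P fun z => c z * c' z) {f : V → W} {g : V → W'}
    (hf : FinSpan P U f) (hg : FinSpan P U g) (B : W →ₗ[ℂ] W' →ₗ[ℂ] W'') :
    FinSpan P U fun z => B (f z) (g z) := by
  induction hf with
  | smul c w hc =>
    induction hg with
    | smul c' w' hc' =>
      refine (FinSpan.smul _ (B w w') (hmul c c' hc hc')).congr _ _ fun z _ => ?_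
      simp [smul_smul, mul_comm]
    | add f g _ _ hf hg => exact (hf.add _ _ hg).congr _ _ fun z _ => by simp
    | congr f g _ h hf => exact hf.congr _ _ fun z hz => by rw [h z hz]
  | add f g _ _ hf hg => exact (hf.add _ _ hg).congr _ _ fun z _ => by simp
  | congr f g _ h hf => exact hf.congr _ _ fun z hz => by rw [h z hz]

theorem mul {A : Type*} [Ring A] [Algebra ℂ A] (hmul : ∀ c c', P c → P c' → P fun z => c z * c' z)
    {f g : V → A} (hf : FinSpan P U f) (hg : FinSpan P U g) : FinSpan P U fun z => f z * g z :=
  map₂ hmul hf hg (LinearMap.mul ℂ A)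

theorem sum (hP : P fun _ => 1) {ι : Type*} (s : Finset ι) {f : ι → V → W}
    (hf : ∀ i ∈ s, FinSpan P U (f i)) : FinSpan P U fun z => ∑ i ∈ s, f i z := by
  classical
  induction s using Finset.induction_on with
  | empty => simpa using zero hP
  | insert i s hi ih =>
    simp only [Finset.sum_insert hi]
    exact (hf i (Finset.mem_insert_self i s)).add _ _ (ih fun j hj => hf j (Finset.mem_insert_of_mem hj))

theorem smul_fun (hmul : ∀ c c', P c → P c' → P fun z => c z * c' z) {c : V → ℂ} (hc : P c)
    {f : V → W} (hf : FinSpan P U f) : FinSpan P U fun z => c z • f z := by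
  have h1 : FinSpan P U fun z => c z • (1 : ℂ) := FinSpan.smul c 1 hc
  exact (map₂ hmul h1 hf (LinearMap.lsmul ℂ W)).congr _ _ fun z _ => by simp

theorem neg {f : V → W} (hf : FinSpan P U f) : FinSpan P U fun z => - f z :=
  hf.map (-LinearMap.id)

theorem mono {P' : (V → ℂ) → Prop} {U' : Set V} (hP : ∀ c, P c → P' c) (hU : U' ⊆ U) {f : V → W}
    (hf : FinSpan P U f) : FinSpan P' U' f := by
  induction hf with
  | smul c w hc => exact .smul c w (hP c hc)
  | add f g _ _ hf hg => exact hf.add _ _ hg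
  | congr f g _ h hf => exact hf.congr _ _ fun z hz => h z (hU hz)

/-- Functions with values in a finite-dimensional space, in terms of coordinates. -/
theorem of_finite [Module.Finite ℂ W] (hP : P fun _ => 1) {f : V → W}
    (hf : ∀ φ : W →ₗ[ℂ] ℂ, P fun z => φ (f z)) : FinSpan P U f := by
  let b := Module.finBasis ℂ W
  have h : f = fun z => ∑ i, (b.coord i (f z)) • b i := funext fun z => (b.sum_repr (f z)).symm
  rw [h]
  exact sum hP _ fun i _ => .smul _ _ (hf (b.coord i))

/-- Functions with values in a finite-dimensional subspace, in terms of coordinates. -/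
theorem of_finite_submodule (S : Submodule ℂ W) [Module.Finite ℂ S] (hP : P fun _ => 1) {f : V → W}
    (hf : ∀ φ : W →ₗ[ℂ] ℂ, P fun z => φ (f z)) (hS : ∀ z ∈ U, f z ∈ S) : FinSpan P U f := by
  obtain ⟨π, hπ⟩ := S.subtype.exists_leftInverse_of_injective (Submodule.ker_subtype S)
  have h : FinSpan P U fun z => π (f z) := of_finite hP fun φ => hf (φ ∘ₗ π)
  refine (h.map S.subtype).congr _ _ fun z hz => ?_
  have := LinearMap.congr_fun hπ ⟨f z, hS z hz⟩
  exact (congrArg Subtype.val this).symm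

end FinSpan

end FinSpan

/-! ### Calculus of the Wirtinger derivatives. -/

section Wirtinger

variable {n : ℕ} {W W' W'' : Type*} [AddCommGroup W] [Module ℂ W] [AddCommGroup W'] [Module ℂ W']
  [AddCommGroup W''] [Module ℂ W'']

/-- The Wirtinger derivative of a scalar function. -/
def wbar (c : EuclideanSpace ℂ (Fin n) → ℂ) (j : Fin n) (z : EuclideanSpace ℂ (Fin n)) : ℂ :=
  (1 / 2 : ℂ) * (fderiv ℝ c z (EuclideanSpace.single j 1) +
    Complex.I * fderiv ℝ c z (EuclideanSpace.single j Complex.I))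

/-- `w` is the Wirtinger derivative of `f` at `z`, and `f` is differentiable there. -/
def IsWirt (f : EuclideanSpace ℂ (Fin n) → W) (j : Fin n) (z : EuclideanSpace ℂ (Fin n)) (w : W) :
    Prop :=
  ∀ φ : W →ₗ[ℂ] ℂ, DifferentiableAt ℝ (fun y => φ (f y)) z ∧ φ w = wbar (fun y => φ (f y)) j z

variable {U : Set (EuclideanSpace ℂ (Fin n))} {j : Fin n} {z : EuclideanSpace ℂ (Fin n)}

theorem wbar_add {c c' : EuclideanSpace ℂ (Fin n) → ℂ} (hc : DifferentiableAt ℝ c z)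
    (hc' : DifferentiableAt ℝ c' z) : wbar (fun y => c y + c' y) j z = wbar c j z + wbar c' j z := by
  unfold wbar
  rw [show (fun y => c y + c' y) = c + c' from rfl, fderiv_add hc hc']
  simp only [add_apply]
  ring

theorem wbar_mul {c c' : EuclideanSpace ℂ (Fin n) → ℂ} (hc : DifferentiableAt ℝ c z)
    (hc' : DifferentiableAt ℝ c' z) :
    wbar (fun y => c y * c' y) j z = wbar c j z * c' z + c z * wbar c' j z := by
  unfold wbar
  rw [show (fun y => c y * c' y) = c * c' from rfl, fderiv_mul hc hc']
  simp only [add_apply, smul_apply, smul_eq_mul]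
  ring

theorem wbar_congr {c c' : EuclideanSpace ℂ (Fin n) → ℂ} (h : c =ᶠ[nhds z] c') :
    wbar c j z = wbar c' j z := by
  unfold wbar
  rw [h.fderiv_eq]

theorem wbar_const (a : ℂ) : wbar (fun _ => a) j z = 0 := by
  simp [wbar]

theorem wbar_of_holomorphic {c : EuclideanSpace ℂ (Fin n) → ℂ} (hc : DifferentiableAt ℂ c z) :
    wbar c j z = 0 := by
  unfold wbar
  rw [hc.fderiv_restrictScalars ℝ]
  have : EuclideanSpace.single j Complex.I = Complex.I • EuclideanSpace.single j (1 : ℂ) := by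
    ext i; simp
  simp only [ContinuousLinearMap.coe_restrictScalars', this, map_smul, smul_eq_mul, ← mul_assoc,
    Complex.I_mul_I]
  ring

namespace IsWirt

/-- Linear functionals separate the points of a vector space, so the vector chosen in `wirtingerBar`
can only be `w`. -/
theorem eq {f : EuclideanSpace ℂ (Fin n) → W} {w : W} (h : IsWirt f j z w) :
    wirtingerBar f j z = w := by
  have hex : ∃ w : W, ∀ φ : W →ₗ[ℂ] ℂ, φ w = (1 / 2 : ℂ) *
      (fderiv ℝ (fun y => φ (f y)) z (EuclideanSpace.single j 1) +
        Complex.I * fderiv ℝ (fun y => φ (f y)) z (EuclideanSpace.single j Complex.I)) :=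
    ⟨w, fun φ => (h φ).2⟩
  rw [wirtingerBar, dif_pos hex, ← sub_eq_zero, ← Module.forall_dual_apply_eq_zero_iff ℂ]
  intro φ
  rw [map_sub, hex.choose_spec φ, (h φ).2, wbar, sub_self]

theorem add {f g : EuclideanSpace ℂ (Fin n) → W} {w w' : W} (hf : IsWirt f j z w)
    (hg : IsWirt g j z w') : IsWirt (fun y => f y + g y) j z (w + w') := fun φ => by
  simp only [map_add]
  exact ⟨(hf φ).1.add (hg φ).1, by rw [wbar_add (hf φ).1 (hg φ).1, (hf φ).2, (hg φ).2]⟩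

theorem map {f : EuclideanSpace ℂ (Fin n) → W} {w : W} (hf : IsWirt f j z w) (T : W →ₗ[ℂ] W') :
    IsWirt (fun y => T (f y)) j z (T w) := fun φ => hf (φ ∘ₗ T)

theorem congr {f g : EuclideanSpace ℂ (Fin n) → W} {w : W} (hf : IsWirt f j z w)
    (h : g =ᶠ[nhds z] f) : IsWirt g j z w := fun φ => by
  have h' : (fun y => φ (g y)) =ᶠ[nhds z] fun y => φ (f y) := h.fun_comp φ
  exact ⟨(hf φ).1.congr_of_eventuallyEq h', by rw [wbar_congr h', (hf φ).2]⟩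

theorem smul {c : EuclideanSpace ℂ (Fin n) → ℂ} (hc : DifferentiableAt ℝ c z) (w : W) :
    IsWirt (fun y => c y • w) j z (wbar c j z • w) := fun φ => by
  simp only [map_smul, smul_eq_mul]
  refine ⟨hc.mul_const _, ?_⟩
  rw [wbar_mul hc (differentiableAt_const _), wbar_const, mul_zero, add_zero]

theorem sum {ι : Type*} (s : Finset ι) {f : ι → EuclideanSpace ℂ (Fin n) → W} {w : ι → W}
    (hf : ∀ i ∈ s, IsWirt (f i) j z (w i)) : IsWirt (fun y => ∑ i ∈ s, f i y) j z (∑ i ∈ s, w i) := by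
  classical
  induction s using Finset.induction_on with
  | empty =>
    intro φ
    simp [wbar_const]
  | insert i s hi ih =>
    simp only [Finset.sum_insert hi]
    exact (hf i (Finset.mem_insert_self i s)).add (ih fun k hk => hf k (Finset.mem_insert_of_mem hk))

end IsWirt

/-- Smooth functions with values in a finite-dimensional subspace. -/
abbrev FinSmooth (U : Set (EuclideanSpace ℂ (Fin n))) (f : EuclideanSpace ℂ (Fin n) → W) : Prop :=
  FinSpan (fun c => ContDiffOn ℝ ∞ c U) U f

/-- Holomorphic functions with values in a finite-dimensional subspace. -/
abbrev FinHolo (U : Set (EuclideanSpace ℂ (Fin n))) (f : EuclideanSpace ℂ (Fin n) → W) : Prop :=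
  FinSpan (fun c => DifferentiableOn ℂ c U) U f

theorem FinHolo.finSmooth (hU : IsOpen U) {f : EuclideanSpace ℂ (Fin n) → W} (hf : FinHolo U f) :
    FinSmooth U f :=
  hf.mono (fun _ hc => contDiffOn_real_of_differentiableOn hU hc) subset_rfl

theorem smooth_one : ContDiffOn ℝ ∞ (fun _ : EuclideanSpace ℂ (Fin n) => (1 : ℂ)) U :=
  contDiffOn_const

theorem smooth_mul (c c' : EuclideanSpace ℂ (Fin n) → ℂ) (hc : ContDiffOn ℝ ∞ c U)
    (hc' : ContDiffOn ℝ ∞ c' U) : ContDiffOn ℝ ∞ (fun z => c z * c' z) U := hc.mul hc'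

theorem holo_mul (c c' : EuclideanSpace ℂ (Fin n) → ℂ) (hc : DifferentiableOn ℂ c U)
    (hc' : DifferentiableOn ℂ c' U) : DifferentiableOn ℂ (fun z => c z * c' z) U := hc.mul hc'

theorem holo_one : DifferentiableOn ℂ (fun _ : EuclideanSpace ℂ (Fin n) => (1 : ℂ)) U :=
  differentiableOn_const 1

theorem FinSmooth.smoothOn {f : EuclideanSpace ℂ (Fin n) → W} (hf : FinSmooth U f) :
    SmoothOn f U := by
  intro φ
  induction hf with
  | smul c w hc =>
    simp only [map_smul, smul_eq_mul]
    exact hc.mul contDiffOn_const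
  | add f g _ _ hf hg =>
    simp only [map_add]
    exact hf.add hg
  | congr f g _ h hf => exact hf.congr fun z hz => by rw [h z hz]

theorem smooth_differentiableAt (hU : IsOpen U) (hz : z ∈ U) {c : EuclideanSpace ℂ (Fin n) → ℂ}
    (hc : ContDiffOn ℝ ∞ c U) : DifferentiableAt ℝ c z :=
  (hc.contDiffAt (hU.mem_nhds hz)).differentiableAt (by simp)

theorem FinSmooth.exists_isWirt (hU : IsOpen U) (hz : z ∈ U) {f : EuclideanSpace ℂ (Fin n) → W}
    (hf : FinSmooth U f) (j : Fin n) : ∃ w, IsWirt f j z w := by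
  induction hf with
  | smul c w hc => exact ⟨_, .smul (smooth_differentiableAt hU hz hc) w⟩
  | add f g _ _ hf hg =>
    obtain ⟨w, hw⟩ := hf
    obtain ⟨w', hw'⟩ := hg
    exact ⟨_, hw.add hw'⟩
  | congr f g _ h hf =>
    obtain ⟨w, hw⟩ := hf
    exact ⟨w, hw.congr (Filter.eventually_of_mem (hU.mem_nhds hz) h)⟩

theorem FinSmooth.isWirt (hU : IsOpen U) (hz : z ∈ U) {f : EuclideanSpace ℂ (Fin n) → W}
    (hf : FinSmooth U f) (j : Fin n) : IsWirt f j z (wirtingerBar f j z) := by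
  obtain ⟨w, hw⟩ := hf.exists_isWirt hU hz j
  rwa [hw.eq]

theorem IsWirt.smul_fun {c : EuclideanSpace ℂ (Fin n) → ℂ} (hc : DifferentiableAt ℝ c z)
    {g : EuclideanSpace ℂ (Fin n) → W} {w : W} (hg : IsWirt g j z w) :
    IsWirt (fun y => c y • g y) j z (wbar c j z • g z + c z • w) := fun φ => by
  simp only [map_smul, map_add, smul_eq_mul]
  exact ⟨hc.mul (hg φ).1, by rw [wbar_mul hc (hg φ).1, (hg φ).2]⟩

theorem IsWirt.map₂ (hU : IsOpen U) (hz : z ∈ U) {f : EuclideanSpace ℂ (Fin n) → W}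
    {g : EuclideanSpace ℂ (Fin n) → W'} (hf : FinSmooth U f) (hg : FinSmooth U g)
    (B : W →ₗ[ℂ] W' →ₗ[ℂ] W'') (j : Fin n) : IsWirt (fun y => B (f y) (g y)) j z
      (B (wirtingerBar f j z) (g z) + B (f z) (wirtingerBar g j z)) := by
  have hg' := hg.isWirt hU hz j
  generalize wirtingerBar g j z = w' at hg'
  -- The derivative of `f` is kept as an unknown vector so that the induction over the finite sums
  -- can build it up; uniqueness identifies it at the end.
  suffices h : ∃ w, IsWirt f j z w ∧
      IsWirt (fun y => B (f y) (g y)) j z (B w (g z) + B (f z) w') by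
    obtain ⟨w, hw, h⟩ := h
    rwa [hw.eq]
  induction hf with
  | smul c v hc =>
    have hcd := smooth_differentiableAt hU hz hc
    refine ⟨_, .smul hcd v, ?_⟩
    have := (hg'.map (B v)).smul_fun hcd
    simpa only [map_smul, LinearMap.smul_apply] using this
  | add f₁ f₂ _ _ h₁ h₂ =>
    obtain ⟨w₁, hw₁, h₁⟩ := h₁
    obtain ⟨w₂, hw₂, h₂⟩ := h₂
    refine ⟨_, hw₁.add hw₂, ?_⟩
    have := h₁.add h₂
    simp only [map_add, LinearMap.add_apply]
    rwa [add_add_add_comm]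
  | congr f f' _ h hf =>
    obtain ⟨w, hw, hB⟩ := hf
    refine ⟨w, hw.congr (Filter.eventually_of_mem (hU.mem_nhds hz) h), ?_⟩
    rw [h z hz]
    exact hB.congr (Filter.eventually_of_mem (hU.mem_nhds hz) fun y hy => by simp only [h y hy])

theorem wbar_smooth (hU : IsOpen U) {c : EuclideanSpace ℂ (Fin n) → ℂ} (hc : ContDiffOn ℝ ∞ c U)
    (j : Fin n) : ContDiffOn ℝ ∞ (wbar c j) U := by
  have h : ContDiffOn ℝ ∞ (fderiv ℝ c) U := hc.fderiv_of_isOpen hU (by simp)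
  exact contDiffOn_const.mul
    ((h.clm_apply contDiffOn_const).add (contDiffOn_const.mul (h.clm_apply contDiffOn_const)))

theorem FinSmooth.wirtingerBar (hU : IsOpen U) {f : EuclideanSpace ℂ (Fin n) → W}
    (hf : FinSmooth U f) (j : Fin n) : FinSmooth U (wirtingerBar f j) := by
  induction hf with
  | smul c w hc =>
    exact (FinSpan.smul _ w (wbar_smooth hU hc j)).congr _ _ fun z hz =>
      (IsWirt.smul (smooth_differentiableAt hU hz hc) w).eq
  | add f g hf hg hf' hg' =>
    exact (hf'.add _ _ hg').congr _ _ fun z hz =>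
      ((FinSmooth.isWirt hU hz hf j).add (FinSmooth.isWirt hU hz hg j)).eq
  | congr f g hf h hf' =>
    exact hf'.congr _ _ fun z hz =>
      ((FinSmooth.isWirt hU hz hf j).congr (Filter.eventually_of_mem (hU.mem_nhds hz) h)).eq

/-- Both sides expand into the four real second derivatives along the coordinate vectors and their
multiples by `I`, and the real second derivative is symmetric. -/
theorem wbar_comm (hU : IsOpen U) (hz : z ∈ U) {c : EuclideanSpace ℂ (Fin n) → ℂ}
    (hc : ContDiffOn ℝ ∞ c U) (j k : Fin n) : wbar (wbar c j) k z = wbar (wbar c k) j z := by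
  have hc2 : ContDiffAt ℝ ∞ c z := hc.contDiffAt (hU.mem_nhds hz)
  have hsymm : IsSymmSndFDerivAt ℝ c z := hc2.isSymmSndFDerivAt (by
    simp only [minSmoothness_of_isRCLikeNormedField]
    exact WithTop.coe_le_coe.2 (le_top (a := (2 : ℕ∞))))
  have hd : DifferentiableAt ℝ (fderiv ℝ c) z :=
    ((hc.fderiv_of_isOpen hU (m := ∞) (by simp)).contDiffAt (hU.mem_nhds hz)).differentiableAt
      (by simp)
  have key : ∀ (l : Fin n) (v : EuclideanSpace ℂ (Fin n)), fderiv ℝ (wbar c l) z v =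
      (1 / 2 : ℂ) * (fderiv ℝ (fderiv ℝ c) z v (EuclideanSpace.single l 1) +
        Complex.I * fderiv ℝ (fderiv ℝ c) z v (EuclideanSpace.single l Complex.I)) := by
    intro l v
    have h1 : ∀ u : EuclideanSpace ℂ (Fin n), HasFDerivAt (fun y => fderiv ℝ c y u)
        ((ContinuousLinearMap.apply ℝ ℂ u).comp (fderiv ℝ (fderiv ℝ c) z)) z := fun u =>
      (ContinuousLinearMap.apply ℝ ℂ u).hasFDerivAt.comp z hd.hasFDerivAt
    have := ((h1 (EuclideanSpace.single l 1)).add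
      ((h1 (EuclideanSpace.single l Complex.I)).const_mul Complex.I)).const_mul (1 / 2 : ℂ)
    rw [show wbar c l = fun y => (1 / 2 : ℂ) * (fderiv ℝ c y (EuclideanSpace.single l 1) +
      Complex.I * fderiv ℝ c y (EuclideanSpace.single l Complex.I)) from rfl]
    exact congrArg (fun D => D v) (HasFDerivAt.fderiv this)
  rw [wbar, wbar, key, key, key, key]
  rw [hsymm (EuclideanSpace.single k 1) (EuclideanSpace.single j 1),
    hsymm (EuclideanSpace.single k 1) (EuclideanSpace.single j Complex.I),
    hsymm (EuclideanSpace.single k Complex.I) (EuclideanSpace.single j 1),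
    hsymm (EuclideanSpace.single k Complex.I) (EuclideanSpace.single j Complex.I)]
  ring

theorem FinSmooth.wirtingerBar_comm (hU : IsOpen U) (hz : z ∈ U)
    {f : EuclideanSpace ℂ (Fin n) → W} (hf : FinSmooth U f) (j k : Fin n) :
    _root_.wirtingerBar (_root_.wirtingerBar f j) k z =
      _root_.wirtingerBar (_root_.wirtingerBar f k) j z := by
  rw [← sub_eq_zero, ← Module.forall_dual_apply_eq_zero_iff ℂ]
  intro φ
  have h : ∀ j k, φ (_root_.wirtingerBar (_root_.wirtingerBar f j) k z) =
      wbar (wbar (fun y => φ (f y)) j) k z := by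
    intro j k
    rw [(FinSmooth.isWirt hU hz (hf.wirtingerBar hU j) k φ).2]
    exact wbar_congr (Filter.eventually_of_mem (hU.mem_nhds hz) fun y hy =>
      (hf.isWirt hU hy j φ).2)
  rw [map_sub, h, h, wbar_comm hU hz (hf.smoothOn φ), sub_self]

theorem FinHolo.wirtingerBar_eq_zero (hU : IsOpen U) (hz : z ∈ U)
    {f : EuclideanSpace ℂ (Fin n) → W} (hf : FinHolo U f) (j : Fin n) :
    wirtingerBar f j z = 0 := by
  refine IsWirt.eq ?_
  induction hf with
  | smul c w hc =>
    have hc' := hc.differentiableAt (hU.mem_nhds hz)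
    have := IsWirt.smul (j := j) (hc'.restrictScalars ℝ) w
    rwa [wbar_of_holomorphic hc', zero_smul] at this
  | add f g _ _ hf hg => simpa using hf.add hg
  | congr f g _ h hf => exact hf.congr (Filter.eventually_of_mem (hU.mem_nhds hz) h)

/-- The derivative of a real differentiable function is the sum of its complex linear part and of
the antilinear part given by the Wirtinger derivatives. -/
theorem wbar_comp {c : EuclideanSpace ℂ (Fin n) → ℂ}
    {χ : EuclideanSpace ℂ (Fin n) → EuclideanSpace ℂ (Fin n)} (hχ : DifferentiableAt ℂ χ z)
    (hc : DifferentiableAt ℝ c (χ z)) (k : Fin n) :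
    wbar (fun y => c (χ y)) k z =
      ∑ j, starRingEnd ℂ (fderiv ℂ χ z (EuclideanSpace.single k 1) j) * wbar c j (χ z) := by
  have hI : ∀ v : EuclideanSpace ℂ (Fin n),
      fderiv ℝ (fun y => c (χ y)) z v = fderiv ℝ c (χ z) (fderiv ℂ χ z v) := by
    intro v
    have := HasFDerivAt.comp z hc.hasFDerivAt (hχ.hasFDerivAt.restrictScalars ℝ)
    rw [show (fun y => c (χ y)) = c ∘ χ from rfl, this.fderiv]
    rfl
  have hsingle : EuclideanSpace.single k Complex.I =
      Complex.I • EuclideanSpace.single k (1 : ℂ) := by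
    ext i; simp
  unfold wbar
  rw [hI, hI, hsingle, map_smul]
  generalize fderiv ℂ χ z (EuclideanSpace.single k 1) = v
  generalize fderiv ℝ c (χ z) = D
  -- `D` is only real linear, so `v` and `I • v` are expanded in the real basis. In the combination
  -- defining `wbar` the part of `D` along `∂/∂z` then cancels.
  have hv : v = ∑ j, ((v j).re • EuclideanSpace.single j (1 : ℂ) +
      (v j).im • EuclideanSpace.single j Complex.I) := by
    ext i
    simp [Pi.single_apply, Finset.sum_add_distrib, Complex.re_add_im]
  have hIv : Complex.I • v = ∑ j, ((v j).re • EuclideanSpace.single j Complex.I -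
      (v j).im • EuclideanSpace.single j (1 : ℂ)) := by
    ext i
    simp [Pi.single_apply, Finset.sum_sub_distrib]
    apply Complex.ext <;> simp
  have hDv : D v = D (∑ j, ((v j).re • EuclideanSpace.single j (1 : ℂ) +
      (v j).im • EuclideanSpace.single j Complex.I)) := congrArg D hv
  rw [hIv, hDv]
  simp only [map_sum, map_add, map_sub, map_smul, Finset.mul_sum, ← Finset.sum_add_distrib]
  refine Finset.sum_congr rfl fun j _ => ?_
  simp only [Complex.real_smul]
  have : starRingEnd ℂ (v j) = (v j).re - (v j).im * Complex.I := by
    apply Complex.ext <;> simp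
  rw [this]
  linear_combination (1 / 2 : ℂ) * (v j).im * (D (EuclideanSpace.single j Complex.I)) * Complex.I_sq

theorem wbar_conj {g : EuclideanSpace ℂ (Fin n) → ℂ} (hg : DifferentiableAt ℂ g z) (k : Fin n) :
    wbar (fun y => starRingEnd ℂ (g y)) k z =
      starRingEnd ℂ (fderiv ℂ g z (EuclideanSpace.single k 1)) := by
  have hI : ∀ v : EuclideanSpace ℂ (Fin n),
      fderiv ℝ (fun y => starRingEnd ℂ (g y)) z v = starRingEnd ℂ (fderiv ℂ g z v) := by
    intro v
    have := HasFDerivAt.comp z Complex.conjCLE.hasFDerivAt (hg.hasFDerivAt.restrictScalars ℝ)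
    rw [show (fun y => starRingEnd ℂ (g y)) = Complex.conjCLE ∘ g from rfl, this.fderiv]
    rfl
  have hsingle : EuclideanSpace.single k Complex.I =
      Complex.I • EuclideanSpace.single k (1 : ℂ) := by
    ext i; simp
  unfold wbar
  rw [hI, hI, hsingle, map_smul, smul_eq_mul, map_mul, Complex.conj_I]
  linear_combination (-1 / 2 : ℂ) * starRingEnd ℂ (fderiv ℂ g z (EuclideanSpace.single k 1)) *
    Complex.I_sq

end Wirtinger

/-! ### The local Cauchy-Riemann operator on functions with values in an algebra. -/

section DbarLocal

variable {n : ℕ} {W W' W'' : Type*} [Ring W] [Algebra ℂ W] [Ring W'] [Algebra ℂ W']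
  [Ring W''] [Algebra ℂ W''] {U : Set (EuclideanSpace ℂ (Fin n))} {z : EuclideanSpace ℂ (Fin n)}
  {ε : Fin n → W} {ε' : Fin n → W'} {ε'' : Fin n → W''}

open Classical in
theorem wirtingerBar_congr {f g : EuclideanSpace ℂ (Fin n) → W} (h : f =ᶠ[nhds z] g)
    (j : Fin n) : wirtingerBar f j z = wirtingerBar g j z := by
  have : (fun φ : W →ₗ[ℂ] ℂ => fderiv ℝ (fun y => φ (f y)) z) =
      fun φ => fderiv ℝ (fun y => φ (g y)) z :=
    funext fun φ => Filter.EventuallyEq.fderiv_eq (h.fun_comp φ)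
  -- The choice in `wirtingerBar` depends on `f` only through the family of derivatives of its
  -- coordinates, so equality holds even where no derivative exists.
  exact congrArg (fun F : (W →ₗ[ℂ] ℂ) → EuclideanSpace ℂ (Fin n) →L[ℝ] ℂ =>
    if h : ∃ w : W, ∀ φ : W →ₗ[ℂ] ℂ, φ w = (1 / 2 : ℂ) * (F φ (EuclideanSpace.single j 1) +
      Complex.I * F φ (EuclideanSpace.single j Complex.I)) then h.choose else 0) this

theorem dbarLocal_congr {f g : EuclideanSpace ℂ (Fin n) → W} (h : f =ᶠ[nhds z] g) :
    dbarLocal ε f z = dbarLocal ε g z :=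
  Finset.sum_congr rfl fun j _ => by rw [wirtingerBar_congr h]

theorem dbarLocal_congr_on (hU : IsOpen U) (hz : z ∈ U) {f g : EuclideanSpace ℂ (Fin n) → W}
    (h : ∀ y ∈ U, f y = g y) : dbarLocal ε f z = dbarLocal ε g z :=
  dbarLocal_congr (Filter.eventually_of_mem (hU.mem_nhds hz) h)

theorem dbarLocal_add (hU : IsOpen U) (hz : z ∈ U) {f g : EuclideanSpace ℂ (Fin n) → W}
    (hf : FinSmooth U f) (hg : FinSmooth U g) :
    dbarLocal ε (fun y => f y + g y) z = dbarLocal ε f z + dbarLocal ε g z := by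
  simp only [dbarLocal, ((hf.isWirt hU hz _).add (hg.isWirt hU hz _)).eq, mul_add,
    Finset.sum_add_distrib]

theorem dbarLocal_map (hU : IsOpen U) (hz : z ∈ U) {f : EuclideanSpace ℂ (Fin n) → W}
    (hf : FinSmooth U f) (T : W →ₗ[ℂ] W') (hT : ∀ j w, T (ε j * w) = ε' j * T w) :
    dbarLocal ε' (fun y => T (f y)) z = T (dbarLocal ε f z) := by
  simp only [dbarLocal, ((hf.isWirt hU hz _).map T).eq, map_sum, hT]

theorem FinSmooth.dbarLocal (hU : IsOpen U) {f : EuclideanSpace ℂ (Fin n) → W}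
    (hf : FinSmooth U f) (ε : Fin n → W) : FinSmooth U (dbarLocal ε f) :=
  FinSpan.sum smooth_one _ fun j _ => (hf.wirtingerBar hU j).map (LinearMap.mulLeft ℂ (ε j))

theorem FinHolo.dbarLocal_eq_zero (hU : IsOpen U) (hz : z ∈ U)
    {f : EuclideanSpace ℂ (Fin n) → W} (hf : FinHolo U f) : dbarLocal ε f z = 0 :=
  Finset.sum_eq_zero fun j _ => by rw [hf.wirtingerBar_eq_zero hU hz, mul_zero]

theorem dbarLocal_smul (hU : IsOpen U) (hz : z ∈ U) {c : EuclideanSpace ℂ (Fin n) → ℂ}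
    (hc : ContDiffOn ℝ ∞ c U) {f : EuclideanSpace ℂ (Fin n) → W} (hf : FinSmooth U f) :
    dbarLocal ε (fun y => c y • f y) z =
      (∑ j, wbar c j z • (ε j * f z)) + c z • dbarLocal ε f z := by
  simp only [dbarLocal,
    ((hf.isWirt hU hz _).smul_fun (smooth_differentiableAt hU hz hc)).eq, mul_add,
    mul_smul_comm, Finset.sum_add_distrib, Finset.smul_sum]

theorem dbarLocal_map₂ (hU : IsOpen U) (hz : z ∈ U) {f : EuclideanSpace ℂ (Fin n) → W}
    {g : EuclideanSpace ℂ (Fin n) → W'} (hf : FinSmooth U f) (hg : FinSmooth U g)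
    (B : W →ₗ[ℂ] W' →ₗ[ℂ] W'') (s : ℤˣ) (hB : ∀ j x y, ε'' j * B x y = B (ε j * x) y)
    (hs : ∀ j y, B (ε j * f z) y = s • B (f z) (ε' j * y)) :
    dbarLocal ε'' (fun y => B (f y) (g y)) z =
      B (dbarLocal ε f z) (g z) + s • B (f z) (dbarLocal ε' g z) := by
  simp only [dbarLocal, (IsWirt.map₂ hU hz hf hg B _).eq, mul_add, Finset.sum_add_distrib, hB,
    map_sum, LinearMap.sum_apply, hs, Finset.smul_sum]

theorem dbarLocal_mul (hU : IsOpen U) (hz : z ∈ U) {f g : EuclideanSpace ℂ (Fin n) → W}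
    (hf : FinSmooth U f) (hg : FinSmooth U g) (s : ℤˣ) (hs : ∀ j, ε j * f z = s • (f z * ε j)) :
    dbarLocal ε (fun y => f y * g y) z =
      dbarLocal ε f z * g z + s • (f z * dbarLocal ε g z) :=
  dbarLocal_map₂ hU hz hf hg (LinearMap.mul ℂ W) s (fun j x y => (mul_assoc _ _ _).symm)
    fun j y => by simp only [LinearMap.mul_apply_apply, hs, smul_mul_assoc, mul_assoc]

theorem sum_sum_antisymm {M : Type*} [AddCommGroup M] [Module ℂ M] (F : Fin n → Fin n → M)
    (h : ∀ j k, F j k = - F k j) : ∑ j, ∑ k, F j k = 0 := by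
  have h1 : ∑ j, ∑ k, F j k = - ∑ j, ∑ k, F j k := by
    conv_lhs => rw [Finset.sum_comm]
    rw [← Finset.sum_neg_distrib]
    refine Finset.sum_congr rfl fun j _ => ?_
    rw [← Finset.sum_neg_distrib]
    exact Finset.sum_congr rfl fun k _ => h k j
  have h2 : (2 : ℂ) • ∑ j, ∑ k, F j k = 0 := by
    rw [two_smul]
    nth_rewrite 1 [h1]
    exact neg_add_cancel _
  exact (smul_eq_zero.1 h2).resolve_left two_ne_zero

/-- The covectors anticommute while mixed derivatives are symmetric, so the double sum is
antisymmetric. -/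
theorem dbarLocal_dbarLocal (hU : IsOpen U) (hz : z ∈ U) {f : EuclideanSpace ℂ (Fin n) → W}
    (hf : FinSmooth U f) (hε : ∀ j k, ε j * ε k = -(ε k * ε j)) :
    dbarLocal ε (dbarLocal ε f) z = 0 := by
  have h : ∀ k, wirtingerBar (dbarLocal ε f) k z =
      ∑ j, ε j * wirtingerBar (wirtingerBar f j) k z := fun k =>
    IsWirt.eq (IsWirt.sum _ fun j _ =>
      ((hf.wirtingerBar hU j).isWirt hU hz k).map (LinearMap.mulLeft ℂ (ε j)))
  rw [dbarLocal]
  simp only [h, Finset.mul_sum]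
  refine sum_sum_antisymm _ fun j k => ?_
  rw [← mul_assoc, ← mul_assoc, hε j k, hf.wirtingerBar_comm hU hz k j, neg_mul]

/-- Modulo `S` the function vanishes on the open set, hence so do its Wirtinger derivatives. -/
theorem dbarLocal_mem (hU : IsOpen U) (hz : z ∈ U) {f : EuclideanSpace ℂ (Fin n) → W}
    (hf : FinSmooth U f) (S S' : Submodule ℂ W) (hS : ∀ y ∈ U, f y ∈ S)
    (hε : ∀ j, ∀ w ∈ S, ε j * w ∈ S') : dbarLocal ε f z ∈ S' := by
  refine sum_mem fun j _ => hε j _ ?_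
  rw [← Submodule.Quotient.mk_eq_zero, ← Submodule.mkQ_apply,
    ← ((hf.isWirt hU hz j).map S.mkQ).eq]
  refine ((IsWirt.smul (W := W ⧸ S) (differentiableAt_const (0 : ℂ)) 0).congr
    (Filter.eventually_of_mem (hU.mem_nhds hz) fun y hy => ?_)).eq.trans (smul_zero _)
  rw [smul_zero]
  exact (Submodule.Quotient.mk_eq_zero S).2 (hS y hy)

/-! ### Invariance under holomorphic changes of coordinates and frames. -/

section CoordChange

variable {U' : Set (EuclideanSpace ℂ (Fin n))}
  {χ : EuclideanSpace ℂ (Fin n) → EuclideanSpace ℂ (Fin n)}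
  {G : EuclideanSpace ℂ (Fin n) → W →ₗ[ℂ] W'}

/-- The function is smooth and is annihilated by the Cauchy-Riemann operator. -/
def DbarClosed (ε : Fin n → W) (U : Set (EuclideanSpace ℂ (Fin n)))
    (f : EuclideanSpace ℂ (Fin n) → W) : Prop :=
  FinSmooth U f ∧ ∀ z ∈ U, dbarLocal ε f z = 0

/-- The complex conjugates of the entries of the Jacobian matrix of `χ`. -/
def conjJacobian (χ : EuclideanSpace ℂ (Fin n) → EuclideanSpace ℂ (Fin n)) (j k : Fin n)
    (z : EuclideanSpace ℂ (Fin n)) : ℂ :=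
  starRingEnd ℂ (fderiv ℂ χ z (EuclideanSpace.single k 1) j)

/-- Recognizing the conjugate Jacobian as the `∂̄`-gradient of the conjugate coordinates of `χ`
supplies both its smoothness and its closedness, namely the symmetry in `wbar_conjJacobian_comm`. -/
theorem conjJacobian_eq (hU' : IsOpen U') (hχ : DifferentiableOn ℂ χ U') (j k : Fin n) {z}
    (hz : z ∈ U') : conjJacobian χ j k z = wbar (fun y => starRingEnd ℂ (χ y j)) k z := by
  have h := hχ.differentiableAt (hU'.mem_nhds hz)
  have h1 : HasFDerivAt (fun y => χ y j) ((EuclideanSpace.proj j : EuclideanSpace ℂ (Fin n) →L[ℂ] ℂ).comp (fderiv ℂ χ z)) z :=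
    (EuclideanSpace.proj j : EuclideanSpace ℂ (Fin n) →L[ℂ] ℂ).hasFDerivAt.comp z h.hasFDerivAt
  rw [wbar_conj h1.differentiableAt, h1.fderiv]
  rfl

theorem contDiffOn_real_of_holomorphic_map (hU' : IsOpen U') (hχ : DifferentiableOn ℂ χ U') :
    ContDiffOn ℝ ∞ χ U' := by
  have h : ContDiffOn ℂ ∞ χ U' := contDiffOn_euclidean.2 fun j =>
    contDiffOn_of_differentiableOn_complex hU'
      ((EuclideanSpace.proj j : EuclideanSpace ℂ (Fin n) →L[ℂ] ℂ).differentiable.comp_differentiableOn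
        hχ)
  exact h.restrict_scalars ℝ

theorem conj_coord_smooth (hU' : IsOpen U') (hχ : DifferentiableOn ℂ χ U') (j : Fin n) :
    ContDiffOn ℝ ∞ (fun y => starRingEnd ℂ (χ y j)) U' := by
  have h := contDiffOn_real_of_holomorphic_map hU' hχ
  have h1 : ContDiffOn ℝ ∞ (fun y => χ y j) U' :=
    ((EuclideanSpace.proj j : EuclideanSpace ℂ (Fin n) →L[ℂ] ℂ).restrictScalars
      ℝ).contDiff.comp_contDiffOn h
  exact Complex.conjCLE.contDiff.comp_contDiffOn h1

theorem conjJacobian_smooth (hU' : IsOpen U') (hχ : DifferentiableOn ℂ χ U') (j k : Fin n) :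
    ContDiffOn ℝ ∞ (conjJacobian χ j k) U' :=
  (wbar_smooth hU' (conj_coord_smooth hU' hχ j) k).congr fun _ hz =>
    conjJacobian_eq hU' hχ j k hz

theorem wbar_conjJacobian_comm (hU' : IsOpen U') (hχ : DifferentiableOn ℂ χ U') (j k l : Fin n) {z}
    (hz : z ∈ U') : wbar (conjJacobian χ j k) l z = wbar (conjJacobian χ j l) k z := by
  have h : ∀ k l, wbar (conjJacobian χ j k) l z =
      wbar (wbar (fun y => starRingEnd ℂ (χ y j)) k) l z := fun k l =>
    wbar_congr (Filter.eventually_of_mem (hU'.mem_nhds hz) fun y hy =>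
      conjJacobian_eq hU' hχ j k hy)
  rw [h, h, wbar_comm hU' hz (conj_coord_smooth hU' hχ j)]

theorem DbarClosed.add (hU : IsOpen U) {f g : EuclideanSpace ℂ (Fin n) → W}
    (hf : DbarClosed ε U f) (hg : DbarClosed ε U g) : DbarClosed ε U fun y => f y + g y :=
  ⟨hf.1.add _ _ hg.1, fun z hz => by
    rw [dbarLocal_add hU hz hf.1 hg.1, hf.2 z hz, hg.2 z hz, add_zero]⟩

theorem DbarClosed.congr (hU : IsOpen U) {f g : EuclideanSpace ℂ (Fin n) → W}
    (hf : DbarClosed ε U f) (h : ∀ z ∈ U, g z = f z) : DbarClosed ε U g :=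
  ⟨hf.1.congr _ _ h, fun z hz => by rw [dbarLocal_congr_on hU hz h, hf.2 z hz]⟩

theorem DbarClosed.const_smul (hU : IsOpen U) {f : EuclideanSpace ℂ (Fin n) → W}
    (hf : DbarClosed ε U f) (a : ℂ) : DbarClosed ε U fun y => a • f y :=
  ⟨hf.1.map (a • LinearMap.id), fun z hz => by
    have := dbarLocal_map (ε' := ε) (ε := ε) hU hz hf.1 (a • LinearMap.id) fun j w => by simp
    simp only [LinearMap.smul_apply, LinearMap.id_apply] at this
    rw [this, hf.2 z hz, smul_zero]⟩

theorem FinHolo.dbarClosed (hU : IsOpen U) {f : EuclideanSpace ℂ (Fin n) → W}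
    (hf : FinHolo U f) : DbarClosed ε U f :=
  ⟨hf.finSmooth hU, fun _ hz => hf.dbarLocal_eq_zero hU hz⟩

/-- Multiplication by the pullback `∑ₖ conj (∂ₖ χ_j) dz̄ₖ` of `dz̄_j` preserves closedness. -/
theorem DbarClosed.covector_mul (hU' : IsOpen U') (hχ : DifferentiableOn ℂ χ U')
    (hε : ∀ j k, ε j * ε k = -(ε k * ε j)) {f : EuclideanSpace ℂ (Fin n) → W}
    (hf : DbarClosed ε U' f) (j : Fin n) :
    DbarClosed ε U' fun z => ∑ k, conjJacobian χ j k z • (ε k * f z) := by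
  have hs : ∀ k, FinSmooth U' fun z => ε k * f z := fun k => hf.1.map (LinearMap.mulLeft ℂ (ε k))
  have hJ := conjJacobian_smooth hU' hχ j
  have hs' : ∀ k, FinSmooth U' fun z => conjJacobian χ j k z • (ε k * f z) := fun k =>
    FinSpan.smul_fun smooth_mul (hJ k) (hs k)
  refine ⟨FinSpan.sum smooth_one _ fun k _ => hs' k, fun z hz => ?_⟩
  have h1 : ∀ l, wirtingerBar (fun z => ∑ k, conjJacobian χ j k z • (ε k * f z)) l z =
      ∑ k, (wbar (conjJacobian χ j k) l z • (ε k * f z) +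
        conjJacobian χ j k z • (ε k * wirtingerBar f l z)) := fun l =>
    IsWirt.eq (IsWirt.sum _ fun k _ =>
      ((hf.1.isWirt hU' hz l).map (LinearMap.mulLeft ℂ (ε k))).smul_fun
        (smooth_differentiableAt hU' hz (hJ k)))
  simp only [dbarLocal, h1, Finset.mul_sum, mul_add, Finset.sum_add_distrib]
  -- The terms differentiating the Jacobian are antisymmetric; in the others the two covectors
  -- anticommute, which brings out the vanishing `∂̄ f`.
  rw [sum_sum_antisymm, zero_add, Finset.sum_comm]
  · refine Finset.sum_eq_zero fun k _ => ?_
    have h0 := hf.2 z hz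
    have : ∀ l, ε l * conjJacobian χ j k z • (ε k * wirtingerBar f l z) =
        -(conjJacobian χ j k z • (ε k * (ε l * wirtingerBar f l z))) := fun l => by
      rw [mul_smul_comm, ← mul_assoc, hε l k, neg_mul, smul_neg, mul_assoc]
    simp only [this, Finset.sum_neg_distrib, ← Finset.smul_sum, ← Finset.mul_sum]
    rw [show ∑ l, ε l * wirtingerBar f l z = 0 from h0, mul_zero, smul_zero, neg_zero]
  · intro l k
    rw [mul_smul_comm, mul_smul_comm, ← mul_assoc, ← mul_assoc, hε l k,
      wbar_conjJacobian_comm hU' hχ j k l hz, neg_mul, smul_neg]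

/-- The Cauchy-Riemann operator is independent of the holomorphic chart and frame. -/
theorem dbarLocal_coordChange (hU : IsOpen U) (hU' : IsOpen U') (hχ : DifferentiableOn ℂ χ U')
    (hm : Set.MapsTo χ U' U)
    (hG : ∀ z ∈ U', ∀ j w, G z (ε j * w) = ∑ k, conjJacobian χ j k z • (ε' k * G z w))
    (hD : ∀ w, DbarClosed ε' U' fun z => G z w)
    {b : EuclideanSpace ℂ (Fin n) → W} (hb : FinSmooth U b) :
    FinSmooth U' (fun z => G z (b (χ z))) ∧
      ∀ z ∈ U', dbarLocal ε' (fun z => G z (b (χ z))) z = G z (dbarLocal ε b (χ z)) := by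
  have hχr := contDiffOn_real_of_holomorphic_map hU' hχ
  induction hb with
  | smul c w hc =>
    have hcχ : ContDiffOn ℝ ∞ (fun z => c (χ z)) U' := hc.comp hχr hm
    have heq : (fun z => G z (c (χ z) • w)) = fun z => c (χ z) • G z w := funext fun z =>
      map_smul _ _ _
    rw [heq]
    refine ⟨FinSpan.smul_fun smooth_mul hcχ (hD w).1, fun z hz => ?_⟩
    have hcd := smooth_differentiableAt hU (hm hz) hc
    -- Transport of a constant vector is `∂̄`-closed, so only `c ∘ χ` is differentiated. The
    -- conjugate Jacobian of the chain rule matches the one in `hG`.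
    rw [dbarLocal_smul hU' hz hcχ (hD w).1, (hD w).2 z hz, smul_zero, add_zero]
    simp only [dbarLocal, (IsWirt.smul hcd w).eq, mul_smul_comm, map_sum, map_smul, hG z hz,
      wbar_comp (hχ.differentiableAt (hU'.mem_nhds hz)) hcd, Finset.sum_smul, Finset.smul_sum,
      smul_smul]
    rw [Finset.sum_comm]
    refine Finset.sum_congr rfl fun j _ => Finset.sum_congr rfl fun k _ => ?_
    rw [mul_comm]
    rfl
  | add f g hf hg hf' hg' =>
    have heq : (fun z => G z (f (χ z) + g (χ z))) = fun z => G z (f (χ z)) + G z (g (χ z)) :=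
      funext fun z => map_add _ _ _
    rw [heq]
    refine ⟨hf'.1.add _ _ hg'.1, fun z hz => ?_⟩
    rw [dbarLocal_add hU' hz hf'.1 hg'.1, dbarLocal_add hU (hm hz) hf hg, hf'.2 z hz, hg'.2 z hz,
      map_add]
  | congr f g hf h hf' =>
    have heq : ∀ z ∈ U', G z (g (χ z)) = G z (f (χ z)) := fun z hz => by rw [h _ (hm hz)]
    refine ⟨hf'.1.congr _ _ heq, fun z hz => ?_⟩
    rw [dbarLocal_congr_on hU' hz heq, hf'.2 z hz, dbarLocal_congr_on hU (hm hz) h]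

end CoordChange

end DbarLocal

/-! ### Finite-dimensionality of the model fibres. -/

section FiniteDimension

theorem finite_exteriorAlgebra (M : Type*) [AddCommGroup M] [Module ℂ M] [Module.Finite ℂ M] :
    Module.Finite ℂ (ExteriorAlgebra ℂ M) :=
  Module.Finite.of_basis (Module.finBasis ℂ M).ExteriorAlgebra

theorem conjDual_eq_sum {n : ℕ} (v : ConjDual (EuclideanSpace ℂ (Fin n))) :
    v = ∑ j, v (EuclideanSpace.single j 1) • dzBar j := by
  ext u
  have hu : u = ∑ j, u j • EuclideanSpace.single j (1 : ℂ) := by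
    ext i
    simp [Pi.single_apply]
  conv_lhs => rw [hu]
  simp only [map_sum, map_smulₛₗ, LinearMap.sum_apply, LinearMap.smul_apply, smul_eq_mul]
  exact Finset.sum_congr rfl fun j _ => mul_comm _ _

theorem finite_conjDual (n : ℕ) : Module.Finite ℂ (ConjDual (EuclideanSpace ℂ (Fin n))) := by
  classical
  refine ⟨⟨Finset.univ.image dzBar, eq_top_iff.2 fun v _ => ?_⟩⟩
  rw [conjDual_eq_sum v]
  exact sum_mem fun j _ => Submodule.smul_mem _ _ (Submodule.subset_span (by simp))

theorem finite_endFib (n : ℕ) (E L : Type*) [AddCommGroup E] [Module ℂ E] [Module.Finite ℂ E]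
    [AddCommGroup L] [Module ℂ L] [Module.Finite ℂ L] :
    Module.Finite ℂ (EndFib (EuclideanSpace ℂ (Fin n)) E L) := by
  have := finite_conjDual n
  have := finite_exteriorAlgebra (ConjDual (EuclideanSpace ℂ (Fin n)))
  have := finite_exteriorAlgebra L
  have : Module.Finite ℂ (ExtFib (EuclideanSpace ℂ (Fin n)) L) :=
    Module.Finite.equiv (GradedTensorProduct.of ℂ _ _)
  infer_instance

/-- The full symmetric algebra is in general infinite-dimensional; smoothness through coordinates is
usable only after fixing the symmetric power, which is generated by products of finitely many
elements. -/
theorem finite_symFibPow (n : ℕ) (L : Type*) [AddCommGroup L] [Module ℂ L] [Module.Finite ℂ L]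
    (k : ℕ) : Module.Finite ℂ (symFibPow (EuclideanSpace ℂ (Fin n)) L k) := by
  have := finite_conjDual n
  have := finite_exteriorAlgebra (ConjDual (EuclideanSpace ℂ (Fin n)))
  have h : (symGr L k).FG := Submodule.FG.pow (Submodule.FG.of_finite (N := LinearMap.range _)) k
  have h2 : (Submodule.map₂ (TensorProduct.mk ℂ (ExteriorAlgebra ℂ
      (ConjDual (EuclideanSpace ℂ (Fin n)))) (SymmetricAlgebra ℂ L)) ⊤ (symGr L k)).FG :=
    Submodule.FG.map₂ _ Module.Finite.fg_top h
  have e : symFibPow (EuclideanSpace ℂ (Fin n)) L k = Submodule.map₂ (TensorProduct.mk ℂ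
      (ExteriorAlgebra ℂ (ConjDual (EuclideanSpace ℂ (Fin n)))) (SymmetricAlgebra ℂ L)) ⊤
      (symGr L k) := by
    refine le_antisymm (Submodule.span_le.2 ?_) (Submodule.map₂_le.2 fun η _ s hs =>
      Submodule.subset_span ⟨η, s, hs, rfl⟩)
    rintro _ ⟨η, s, hs, rfl⟩
    exact Submodule.apply_mem_map₂ _ trivial hs
  rw [e]
  exact Module.Finite.iff_fg.2 h2

/-- An independent family of subspaces of a finite-dimensional space has finitely many nonzero
members. The second condition is shifted by one, since degree `m` of the target, and of a letter's
form part, means type `(0, m - 1)`. -/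
theorem exists_finset_endFibGr (n : ℕ) (E L : Type*) [AddCommGroup E] [Module ℂ E]
    [Module.Finite ℂ E] [AddCommGroup L] [Module ℂ L] [Module.Finite ℂ L] :
    ∃ s : Finset ℤ, (∀ m ∉ s, endFibGr (EuclideanSpace ℂ (Fin n)) E L m = ⊥) ∧
      ∀ p : ℕ, (p : ℤ) + 1 ∉ s → extGr (ConjDual (EuclideanSpace ℂ (Fin n))) p = ⊥ := by
  classical
  have := finite_endFib n E L
  have := finite_conjDual n
  have := finite_exteriorAlgebra (ConjDual (EuclideanSpace ℂ (Fin n)))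
  have h1 := WellFoundedGT.finite_ne_bot_of_iSupIndep
    (endFibGr_isInternal (EuclideanSpace ℂ (Fin n)) E L).submodule_iSupIndep
  have h2 := WellFoundedGT.finite_ne_bot_of_iSupIndep
    (DirectSum.Decomposition.isInternal
      (extGr (ConjDual (EuclideanSpace ℂ (Fin n))))).submodule_iSupIndep
  refine ⟨h1.toFinset ∪ h2.toFinset.image (fun p : ℕ => (p : ℤ) + 1), fun m hm => ?_, fun p hp => ?_⟩
  · by_contra h
    exact hm (Finset.mem_union_left _ (h1.mem_toFinset.2 h))
  · by_contra h
    exact hp (Finset.mem_union_right _ (Finset.mem_image.2 ⟨p, h2.mem_toFinset.2 h, rfl⟩))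

end FiniteDimension

/-! ### Transition maps, changes of frame and the tangent bundle. -/

section Charts

variable {n : ℕ} {X : Type*} [TopologicalSpace X] [ChartedSpace (EuclideanSpace ℂ (Fin n)) X]

/-- The transition map from the chart at `x₀` to the chart at `x₁`. -/
def transMap (n : ℕ) {X : Type*} [TopologicalSpace X] [ChartedSpace (EuclideanSpace ℂ (Fin n)) X]
    (x₀ x₁ : X) (z : EuclideanSpace ℂ (Fin n)) : EuclideanSpace ℂ (Fin n) :=
  chartAt (EuclideanSpace ℂ (Fin n)) x₁ (pt n x₀ z)

/-- The set of coordinates `z` in the chart at `x₀` of points that lie in the chart at `x₁` and in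
the domains of the trivializations of `B` at `x₀` and `x₁`. -/
def transDomain (n : ℕ) {X : Type*} [TopologicalSpace X]
    [ChartedSpace (EuclideanSpace ℂ (Fin n)) X]
    (F : Type*) [NormedAddCommGroup F] [NormedSpace ℂ F]
    (B : X → Type*) [TopologicalSpace (Bundle.TotalSpace F B)] [∀ x, TopologicalSpace (B x)]
    [FiberBundle F B] (x₀ x₁ : X) : Set (EuclideanSpace ℂ (Fin n)) :=
  (chartAt (EuclideanSpace ℂ (Fin n)) x₀).target ∩
    (chartAt (EuclideanSpace ℂ (Fin n)) x₀).symm ⁻¹'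
      ((chartAt (EuclideanSpace ℂ (Fin n)) x₁).source ∩
        ((trivializationAt F B x₀).baseSet ∩ (trivializationAt F B x₁).baseSet))

section

variable (F : Type*) [NormedAddCommGroup F] [NormedSpace ℂ F]
  (B : X → Type*) [TopologicalSpace (Bundle.TotalSpace F B)] [∀ x, TopologicalSpace (B x)]
  [FiberBundle F B] (x₀ x₁ : X)

theorem isOpen_localDomain : IsOpen (localDomain n F B x₀) :=
  (chartAt _ x₀).isOpen_inter_preimage_symm (trivializationAt F B x₀).open_baseSet

theorem isOpen_transDomain : IsOpen (transDomain n F B x₀ x₁) :=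
  (chartAt _ x₀).isOpen_inter_preimage_symm ((chartAt _ x₁).open_source.inter
    ((trivializationAt F B x₀).open_baseSet.inter (trivializationAt F B x₁).open_baseSet))

variable {F B x₀ x₁} {z : EuclideanSpace ℂ (Fin n)}

theorem pt_transMap (hz : z ∈ transDomain n F B x₀ x₁) : pt n x₁ (transMap n x₀ x₁ z) = pt n x₀ z :=
  (chartAt _ x₁).left_inv hz.2.1

theorem transMap_mem (hz : z ∈ transDomain n F B x₀ x₁) :
    transMap n x₀ x₁ z ∈ localDomain n F B x₁ := by
  refine ⟨(chartAt _ x₁).map_source hz.2.1, ?_⟩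
  have h := pt_transMap hz
  rw [Set.mem_preimage]
  rw [pt, pt] at h
  rw [h]
  exact hz.2.2.2

theorem mem_transDomain_self (hz : z ∈ localDomain n F B x₀) :
    z ∈ transDomain n F B x₀ (pt n x₀ z) :=
  ⟨hz.1, mem_chart_source _ _, hz.2, FiberBundle.mem_baseSet_trivializationAt F B _⟩

theorem chart_mem_localDomain (x : X) :
    chartAt (EuclideanSpace ℂ (Fin n)) x x ∈ localDomain n F B x := by
  refine ⟨mem_chart_target _ _, ?_⟩
  rw [Set.mem_preimage, (chartAt _ x).left_inv (mem_chart_source _ x)]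
  exact FiberBundle.mem_baseSet_trivializationAt F B x

theorem pt_chart (x : X) : pt n x (chartAt (EuclideanSpace ℂ (Fin n)) x x) = x :=
  (chartAt _ x).left_inv (mem_chart_source _ x)

end

section Frames

variable (F : Type*) [NormedAddCommGroup F] [NormedSpace ℂ F]
  (B : X → Type*) [∀ x, AddCommGroup (B x)] [∀ x, Module ℂ (B x)]
  [TopologicalSpace (Bundle.TotalSpace F B)] [∀ x, TopologicalSpace (B x)]
  [FiberBundle F B] [VectorBundle ℂ F B]

/-- The change of frame from the trivialization at `x₁` to the one at `x₀`, at the point `p`. -/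
def frameChange (x₀ x₁ p : X) : F ≃ₗ[ℂ] F := (triv F B x₁ p).symm.trans (triv F B x₀ p)

variable {F B}

theorem triv_of_mem {x₀ p : X} (h : p ∈ (trivializationAt F B x₀).baseSet) :
    triv F B x₀ p = (trivializationAt F B x₀).linearEquivAt ℂ p h := dif_pos h

theorem frameChange_eq {x₀ x₁ p : X} (h₀ : p ∈ (trivializationAt F B x₀).baseSet)
    (h₁ : p ∈ (trivializationAt F B x₁).baseSet) (v : F) :
    frameChange F B x₀ x₁ p v =
      (trivializationAt F B x₁).coordChangeL ℂ (trivializationAt F B x₀) p v := by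
  rw [frameChange, triv_of_mem h₀, triv_of_mem h₁, Bundle.Trivialization.coordChangeL_apply _ _ ⟨h₁, h₀⟩]
  rfl

variable [FiniteDimensional ℂ F] [IsManifold 𝓘(ℂ, EuclideanSpace ℂ (Fin n)) ω X]
  [ContMDiffVectorBundle ω F B 𝓘(ℂ, EuclideanSpace ℂ (Fin n))]

/-- The coordinate changes of an analytic bundle, read in a chart, are complex differentiable with
values in a finite-dimensional space of operators, and coordinates there give the finite sum. The
base chart and the two frames are independent, so the inverse change of frame is covered as well. -/
theorem finHolo_frameChange_on (x₀ y₀ y₁ : X) (S : Set X)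
    (h₀ : S ⊆ (trivializationAt F B y₀).baseSet) (h₁ : S ⊆ (trivializationAt F B y₁).baseSet) :
    FinHolo ((chartAt (EuclideanSpace ℂ (Fin n)) x₀).target ∩
      (chartAt (EuclideanSpace ℂ (Fin n)) x₀).symm ⁻¹' S)
      (fun z => (frameChange F B y₀ y₁ (pt n x₀ z)).toLinearMap) := by
  have h := contMDiffOn_coordChangeL (n := ω) (IB := 𝓘(ℂ, EuclideanSpace ℂ (Fin n)))
    (trivializationAt F B y₁) (trivializationAt F B y₀)
  have h2 := h.comp' (contMDiffOn_chart_symm (I := 𝓘(ℂ, EuclideanSpace ℂ (Fin n))) (n := ω)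
    (x := x₀))
  have h3 : DifferentiableOn ℂ (fun z => ((trivializationAt F B y₁).coordChangeL ℂ
      (trivializationAt F B y₀) (pt n x₀ z) : F →L[ℂ] F))
      ((chartAt (EuclideanSpace ℂ (Fin n)) x₀).target ∩
      (chartAt (EuclideanSpace ℂ (Fin n)) x₀).symm ⁻¹' S) := by
    refine (ContDiffOn.differentiableOn (contMDiffOn_iff_contDiffOn.1 h2) (by simp)).mono ?_
    exact fun z hz => ⟨hz.1, h₁ hz.2, h₀ hz.2⟩
  have : Module.Finite ℂ (F →L[ℂ] F) :=
    Module.Finite.equiv (LinearMap.toContinuousLinearMap (𝕜 := ℂ) (E := F) (F' := F))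
  have h4 : FinHolo ((chartAt (EuclideanSpace ℂ (Fin n)) x₀).target ∩
      (chartAt (EuclideanSpace ℂ (Fin n)) x₀).symm ⁻¹' S) (fun z =>
        ((trivializationAt F B y₁).coordChangeL ℂ (trivializationAt F B y₀) (pt n x₀ z) :
          F →L[ℂ] F)) :=
    FinSpan.of_finite holo_one fun φ =>
      (LinearMap.toContinuousLinearMap φ).differentiable.comp_differentiableOn h3
  refine (h4.map (ContinuousLinearMap.coeLM ℂ)).congr _ _ fun z hz => ?_
  ext v
  exact frameChange_eq (h₀ hz.2) (h₁ hz.2) v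

theorem finHolo_frameChange (x₀ x₁ : X) : FinHolo (transDomain n F B x₀ x₁)
      (fun z => (frameChange F B x₀ x₁ (pt n x₀ z)).toLinearMap) :=
  finHolo_frameChange_on x₀ x₀ x₁ _ (fun _ h => h.2.1) (fun _ h => h.2.2)

theorem finHolo_frameChange_symm (x₀ x₁ : X) : FinHolo (transDomain n F B x₀ x₁)
      (fun z => (frameChange F B x₀ x₁ (pt n x₀ z)).symm.toLinearMap) :=
  finHolo_frameChange_on x₀ x₁ x₀ _ (fun _ h => h.2.2) (fun _ h => h.2.1)

end Frames

section Tangent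

variable [IsManifold 𝓘(ℂ, EuclideanSpace ℂ (Fin n)) ω X]

/-- The change of coordinates of tangent vectors from the chart at `x₁` to the one at `x₀`. -/
def tangentChange (x₀ x₁ p : X) : EuclideanSpace ℂ (Fin n) ≃ₗ[ℂ] EuclideanSpace ℂ (Fin n) :=
  (trivT n x₁ p).symm.trans (trivT n x₀ p)

theorem trivT_apply {x₀ p : X} (h : p ∈ (chartAt (EuclideanSpace ℂ (Fin n)) x₀).source)
    (v : TSpace n p) :
    trivT n x₀ p v = tangentCoordChange 𝓘(ℂ, EuclideanSpace ℂ (Fin n)) p x₀ p v := by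
  have h' : p ∈ (trivializationAt (EuclideanSpace ℂ (Fin n))
    (TangentSpace 𝓘(ℂ, EuclideanSpace ℂ (Fin n)) : X → Type _) x₀).baseSet := h
  have h1 : trivT n x₀ p v = (trivializationAt (EuclideanSpace ℂ (Fin n))
    (TangentSpace 𝓘(ℂ, EuclideanSpace ℂ (Fin n)) : X → Type _) x₀).linearEquivAt ℂ p h' v := by
    rw [trivT, triv_of_mem h']
  rw [h1]
  have h2 := congrArg (fun T => T v)
    (TangentBundle.continuousLinearMapAt_trivializationAt_eq_core (𝕜 := ℂ)
      (I := 𝓘(ℂ, EuclideanSpace ℂ (Fin n))) h)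
  refine Eq.trans ?_ h2
  exact (congrFun (Bundle.Trivialization.coe_linearMapAt_of_mem (R := ℂ) _ h') v).symm

/-- The coordinate changes of the tangent bundle are by construction the derivatives of the
transition maps; the cocycle rule removes the chart at the point itself, through which `trivT` is
expressed. -/
theorem tangentChange_symm_apply {x₀ x₁ : X} {z : EuclideanSpace ℂ (Fin n)}
    (hz : z ∈ (chartAt (EuclideanSpace ℂ (Fin n)) x₀).target)
    (hz₁ : pt n x₀ z ∈ (chartAt (EuclideanSpace ℂ (Fin n)) x₁).source)
    (v : EuclideanSpace ℂ (Fin n)) :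
    HasFDerivAt (transMap n x₀ x₁) (fderiv ℂ (transMap n x₀ x₁) z) z ∧
    (tangentChange x₀ x₁ (pt n x₀ z)).symm v = fderiv ℂ (transMap n x₀ x₁) z v := by
  have hz₀ : pt n x₀ z ∈ (chartAt (EuclideanSpace ℂ (Fin n)) x₀).source :=
    (chartAt _ x₀).map_target hz
  have h := hasFDerivWithinAt_tangentCoordChange (I := 𝓘(ℂ, EuclideanSpace ℂ (Fin n)))
    (x := x₀) (y := x₁) (z := pt n x₀ z) (by
      simp only [extChartAt_source]
      exact ⟨hz₀, hz₁⟩)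
  rw [modelWithCornersSelf_coe, Set.range_id, hasFDerivWithinAt_univ] at h
  have hzz : extChartAt 𝓘(ℂ, EuclideanSpace ℂ (Fin n)) x₀ (pt n x₀ z) = z := by
    simp [pt, hz]
  rw [hzz] at h
  have h' : HasFDerivAt (transMap n x₀ x₁)
    (tangentCoordChange 𝓘(ℂ, EuclideanSpace ℂ (Fin n)) x₀ x₁ (pt n x₀ z)) z := h
  refine ⟨h'.differentiableAt.hasFDerivAt, ?_⟩
  rw [h'.fderiv, tangentChange, LinearEquiv.trans_symm, LinearEquiv.symm_symm,
    LinearEquiv.trans_apply]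
  generalize hu : (trivT n x₀ (pt n x₀ z)).symm v = u
  rw [LinearEquiv.symm_apply_eq] at hu
  rw [hu, trivT_apply hz₁, trivT_apply hz₀]
  exact (tangentCoordChange_comp (by
    simp only [extChartAt_source]
    exact ⟨⟨mem_chart_source _ _, hz₀⟩, hz₁⟩)).symm

/-- Covectors are pulled back by the inverse of the tangent change, which is the derivative of the
transition map; antilinearity conjugates its entries. -/
theorem conjDualMap_tangentChange {x₀ x₁ : X} {z : EuclideanSpace ℂ (Fin n)}
    (hz : z ∈ (chartAt (EuclideanSpace ℂ (Fin n)) x₀).target)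
    (hz₁ : pt n x₀ z ∈ (chartAt (EuclideanSpace ℂ (Fin n)) x₁).source) (j : Fin n) :
    conjDualMap (tangentChange x₀ x₁ (pt n x₀ z)) (dzBar j) =
      ∑ k, conjJacobian (transMap n x₀ x₁) j k z • dzBar k := by
  rw [conjDual_eq_sum (conjDualMap _ _)]
  refine Finset.sum_congr rfl fun k _ => ?_
  congr 1
  change starRingEnd ℂ ((tangentChange x₀ x₁ (pt n x₀ z)).symm _ j) = _
  rw [(tangentChange_symm_apply hz hz₁ _).2]
  rfl

end Tangent

end Charts

/-! ### Families of frames and `∂̄`-closed transports. -/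

section FrameFamilies

variable {n : ℕ} {FE FL : Type*} [NormedAddCommGroup FE] [NormedSpace ℂ FE]
  [NormedAddCommGroup FL] [NormedSpace ℂ FL]
  {U : Set (EuclideanSpace ℂ (Fin n))}

theorem finHolo_map_exterior {e : EuclideanSpace ℂ (Fin n) → FL →ₗ[ℂ] FL} (he : FinHolo U e)
    (h : ExteriorAlgebra ℂ FL) : FinHolo U fun z => ExteriorAlgebra.map (e z) h := by
  induction h using ExteriorAlgebra.induction with
  | algebraMap r => exact (FinSpan.const holo_one _).congr _ _ fun z _ => AlgHom.commutes _ r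
  | ι x =>
    refine (he.map (ExteriorAlgebra.ι ℂ ∘ₗ LinearMap.applyₗ x)).congr _ _ fun z _ => ?_
    rw [ExteriorAlgebra.map_apply_ι]
    rfl
  | mul a b ha hb => exact (FinSpan.mul holo_mul ha hb).congr _ _ fun z _ => map_mul _ a b
  | add a b ha hb => exact (ha.add _ _ hb).congr _ _ fun z _ => map_add _ a b

theorem finHolo_map_symmetric {e : EuclideanSpace ℂ (Fin n) → FL ≃ₗ[ℂ] FL}
    (he : FinHolo U fun z => (e z).toLinearMap) (s : SymmetricAlgebra ℂ FL) :
    FinHolo U fun z => symMap (e z) s := by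
  induction s using SymmetricAlgebra.induction with
  | algebraMap r => exact (FinSpan.const holo_one _).congr _ _ fun z _ => AlgHom.commutes _ r
  | ι x =>
    refine (he.map (SymmetricAlgebra.ι ℂ FL ∘ₗ LinearMap.applyₗ x)).congr _ _ fun z _ => ?_
    rw [symMap_ι]
    rfl
  | mul a b ha hb => exact (FinSpan.mul holo_mul ha hb).congr _ _ fun z _ => map_mul _ a b
  | add a b ha hb => exact (ha.add _ _ hb).congr _ _ fun z _ => map_add _ a b

theorem finHolo_conj {e : EuclideanSpace ℂ (Fin n) → FE ≃ₗ[ℂ] FE}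
    (he : FinHolo U fun z => (e z).toLinearMap) (he' : FinHolo U fun z => (e z).symm.toLinearMap)
    (φ : Module.End ℂ FE) : FinHolo U fun z => (e z).conj φ := by
  have h1 : FinHolo U fun z => ((e z).toLinearMap : Module.End ℂ FE) * φ :=
    FinSpan.map he (LinearMap.mulRight ℂ φ)
  exact (FinSpan.mul holo_mul h1 (g := fun z => ((e z).symm.toLinearMap : Module.End ℂ FE))
    he').congr _ _ fun z _ => rfl

/-- The covectors `dz̄_j` in the algebra `EndFib`. -/
abbrev endDzBar (n : ℕ) (FE FL : Type*) [NormedAddCommGroup FE] [NormedSpace ℂ FE]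
    [NormedAddCommGroup FL] [NormedSpace ℂ FL] (j : Fin n) :
    EndFib (EuclideanSpace ℂ (Fin n)) FE FL := endCovector FE FL (dzBar j)

/-- The covectors `dz̄_j` in the algebra `SymFib`. -/
abbrev symDzBar (n : ℕ) (FL : Type*) [NormedAddCommGroup FL] [NormedSpace ℂ FL] (j : Fin n) :
    SymFib (EuclideanSpace ℂ (Fin n)) FL := symCovector FL (dzBar j)

variable (n FE FL) in
/-- `endCovector` as a linear map. -/
def endCovectorₗ : ConjDual (EuclideanSpace ℂ (Fin n)) →ₗ[ℂ]
    EndFib (EuclideanSpace ℂ (Fin n)) FE FL where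
  toFun := endCovector FE FL
  map_add' := endCovector_add
  map_smul' := endCovector_smul

variable (n FL) in
/-- `symCovector` as a linear map. -/
def symCovectorₗ : ConjDual (EuclideanSpace ℂ (Fin n)) →ₗ[ℂ]
    SymFib (EuclideanSpace ℂ (Fin n)) FL where
  toFun := symCovector FL
  map_add' := symCovector_add
  map_smul' := symCovector_smul

theorem endCovector_sum (c : Fin n → ℂ) : endCovector FE FL (∑ k, c k • dzBar k) =
    ∑ k, c k • endDzBar n FE FL k := by
  have := map_sum (endCovectorₗ n FE FL) (fun k => c k • dzBar k) Finset.univ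
  simp only [map_smul] at this
  exact this

theorem symCovector_sum (c : Fin n → ℂ) : symCovector FL (∑ k, c k • dzBar k) =
    ∑ k, c k • symDzBar n FL k := by
  have := map_sum (symCovectorₗ n FL) (fun k => c k • dzBar k) Finset.univ
  simp only [map_smul] at this
  exact this

variable {χ : EuclideanSpace ℂ (Fin n) → EuclideanSpace ℂ (Fin n)}
  {eT : EuclideanSpace ℂ (Fin n) → EuclideanSpace ℂ (Fin n) ≃ₗ[ℂ] EuclideanSpace ℂ (Fin n)}
  {eE : EuclideanSpace ℂ (Fin n) → FE ≃ₗ[ℂ] FE} {eL : EuclideanSpace ℂ (Fin n) → FL ≃ₗ[ℂ] FL}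

theorem endFibMap_covector_mul (heT : ∀ z ∈ U, ∀ j, conjDualMap (eT z) (dzBar j) =
      ∑ k, conjJacobian χ j k z • dzBar k) {z : EuclideanSpace ℂ (Fin n)} (hz : z ∈ U) (j : Fin n)
    (w : EndFib (EuclideanSpace ℂ (Fin n)) FE FL) :
    endFibMap (eT z) (eE z) (eL z) (endDzBar n FE FL j * w) =
      ∑ k, conjJacobian χ j k z • (endDzBar n FE FL k * endFibMap (eT z) (eE z) (eL z) w) := by
  rw [endFibMap_mul, endFibMap_covector, heT z hz, endCovector_sum, Finset.sum_mul]
  simp only [smul_mul_assoc]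

theorem symFibMap_covector_mul (heT : ∀ z ∈ U, ∀ j, conjDualMap (eT z) (dzBar j) =
      ∑ k, conjJacobian χ j k z • dzBar k) {z : EuclideanSpace ℂ (Fin n)} (hz : z ∈ U) (j : Fin n)
    (w : SymFib (EuclideanSpace ℂ (Fin n)) FL) :
    symFibMap (eT z) (eL z) (symDzBar n FL j * w) =
      ∑ k, conjJacobian χ j k z • (symDzBar n FL k * symFibMap (eT z) (eL z) w) := by
  rw [symFibMap_mul, symFibMap_covector, heT z hz, symCovector_sum, Finset.sum_mul]
  simp only [smul_mul_assoc]

/-- Any covector is a constant combination of the `dz̄_j`, so this is `DbarClosed.covector_mul`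
extended by linearity. The map `cov` allows both fibre algebras to use it. -/
theorem covector_mul_closed {W : Type*} [Ring W] [Algebra ℂ W]
    {cov : ConjDual (EuclideanSpace ℂ (Fin n)) →ₗ[ℂ] W}
    (hcov : ∀ v w, cov v * cov w = -(cov w * cov v)) (hU : IsOpen U) (hχ : DifferentiableOn ℂ χ U)
    (heT : ∀ z ∈ U, ∀ j, conjDualMap (eT z) (dzBar j) = ∑ k, conjJacobian χ j k z • dzBar k)
    {f : EuclideanSpace ℂ (Fin n) → W} (hf : DbarClosed (fun j => cov (dzBar j)) U f)
    (v : ConjDual (EuclideanSpace ℂ (Fin n))) :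
    DbarClosed (fun j => cov (dzBar j)) U fun z => cov (conjDualMap (eT z) v) * f z := by
  have h := fun j => DbarClosed.covector_mul hU hχ (fun j k => hcov (dzBar j) (dzBar k)) hf j
  have h2 : ∀ s : Finset (Fin n), DbarClosed (fun j => cov (dzBar j)) U fun z =>
      ∑ j ∈ s, v (EuclideanSpace.single j 1) •
        ∑ k, conjJacobian χ j k z • (cov (dzBar k) * f z) := by
    intro s
    classical
    induction s using Finset.induction_on with
    | empty =>
      simp only [Finset.sum_empty]
      exact FinHolo.dbarClosed hU (FinSpan.zero holo_one)
    | insert a s ha ih =>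
      simp only [Finset.sum_insert ha]
      exact ((h a).const_smul hU _).add hU ih
  refine (h2 Finset.univ).congr hU fun z hz => ?_
  conv_lhs => rw [conjDual_eq_sum v]
  simp only [map_sum, map_smul, heT z hz, Finset.sum_mul, smul_mul_assoc]

/-- Induction on the form degree: without covectors the transport involves only the frames of `End
E` and `⋀ L`, which vary holomorphically, and each covector factor preserves closedness. -/
theorem endFibMap_closed (hU : IsOpen U) (hχ : DifferentiableOn ℂ χ U)
    (heT : ∀ z ∈ U, ∀ j, conjDualMap (eT z) (dzBar j) = ∑ k, conjJacobian χ j k z • dzBar k)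
    (heE : FinHolo U fun z => (eE z).toLinearMap) (heE' : FinHolo U fun z => (eE z).symm.toLinearMap)
    (heL : FinHolo U fun z => (eL z).toLinearMap) (w : EndFib (EuclideanSpace ℂ (Fin n)) FE FL) :
    DbarClosed (endDzBar n FE FL) U fun z => endFibMap (eT z) (eE z) (eL z) w := by
  refine endFib_induction (C := fun w => DbarClosed (endDzBar n FE FL) U fun z =>
    endFibMap (eT z) (eE z) (eL z) w) ?_ ?_ w
  · intro p q φ η h hη hh
    refine extGr_induction (C := fun p η => DbarClosed (endDzBar n FE FL) U fun z =>
      endFibMap (eT z) (eE z) (eL z) (formTensor η (φ ⊗ₜ h))) ?_ ?_ ?_ hη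
    · intro c
      refine FinHolo.dbarClosed hU ?_
      have h1 := FinSpan.map₂ holo_mul (finHolo_conj heE heE' φ) (finHolo_map_exterior heL h)
        ((TensorProduct.mk ℂ _ _).compr₂ (formTensor (T := EuclideanSpace ℂ (Fin n))
          (algebraMap ℂ _ c)))
      refine h1.congr _ _ fun z _ => ?_
      rw [endFibMap_formTensor, AlgHom.commutes]
      rfl
    · intro p x y hx hy
      refine (hx.add hU hy).congr hU fun z _ => ?_
      rw [formTensor_add_left, map_add]
    · intro v p x hx hc
      refine (covector_mul_closed (cov := endCovectorₗ n FE FL) endCovector_anticomm hU hχ heT hc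
        v).congr hU fun z _ => ?_
      rw [← endCovector_mul_formTensor v x φ h hx, endFibMap_mul, endFibMap_covector]
      rfl
  · intro a b ha hb
    exact (ha.add hU hb).congr hU fun z _ => map_add _ a b

theorem symFibMap_closed (hU : IsOpen U) (hχ : DifferentiableOn ℂ χ U)
    (heT : ∀ z ∈ U, ∀ j, conjDualMap (eT z) (dzBar j) = ∑ k, conjJacobian χ j k z • dzBar k)
    (heL : FinHolo U fun z => (eL z).toLinearMap) (w : SymFib (EuclideanSpace ℂ (Fin n)) FL) :
    DbarClosed (symDzBar n FL) U fun z => symFibMap (eT z) (eL z) w := by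
  induction w using TensorProduct.induction_on with
  | zero => exact (FinHolo.dbarClosed hU (FinSpan.zero holo_one)).congr hU fun z _ => map_zero _
  | add a b ha hb => exact (ha.add hU hb).congr hU fun z _ => map_add _ a b
  | tmul η s =>
    induction η using CliffordAlgebra.left_induction with
    | algebraMap r =>
      refine FinHolo.dbarClosed hU ?_
      refine ((finHolo_map_symmetric heL s).map (TensorProduct.mk ℂ (ExteriorAlgebra ℂ
        (ConjDual (EuclideanSpace ℂ (Fin n)))) _ (algebraMap ℂ _ r))).congr _ _ fun z _ => ?_
      change symFibMap (eT z) (eL z) (algebraMap ℂ (ExteriorAlgebra ℂ _) r ⊗ₜ s) = _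
      rw [symFibMap_tmul, AlgHom.commutes]
      rfl
    | add x y hx hy =>
      refine (hx.add hU hy).congr hU fun z _ => ?_
      rw [TensorProduct.add_tmul, map_add]
    | ι_mul x v hx =>
      refine (covector_mul_closed (cov := symCovectorₗ n FL) symCovector_anticomm hU hχ heT hx
        v).congr hU fun z _ => ?_
      have h1 : (ExteriorAlgebra.ι ℂ v * x : ExteriorAlgebra ℂ _) ⊗ₜ[ℂ] s =
          symCovector FL v * (x ⊗ₜ[ℂ] s) := by
        rw [symCovector, Algebra.TensorProduct.tmul_mul_tmul, one_mul]
      change symFibMap (eT z) (eL z) ((ExteriorAlgebra.ι ℂ v * x : ExteriorAlgebra ℂ _) ⊗ₜ s) = _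
      rw [h1, symFibMap_mul, symFibMap_covector]
      rfl

end FrameFamilies

set_option linter.unusedSectionVars false

/-! ### The Dolbeault operator in arbitrary charts and frames. -/

section Dolbeault

variable {n : ℕ} {X : Type*} [TopologicalSpace X] [ChartedSpace (EuclideanSpace ℂ (Fin n)) X]
  [IsManifold 𝓘(ℂ, EuclideanSpace ℂ (Fin n)) ω X]
variable (FE : Type*) [NormedAddCommGroup FE] [NormedSpace ℂ FE]
  {E : X → Type*} [∀ x, AddCommGroup (E x)] [∀ x, Module ℂ (E x)]
  [TopologicalSpace (Bundle.TotalSpace FE E)] [∀ x, TopologicalSpace (E x)] [FiberBundle FE E]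
  [VectorBundle ℂ FE E]
variable (FL : Type*) [NormedAddCommGroup FL] [NormedSpace ℂ FL]
  {L : X → Type*} [∀ x, AddCommGroup (L x)] [∀ x, Module ℂ (L x)]
  [TopologicalSpace (Bundle.TotalSpace FL L)] [∀ x, TopologicalSpace (L x)] [FiberBundle FL L]
  [VectorBundle ℂ FL L]

variable (n E L) in
/-- The domain on which local expressions of `EndForms` near `x₀` are considered. -/
abbrev endDomain (x₀ : X) : Set (EuclideanSpace ℂ (Fin n)) :=
  localDomain n FE E x₀ ∩ localDomain n FL L x₀

theorem isOpen_endDomain (x₀ : X) : IsOpen (endDomain n FE E FL L x₀) :=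
  (isOpen_localDomain FE E x₀).inter (isOpen_localDomain FL L x₀)

theorem transMap_differentiableOn {x₀ x₁ : X} :
    DifferentiableOn ℂ (transMap n x₀ x₁) (transDomain n FL L x₀ x₁) := fun _ hz =>
  (tangentChange_symm_apply hz.1 hz.2.1 0).1.differentiableAt.differentiableWithinAt

theorem endLocal_eq (α : ∀ x, EndFib (TSpace n x) (E x) (L x)) {x₀ x₁ : X}
    {z : EuclideanSpace ℂ (Fin n)} (hz : z ∈ transDomain n FL L x₀ x₁) :
    endLocal FE FL L α x₀ z = endFibMap (tangentChange x₀ x₁ (pt n x₀ z))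
      (frameChange FE E x₀ x₁ (pt n x₀ z)) (frameChange FL L x₀ x₁ (pt n x₀ z))
      (endLocal FE FL L α x₁ (transMap n x₀ x₁ z)) := by
  -- The two charts give the same point only up to a propositional equality, and the fibres depend
  -- on the point; generalizing it allows the substitution.
  have h : ∀ q, q = pt n x₀ z → endLocal FE FL L α x₀ z =
      endFibMap (tangentChange x₀ x₁ (pt n x₀ z))
      (frameChange FE E x₀ x₁ (pt n x₀ z)) (frameChange FL L x₀ x₁ (pt n x₀ z))
      (endFibMap (trivT n x₁ q) (triv FE E x₁ q) (triv FL L x₁ q) (α q)) := by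
    rintro q rfl
    rw [endFibMap_trans, tangentChange, frameChange, frameChange, ← LinearEquiv.trans_assoc,
      ← LinearEquiv.trans_assoc, ← LinearEquiv.trans_assoc, LinearEquiv.self_trans_symm,
      LinearEquiv.self_trans_symm, LinearEquiv.self_trans_symm, LinearEquiv.refl_trans,
      LinearEquiv.refl_trans, LinearEquiv.refl_trans]
    rfl
  exact h _ (pt_transMap hz)

theorem symLocal_eq (β : ∀ x, SymFib (TSpace n x) (L x)) {x₀ x₁ : X}
    {z : EuclideanSpace ℂ (Fin n)} (hz : z ∈ transDomain n FL L x₀ x₁) :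
    symLocal FL β x₀ z = symFibMap (tangentChange x₀ x₁ (pt n x₀ z))
      (frameChange FL L x₀ x₁ (pt n x₀ z)) (symLocal FL β x₁ (transMap n x₀ x₁ z)) := by
  have h : ∀ q, q = pt n x₀ z → symLocal FL β x₀ z =
      symFibMap (tangentChange x₀ x₁ (pt n x₀ z)) (frameChange FL L x₀ x₁ (pt n x₀ z))
      (symFibMap (trivT n x₁ q) (triv FL L x₁ q) (β q)) := by
    rintro q rfl
    rw [symFibMap_trans, tangentChange, frameChange, ← LinearEquiv.trans_assoc,
      ← LinearEquiv.trans_assoc, LinearEquiv.self_trans_symm,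
      LinearEquiv.self_trans_symm, LinearEquiv.refl_trans, LinearEquiv.refl_trans]
    rfl
  exact h _ (pt_transMap hz)

variable [FiniteDimensional ℂ FE] [FiniteDimensional ℂ FL]
  [ContMDiffVectorBundle ω FE E 𝓘(ℂ, EuclideanSpace ℂ (Fin n))]
  [ContMDiffVectorBundle ω FL L 𝓘(ℂ, EuclideanSpace ℂ (Fin n))]

theorem conjDualMap_tangentChange_on {x₀ x₁ : X} :
    ∀ z ∈ transDomain n FL L x₀ x₁, ∀ j,
      conjDualMap (tangentChange x₀ x₁ (pt n x₀ z)) (dzBar j) =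
        ∑ k, conjJacobian (transMap n x₀ x₁) j k z • dzBar k := fun _ hz j =>
  conjDualMap_tangentChange hz.1 hz.2.1 j

/-- This is `dbarLocal_coordChange` for the transport between the frames at `x₁` and `x₀`, on the
open set where all charts and frames involved are available. -/
theorem dbarLocal_endLocal {α : ∀ x, EndFib (TSpace n x) (E x) (L x)}
    (hα : ∀ x₀, FinSmooth (endDomain n FE E FL L x₀) (endLocal FE FL L α x₀)) {x₀ x₁ : X}
    {z : EuclideanSpace ℂ (Fin n)} (hzE : z ∈ transDomain n FE E x₀ x₁)
    (hzL : z ∈ transDomain n FL L x₀ x₁) :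
    dbarLocal (endDzBar n FE FL) (endLocal FE FL L α x₀) z =
      endFibMap (tangentChange x₀ x₁ (pt n x₀ z))
        (frameChange FE E x₀ x₁ (pt n x₀ z)) (frameChange FL L x₀ x₁ (pt n x₀ z))
        (dbarLocal (endDzBar n FE FL) (endLocal FE FL L α x₁) (transMap n x₀ x₁ z)) := by
  have hU' : IsOpen (transDomain n FE E x₀ x₁ ∩ transDomain n FL L x₀ x₁) :=
    (isOpen_transDomain FE E x₀ x₁).inter (isOpen_transDomain FL L x₀ x₁)
  have hχ : DifferentiableOn ℂ (transMap n x₀ x₁)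
      (transDomain n FE E x₀ x₁ ∩ transDomain n FL L x₀ x₁) :=
    (transMap_differentiableOn FL).mono Set.inter_subset_right
  have heT : ∀ z ∈ transDomain n FE E x₀ x₁ ∩ transDomain n FL L x₀ x₁, ∀ j,
      conjDualMap (tangentChange x₀ x₁ (pt n x₀ z)) (dzBar j) =
        ∑ k, conjJacobian (transMap n x₀ x₁) j k z • dzBar k := fun z hz =>
    conjDualMap_tangentChange_on FL z hz.2
  have hE : FinHolo (transDomain n FE E x₀ x₁ ∩ transDomain n FL L x₀ x₁)
      (fun z => (frameChange FE E x₀ x₁ (pt n x₀ z)).toLinearMap) :=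
    FinSpan.mono (fun _ h => h.mono Set.inter_subset_left) Set.inter_subset_left
      (finHolo_frameChange x₀ x₁)
  have hE' : FinHolo (transDomain n FE E x₀ x₁ ∩ transDomain n FL L x₀ x₁)
      (fun z => (frameChange FE E x₀ x₁ (pt n x₀ z)).symm.toLinearMap) :=
    FinSpan.mono (fun _ h => h.mono Set.inter_subset_left) Set.inter_subset_left
      (finHolo_frameChange_symm x₀ x₁)
  have hL : FinHolo (transDomain n FE E x₀ x₁ ∩ transDomain n FL L x₀ x₁)
      (fun z => (frameChange FL L x₀ x₁ (pt n x₀ z)).toLinearMap) :=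
    FinSpan.mono (fun _ h => h.mono Set.inter_subset_right) Set.inter_subset_right
      (finHolo_frameChange x₀ x₁)
  have hclosed := endFibMap_closed (eT := fun z => tangentChange x₀ x₁ (pt n x₀ z))
    (eE := fun z => frameChange FE E x₀ x₁ (pt n x₀ z))
    (eL := fun z => frameChange FL L x₀ x₁ (pt n x₀ z)) hU' hχ heT hE hE' hL
  have key := (dbarLocal_coordChange (ε := endDzBar n FE FL) (ε' := endDzBar n FE FL)
    (G := fun z => endFibMap (tangentChange x₀ x₁ (pt n x₀ z))
      (frameChange FE E x₀ x₁ (pt n x₀ z)) (frameChange FL L x₀ x₁ (pt n x₀ z)))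
    (isOpen_endDomain (n := n) FE (E := E) FL (L := L) x₁) hU' hχ
    (fun z hz => ⟨transMap_mem hz.1, transMap_mem hz.2⟩)
    (fun z hz j w => endFibMap_covector_mul (eT := fun z => tangentChange x₀ x₁ (pt n x₀ z))
      (eE := fun z => frameChange FE E x₀ x₁ (pt n x₀ z))
      (eL := fun z => frameChange FL L x₀ x₁ (pt n x₀ z)) heT hz j w) hclosed (hα x₁)).2 z ⟨hzE, hzL⟩
  exact (dbarLocal_congr_on hU' ⟨hzE, hzL⟩ fun y hy => endLocal_eq FE FL α hy.2).trans key

/-- At each point the operator is computed in the chart centred at that very point. Taking that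
point for `x₁` in `dbarLocal_endLocal` shows that any other chart gives the same result, and hence
that the result is smooth. -/
theorem endLocal_dbarEnd {α : ∀ x, EndFib (TSpace n x) (E x) (L x)}
    (hα : ∀ x₀, FinSmooth (endDomain n FE E FL L x₀) (endLocal FE FL L α x₀)) {x₀ : X}
    {z : EuclideanSpace ℂ (Fin n)} (hz : z ∈ endDomain n FE E FL L x₀) :
    endLocal FE FL L (dbarEnd FE FL α) x₀ z =
      dbarLocal (endDzBar n FE FL) (endLocal FE FL L α x₀) z := by
  rw [dbarLocal_endLocal FE FL hα (mem_transDomain_self hz.1) (mem_transDomain_self hz.2),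
    endLocal, dbarEnd, endFibMap_trans]
  rfl

theorem dbarLocal_symLocal {β : ∀ x, SymFib (TSpace n x) (L x)}
    (hβ : ∀ x₀, FinSmooth (localDomain n FL L x₀) (symLocal FL β x₀)) {x₀ x₁ : X}
    {z : EuclideanSpace ℂ (Fin n)} (hz : z ∈ transDomain n FL L x₀ x₁) :
    dbarLocal (symDzBar n FL) (symLocal FL β x₀) z =
      symFibMap (tangentChange x₀ x₁ (pt n x₀ z)) (frameChange FL L x₀ x₁ (pt n x₀ z))
        (dbarLocal (symDzBar n FL) (symLocal FL β x₁) (transMap n x₀ x₁ z)) := by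
  have hU' := isOpen_transDomain (n := n) FL L x₀ x₁
  have hχ : DifferentiableOn ℂ (transMap n x₀ x₁) (transDomain n FL L x₀ x₁) :=
    transMap_differentiableOn FL
  have heT := conjDualMap_tangentChange_on (n := n) FL (L := L) (x₀ := x₀) (x₁ := x₁)
  have hL : FinHolo (transDomain n FL L x₀ x₁)
      (fun z => (frameChange FL L x₀ x₁ (pt n x₀ z)).toLinearMap) := finHolo_frameChange x₀ x₁
  have hclosed := symFibMap_closed (eT := fun z => tangentChange x₀ x₁ (pt n x₀ z))
    (eL := fun z => frameChange FL L x₀ x₁ (pt n x₀ z)) hU' hχ heT hL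
  have key := (dbarLocal_coordChange (ε := symDzBar n FL) (ε' := symDzBar n FL)
    (G := fun z => symFibMap (tangentChange x₀ x₁ (pt n x₀ z))
      (frameChange FL L x₀ x₁ (pt n x₀ z)))
    (isOpen_localDomain (n := n) FL L x₁) hU' hχ (fun z hz => transMap_mem hz)
    (fun z hz j w => symFibMap_covector_mul (eT := fun z => tangentChange x₀ x₁ (pt n x₀ z))
      (eL := fun z => frameChange FL L x₀ x₁ (pt n x₀ z)) heT hz j w) hclosed (hβ x₁)).2 z hz
  exact (dbarLocal_congr_on hU' hz fun y hy => symLocal_eq FL β hy).trans key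

theorem symLocal_dbarSym {β : ∀ x, SymFib (TSpace n x) (L x)}
    (hβ : ∀ x₀, FinSmooth (localDomain n FL L x₀) (symLocal FL β x₀)) {x₀ : X}
    {z : EuclideanSpace ℂ (Fin n)} (hz : z ∈ localDomain n FL L x₀) :
    symLocal FL (dbarSym FL β) x₀ z = dbarLocal (symDzBar n FL) (symLocal FL β x₀) z := by
  rw [dbarLocal_symLocal FL hβ (mem_transDomain_self hz), symLocal, dbarSym, symFibMap_trans]
  rfl

end Dolbeault

/-! ### Covectors, the bracket and elements of square zero. -/

section FibreBracket

variable {T E L : Type*} [AddCommGroup T] [Module ℂ T] [AddCommGroup E] [Module ℂ E]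
  [AddCommGroup L] [Module ℂ L]

theorem fibBracket_tmul (φ ψ : Module.End ℂ E) (c c' : ExtFib T L) :
    fibBracket (φ ⊗ₜ[ℂ] c : EndFib T E L) (ψ ⊗ₜ[ℂ] c') = (φ * ψ - ψ * φ) ⊗ₜ (c * c') := rfl

/-- The endomorphism part of a covector is the identity, so it does not interfere with the
commutator of endomorphisms. -/
theorem covector_mul_fibBracket (v : ConjDual T) (x y : EndFib T E L) :
    endCovector E L v * fibBracket x y = fibBracket (endCovector E L v * x) y := by
  induction x using TensorProduct.induction_on with
  | zero => simp
  | add a b ha hb => simp only [map_add, mul_add, LinearMap.add_apply, ha, hb]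
  | tmul φ c =>
    induction y using TensorProduct.induction_on with
    | zero => simp
    | add a b ha hb => simp only [map_add, mul_add, ha, hb]
    | tmul ψ c' =>
      rw [endCovector, fibBracket_tmul, Algebra.TensorProduct.tmul_mul_tmul,
        Algebra.TensorProduct.tmul_mul_tmul, fibBracket_tmul, one_mul, one_mul, mul_assoc]

theorem fibBracket_mul_covector (v : ConjDual T) (x y : EndFib T E L) :
    fibBracket (x * endCovector E L v) y = fibBracket x (endCovector E L v * y) := by
  induction x using TensorProduct.induction_on with
  | zero => simp
  | add a b ha hb => simp only [map_add, add_mul, LinearMap.add_apply, ha, hb]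
  | tmul φ c =>
    induction y using TensorProduct.induction_on with
    | zero => simp
    | add a b ha hb => simp only [map_add, mul_add, ha, hb]
    | tmul ψ c' =>
      rw [endCovector, Algebra.TensorProduct.tmul_mul_tmul, fibBracket_tmul,
        Algebra.TensorProduct.tmul_mul_tmul, fibBracket_tmul, one_mul, mul_one, mul_assoc]

theorem covector_fibBracket_comm (v : ConjDual T) {m : ℤ} {x : EndFib T E L}
    (hx : x ∈ endFibGr T E L m) (y : EndFib T E L) :
    fibBracket (endCovector E L v * x) y = m.negOnePow • fibBracket x (endCovector E L v * y) := by
  rw [endCovector_mul_comm v hx, ← fibBracket_mul_covector, negOnePow_smul_eq_cast,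
    negOnePow_smul_eq_cast, map_smul, LinearMap.smul_apply]

theorem formTensor_one_mul (a b : Module.End ℂ E ⊗[ℂ] L) :
    (formTensor 1 (toExt a) * formTensor 1 (toExt b) : EndFib T E L) =
      formTensor 1 (toExt a * toExt b) := by
  induction a using TensorProduct.induction_on with
  | zero => simp
  | add x y hx hy => simp only [map_add, add_mul, hx, hy]
  | tmul φ l =>
    induction b using TensorProduct.induction_on with
    | zero => simp
    | add x y hx hy => simp only [map_add, mul_add, hx, hy]
    | tmul ψ l' =>
      rw [toExt, TensorProduct.map_tmul, TensorProduct.map_tmul,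
        formTensor_mul _ _ _ _ _ _ (one_mem_extGr (M := ConjDual T)) (ι_mem_extGr (M := L) l)]
      simp

theorem formTensor_one_toExt_mem (a : Module.End ℂ E ⊗[ℂ] L) :
    (formTensor 1 (toExt a) : EndFib T E L) ∈ endFibGr T E L 1 := by
  induction a using TensorProduct.induction_on with
  | zero => simp
  | add x y hx hy => rw [map_add, map_add]; exact add_mem hx hy
  | tmul φ l =>
    exact formTensor_mem_endFibGr (p := 0) (q := 1) (by simp) _ one_mem_extGr (ι_mem_extGr l)

/-- For odd `t` the bracket of `t` with itself is twice its square, hence zero, and the Jacobi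
identity makes the double bracket its own negative. -/
theorem fibBracket_fibBracket_self {t : EndFib T E L} (ht : t ∈ endFibGr T E L 1) (h : t * t = 0)
    (y : EndFib T E L) : fibBracket t (fibBracket t y) = 0 := by
  refine graded_induction (endFibGr_isInternal T E L) (C := fun y => fibBracket t (fibBracket t y) = 0)
    ?_ ?_ y
  · intro m y hy
    have h1 := fibBracket_jacobi 1 1 m ht ht hy
    have h0 : fibBracket t t = 0 := by
      rw [fibBracket_eq 1 1 ht ht, h, smul_zero, sub_zero]
    rw [h0, map_zero, LinearMap.zero_apply, zero_add, mul_one, Int.negOnePow_one, Units.neg_smul,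
      one_smul] at h1
    have h2 : (2 : ℂ) • fibBracket t (fibBracket t y) = 0 := by
      rw [two_smul]
      nth_rewrite 1 [h1]
      exact neg_add_cancel _
    exact (smul_eq_zero.1 h2).resolve_left two_ne_zero
  · intro a b ha hb
    rw [map_add, map_add, ha, hb, add_zero]

end FibreBracket

/-! ### The operator `∂̄ + [t, -]` in local coordinates. -/

section LocalDGLA

variable {n : ℕ} {FE FL : Type*} [NormedAddCommGroup FE] [NormedSpace ℂ FE]
  [NormedAddCommGroup FL] [NormedSpace ℂ FL]
  {U : Set (EuclideanSpace ℂ (Fin n))} {z : EuclideanSpace ℂ (Fin n)}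
  {f g t : EuclideanSpace ℂ (Fin n) → EndFib (EuclideanSpace ℂ (Fin n)) FE FL}

theorem dbarLocal_fibBracket (hU : IsOpen U) (hz : z ∈ U) (hf : FinSmooth U f) (hg : FinSmooth U g)
    {m : ℤ} (hm : f z ∈ endFibGr (EuclideanSpace ℂ (Fin n)) FE FL m) :
    dbarLocal (endDzBar n FE FL) (fun z => fibBracket (f z) (g z)) z =
      fibBracket (dbarLocal (endDzBar n FE FL) f z) (g z) +
        m.negOnePow • fibBracket (f z) (dbarLocal (endDzBar n FE FL) g z) :=
  dbarLocal_map₂ hU hz hf hg fibBracket m.negOnePow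
    (fun j x y => covector_mul_fibBracket (dzBar j) x y)
    (fun j y => covector_fibBracket_comm (dzBar j) hm y)

variable (n FE FL) in
/-- The operator `∂̄ + [t, -]` on local forms. -/
def twistedDbar (t f : EuclideanSpace ℂ (Fin n) → EndFib (EuclideanSpace ℂ (Fin n)) FE FL)
    (z : EuclideanSpace ℂ (Fin n)) : EndFib (EuclideanSpace ℂ (Fin n)) FE FL :=
  dbarLocal (endDzBar n FE FL) f z + fibBracket (t z) (f z)

theorem FinSmooth.twistedDbar (hU : IsOpen U) (ht : FinSmooth U t) (hf : FinSmooth U f) :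
    FinSmooth U (twistedDbar n FE FL t f) :=
  FinSpan.add _ _ (hf.dbarLocal hU _) (FinSpan.map₂ smooth_mul ht hf fibBracket)

theorem twistedDbar_mem (hU : IsOpen U) (hz : z ∈ U) (hf : FinSmooth U f)
    (htm : ∀ z ∈ U, t z ∈ endFibGr (EuclideanSpace ℂ (Fin n)) FE FL 1) {m : ℤ}
    (hm : ∀ z ∈ U, f z ∈ endFibGr (EuclideanSpace ℂ (Fin n)) FE FL m) :
    twistedDbar n FE FL t f z ∈ endFibGr (EuclideanSpace ℂ (Fin n)) FE FL (m + 1) := by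
  rw [add_comm]
  refine add_mem (dbarLocal_mem hU hz hf _ _ hm fun j w hw =>
    endFibGr_mul_mem 1 m _ (endCovector_mem _) _ hw) (fibBracket_mem 1 m (htm z hz) (hm z hz))

/-- Four terms: `∂̄²` and `[t, [t, -]]` vanish separately, and since `∂̄ t = 0` the Leibniz rule
makes the two mixed terms opposite. -/
theorem twistedDbar_twistedDbar (hU : IsOpen U) (hz : z ∈ U) (ht : FinHolo U t)
    (hf : FinSmooth U f) (htm : ∀ z ∈ U, t z ∈ endFibGr (EuclideanSpace ℂ (Fin n)) FE FL 1)
    (htt : ∀ z ∈ U, t z * t z = 0) :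
    twistedDbar n FE FL t (twistedDbar n FE FL t f) z = 0 := by
  have h1 : FinSmooth U (dbarLocal (endDzBar n FE FL) f) := hf.dbarLocal hU _
  have ht' := ht.finSmooth hU
  have h2 : FinSmooth U fun z => fibBracket (t z) (f z) := FinSpan.map₂ smooth_mul ht' hf fibBracket
  have h3 : dbarLocal (endDzBar n FE FL) (twistedDbar n FE FL t f) z =
      dbarLocal (endDzBar n FE FL) (dbarLocal (endDzBar n FE FL) f) z +
        dbarLocal (endDzBar n FE FL) (fun z => fibBracket (t z) (f z)) z :=
    dbarLocal_add hU hz h1 h2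
  rw [twistedDbar, h3, dbarLocal_dbarLocal hU hz hf fun j k => endCovector_anticomm _ _,
    dbarLocal_fibBracket hU hz ht' hf (htm z hz), ht.dbarLocal_eq_zero hU hz, twistedDbar, map_add,
    fibBracket_fibBracket_self (htm z hz) (htt z hz), map_zero, LinearMap.zero_apply,
    Int.negOnePow_one, Units.neg_smul, one_smul]
  abel

theorem twistedDbar_fibBracket (hU : IsOpen U) (hz : z ∈ U) (hf : FinSmooth U f)
    (hg : FinSmooth U g) (htm : ∀ z ∈ U, t z ∈ endFibGr (EuclideanSpace ℂ (Fin n)) FE FL 1)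
    {i j : ℤ} (hi : f z ∈ endFibGr (EuclideanSpace ℂ (Fin n)) FE FL i)
    (hj : g z ∈ endFibGr (EuclideanSpace ℂ (Fin n)) FE FL j) :
    twistedDbar n FE FL t (fun z => fibBracket (f z) (g z)) z =
      fibBracket (twistedDbar n FE FL t f z) (g z) +
        i.negOnePow • fibBracket (f z) (twistedDbar n FE FL t g z) := by
  simp only [twistedDbar]
  rw [dbarLocal_fibBracket hU hz hf hg hi, fibBracket_jacobi 1 i j (htm z hz) hi hj]
  simp only [map_add, LinearMap.add_apply, smul_add, one_mul]
  abel

theorem twistedDbar_add (hU : IsOpen U) (hz : z ∈ U) (hf : FinSmooth U f) (hg : FinSmooth U g) :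
    twistedDbar n FE FL t (fun z => f z + g z) z =
      twistedDbar n FE FL t f z + twistedDbar n FE FL t g z := by
  simp only [twistedDbar]
  rw [dbarLocal_add hU hz hf hg, map_add]
  abel

theorem dbarLocal_const_smul {W : Type*} [Ring W] [Algebra ℂ W]
    {b : EuclideanSpace ℂ (Fin n) → W} {ε : Fin n → W} (hU : IsOpen U) (hz : z ∈ U)
    (hb : FinSmooth U b) (c : ℂ) :
    dbarLocal ε (fun z => c • b z) z = c • dbarLocal ε b z := by
  have := dbarLocal_map (ε' := ε) (ε := ε) hU hz hb (c • LinearMap.id) fun j w => by simp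
  simpa only [LinearMap.smul_apply, LinearMap.id_apply] using this

theorem twistedDbar_smul (hU : IsOpen U) (hz : z ∈ U) (hf : FinSmooth U f) (c : ℂ) :
    twistedDbar n FE FL t (fun z => c • f z) z = c • twistedDbar n FE FL t f z := by
  simp only [twistedDbar]
  rw [dbarLocal_const_smul hU hz hf, map_smul, smul_add]

end LocalDGLA

set_option linter.unusedSectionVars false

/-! ### Global forms with values in `End E ⊗ ⋀ L`: grading and bracket. -/

section EndForms

variable {n : ℕ} {X : Type*} [TopologicalSpace X] [ChartedSpace (EuclideanSpace ℂ (Fin n)) X]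
  [IsManifold 𝓘(ℂ, EuclideanSpace ℂ (Fin n)) ω X]
variable (FE : Type*) [NormedAddCommGroup FE] [NormedSpace ℂ FE]
  {E : X → Type*} [∀ x, AddCommGroup (E x)] [∀ x, Module ℂ (E x)]
  [TopologicalSpace (Bundle.TotalSpace FE E)] [∀ x, TopologicalSpace (E x)] [FiberBundle FE E]
  [VectorBundle ℂ FE E]
variable (FL : Type*) [NormedAddCommGroup FL] [NormedSpace ℂ FL]
  {L : X → Type*} [∀ x, AddCommGroup (L x)] [∀ x, Module ℂ (L x)]
  [TopologicalSpace (Bundle.TotalSpace FL L)] [∀ x, TopologicalSpace (L x)] [FiberBundle FL L]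
  [VectorBundle ℂ FL L]

/-- The point with the coordinates of `x` in its own chart equals `x` only propositionally; the
predicate carries the dependent fibre along this equality. -/
theorem endLocal_chart_induction {α : ∀ x, EndFib (TSpace n x) (E x) (L x)} {x : X}
    {C : ∀ x, EndFib (TSpace n x) (E x) (L x) → Prop}
    (h : C (pt n x (chartAt (EuclideanSpace ℂ (Fin n)) x x))
      (α (pt n x (chartAt (EuclideanSpace ℂ (Fin n)) x x)))) : C x (α x) := by
  rwa [pt_chart] at h

theorem chart_mem_endDomain (x : X) :
    chartAt (EuclideanSpace ℂ (Fin n)) x x ∈ endDomain n FE E FL L x :=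
  ⟨chart_mem_localDomain x, chart_mem_localDomain x⟩

theorem eq_of_endLocal_eq {α β : ∀ x, EndFib (TSpace n x) (E x) (L x)}
    (h : ∀ x₀, ∀ z ∈ endDomain n FE E FL L x₀, endLocal FE FL L α x₀ z = endLocal FE FL L β x₀ z)
    (x : X) : α x = β x := by
  refine endLocal_chart_induction (n := n) (C := fun x a => a = β x) ?_
  have h1 := h x _ (chart_mem_endDomain FE FL x)
  rw [endLocal, endLocal] at h1
  rw [← endFibMap_symm_apply' (trivT n x (pt n x (chartAt (EuclideanSpace ℂ (Fin n)) x x)))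
    (triv FE E x _) (triv FL L x _) (α _), h1, endFibMap_symm_apply']

theorem mem_of_endLocal_mem {α : ∀ x, EndFib (TSpace n x) (E x) (L x)} {m : ℤ}
    (h : ∀ x₀, ∀ z ∈ endDomain n FE E FL L x₀,
      endLocal FE FL L α x₀ z ∈ endFibGr (EuclideanSpace ℂ (Fin n)) FE FL m)
    (x : X) : α x ∈ endFibGr (TSpace n x) (E x) (L x) m := by
  refine endLocal_chart_induction (n := n)
    (C := fun x a => a ∈ endFibGr (TSpace n x) (E x) (L x) m) ?_
  have h1 := h x _ (chart_mem_endDomain FE FL x)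
  rw [endLocal] at h1
  rw [← endFibMap_symm_apply' (trivT n x (pt n x (chartAt (EuclideanSpace ℂ (Fin n)) x x)))
    (triv FE E x _) (triv FL L x _) (α _)]
  exact endFibMap_mem _ _ _ h1

theorem EndForms.finSmooth [FiniteDimensional ℂ FE] [FiniteDimensional ℂ FL]
    (α : EndForms (n := n) FE E FL L) (x₀ : X) :
    FinSmooth (endDomain n FE E FL L x₀) (endLocal FE FL L α.1 x₀) := by
  have := finite_endFib n FE FL
  exact FinSpan.of_finite smooth_one (α.2 x₀)

/-- A form given by its smooth local expressions. -/
def EndForms.mk (α : ∀ x, EndFib (TSpace n x) (E x) (L x))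
    (h : ∀ x₀, FinSmooth (endDomain n FE E FL L x₀) (endLocal FE FL L α x₀)) :
    EndForms (n := n) FE E FL L := ⟨α, fun x₀ => (h x₀).smoothOn⟩

theorem EndForms.ext {α β : EndForms (n := n) FE E FL L} (h : ∀ x, α.1 x = β.1 x) : α = β :=
  Subtype.ext (funext h)

variable {FE FL} in
/-- The homogeneous parts of `EndForms`. -/
def endFormsGr (m : ℤ) : Submodule ℂ (EndForms (n := n) FE E FL L) where
  carrier := {α | ∀ x, α.1 x ∈ endFibGr (TSpace n x) (E x) (L x) m}
  add_mem' ha hb x := add_mem (ha x) (hb x)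
  zero_mem' _ := zero_mem _
  smul_mem' c _ ha x := Submodule.smul_mem _ c (ha x)

theorem endLocal_gradedProj (α : ∀ x, EndFib (TSpace n x) (E x) (L x)) (m : ℤ) (x₀ : X)
    (z : EuclideanSpace ℂ (Fin n)) :
    endLocal FE FL L (fun x => gradedProj (endFibGr_isInternal (TSpace n x) (E x) (L x)) m (α x)) x₀ z =
      gradedProj (endFibGr_isInternal _ FE FL) m (endLocal FE FL L α x₀ z) :=
  map_gradedProj _ _ _ (fun _ _ h => endFibMap_mem _ _ _ h) m _

theorem endFibGr_eq_bot (x : X) {m : ℤ}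
    (hm : endFibGr (EuclideanSpace ℂ (Fin n)) FE FL m = ⊥) :
    endFibGr (TSpace n x) (E x) (L x) m = ⊥ := by
  refine (Submodule.eq_bot_iff _).2 fun y hy => ?_
  have h := endFibMap_mem (trivT n x x) (triv FE E x x) (triv FL L x x) hy
  rw [hm, Submodule.mem_bot] at h
  rw [← endFibMap_symm_apply' (trivT n x x) (triv FE E x x) (triv FL L x x) y, h, map_zero]

theorem extGr_conjDual_eq_bot (x : X) {p : ℕ}
    (hp : extGr (ConjDual (EuclideanSpace ℂ (Fin n))) p = ⊥) :
    extGr (ConjDual (TSpace n x)) p = ⊥ := by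
  refine (Submodule.eq_bot_iff _).2 fun y hy => ?_
  have h := map_mem_extGr (conjDualMap (trivT n x x)) hy
  rw [hp, Submodule.mem_bot] at h
  have h2 := exteriorMap_comp (conjDualMap (trivT n x x)) (conjDualMap (trivT n x x).symm) y
  rw [h, map_zero] at h2
  have h3 : conjDualMap (trivT n x x).symm ∘ₗ conjDualMap (trivT n x x) = LinearMap.id := by
    ext v u
    exact congrArg v ((trivT n x x).symm_apply_apply u)
  rw [h3, ExteriorAlgebra.map_id] at h2
  exact h2.symm

variable [FiniteDimensional ℂ FE] [FiniteDimensional ℂ FL]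

/-- The homogeneous component of degree `m` of a form. -/
def EndForms.proj (m : ℤ) (α : EndForms (n := n) FE E FL L) : EndForms (n := n) FE E FL L :=
  EndForms.mk FE FL (fun x => gradedProj (endFibGr_isInternal (TSpace n x) (E x) (L x)) m (α.1 x))
    fun x₀ => ((α.finSmooth FE FL x₀).map (gradedProj (endFibGr_isInternal _ FE FL) m)).congr _ _
      fun z _ => endLocal_gradedProj FE FL α.1 m x₀ z

theorem EndForms.sum_proj {s : Finset ℤ}
    (hs : ∀ m ∉ s, endFibGr (EuclideanSpace ℂ (Fin n)) FE FL m = ⊥)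
    (α : EndForms (n := n) FE E FL L) : ∑ m ∈ s, EndForms.proj FE FL m α = α := by
  refine EndForms.ext FE FL fun x => ?_
  have h : ∀ s : Finset ℤ, (∑ m ∈ s, EndForms.proj FE FL m α).1 x =
      ∑ m ∈ s, gradedProj (endFibGr_isInternal (TSpace n x) (E x) (L x)) m (α.1 x) := by
    intro s
    classical
    induction s using Finset.induction_on with
    | empty => rfl
    | insert a s ha ih => rw [Finset.sum_insert ha, Finset.sum_insert ha, ← ih]; rfl
  rw [h, sum_gradedProj _ fun m hm => endFibGr_eq_bot FE (E := E) FL (L := L) x (hs m hm)]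

/-- Fibrewise projections commute with the transport to local frames, so they preserve smoothness;
finitely many degrees suffice because the model fibre is finite-dimensional. -/
theorem endFormsGr_isInternal :
    DirectSum.IsInternal (endFormsGr (n := n) (FE := FE) (E := E) (FL := FL) (L := L)) := by
  obtain ⟨s, hs, -⟩ := exists_finset_endFibGr n FE FL
  refine isInternal_of_proj (EndForms.proj FE FL) ?_ ?_ ?_ ?_ s (EndForms.sum_proj FE FL hs)
  · exact fun m α β => EndForms.ext FE FL fun x => map_add _ _ _
  · exact fun m α x => gradedProj_mem _ m _
  · exact fun m α h => EndForms.ext FE FL fun x => gradedProj_of_mem _ (h x)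
  · exact fun m m' hne α h => EndForms.ext FE FL fun x => gradedProj_of_mem_ne _ hne (h x)

section Bracket

variable {FE FL}

theorem endLocal_fibBracket (α β : ∀ x, EndFib (TSpace n x) (E x) (L x)) (x₀ : X)
    (z : EuclideanSpace ℂ (Fin n)) :
    endLocal FE FL L (fun x => fibBracket (α x) (β x)) x₀ z =
      fibBracket (endLocal FE FL L α x₀ z) (endLocal FE FL L β x₀ z) :=
  endFibMap_fibBracket _ _ _ _ _

variable (FE E FL L) in
/-- The pointwise bracket of forms. -/
def endFormsBracket : EndForms (n := n) FE E FL L →ₗ[ℂ] EndForms (n := n) FE E FL L →ₗ[ℂ]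
    EndForms (n := n) FE E FL L :=
  LinearMap.mk₂ ℂ (fun α β => EndForms.mk FE FL (fun x => fibBracket (α.1 x) (β.1 x)) fun x₀ =>
      (FinSpan.map₂ smooth_mul (α.finSmooth FE FL x₀) (β.finSmooth FE FL x₀) fibBracket).congr _ _
        fun z _ => endLocal_fibBracket α.1 β.1 x₀ z)
    (fun _ _ _ => EndForms.ext FE FL fun _ => LinearMap.map_add₂ _ _ _ _)
    (fun _ _ _ => EndForms.ext FE FL fun _ => LinearMap.map_smul₂ _ _ _ _)
    (fun _ _ _ => EndForms.ext FE FL fun _ => map_add _ _ _)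
    (fun _ _ _ => EndForms.ext FE FL fun _ => map_smul (fibBracket _) _ _)

end Bracket

end EndForms

set_option linter.unusedSectionVars false

/-! ### The differential graded Lie algebra of a Hitchin pair. -/

section HitchinDGLA

variable {n : ℕ} {X : Type*} [TopologicalSpace X] [ChartedSpace (EuclideanSpace ℂ (Fin n)) X]
  [IsManifold 𝓘(ℂ, EuclideanSpace ℂ (Fin n)) ω X]
variable (FE : Type*) [NormedAddCommGroup FE] [NormedSpace ℂ FE] [FiniteDimensional ℂ FE]
  {E : X → Type*} [∀ x, AddCommGroup (E x)] [∀ x, Module ℂ (E x)]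
  [TopologicalSpace (Bundle.TotalSpace FE E)] [∀ x, TopologicalSpace (E x)] [FiberBundle FE E]
  [VectorBundle ℂ FE E] [ContMDiffVectorBundle ω FE E 𝓘(ℂ, EuclideanSpace ℂ (Fin n))]
variable (FL : Type*) [NormedAddCommGroup FL] [NormedSpace ℂ FL] [FiniteDimensional ℂ FL]
  {L : X → Type*} [∀ x, AddCommGroup (L x)] [∀ x, Module ℂ (L x)]
  [TopologicalSpace (Bundle.TotalSpace FL L)] [∀ x, TopologicalSpace (L x)] [FiberBundle FL L]
  [VectorBundle ℂ FL L] [ContMDiffVectorBundle ω FL L 𝓘(ℂ, EuclideanSpace ℂ (Fin n))]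

/-- The section `θ` as a form of type `(0, 0)` with values in `End E ⊗ ⋀ L`. -/
def higgsForm (θ : ∀ x, Module.End ℂ (E x) ⊗[ℂ] L x) (x : X) : EndFib (TSpace n x) (E x) (L x) :=
  formTensor 1 (toExt (θ x))

/-- The local expression of `θ`. -/
def higgsLocal (θ : ∀ x, Module.End ℂ (E x) ⊗[ℂ] L x) (x₀ : X) (z : EuclideanSpace ℂ (Fin n)) :
    Module.End ℂ FE ⊗[ℂ] FL :=
  TensorProduct.map (triv FE E x₀ (pt n x₀ z)).conj.toLinearMap
    (triv FL L x₀ (pt n x₀ z)).toLinearMap (θ (pt n x₀ z))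

variable {θ : ∀ x, Module.End ℂ (E x) ⊗[ℂ] L x}

theorem endLocal_higgsForm (x₀ : X) (z : EuclideanSpace ℂ (Fin n)) :
    endLocal FE FL L (higgsForm θ) x₀ z = formTensor 1 (toExt (higgsLocal FE FL θ x₀ z)) :=
  endFibMap_one_toExt _ _ _ _

variable {FE FL} in
theorem IsHitchinPair.finHolo_higgsLocal (hθ : IsHitchinPair n FE FL θ) (x₀ : X) :
    FinHolo (endDomain n FE E FL L x₀) (higgsLocal FE FL θ x₀) :=
  FinSpan.of_finite holo_one (hθ.holomorphic x₀)

variable {FE FL} in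
theorem IsHitchinPair.finHolo (hθ : IsHitchinPair n FE FL θ) (x₀ : X) :
    FinHolo (endDomain n FE E FL L x₀) (endLocal FE FL L (higgsForm θ) x₀) :=
  ((hθ.finHolo_higgsLocal x₀).map (formTensor 1 ∘ₗ toExt)).congr _ _ fun z _ =>
    endLocal_higgsForm FE FL x₀ z

theorem endLocal_higgsForm_mem (x₀ : X) (z : EuclideanSpace ℂ (Fin n)) :
    endLocal FE FL L (higgsForm θ) x₀ z ∈ endFibGr (EuclideanSpace ℂ (Fin n)) FE FL 1 := by
  rw [endLocal_higgsForm]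
  exact formTensor_one_toExt_mem _

variable {FE FL} in
theorem IsHitchinPair.higgs_mul_self (hθ : IsHitchinPair n FE FL θ) (x₀ : X)
    (z : EuclideanSpace ℂ (Fin n)) :
    endLocal FE FL L (higgsForm θ) x₀ z * endLocal FE FL L (higgsForm θ) x₀ z = 0 := by
  rw [endLocal, ← endFibMap_mul, higgsForm, formTensor_one_mul, hθ.wedge, map_zero, map_zero]

variable (θ) in
/-- The differential `∂̄ + [θ, -]`. -/
def hitchinD (α : ∀ x, EndFib (TSpace n x) (E x) (L x)) (x : X) :
    EndFib (TSpace n x) (E x) (L x) :=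
  dbarEnd FE FL α x + fibBracket (formTensor 1 (toExt (θ x))) (α x)

theorem endLocal_hitchinD (α : EndForms (n := n) FE E FL L) {x₀ : X}
    {z : EuclideanSpace ℂ (Fin n)} (hz : z ∈ endDomain n FE E FL L x₀) :
    endLocal FE FL L (hitchinD FE FL θ α.1) x₀ z =
      twistedDbar n FE FL (endLocal FE FL L (higgsForm θ) x₀) (endLocal FE FL L α.1 x₀) z := by
  have h := endLocal_dbarEnd FE FL (α.finSmooth FE FL) hz
  have h2 := endLocal_fibBracket (FE := FE) (FL := FL) (higgsForm θ) α.1 x₀ z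
  rw [twistedDbar, ← h, ← h2]
  exact map_add _ _ _

variable {FE FL} in
/-- The differential on forms. -/
def hitchinDForm (hθ : IsHitchinPair n FE FL θ) (α : EndForms (n := n) FE E FL L) :
    EndForms (n := n) FE E FL L :=
  EndForms.mk FE FL (hitchinD FE FL θ α.1) fun x₀ =>
    (FinSmooth.twistedDbar (isOpen_endDomain FE FL x₀)
      ((hθ.finHolo x₀).finSmooth (isOpen_endDomain FE FL x₀)) (α.finSmooth FE FL x₀)).congr _ _
      fun _ hz => endLocal_hitchinD FE FL α hz

variable {FE FL} in
theorem endLocal_hitchinDForm (hθ : IsHitchinPair n FE FL θ) (α : EndForms (n := n) FE E FL L)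
    {x₀ : X} {z : EuclideanSpace ℂ (Fin n)} (hz : z ∈ endDomain n FE E FL L x₀) :
    endLocal FE FL L (hitchinDForm hθ α).1 x₀ z =
      twistedDbar n FE FL (endLocal FE FL L (higgsForm θ) x₀) (endLocal FE FL L α.1 x₀) z :=
  endLocal_hitchinD FE FL α hz

theorem endLocal_add (α β : EndForms (n := n) FE E FL L) (x₀ : X) (z : EuclideanSpace ℂ (Fin n)) :
    endLocal FE FL L (α + β).1 x₀ z = endLocal FE FL L α.1 x₀ z + endLocal FE FL L β.1 x₀ z :=
  map_add _ _ _

theorem endLocal_smul (c : ℂ) (α : EndForms (n := n) FE E FL L) (x₀ : X)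
    (z : EuclideanSpace ℂ (Fin n)) :
    endLocal FE FL L (c • α).1 x₀ z = c • endLocal FE FL L α.1 x₀ z :=
  map_smul (endFibMap _ _ _) _ _

section Differential

variable {FE FL} (hθ : IsHitchinPair n FE FL θ)

theorem hitchinDForm_add (α β : EndForms (n := n) FE E FL L) :
    hitchinDForm hθ (α + β) = hitchinDForm hθ α + hitchinDForm hθ β :=
  EndForms.ext FE FL <| eq_of_endLocal_eq FE FL fun x₀ z hz => by
    rw [endLocal_add, endLocal_hitchinDForm hθ _ hz, endLocal_hitchinDForm hθ _ hz,
      endLocal_hitchinDForm hθ _ hz,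
      ← twistedDbar_add (isOpen_endDomain FE FL x₀) hz (α.finSmooth FE FL x₀)
      (β.finSmooth FE FL x₀), ← funext (endLocal_add FE FL α β x₀)]

theorem hitchinDForm_smul (c : ℂ) (α : EndForms (n := n) FE E FL L) :
    hitchinDForm hθ (c • α) = c • hitchinDForm hθ α :=
  EndForms.ext FE FL <| eq_of_endLocal_eq FE FL fun x₀ z hz => by
    rw [endLocal_smul, endLocal_hitchinDForm hθ _ hz, endLocal_hitchinDForm hθ _ hz,
      ← twistedDbar_smul (isOpen_endDomain FE FL x₀) hz (α.finSmooth FE FL x₀),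
      ← funext (endLocal_smul FE FL c α x₀)]

theorem hitchinDForm_mem {m : ℤ} {α : EndForms (n := n) FE E FL L} (hα : α ∈ endFormsGr m) :
    hitchinDForm hθ α ∈ endFormsGr (m + 1) :=
  mem_of_endLocal_mem FE FL fun x₀ z hz => by
    rw [endLocal_hitchinDForm hθ _ hz]
    exact twistedDbar_mem (isOpen_endDomain FE FL x₀) hz (α.finSmooth FE FL x₀)
      (fun z _ => endLocal_higgsForm_mem FE FL x₀ z) fun z _ => endFibMap_mem _ _ _ (hα _)

theorem hitchinDForm_hitchinDForm (α : EndForms (n := n) FE E FL L) :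
    hitchinDForm hθ (hitchinDForm hθ α) = 0 :=
  EndForms.ext FE FL <| eq_of_endLocal_eq FE FL fun x₀ z hz => by
    -- The inner local expression is known only on the domain of the frames; openness of the domain
    -- is what allows replacing it under the outer operator.
    have h : twistedDbar n FE FL (endLocal FE FL L (higgsForm θ) x₀)
        (endLocal FE FL L (hitchinDForm hθ α).1 x₀) z =
        twistedDbar n FE FL (endLocal FE FL L (higgsForm θ) x₀)
          (twistedDbar n FE FL (endLocal FE FL L (higgsForm θ) x₀) (endLocal FE FL L α.1 x₀)) z := by
      rw [twistedDbar, endLocal_hitchinDForm hθ _ hz,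
        dbarLocal_congr_on (isOpen_endDomain FE FL x₀) hz fun y hy => endLocal_hitchinDForm hθ α hy]
      rfl
    rw [endLocal_hitchinDForm hθ _ hz, h,
      twistedDbar_twistedDbar (isOpen_endDomain FE FL x₀) hz (hθ.finHolo x₀)
      (α.finSmooth FE FL x₀) (fun z _ => endLocal_higgsForm_mem FE FL x₀ z)
      (fun z _ => hθ.higgs_mul_self x₀ z)]
    exact (map_zero (endFibMap _ _ _)).symm

theorem endLocal_bracket (α β : EndForms (n := n) FE E FL L) (x₀ : X)
    (z : EuclideanSpace ℂ (Fin n)) : endLocal FE FL L (endFormsBracket FE E FL L α β).1 x₀ z =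
      fibBracket (endLocal FE FL L α.1 x₀ z) (endLocal FE FL L β.1 x₀ z) :=
  endLocal_fibBracket α.1 β.1 x₀ z

theorem hitchinDForm_bracket {i j : ℤ} {α β : EndForms (n := n) FE E FL L}
    (hα : α ∈ endFormsGr i) (hβ : β ∈ endFormsGr j) :
    hitchinDForm hθ (endFormsBracket FE E FL L α β) =
      endFormsBracket FE E FL L (hitchinDForm hθ α) β +
        (((i.negOnePow : ℤˣ) : ℤ) : ℂ) • endFormsBracket FE E FL L α (hitchinDForm hθ β) :=
  EndForms.ext FE FL <| eq_of_endLocal_eq FE FL fun x₀ z hz => by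
    rw [endLocal_add, endLocal_smul, endLocal_bracket, endLocal_bracket,
      endLocal_hitchinDForm hθ _ hz, endLocal_hitchinDForm hθ _ hz, endLocal_hitchinDForm hθ _ hz,
      funext (endLocal_bracket α β x₀), ← negOnePow_smul_eq_cast]
    exact twistedDbar_fibBracket (isOpen_endDomain FE FL x₀) hz (α.finSmooth FE FL x₀)
      (β.finSmooth FE FL x₀) (fun z _ => endLocal_higgsForm_mem (θ := θ) FE FL x₀ z)
      (endFibMap_mem _ _ _ (hα _)) (endFibMap_mem _ _ _ (hβ _))

theorem endFormsBracket_skew {i j : ℤ} {α β : EndForms (n := n) FE E FL L}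
    (hα : α ∈ endFormsGr i) (hβ : β ∈ endFormsGr j) : endFormsBracket FE E FL L α β =
      -((((i * j).negOnePow : ℤˣ) : ℤ) : ℂ) • endFormsBracket FE E FL L β α :=
  EndForms.ext FE FL fun x => by
    refine (fibBracket_skew i j (hα x) (hβ x)).trans ?_
    rw [negOnePow_smul_eq_cast, ← neg_smul]
    rfl

theorem endFormsBracket_jacobi {i j k : ℤ} {α β γ : EndForms (n := n) FE E FL L}
    (hα : α ∈ endFormsGr i) (hβ : β ∈ endFormsGr j) (hγ : γ ∈ endFormsGr k) :
    endFormsBracket FE E FL L α (endFormsBracket FE E FL L β γ) =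
      endFormsBracket FE E FL L (endFormsBracket FE E FL L α β) γ +
      (((i * j).negOnePow : ℤˣ) : ℤ) • endFormsBracket FE E FL L β (endFormsBracket FE E FL L α γ) :=
  EndForms.ext FE FL fun x => by
    rw [← Int.cast_smul_eq_zsmul ℂ]
    refine (fibBracket_jacobi i j k (hα x) (hβ x) (hγ x)).trans ?_
    rw [negOnePow_smul_eq_cast]
    rfl

/-- The differential graded Lie algebra of a Hitchin pair. -/
def hitchinDGLA : DGLA (EndForms (n := n) FE E FL L) where
  gr := endFormsGr
  isInternal := endFormsGr_isInternal FE FL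
  d :=
    { toFun := hitchinDForm hθ
      map_add' := hitchinDForm_add hθ
      map_smul' := hitchinDForm_smul hθ }
  d_mem _ _ hα := hitchinDForm_mem hθ hα
  d_d := hitchinDForm_hitchinDForm hθ
  br := endFormsBracket FE E FL L
  br_mem i j α hα β hβ x := fibBracket_mem i j (hα x) (hβ x)
  skew i j α hα β hβ := by
    rw [negOnePow_smul_eq_cast, ← neg_smul]
    exact endFormsBracket_skew hα hβ
  jacobi i j k α hα β hβ γ hγ := endFormsBracket_jacobi hα hβ hγ
  leibniz i j α hα β hβ := by
    rw [negOnePow_smul_eq_cast]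
    exact hitchinDForm_bracket hθ hα hβ

end Differential

variable {FE FL} in
theorem hitchinDGLA_isHitchinDGLA (hθ : IsHitchinPair n FE FL θ) :
    IsHitchinDGLA FE FL θ (hitchinDGLA hθ) where
  mem_gr _ _ := Iff.rfl
  d_apply _ _ := rfl
  br_apply _ _ _ := rfl

end HitchinDGLA

/-! ### The abelian target. -/

section AbelianTarget

variable {n : ℕ} {X : Type*} [TopologicalSpace X] [ChartedSpace (EuclideanSpace ℂ (Fin n)) X]
  [IsManifold 𝓘(ℂ, EuclideanSpace ℂ (Fin n)) ω X]
variable (FL : Type*) [NormedAddCommGroup FL] [NormedSpace ℂ FL] [FiniteDimensional ℂ FL]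
  {L : X → Type*} [∀ x, AddCommGroup (L x)] [∀ x, Module ℂ (L x)]
  [TopologicalSpace (Bundle.TotalSpace FL L)] [∀ x, TopologicalSpace (L x)] [FiberBundle FL L]
  [VectorBundle ℂ FL L]

theorem symLocal_chart_induction {α : ∀ x, SymFib (TSpace n x) (L x)} {x : X}
    {C : ∀ x, SymFib (TSpace n x) (L x) → Prop}
    (h : C (pt n x (chartAt (EuclideanSpace ℂ (Fin n)) x x))
      (α (pt n x (chartAt (EuclideanSpace ℂ (Fin n)) x x)))) : C x (α x) := by
  rwa [pt_chart] at h

theorem eq_of_symLocal_eq {α β : ∀ x, SymFib (TSpace n x) (L x)}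
    (h : ∀ x₀, ∀ z ∈ localDomain n FL L x₀, symLocal FL α x₀ z = symLocal FL β x₀ z)
    (x : X) : α x = β x := by
  refine symLocal_chart_induction (n := n) (C := fun x a => a = β x) ?_
  have h1 := h x _ (chart_mem_localDomain x)
  rw [symLocal, symLocal] at h1
  rw [← symFibMap_symm_apply' (trivT n x (pt n x (chartAt (EuclideanSpace ℂ (Fin n)) x x)))
    (triv FL L x _) (α _), h1, symFibMap_symm_apply']

theorem mem_gr_of_symLocal_mem {α : ∀ x, SymFib (TSpace n x) (L x)} {m : ℤ}
    (h : ∀ x₀, ∀ z ∈ localDomain n FL L x₀,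
      symLocal FL α x₀ z ∈ symFibGr (EuclideanSpace ℂ (Fin n)) FL m)
    (x : X) : α x ∈ symFibGr (TSpace n x) (L x) m := by
  refine symLocal_chart_induction (n := n) (C := fun x a => a ∈ symFibGr (TSpace n x) (L x) m) ?_
  rw [← symFibMap_symm_apply' (trivT n x (pt n x (chartAt (EuclideanSpace ℂ (Fin n)) x x)))
    (triv FL L x _) (α _)]
  exact symFibMap_mem_gr _ _ (h x _ (chart_mem_localDomain x))

theorem mem_pow_of_symLocal_mem {α : ∀ x, SymFib (TSpace n x) (L x)} {k : ℕ}
    (h : ∀ x₀, ∀ z ∈ localDomain n FL L x₀,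
      symLocal FL α x₀ z ∈ symFibPow (EuclideanSpace ℂ (Fin n)) FL k)
    (x : X) : α x ∈ symFibPow (TSpace n x) (L x) k := by
  refine symLocal_chart_induction (n := n) (C := fun x a => a ∈ symFibPow (TSpace n x) (L x) k) ?_
  rw [← symFibMap_symm_apply' (trivT n x (pt n x (chartAt (EuclideanSpace ℂ (Fin n)) x x)))
    (triv FL L x _) (α _)]
  exact symFibMap_mem_pow _ _ (h x _ (chart_mem_localDomain x))

variable {k : ℕ}

theorem SymForms.ext {α β : SymForms (n := n) FL L k} (h : ∀ x, α.1 x = β.1 x) : α = β :=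
  Subtype.ext (funext h)

theorem symLocal_mem_pow (β : SymForms (n := n) FL L k) (x₀ : X) (z : EuclideanSpace ℂ (Fin n)) :
    symLocal FL β.1 x₀ z ∈ symFibPow (EuclideanSpace ℂ (Fin n)) FL k :=
  symFibMap_mem_pow _ _ (β.2.1 _)

/-- Transport keeps the values in the finite-dimensional space of forms with values in the fixed
symmetric power, where coordinates suffice. -/
theorem SymForms.finSmooth (β : SymForms (n := n) FL L k) (x₀ : X) :
    FinSmooth (localDomain n FL L x₀) (symLocal FL β.1 x₀) := by
  have := finite_symFibPow n FL k
  exact FinSpan.of_finite_submodule (symFibPow _ FL k) smooth_one (β.2.2 x₀)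
    fun z _ => symLocal_mem_pow FL β x₀ z

/-- A form given by its smooth local expressions. -/
def SymForms.mk (β : ∀ x, SymFib (TSpace n x) (L x))
    (hk : ∀ x, β x ∈ symFibPow (TSpace n x) (L x) k)
    (h : ∀ x₀, FinSmooth (localDomain n FL L x₀) (symLocal FL β x₀)) :
    SymForms (n := n) FL L k := ⟨β, hk, fun x₀ => (h x₀).smoothOn⟩

theorem symLocal_gradedProj (β : ∀ x, SymFib (TSpace n x) (L x)) (m : ℤ) (x₀ : X)
    (z : EuclideanSpace ℂ (Fin n)) :
    symLocal FL (fun x => gradedProj (symFibGr_isInternal (TSpace n x) (L x)) m (β x)) x₀ z =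
      gradedProj (symFibGr_isInternal _ FL) m (symLocal FL β x₀ z) :=
  map_gradedProj _ _ _ (fun _ _ h => symFibMap_mem_gr _ _ h) m _

/-- The homogeneous component of type `(0, m)` of a form. -/
def SymForms.proj (m : ℤ) (β : SymForms (n := n) FL L k) : SymForms (n := n) FL L k :=
  SymForms.mk FL (fun x => gradedProj (symFibGr_isInternal (TSpace n x) (L x)) m (β.1 x))
    (fun x => gradedProj_mem_symFibPow m (β.2.1 x))
    fun x₀ => ((β.finSmooth FL x₀).map (gradedProj (symFibGr_isInternal _ FL) m)).congr _ _
      fun z _ => symLocal_gradedProj FL β.1 m x₀ z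

theorem symFibGr_eq_bot (x : X) {m : ℤ}
    (h : ∀ p : ℕ, (p : ℤ) = m → extGr (ConjDual (EuclideanSpace ℂ (Fin n))) p = ⊥) :
    symFibGr (TSpace n x) (L x) m = ⊥ := by
  refine (Submodule.eq_bot_iff _).2 fun y hy => ?_
  have h0 : symFibGr (TSpace n x) (L x) m ≤ ⊥ := by
    refine Submodule.span_le.2 ?_
    rintro _ ⟨p, η, s, hp, hη, rfl⟩
    rw [extGr_conjDual_eq_bot x (h p hp), Submodule.mem_bot] at hη
    rw [hη, TensorProduct.zero_tmul]
    exact zero_mem _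
  exact h0 hy

theorem SymForms.sum_proj {s : Finset ℤ}
    (hs : ∀ p : ℕ, (p : ℤ) + 1 ∉ s → extGr (ConjDual (EuclideanSpace ℂ (Fin n))) p = ⊥)
    (β : SymForms (n := n) FL L k) : ∑ m ∈ s, SymForms.proj FL (m - 1) β = β := by
  refine SymForms.ext FL fun x => ?_
  have h : ∀ s : Finset ℤ, (∑ m ∈ s, SymForms.proj FL (m - 1) β).1 x =
      ∑ m ∈ s, gradedProj (symFibGr_isInternal (TSpace n x) (L x)) (m - 1) (β.1 x) := by
    intro s
    classical
    induction s using Finset.induction_on with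
    | empty => rfl
    | insert a s ha ih => rw [Finset.sum_insert ha, Finset.sum_insert ha, ← ih]; rfl
  -- Reindexing by `m - 1` undoes the shift of the target, so that the finite set bounds the form
  -- degrees.
  rw [h, ← Finset.sum_image (f := fun m => gradedProj (symFibGr_isInternal (TSpace n x) (L x)) m
    (β.1 x)) (fun a _ b _ hab => by simpa using hab)]
  refine sum_gradedProj _ (fun m hm => symFibGr_eq_bot x fun p hp => hs p fun hps => hm ?_) _
  exact Finset.mem_image.2 ⟨_, hps, by rw [hp]; ring⟩

variable {r : ℕ}

/-- The homogeneous parts of the target. -/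
def sumSymFormsGr (r : ℕ) (m : ℤ) : Submodule ℂ (SumSymForms n FL L r) where
  carrier := {β | ∀ k x, (β k).1 x ∈ symFibGr (TSpace n x) (L x) (m - 1)}
  add_mem' ha hb k x := add_mem (ha k x) (hb k x)
  zero_mem' _ _ := zero_mem _
  smul_mem' c _ ha k x := Submodule.smul_mem _ c (ha k x)

theorem sumSymFormsGr_isInternal :
    DirectSum.IsInternal (sumSymFormsGr (n := n) (L := L) FL r) := by
  obtain ⟨s, -, hs⟩ := exists_finset_endFibGr n FL FL
  refine isInternal_of_proj (fun m β k => SymForms.proj FL (m - 1) (β k)) ?_ ?_ ?_ ?_ s ?_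
  · exact fun m α β => funext fun k => SymForms.ext FL fun x => map_add _ _ _
  · exact fun m α k x => gradedProj_mem _ _ _
  · exact fun m α h => funext fun k => SymForms.ext FL fun x => gradedProj_of_mem _ (h k x)
  · exact fun m m' hne α h => funext fun k => SymForms.ext FL fun x =>
      gradedProj_of_mem_ne _ (by omega) (h k x)
  · intro β
    funext k
    rw [Finset.sum_apply]
    exact SymForms.sum_proj FL hs (β k)

variable [ContMDiffVectorBundle ω FL L 𝓘(ℂ, EuclideanSpace ℂ (Fin n))]

theorem dbarLocal_symDzBar_mem_pow (β : SymForms (n := n) FL L k) {x₀ : X}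
    {z : EuclideanSpace ℂ (Fin n)} (hz : z ∈ localDomain n FL L x₀) :
    dbarLocal (symDzBar n FL) (symLocal FL β.1 x₀) z ∈
      symFibPow (EuclideanSpace ℂ (Fin n)) FL k :=
  dbarLocal_mem (isOpen_localDomain FL L x₀) hz (β.finSmooth FL x₀) _ _
    (fun z _ => symLocal_mem_pow FL β x₀ z) fun _ _ hw => symFibMul_mem_pow _ hw

/-- The Dolbeault operator on forms with values in a symmetric power. -/
def dbarSymForm (β : SymForms (n := n) FL L k) : SymForms (n := n) FL L k :=
  SymForms.mk FL (dbarSym FL β.1)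
    (mem_pow_of_symLocal_mem FL fun x₀ z hz => by
      rw [symLocal_dbarSym FL (β.finSmooth FL) hz]
      exact dbarLocal_symDzBar_mem_pow FL β hz)
    fun x₀ => ((β.finSmooth FL x₀).dbarLocal (isOpen_localDomain FL L x₀) (symDzBar n FL)).congr _ _
      fun z hz => symLocal_dbarSym FL (β.finSmooth FL) hz

theorem symLocal_dbarSymForm (β : SymForms (n := n) FL L k) {x₀ : X}
    {z : EuclideanSpace ℂ (Fin n)} (hz : z ∈ localDomain n FL L x₀) :
    symLocal FL (dbarSymForm FL β).1 x₀ z = dbarLocal (symDzBar n FL) (symLocal FL β.1 x₀) z :=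
  symLocal_dbarSym FL (β.finSmooth FL) hz

theorem symLocal_add (α β : SymForms (n := n) FL L k) (x₀ : X) (z : EuclideanSpace ℂ (Fin n)) :
    symLocal FL (α + β).1 x₀ z = symLocal FL α.1 x₀ z + symLocal FL β.1 x₀ z :=
  map_add _ _ _

theorem symLocal_smul (c : ℂ) (α : SymForms (n := n) FL L k) (x₀ : X)
    (z : EuclideanSpace ℂ (Fin n)) : symLocal FL (c • α).1 x₀ z = c • symLocal FL α.1 x₀ z :=
  map_smul (symFibMap _ _) _ _

theorem dbarSymForm_add (α β : SymForms (n := n) FL L k) :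
    dbarSymForm FL (α + β) = dbarSymForm FL α + dbarSymForm FL β :=
  SymForms.ext FL <| eq_of_symLocal_eq FL fun x₀ z hz => by
    rw [symLocal_add, symLocal_dbarSymForm FL _ hz, symLocal_dbarSymForm FL _ hz,
      symLocal_dbarSymForm FL _ hz, funext (symLocal_add FL α β x₀)]
    exact dbarLocal_add (isOpen_localDomain FL L x₀) hz (α.finSmooth FL x₀) (β.finSmooth FL x₀)

theorem dbarSymForm_smul (c : ℂ) (α : SymForms (n := n) FL L k) :
    dbarSymForm FL (c • α) = c • dbarSymForm FL α :=
  SymForms.ext FL <| eq_of_symLocal_eq FL fun x₀ z hz => by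
    rw [symLocal_smul, symLocal_dbarSymForm FL _ hz, symLocal_dbarSymForm FL _ hz,
      funext (symLocal_smul FL c α x₀)]
    exact dbarLocal_const_smul (isOpen_localDomain FL L x₀) hz (α.finSmooth FL x₀) c

theorem dbarSymForm_dbarSymForm (β : SymForms (n := n) FL L k) :
    dbarSymForm FL (dbarSymForm FL β) = 0 :=
  SymForms.ext FL <| eq_of_symLocal_eq FL fun x₀ z hz => by
    rw [symLocal_dbarSymForm FL _ hz, dbarLocal_congr_on (isOpen_localDomain FL L x₀) hz
      fun y hy => symLocal_dbarSymForm FL β hy]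
    refine (dbarLocal_dbarLocal (isOpen_localDomain FL L x₀) hz (β.finSmooth FL x₀)
      fun j k => symCovector_anticomm _ _).trans ?_
    exact (map_zero (symFibMap (trivT n x₀ (pt n x₀ z)) (triv FL L x₀ (pt n x₀ z)))).symm

theorem symCovector_mul_mem {T L : Type*} [AddCommGroup T] [Module ℂ T] [AddCommGroup L]
    [Module ℂ L] (v : ConjDual T) {m : ℤ} {y : SymFib T L} (hy : y ∈ symFibGr T L m) :
    symCovector L v * y ∈ symFibGr T L (m + 1) := by
  refine Submodule.span_induction (p := fun y _ => symCovector L v * y ∈ symFibGr T L (m + 1))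
    ?_ ?_ ?_ ?_ hy
  · rintro _ ⟨p, η, s, rfl, hη, rfl⟩
    rw [symCovector, Algebra.TensorProduct.tmul_mul_tmul, one_mul]
    refine Submodule.subset_span ⟨1 + p, _, _, ?_, extGr_mul_mem (ι_mem_extGr v) hη, rfl⟩
    push_cast
    ring
  · rw [mul_zero]; exact zero_mem _
  · intro x y _ _ h h'; rw [mul_add]; exact add_mem h h'
  · intro c x _ h; rw [mul_smul_comm]; exact Submodule.smul_mem _ _ h

theorem dbarSymForm_mem (β : SymForms (n := n) FL L k) {m : ℤ}
    (hβ : ∀ x, β.1 x ∈ symFibGr (TSpace n x) (L x) m) (x : X) :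
    (dbarSymForm FL β).1 x ∈ symFibGr (TSpace n x) (L x) (m + 1) := by
  refine mem_gr_of_symLocal_mem FL (fun x₀ z hz => ?_) x
  rw [symLocal_dbarSymForm FL _ hz]
  exact dbarLocal_mem (isOpen_localDomain FL L x₀) hz (β.finSmooth FL x₀) _ _
    (fun z _ => symFibMap_mem_gr _ _ (hβ _)) fun j w hw => symCovector_mul_mem _ hw

/-- The Dolbeault operator on the target. -/
def dbarSumSymForms (r : ℕ) : SumSymForms n FL L r →ₗ[ℂ] SumSymForms n FL L r where
  toFun β k := dbarSymForm FL (β k)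
  map_add' α β := funext fun k => dbarSymForm_add FL (α k) (β k)
  map_smul' c α := funext fun k => dbarSymForm_smul FL c (α k)

/-- The abelian differential graded Lie algebra `⨁ A^{0,*}(⨀ᵏ L)[-1]`. -/
def abelianTargetDGLA (r : ℕ) : DGLA (SumSymForms n FL L r) where
  gr := sumSymFormsGr FL r
  isInternal := sumSymFormsGr_isInternal FL
  d := dbarSumSymForms FL r
  d_mem m β hβ k x := by
    rw [show m + 1 - 1 = m - 1 + 1 by ring]
    exact dbarSymForm_mem FL (β k) (hβ k) x
  d_d β := funext fun k => dbarSymForm_dbarSymForm FL (β k)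
  br := 0
  br_mem _ _ _ _ _ _ := zero_mem _
  skew _ _ _ _ _ _ := by simp
  jacobi _ _ _ _ _ _ _ _ _ := by simp
  leibniz _ _ _ _ _ _ := by simp

theorem abelianTargetDGLA_isAbelianTargetDGLA (r : ℕ) :
    IsAbelianTargetDGLA FL r (abelianTargetDGLA (n := n) (L := L) FL r) where
  mem_gr _ _ := Iff.rfl
  d_apply _ _ _ := rfl
  abelian := rfl

end AbelianTarget

set_option linter.unusedSectionVars false

/-! ### Values of convolution powers in a multiplicative filtration. -/

section ConvPowMem

variable {α B : Type*} [Ring B] {d : α → ℤ}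

theorem convPow_mem_pow (P : ℕ → AddSubgroup B) (h1 : (1 : B) ∈ P 0)
    (hmul : ∀ k, ∀ x ∈ P 1, ∀ y ∈ P k, x * y ∈ P (k + 1)) {m : List α → B} (hm : ∀ w, m w ∈ P 1)
    (k : ℕ) (w : List α) : convPow d m k w ∈ P k := by
  induction k generalizing w with
  | zero =>
    rw [convPow]
    split_ifs
    exacts [h1, zero_mem _]
  | succ k ih => exact conv_mem _ fun u v _ _ => hmul k _ (hm u) _ (ih v)

theorem map_shortWord {Z Z' : Type*} [AddCommMonoid Z] [AddCommMonoid Z'] (f : Z →+ Z') (t : Z)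
    (M : α → Z) (w : List α) : f (shortWord t M w) = shortWord (f t) (fun x => f (M x)) w := by
  rcases w with _ | ⟨x, _ | ⟨y, w⟩⟩
  exacts [rfl, rfl, map_zero f]

end ConvPowMem

/-! ### Symmetric powers of `L` and the parts of `θ`. -/

section EndSymPow

variable {T E L : Type*} [AddCommGroup T] [Module ℂ T] [AddCommGroup E] [Module ℂ E]
  [AddCommGroup L] [Module ℂ L]

variable (T E L) in
/-- The forms with values in `End E ⊗ ⨀ᵏ L`. -/
def endSymPow (k : ℕ) : Submodule ℂ (EndSym T E L) :=
  Submodule.span ℂ {y | ∃ (φ : Module.End ℂ E) (η : ExteriorAlgebra ℂ (ConjDual T))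
    (s : SymmetricAlgebra ℂ L), s ∈ symGr L k ∧ y = φ ⊗ₜ (η ⊗ₜ s)}

theorem endSymPow_one_mem : (1 : EndSym T E L) ∈ endSymPow T E L 0 :=
  Submodule.subset_span ⟨1, 1, 1, by simp, rfl⟩

theorem endSymPow_mul_mem (k : ℕ) (x : EndSym T E L) (hx : x ∈ endSymPow T E L 1)
    (y : EndSym T E L) (hy : y ∈ endSymPow T E L k) : x * y ∈ endSymPow T E L (k + 1) := by
  refine Submodule.span_induction₂ (R := ℂ) (p := fun x y _ _ => x * y ∈ endSymPow T E L (k + 1))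
    ?_ ?_ ?_ ?_ ?_ ?_ ?_ hx hy
  · rintro _ _ ⟨φ, η, s, hs, rfl⟩ ⟨φ', η', s', hs', rfl⟩
    rw [Algebra.TensorProduct.tmul_mul_tmul, Algebra.TensorProduct.tmul_mul_tmul]
    refine Submodule.subset_span ⟨_, _, _, ?_, rfl⟩
    rw [add_comm k 1]
    change _ ∈ LinearMap.range (SymmetricAlgebra.ι ℂ L) ^ (1 + k)
    rw [pow_add]
    exact Submodule.mul_mem_mul hs hs'
  · intro y _; rw [zero_mul]; exact zero_mem _
  · intro y _; rw [mul_zero]; exact zero_mem _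
  · intro x y z _ _ _ h h'; rw [add_mul]; exact add_mem h h'
  · intro x y z _ _ _ h h'; rw [mul_add]; exact add_mem h h'
  · intro c x y _ _ h; rw [smul_mul_assoc]; exact Submodule.smul_mem _ _ h
  · intro c x y _ _ h; rw [mul_smul_comm]; exact Submodule.smul_mem _ _ h

theorem linPart_mem_pow (y : EndFib T E L) : linPart y ∈ endSymPow T E L 1 := by
  refine endFib_induction (C := fun y => linPart y ∈ endSymPow T E L 1) ?_ ?_ y
  · intro p q φ η h _ _
    rw [linPart_formTensor]
    refine Submodule.subset_span ⟨_, _, _, ?_, rfl⟩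
    change _ ∈ LinearMap.range (SymmetricAlgebra.ι ℂ L) ^ 1
    rw [pow_one]
    exact LinearMap.mem_range_self _ _
  · intro x y hx hy
    rw [map_add]
    exact add_mem hx hy

theorem endSymTrace_mem_pow {k : ℕ} {y : EndSym T E L} (hy : y ∈ endSymPow T E L k) :
    endSymTrace y ∈ symFibPow T L k := by
  refine Submodule.span_induction (p := fun y _ => endSymTrace y ∈ symFibPow T L k)
    ?_ ?_ ?_ ?_ hy
  · rintro _ ⟨φ, η, s, hs, rfl⟩
    have h : η ⊗ₜ s ∈ symFibPow T L k := Submodule.subset_span ⟨η, s, hs, rfl⟩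
    exact Submodule.smul_mem _ _ h
  · rw [map_zero]; exact zero_mem _
  · intro x y _ _ h h'; rw [map_add]; exact add_mem h h'
  · intro c x _ h; rw [map_smul]; exact Submodule.smul_mem _ _ h

theorem linPart_formTensor_toExt (t : Module.End ℂ E ⊗[ℂ] L) :
    linPart (formTensor (T := T) 1 (toExt t)) = formSym 1 (toSym t) := by
  induction t using TensorProduct.induction_on with
  | zero => simp
  | add x y hx hy => simp only [map_add, hx, hy]
  | tmul φ l =>
    change linPart (formTensor 1 (φ ⊗ₜ ExteriorAlgebra.ι ℂ l)) = _
    rw [linPart_formTensor, ExteriorAlgebra.ι_leftInverse]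
    rfl

theorem constPart_formTensor_toExt (t : Module.End ℂ E ⊗[ℂ] L) :
    constPart (formTensor (T := T) 1 (toExt t)) = 0 := by
  induction t using TensorProduct.induction_on with
  | zero => simp
  | add x y hx hy => simp only [map_add, hx, hy, add_zero]
  | tmul φ l =>
    change constPart (formTensor 1 (φ ⊗ₜ ExteriorAlgebra.ι ℂ l)) = _
    rw [constPart_formTensor, algebraMapInv_of_mem one_ne_zero (ι_mem_extGr l), map_zero,
      TensorProduct.tmul_zero, TensorProduct.tmul_zero]

/-- The section `θ` has degree one, that is, shifted degree zero, and no constant part. This leaves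
two of the four terms of `linPart_fibBracket`. -/
theorem linPart_fibBracket_toExt (t : Module.End ℂ E ⊗[ℂ] L) (b : ℤ) {y : EndFib T E L}
    (hy : y ∈ endFibGr T E L (b + 1)) :
    -linPart (fibBracket (formTensor 1 (toExt t)) y) =
      ((b + 1).negOnePow • constPart y) * linPart (formTensor 1 (toExt t)) -
        linPart (formTensor 1 (toExt t)) * ((b + 1).negOnePow • constPart y) := by
  have h := linPart_fibBracket 0 b (x := formTensor 1 (toExt t))
    (by simpa using formTensor_one_toExt_mem t) hy
  rw [constPart_formTensor_toExt] at h
  simpa using h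

end EndSymPow

/-! ### Convolution powers of smooth functions. -/

section SmoothRing

variable {n : ℕ} {A : Type*} [Ring A] [Algebra ℂ A]

/-- The ring of functions that are smooth on `U`. -/
def smoothSubring (U : Set (EuclideanSpace ℂ (Fin n))) (A : Type*) [Ring A] [Algebra ℂ A] :
    Subring (EuclideanSpace ℂ (Fin n) → A) where
  carrier := {f | FinSmooth U f}
  mul_mem' hf hg := FinSpan.mul smooth_mul hf hg
  one_mem' := FinSpan.const smooth_one 1
  add_mem' hf hg := FinSpan.add _ _ hf hg
  zero_mem' := FinSpan.zero smooth_one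
  neg_mem' hf := FinSpan.neg hf

namespace smoothSubring

variable {U : Set (EuclideanSpace ℂ (Fin n))}

/-- The value at a point. -/
def eval (z : EuclideanSpace ℂ (Fin n)) : smoothSubring U A →+* A :=
  (Pi.evalRingHom _ z).comp (smoothSubring U A).subtype

open Classical in
/-- The extension by zero of a smooth function on `U`. -/
def extend (f : EuclideanSpace ℂ (Fin n) → A) (hf : FinSmooth U f) : smoothSubring U A :=
  ⟨fun z => if z ∈ U then f z else 0, hf.congr _ _ fun z hz => by simp [hz]⟩

theorem eval_extend {f : EuclideanSpace ℂ (Fin n) → A} {hf : FinSmooth U f}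
    {z : EuclideanSpace ℂ (Fin n)} (hz : z ∈ U) : eval z (extend f hf) = f z := if_pos hz

theorem eval_extend_of_notMem {f : EuclideanSpace ℂ (Fin n) → A} {hf : FinSmooth U f}
    {z : EuclideanSpace ℂ (Fin n)} (hz : z ∉ U) : eval z (extend f hf) = 0 := if_neg hz

theorem ext_eval {f g : smoothSubring U A} (h : ∀ z, eval z f = eval z g) : f = g :=
  Subtype.ext (funext h)

/-- The operator `∂̄` on functions that are smooth on `U`. -/
def dbar (hU : IsOpen U) (ε : Fin n → A) : smoothSubring U A →+ smoothSubring U A where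
  toFun f := extend (dbarLocal ε f.1) (FinSmooth.dbarLocal hU f.2 ε)
  map_zero' := ext_eval fun z => by
    by_cases hz : z ∈ U
    · rw [eval_extend hz, map_zero]
      exact FinHolo.dbarLocal_eq_zero hU hz (FinSpan.zero holo_one)
    · rw [eval_extend_of_notMem hz, map_zero]
  map_add' f g := ext_eval fun z => by
    by_cases hz : z ∈ U
    · rw [map_add, eval_extend hz, eval_extend hz, eval_extend hz]
      exact dbarLocal_add hU hz f.2 g.2
    · rw [map_add, eval_extend_of_notMem hz, eval_extend_of_notMem hz, eval_extend_of_notMem hz,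
        add_zero]

theorem eval_dbar (hU : IsOpen U) (ε : Fin n → A) (f : smoothSubring U A)
    {z : EuclideanSpace ℂ (Fin n)} (hz : z ∈ U) : eval z (dbar hU ε f) = dbarLocal ε f.1 z :=
  eval_extend (hf := FinSmooth.dbarLocal hU f.2 ε) hz

theorem eval_dbar_of_notMem (hU : IsOpen U) (ε : Fin n → A) (f : smoothSubring U A)
    {z : EuclideanSpace ℂ (Fin n)} (hz : z ∉ U) : eval z (dbar hU ε f) = 0 :=
  eval_extend_of_notMem (hf := FinSmooth.dbarLocal hU f.2 ε) hz

theorem eval_units_smul (z : EuclideanSpace ℂ (Fin n)) (u : ℤˣ) (f : smoothSubring U A) :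
    eval z (u • f) = u • eval z f := by
  rw [Units.smul_def, map_zsmul, Units.smul_def]

/-- Functions that agree at the points of `U` and vanish elsewhere. -/
theorem ext_on {f g : smoothSubring U A} (h : ∀ z ∈ U, eval z f = eval z g)
    (h' : ∀ z ∉ U, eval z f = eval z g) : f = g :=
  ext_eval fun z => (Classical.em (z ∈ U)).elim (h z) (h' z)

/-- The functions with values on `U` in a given subspace. -/
def valuesIn (U : Set (EuclideanSpace ℂ (Fin n))) (S : Submodule ℂ A) :
    AddSubgroup (smoothSubring U A) where
  carrier := {f | ∀ z ∈ U, eval z f ∈ S}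
  add_mem' hf hg z hz := by rw [map_add]; exact add_mem (hf z hz) (hg z hz)
  zero_mem' z _ := by rw [map_zero]; exact zero_mem _
  neg_mem' hf z hz := by rw [map_neg]; exact neg_mem (hf z hz)

/-- On `U` this is the local Leibniz rule. Off `U` every term contains a value extended by zero,
which makes it an identity in the ring, as the abstract convolution lemmas require. -/
theorem dbar_mul (hU : IsOpen U) {ε : Fin n → A} {f : smoothSubring U A} (s : ℤˣ)
    (hs : ∀ z ∈ U, ∀ j, ε j * eval z f = s • (eval z f * ε j)) (g : smoothSubring U A) :
    dbar hU ε (f * g) = dbar hU ε f * g + s • (f * dbar hU ε g) := by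
  refine ext_on (fun z hz => ?_) fun z hz => ?_
  · rw [map_add, eval_units_smul, map_mul (eval z), map_mul (eval z), eval_dbar _ _ _ hz, eval_dbar _ _ _ hz,
      eval_dbar _ _ _ hz]
    exact dbarLocal_mul hU hz f.2 g.2 s (hs z hz)
  · rw [map_add, eval_units_smul, map_mul (eval z), map_mul (eval z), eval_dbar_of_notMem _ _ _ hz,
      eval_dbar_of_notMem _ _ _ hz, eval_dbar_of_notMem _ _ _ hz, zero_mul, mul_zero, smul_zero,
      add_zero]

end smoothSubring

section LocalWords

open smoothSubring

variable {U : Set (EuclideanSpace ℂ (Fin n))} {α : Type*} {d : α → ℤ}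
  {t : EuclideanSpace ℂ (Fin n) → A} {M K : α → EuclideanSpace ℂ (Fin n) → A}

/-- The functions on words of smooth functions given by `shortWord`. -/
theorem eval_shortWord_extend (ht : FinSmooth U t) (hM : ∀ x, FinSmooth U (M x))
    {z : EuclideanSpace ℂ (Fin n)} (hz : z ∈ U) (w : List α) :
    eval z (shortWord (extend t ht) (fun x => extend (M x) (hM x)) w) =
      shortWord (t z) (fun x => M x z) w := by
  refine (map_shortWord (eval z : smoothSubring U A →+* A).toAddMonoidHom _ _ w).trans ?_
  congr 1
  · exact eval_extend (hf := ht) hz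
  · funext x
    exact eval_extend (hf := hM x) hz

theorem eval_convPow_extend (ht : FinSmooth U t) (hM : ∀ x, FinSmooth U (M x))
    {z : EuclideanSpace ℂ (Fin n)} (hz : z ∈ U) (k : ℕ) (w : List α) :
    eval z (convPow d (shortWord (extend t ht) fun x => extend (M x) (hM x)) k w) =
      convPow d (shortWord (t z) fun x => M x z) k w := by
  rw [map_convPow]
  congr 1
  funext u
  exact eval_shortWord_extend ht hM hz u

theorem finSmooth_convPow (ht : FinSmooth U t) (hM : ∀ x, FinSmooth U (M x)) (k : ℕ) (w : List α) :
    FinSmooth U fun z => convPow d (shortWord (t z) fun x => M x z) k w :=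
  FinSpan.congr _ _ (convPow d (shortWord (extend t ht) fun x => extend (M x) (hM x)) k w).2
    fun _ hz => (eval_convPow_extend ht hM hz k w).symm

/-- The trace of a convolution power of smooth functions intertwines the operation `op` on words
with `∂̄`. -/
theorem conv_trace_convPow_of_smooth {C : Type*} [AddCommGroup C] (hU : IsOpen U) {ε : Fin n → A}
    (gr : ℤ → Submodule ℂ A) (h1 : (1 : A) ∈ gr 0)
    (hmul : ∀ i j, ∀ x ∈ gr i, ∀ y ∈ gr j, x * y ∈ gr (i + j))
    (hε : ∀ i, ∀ x ∈ gr i, ∀ j, ε j * x = i.negOnePow • (x * ε j))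
    (op : List α → α) (hop : ∀ u, d (op u) = wdeg d u + 1) (ht : FinHolo U t)
    (hM : ∀ x, FinSmooth U (M x)) (hK : ∀ x, FinSmooth U (K x)) (htg : ∀ z ∈ U, t z ∈ gr 0)
    (hMg : ∀ x, ∀ z ∈ U, M x z ∈ gr (d x)) (hKg : ∀ x, ∀ z ∈ U, K x z ∈ gr (d x + 1))
    (hop0 : ∀ z ∈ U, M (op []) z = 0)
    (hop1 : ∀ x, ∀ z ∈ U, M (op [x]) z = -dbarLocal ε (M x) z + K x z * t z - t z * K x z)
    (hop2 : ∀ x y, ∀ z ∈ U, M (op [x, y]) z = K x z * M y z +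
      (d x * d y).negOnePow • (K y z * M x z) - (d x).negOnePow • (M x z * K y z) -
      (d x * d y + d y).negOnePow • (M y z * K x z))
    (hop3 : ∀ x y y' w, ∀ z ∈ U, M (op (x :: y :: y' :: w)) z = 0)
    (tr : A →+ C) (htr : ∀ i j, ∀ x ∈ gr i, ∀ y ∈ gr j, tr (x * y) = (i * j).negOnePow • tr (y * x))
    (k : ℕ) (w : List α) {z : EuclideanSpace ℂ (Fin n)} (hz : z ∈ U) :
    conv d (fun u v => tr (convPow d (shortWord (t z) fun x => M x z) k (op u :: v))) w =
      -tr (dbarLocal ε (fun y => convPow d (shortWord (t y) fun x => M x y) k w) z) := by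
  have ht' := ht.finSmooth hU
  have hw : ∀ (t : EuclideanSpace ℂ (Fin n) → A) (M : α → EuclideanSpace ℂ (Fin n) → A)
      (ht : FinSmooth U t) (hM : ∀ x, FinSmooth U (M x)) (e : ℤ) (_ : ∀ z ∈ U, t z ∈ gr e)
      (_ : ∀ x, ∀ z ∈ U, M x z ∈ gr (d x + e)) (w : List α),
      shortWord (extend t ht) (fun x => extend (M x) (hM x)) w ∈
        valuesIn U (gr (wdeg d w + e)) := by
    intro t M ht hM e htg hMg w z hz
    rw [eval_shortWord_extend ht hM hz]
    rcases w with _ | ⟨x, _ | ⟨y, w⟩⟩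
    · simpa [shortWord] using htg z hz
    · simpa [shortWord] using hMg x z hz
    · exact zero_mem _
  have h0 : (extend (fun _ => 0) (FinSpan.zero smooth_one) : smoothSubring U A) = 0 :=
    ext_on (fun z hz => by rw [eval_extend hz, map_zero])
      fun z hz => by rw [eval_extend_of_notMem hz, map_zero]
  -- The abstract lemma is applied in the ring of functions smooth on `U`, because `∂̄` is not
  -- defined on values at a single point; the trace is composed with evaluation at `z`.
  have key := conv_trace_convPow (d := d) (fun i => valuesIn U (gr i)) (dbar hU ε) op hop
    (m := shortWord (extend t ht') fun x => extend (M x) (hM x))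
    (a := shortWord 0 fun x => extend (K x) (hK x))
    (fun z _ => by rw [map_one]; exact h1)
    (fun i j f hf g hg z hz => by rw [map_mul]; exact hmul i j _ (hf z hz) _ (hg z hz))
    (fun w => by simpa using hw t M ht' hM 0 htg (by simpa using hMg) w)
    (fun w => by
      rw [← h0]
      exact hw _ K _ hK 1 (fun _ _ => zero_mem _) hKg w)
    (fun i f hf g => dbar_mul hU _ (fun z hz j => hε i _ (hf z hz) j) g)
    (conv_shortWord (dbar hU ε) op (extend t ht') (fun x => extend (M x) (hM x))
      (fun x => extend (K x) (hK x)) ?_ ?_ ?_ ?_ ?_)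
    (tr.comp (eval z : smoothSubring U A →+* A).toAddMonoidHom)
    (fun i j f hf g hg => by
      have := htr i j _ (hf z hz) _ (hg z hz)
      rwa [← map_mul, ← map_mul] at this) k w
  · refine Eq.trans ?_ (key.trans ?_)
    · refine conv_congr fun u v _ _ => ?_
      rw [← eval_convPow_extend ht' hM hz]
      rfl
    · refine congrArg (fun c => -tr c) ((eval_dbar hU _ _ hz).trans ?_)
      exact dbarLocal_congr_on hU hz fun y hy => eval_convPow_extend ht' hM hy k w
  · refine ext_on (fun z hz => ?_) fun z hz => ?_
    · rw [eval_dbar _ _ _ hz, map_zero]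
      refine FinHolo.dbarLocal_eq_zero hU hz (ht.congr _ _ fun y hy => ?_)
      exact eval_extend (hf := ht') hy
    · rw [eval_dbar_of_notMem _ _ _ hz, map_zero]
  · refine ext_on (fun z hz => ?_) fun z hz => ?_
    · rw [eval_extend hz, map_zero, hop0 z hz]
    · rw [eval_extend_of_notMem hz, map_zero]
  · refine fun x => ext_on (fun z hz => ?_) fun z hz => ?_
    · rw [map_sub, map_add, map_neg, map_mul, map_mul, eval_dbar _ _ _ hz, eval_extend hz,
        eval_extend hz, eval_extend hz, hop1 x z hz]
      congr 3
      exact dbarLocal_congr_on hU hz fun y hy => (eval_extend (hf := hM x) hy).symm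
    · rw [map_sub, map_add, map_neg, map_mul, map_mul, eval_dbar_of_notMem _ _ _ hz,
        eval_extend_of_notMem hz, eval_extend_of_notMem hz, zero_mul, mul_zero]
      simp
  · refine fun x y => ext_on (fun z hz => ?_) fun z hz => ?_
    · simp only [map_sub, map_add, map_mul, eval_units_smul]
      simp only [eval_extend hz]
      exact hop2 x y z hz
    · simp only [map_sub, map_add, map_mul, eval_units_smul, eval_extend_of_notMem hz]
      simp
  · refine fun x y y' w => ext_on (fun z hz => ?_) fun z hz => ?_
    · rw [eval_extend hz, map_zero, hop3 x y y' w z hz]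
    · rw [eval_extend_of_notMem hz, map_zero]

end LocalWords

end SmoothRing

set_option linter.unusedSectionVars false

/-! ### Traces of words of forms, pointwise and in local frames. -/

section HitchinMaps

variable {n : ℕ} {X : Type*} [TopologicalSpace X] [ChartedSpace (EuclideanSpace ℂ (Fin n)) X]
  [IsManifold 𝓘(ℂ, EuclideanSpace ℂ (Fin n)) ω X]
variable (FE : Type*) [NormedAddCommGroup FE] [NormedSpace ℂ FE] [FiniteDimensional ℂ FE]
  {E : X → Type*} [∀ x, AddCommGroup (E x)] [∀ x, Module ℂ (E x)]
  [TopologicalSpace (Bundle.TotalSpace FE E)] [∀ x, TopologicalSpace (E x)] [FiberBundle FE E]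
  [VectorBundle ℂ FE E] [ContMDiffVectorBundle ω FE E 𝓘(ℂ, EuclideanSpace ℂ (Fin n))]
variable (FL : Type*) [NormedAddCommGroup FL] [NormedSpace ℂ FL] [FiniteDimensional ℂ FL]
  {L : X → Type*} [∀ x, AddCommGroup (L x)] [∀ x, Module ℂ (L x)]
  [TopologicalSpace (Bundle.TotalSpace FL L)] [∀ x, TopologicalSpace (L x)] [FiberBundle FL L]
  [VectorBundle ℂ FL L] [ContMDiffVectorBundle ω FL L 𝓘(ℂ, EuclideanSpace ℂ (Fin n))]

theorem eq_of_symLocal_chart_eq {α β : ∀ x, SymFib (TSpace n x) (L x)} {x : X}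
    (h : symLocal FL α x (chartAt (EuclideanSpace ℂ (Fin n)) x x) =
      symLocal FL β x (chartAt (EuclideanSpace ℂ (Fin n)) x x)) : α x = β x := by
  refine symLocal_chart_induction (n := n) (C := fun x a => a = β x) ?_
  rw [symLocal, symLocal] at h
  rw [← symFibMap_symm_apply' (trivT n x (pt n x (chartAt (EuclideanSpace ℂ (Fin n)) x x)))
    (triv FL L x _) (α _), h, symFibMap_symm_apply']

/-- Smoothness of the local expressions only has to be checked where a second bundle is also
trivialized. -/
theorem smoothOn_symLocal {β : ∀ x, SymFib (TSpace n x) (L x)}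
    (h : ∀ x₁, FinSmooth (endDomain n FE E FL L x₁) (symLocal FL β x₁)) (x₀ : X) :
    SmoothOn (symLocal FL β x₀) (localDomain n FL L x₀) := by
  intro φ z hz
  have hz' : z ∈ transDomain n FL L x₀ (pt n x₀ z) := mem_transDomain_self hz
  -- Near `z` the expression is compared with the one in the chart and frames at the point itself,
  -- where `E` is trivialized too and `h` applies.
  generalize hx₁ : pt n x₀ z = x₁ at hz'
  let U' : Set (EuclideanSpace ℂ (Fin n)) := transDomain n FL L x₀ x₁ ∩
    ((chartAt (EuclideanSpace ℂ (Fin n)) x₀).target ∩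
      (chartAt (EuclideanSpace ℂ (Fin n)) x₀).symm ⁻¹' (trivializationAt FE E x₁).baseSet)
  have hU' : IsOpen U' := (isOpen_transDomain FL L x₀ x₁).inter
    ((chartAt _ x₀).isOpen_inter_preimage_symm (trivializationAt FE E x₁).open_baseSet)
  have hzU : z ∈ U' := by
    refine ⟨hz', hz.1, ?_⟩
    rw [← hx₁]
    exact FiberBundle.mem_baseSet_trivializationAt FE E _
  have hχ : DifferentiableOn ℂ (transMap n x₀ x₁) U' :=
    (transMap_differentiableOn FL).mono Set.inter_subset_left
  have heT : ∀ z ∈ U', ∀ j, conjDualMap (tangentChange x₀ x₁ (pt n x₀ z)) (dzBar j) =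
        ∑ k, conjJacobian (transMap n x₀ x₁) j k z • dzBar k := fun z hz =>
    conjDualMap_tangentChange_on FL z hz.1
  have hL : FinHolo U' (fun z => (frameChange FL L x₀ x₁ (pt n x₀ z)).toLinearMap) :=
    FinSpan.mono (fun _ h => h.mono Set.inter_subset_left) Set.inter_subset_left
      (finHolo_frameChange x₀ x₁)
  have hclosed := symFibMap_closed (eT := fun z => tangentChange x₀ x₁ (pt n x₀ z))
    (eL := fun z => frameChange FL L x₀ x₁ (pt n x₀ z)) hU' hχ heT hL
  have hmaps : Set.MapsTo (transMap n x₀ x₁) U' (endDomain n FE E FL L x₁) := by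
    intro y hy
    have h1 := transMap_mem hy.1
    refine ⟨⟨h1.1, ?_⟩, h1⟩
    have h2 := pt_transMap hy.1
    rw [Set.mem_preimage]
    rw [pt, pt] at h2
    rw [h2]
    exact hy.2.2
  have key := (dbarLocal_coordChange (ε := symDzBar n FL) (ε' := symDzBar n FL)
    (G := fun z => symFibMap (tangentChange x₀ x₁ (pt n x₀ z))
      (frameChange FL L x₀ x₁ (pt n x₀ z)))
    (isOpen_endDomain (n := n) FE (E := E) FL (L := L) x₁) hU' hχ hmaps
    (fun z hz j w => symFibMap_covector_mul (eT := fun z => tangentChange x₀ x₁ (pt n x₀ z))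
      (eL := fun z => frameChange FL L x₀ x₁ (pt n x₀ z)) heT hz j w) hclosed (h x₁)).1
  have h2 : FinSmooth U' (symLocal FL β x₀) := key.congr _ _ fun y hy => symLocal_eq FL β hy.1
  exact ((h2.smoothOn φ).contDiffAt (hU'.mem_nhds hzU)).contDiffWithinAt

variable {FE FL}

/-- The value of a form at a point. -/
def EndForms.evalAt (x : X) :
    EndForms (n := n) FE E FL L →ₗ[ℂ] EndFib (TSpace n x) (E x) (L x) where
  toFun α := α.1 x
  map_add' _ _ := rfl
  map_smul' _ _ := rfl

/-- The letters of the words of forms. -/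
abbrev FormLetter (n : ℕ) {X : Type*} [TopologicalSpace X]
    [ChartedSpace (EuclideanSpace ℂ (Fin n)) X] [IsManifold 𝓘(ℂ, EuclideanSpace ℂ (Fin n)) ω X]
    (FE : Type*) [NormedAddCommGroup FE] [NormedSpace ℂ FE]
    (E : X → Type*) [∀ x, AddCommGroup (E x)] [∀ x, Module ℂ (E x)]
    [TopologicalSpace (Bundle.TotalSpace FE E)] [∀ x, TopologicalSpace (E x)] [FiberBundle FE E]
    [VectorBundle ℂ FE E]
    (FL : Type*) [NormedAddCommGroup FL] [NormedSpace ℂ FL]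
    (L : X → Type*) [∀ x, AddCommGroup (L x)] [∀ x, Module ℂ (L x)]
    [TopologicalSpace (Bundle.TotalSpace FL L)] [∀ x, TopologicalSpace (L x)] [FiberBundle FL L]
    [VectorBundle ℂ FL L] : Type _ :=
  Letter (shiftGr (endFormsGr (n := n) (FE := FE) (E := E) (FL := FL) (L := L)))

/-- The degree of a letter in the shifted grading. -/
abbrev formDeg (x : FormLetter n FE E FL L) : ℤ := x.1

variable (θ : ∀ x, Module.End ℂ (E x) ⊗[ℂ] L x)

/-- The value at `x` of the multilinear extension of the trace of the `k`-th power. -/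
def traceWordAt (k : ℕ) (w : List (FormLetter n FE E FL L)) (x : X) : SymFib (TSpace n x) (L x) :=
  endSymTrace (convPow formDeg (shortWord (linPart (higgsForm (n := n) θ x))
    fun v : FormLetter n FE E FL L => linPart (EndForms.evalAt x (lval v))) k w)

theorem isSymWordFun_traceWordAt (k : ℕ) (x : X) :
    IsSymWordFun fun w : List (FormLetter n FE E FL L) => traceWordAt θ k w x :=
  ((isSymWordFun_shortWord (linPart (higgsForm θ x))
    (linPart ∘ₗ EndForms.evalAt x)).convPow k).map endSymTrace

theorem traceWordAt_mem_pow (k : ℕ) (w : List (FormLetter n FE E FL L)) (x : X) :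
    traceWordAt θ k w x ∈ symFibPow (TSpace n x) (L x) k := by
  refine endSymTrace_mem_pow ?_
  refine convPow_mem_pow (fun k => (endSymPow (TSpace n x) (E x) (L x) k).toAddSubgroup)
    endSymPow_one_mem endSymPow_mul_mem (fun w => ?_) k w
  rcases w with _ | ⟨y, _ | ⟨z, w⟩⟩
  exacts [linPart_mem_pow _, linPart_mem_pow _, zero_mem _]

theorem linPart_higgsForm_mem (x : X) :
    linPart (higgsForm (n := n) θ x) ∈ endSymGr (TSpace n x) (E x) (L x) 0 :=
  linPart_mem (m := 1) (formTensor_one_toExt_mem (θ x))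

/-- The linear part lowers the degree by one, so a letter of shifted degree `y.1` contributes a form
of exactly that degree, and `θ` contributes one of degree zero. -/
theorem traceWordAt_mem_gr (k : ℕ) (w : List (FormLetter n FE E FL L)) (x : X) :
    traceWordAt θ k w x ∈ symFibGr (TSpace n x) (L x) (wdeg formDeg w) := by
  refine endSymTrace_mem ?_
  refine convPow_mem (fun m => (endSymGr (TSpace n x) (E x) (L x) m).toAddSubgroup)
    endSymGr_one_mem endSymGr_mul_mem (fun w => ?_) k w
  rcases w with _ | ⟨y, _ | ⟨z, w⟩⟩
  · exact linPart_higgsForm_mem θ x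
  · have h := linPart_mem (m := y.1 + 1) (y.2.2 x)
    rw [add_sub_cancel_right] at h
    rw [show wdeg formDeg [y] = y.1 by simp [wdeg]]
    exact h
  · exact zero_mem _

/-- The local expression of `traceWordAt`. -/
theorem symLocal_traceWordAt (k : ℕ) (w : List (FormLetter n FE E FL L)) (x₀ : X)
    (z : EuclideanSpace ℂ (Fin n)) : symLocal FL (traceWordAt θ k w) x₀ z =
      endSymTrace (convPow formDeg (shortWord (linPart (endLocal FE FL L (higgsForm θ) x₀ z))
        fun v : FormLetter n FE E FL L => linPart (endLocal FE FL L (lval v).1 x₀ z)) k w) := by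
  rw [symLocal, traceWordAt, ← endSymTrace_endSymMap _ (triv FE E x₀ (pt n x₀ z))]
  have h := map_convPow (d := (formDeg : FormLetter n FE E FL L → ℤ))
    (m := shortWord (linPart (higgsForm (n := n) θ (pt n x₀ z)))
      fun v : FormLetter n FE E FL L => linPart (EndForms.evalAt (pt n x₀ z) (lval v)))
    (endSymMap (trivT n x₀ (pt n x₀ z)) (triv FE E x₀ (pt n x₀ z))
      (triv FL L x₀ (pt n x₀ z))).toRingHom k w
  refine congrArg endSymTrace (h.trans ?_)
  congr 1
  funext u
  refine (map_shortWord (AddMonoidHomClass.toAddMonoidHom (endSymMap (trivT n x₀ (pt n x₀ z))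
    (triv FE E x₀ (pt n x₀ z)) (triv FL L x₀ (pt n x₀ z)))) _ _ u).trans ?_
  congr 1
  · exact (linPart_endFibMap _ _ _ _).symm
  · funext v
    exact (linPart_endFibMap _ _ _ _).symm

end HitchinMaps

set_option linter.unusedSectionVars false

/-! ### The key identity for words of forms. -/

section HitchinMaps

variable {n : ℕ} {X : Type*} [TopologicalSpace X] [ChartedSpace (EuclideanSpace ℂ (Fin n)) X]
  [IsManifold 𝓘(ℂ, EuclideanSpace ℂ (Fin n)) ω X]
variable (FE : Type*) [NormedAddCommGroup FE] [NormedSpace ℂ FE] [FiniteDimensional ℂ FE]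
  {E : X → Type*} [∀ x, AddCommGroup (E x)] [∀ x, Module ℂ (E x)]
  [TopologicalSpace (Bundle.TotalSpace FE E)] [∀ x, TopologicalSpace (E x)] [FiberBundle FE E]
  [VectorBundle ℂ FE E] [ContMDiffVectorBundle ω FE E 𝓘(ℂ, EuclideanSpace ℂ (Fin n))]
variable (FL : Type*) [NormedAddCommGroup FL] [NormedSpace ℂ FL] [FiniteDimensional ℂ FL]
  {L : X → Type*} [∀ x, AddCommGroup (L x)] [∀ x, Module ℂ (L x)]
  [TopologicalSpace (Bundle.TotalSpace FL L)] [∀ x, TopologicalSpace (L x)] [FiberBundle FL L]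
  [VectorBundle ℂ FL L] [ContMDiffVectorBundle ω FL L 𝓘(ℂ, EuclideanSpace ℂ (Fin n))]

variable {FE FL} {θ : ∀ x, Module.End ℂ (E x) ⊗[ℂ] L x}

/-- The covectors `dz̄_j` in the algebra `EndSym`. -/
abbrev endSymDzBar (n : ℕ) (FE FL : Type*) [NormedAddCommGroup FE] [NormedSpace ℂ FE]
    [NormedAddCommGroup FL] [NormedSpace ℂ FL] (j : Fin n) :
    EndSym (EuclideanSpace ℂ (Fin n)) FE FL := 1 ⊗ₜ symDzBar n FL j

section LocalWords

variable {x₀ : X} {z : EuclideanSpace ℂ (Fin n)}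

theorem endLocal_zero {α : EndForms (n := n) FE E FL L} (hα : α = 0) :
    endLocal FE FL L α.1 x₀ z = 0 := by
  rw [hα]
  exact map_zero (endFibMap _ _ _)

variable (hθ : IsHitchinPair n FE FL θ)

/-- The base relation in length one: `linPart` commutes with `∂̄`, and the bracket with `θ` sees
only the part of the form in `End E`. -/
theorem linPart_endLocal_neg_hitchinDForm {b : ℤ} {α β : EndForms (n := n) FE E FL L}
    (hα : α ∈ endFormsGr (b + 1)) (hβ : β = -hitchinDForm hθ α)
    (hz : z ∈ endDomain n FE E FL L x₀) :
    linPart (endLocal FE FL L β.1 x₀ z) =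
      -dbarLocal (endSymDzBar n FE FL) (fun y => linPart (endLocal FE FL L α.1 x₀ y)) z +
      ((b + 1).negOnePow • constPart (endLocal FE FL L α.1 x₀ z)) *
        linPart (endLocal FE FL L (higgsForm θ) x₀ z) -
      linPart (endLocal FE FL L (higgsForm θ) x₀ z) *
        ((b + 1).negOnePow • constPart (endLocal FE FL L α.1 x₀ z)) := by
  have h1 : endLocal FE FL L β.1 x₀ z = -endLocal FE FL L (hitchinDForm hθ α).1 x₀ z := by
    rw [hβ]
    exact map_neg (endFibMap _ _ _) _
  have h2 := dbarLocal_map (ε := endDzBar n FE FL) (ε' := endSymDzBar n FE FL)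
    (isOpen_endDomain FE FL x₀) hz (α.finSmooth FE FL x₀) linPart
    fun j w => linPart_covector_mul (dzBar j) w
  have h3 := linPart_fibBracket_toExt (higgsLocal FE FL θ x₀ z) b
    (y := endLocal FE FL L α.1 x₀ z) (endFibMap_mem _ _ _ (hα _))
  rw [← endLocal_higgsForm] at h3
  rw [h2, add_sub_assoc, ← h3, h1, endLocal_hitchinDForm hθ α hz, twistedDbar, map_neg, map_add,
    neg_add]

theorem linPart_endLocal_bracket {a b : ℤ} {α β γ : EndForms (n := n) FE E FL L}
    (hα : α ∈ endFormsGr (a + 1)) (hβ : β ∈ endFormsGr (b + 1))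
    (hγ : γ = (((a + 1).negOnePow : ℤ) : ℂ) • endFormsBracket FE E FL L α β) :
    linPart (endLocal FE FL L γ.1 x₀ z) =
      ((a + 1).negOnePow • constPart (endLocal FE FL L α.1 x₀ z)) *
          linPart (endLocal FE FL L β.1 x₀ z) +
        (a * b).negOnePow • (((b + 1).negOnePow • constPart (endLocal FE FL L β.1 x₀ z)) *
          linPart (endLocal FE FL L α.1 x₀ z)) -
        a.negOnePow • (linPart (endLocal FE FL L α.1 x₀ z) *
          ((b + 1).negOnePow • constPart (endLocal FE FL L β.1 x₀ z))) -
        (a * b + b).negOnePow • (linPart (endLocal FE FL L β.1 x₀ z) *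
          ((a + 1).negOnePow • constPart (endLocal FE FL L α.1 x₀ z))) := by
  have h := linPart_fibBracket a b (x := endLocal FE FL L α.1 x₀ z)
    (y := endLocal FE FL L β.1 x₀ z) (endFibMap_mem _ _ _ (hα _)) (endFibMap_mem _ _ _ (hβ _))
  rw [← h, hγ, endLocal_smul, endLocal_bracket, map_smul, negOnePow_smul_eq_cast]

/-- The operation on words given by the `L∞`-brackets. -/
abbrev hitchinOp (w : List (FormLetter n FE E FL L)) : FormLetter n FE E FL L :=
  opLetter (evalWord₀ (hitchinDGLA hθ).lInfty) 1 (hitchinDGLA hθ).evalWord₀_lInfty_mem w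

/-- Everything is transported to the frames at `x₀`, where `conv_trace_convPow_of_smooth` applies
with the linear parts in the role of `M`; the trace then commutes with `∂̄` because covectors do not
act on `E`. -/
theorem conv_traceWord_local (k : ℕ) (w : List (FormLetter n FE E FL L))
    (hz : z ∈ endDomain n FE E FL L x₀) :
    conv formDeg (fun u v => symLocal FL (traceWordAt θ k (hitchinOp hθ u :: v)) x₀ z) w =
      -dbarLocal (symDzBar n FL) (symLocal FL (traceWordAt θ k w) x₀) z := by
  have hU := isOpen_endDomain (n := n) FE (E := E) FL (L := L) x₀
  have hM : ∀ x : FormLetter n FE E FL L, FinSmooth (endDomain n FE E FL L x₀)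
      fun z => linPart (endLocal FE FL L (lval x).1 x₀ z) := fun x =>
    FinSpan.map ((lval x).finSmooth FE FL x₀) linPart
  have ht : FinHolo (endDomain n FE E FL L x₀)
      fun z => linPart (endLocal FE FL L (higgsForm θ) x₀ z) := (hθ.finHolo x₀).map linPart
  have h0 : ∀ (f : EndForms (n := n) FE E FL L), f = 0 → ∀ z : EuclideanSpace ℂ (Fin n),
      linPart (endLocal FE FL L f.1 x₀ z) = 0 := fun f hf z => by rw [endLocal_zero hf, map_zero]
  have key := conv_trace_convPow_of_smooth (d := (formDeg : FormLetter n FE E FL L → ℤ)) hU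
    (ε := endSymDzBar n FE FL)
    (t := fun z => linPart (endLocal FE FL L (higgsForm θ) x₀ z))
    (M := fun x z => linPart (endLocal FE FL L (lval x).1 x₀ z))
    -- The sign is that of the unshifted degree of the letter, as in the binary `L∞`-bracket.
    (K := fun x z => (x.1 + 1).negOnePow • constPart (endLocal FE FL L (lval x).1 x₀ z))
    (endSymGr (EuclideanSpace ℂ (Fin n)) FE FL) endSymGr_one_mem endSymGr_mul_mem
    (fun i x hx j => endSym_covector_mul_comm (dzBar j) hx) (hitchinOp hθ) (fun u => rfl) ht hM
    (fun x => ?_) (fun z _ => ?_) (fun x z _ => ?_) (fun x z _ => ?_)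
    (fun z _ => h0 _ (evalWord₀_nil (hitchinDGLA hθ).lInfty) z)
    (fun x z hz => linPart_endLocal_neg_hitchinDForm hθ (b := x.1) (α := lval x) x.2.2
      ((hitchinDGLA hθ).evalWord₀_lInfty_one x) hz)
    (fun x y z _ => linPart_endLocal_bracket (a := x.1) (b := y.1) (α := lval x) (β := lval y)
      x.2.2 y.2.2 (((hitchinDGLA hθ).evalWord₀_lInfty_two x y).trans (negOnePow_smul_eq_cast _ _)))
    (fun x y y' w z _ => h0 _ ((hitchinDGLA hθ).evalWord₀_lInfty_of_three_le
      (x :: y :: y' :: w) (Nat.le_add_left 3 w.length)) z)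
    (endSymTrace (T := EuclideanSpace ℂ (Fin n)) (E := FE) (L := FL)).toAddMonoidHom
    (fun i j x hx y hy => endSymTrace_mul_comm i j hx hy) k w hz
  · refine Eq.trans (conv_congr fun u v _ _ => symLocal_traceWordAt θ k _ x₀ z)
      (key.trans (congrArg Neg.neg ?_))
    have h2 := dbarLocal_map (ε := endSymDzBar n FE FL) (ε' := symDzBar n FL) hU hz
      (finSmooth_convPow (d := (formDeg : FormLetter n FE E FL L → ℤ)) (ht.finSmooth hU) hM k w)
      endSymTrace fun j w => endSymTrace_covector_mul (dzBar j) w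
    rw [funext (symLocal_traceWordAt θ k w x₀), h2]
    rfl
  · have h : FinSmooth (endDomain n FE E FL L x₀)
        fun z => (((x.1 + 1).negOnePow : ℤ) : ℂ) • constPart (endLocal FE FL L (lval x).1 x₀ z) :=
      FinSpan.map ((lval x).finSmooth FE FL x₀) ((((x.1 + 1).negOnePow : ℤ) : ℂ) • constPart)
    exact h.congr _ _ fun z _ => negOnePow_smul_eq_cast _ _
  · exact linPart_mem (m := 1) (endLocal_higgsForm_mem FE FL x₀ z)
  · have h := linPart_mem (m := x.1 + 1) (endFibMap_mem (trivT n x₀ (pt n x₀ z))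
      (triv FE E x₀ (pt n x₀ z)) (triv FL L x₀ (pt n x₀ z)) (x.2.2 (pt n x₀ z)))
    rw [add_sub_cancel_right] at h
    exact h
  · exact DGLA.units_smul_mem _ (constPart_mem (endFibMap_mem _ _ _ (x.2.2 _)))

end LocalWords

/-- The `k`-th component of the extension of the maps to words of forms. -/
def traceWordForm (hθ : IsHitchinPair n FE FL θ) (k : ℕ) (w : List (FormLetter n FE E FL L)) :
    SymForms (n := n) FL L k :=
  ⟨traceWordAt θ k w, traceWordAt_mem_pow θ k w, smoothOn_symLocal FE FL fun x₁ => by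
    rw [funext (symLocal_traceWordAt θ k w x₁)]
    exact FinSpan.map (finSmooth_convPow
      (FinSpan.map ((hθ.finHolo x₁).finSmooth (isOpen_endDomain FE FL x₁)) linPart)
      (fun v => FinSpan.map ((lval v).finSmooth FE FL x₁) linPart) k w) endSymTrace⟩

variable (hθ : IsHitchinPair n FE FL θ)

theorem isSymWordFun_traceWordForm (k : ℕ) :
    IsSymWordFun (traceWordForm (n := n) (FE := FE) (E := E) (FL := FL) (L := L) hθ k) where
  add l r x y z hx hy h := SymForms.ext FL fun p =>
    (isSymWordFun_traceWordAt θ k p).add l r x y z hx hy h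
  smul l r c x z hx h := SymForms.ext FL fun p =>
    (isSymWordFun_traceWordAt θ k p).smul l r c x z hx h
  swap l x y r := SymForms.ext FL fun p => by
    refine ((isSymWordFun_traceWordAt θ k p).swap l x y r).trans ?_
    rw [negOnePow_smul_eq_cast, negOnePow_smul_eq_cast]
    rfl

/-- The value of a form at a point. -/
def SymForms.evalAt (k : ℕ) (x : X) : SymForms (n := n) FL L k →ₗ[ℂ] SymFib (TSpace n x) (L x) where
  toFun β := β.1 x
  map_add' _ _ := rfl
  map_smul' _ _ := rfl

/-- At each point it suffices to compare the local expressions in the chart and frames of that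
point; evaluation there is additive and commutes with `conv`. -/
theorem conv_traceWordForm (k : ℕ) (w : List (FormLetter n FE E FL L)) :
    conv formDeg (fun u v => traceWordForm hθ k (hitchinOp hθ u :: v)) w =
      -dbarSymForm FL (traceWordForm hθ k w) := by
  refine SymForms.ext FL fun x => eq_of_symLocal_chart_eq FL ?_
  have h := conv_traceWord_local hθ (x₀ := x) k w (chart_mem_endDomain FE FL x)
  have h1 : ∀ β : SymForms (n := n) FL L k, symLocal FL (-β).1 x
      (chartAt (EuclideanSpace ℂ (Fin n)) x x) =
        -symLocal FL β.1 x (chartAt (EuclideanSpace ℂ (Fin n)) x x) := fun β =>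
    map_neg (symFibMap _ _) _
  rw [h1, symLocal_dbarSymForm FL _ (chart_mem_localDomain x)]
  refine Eq.trans ?_ h
  exact map_conv (((symFibMap (trivT n x (pt n x (chartAt (EuclideanSpace ℂ (Fin n)) x x)))
    (triv FL L x (pt n x (chartAt (EuclideanSpace ℂ (Fin n)) x x)))) ∘ₗ
      SymForms.evalAt k _).toAddMonoidHom) _ w

end HitchinMaps

set_option linter.unusedSectionVars false

section WordFunctions

variable {V Z : Type*} [AddCommGroup V] [Module ℂ V] [AddCommGroup Z] [Module ℂ Z]
  {gr : ℤ → Submodule ℂ V}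

theorem evalWord₀_eq_of_sprod {f : ∀ k, SymPow gr k →ₗ[ℂ] Z} {G : List (Letter gr) → Z}
    (h : ∀ (k : ℕ) (x : Fin k → Letter gr), f k (sprod gr fun i => lval (x i)) = G (List.ofFn x))
    {w : List (Letter gr)} (hw : w ≠ []) : evalWord₀ f w = G w := by
  have h1 := evalWord₀_ofFn f (n := w.length) (by simpa using hw) w.get
  rwa [h, List.ofFn_get] at h1

end WordFunctions

/-! ### The maps `h_N` and the `L∞`-morphism. -/

section HitchinMaps

variable {n : ℕ} {X : Type*} [TopologicalSpace X] [ChartedSpace (EuclideanSpace ℂ (Fin n)) X]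
  [IsManifold 𝓘(ℂ, EuclideanSpace ℂ (Fin n)) ω X]
variable (FE : Type*) [NormedAddCommGroup FE] [NormedSpace ℂ FE] [FiniteDimensional ℂ FE]
  {E : X → Type*} [∀ x, AddCommGroup (E x)] [∀ x, Module ℂ (E x)]
  [TopologicalSpace (Bundle.TotalSpace FE E)] [∀ x, TopologicalSpace (E x)] [FiberBundle FE E]
  [VectorBundle ℂ FE E] [ContMDiffVectorBundle ω FE E 𝓘(ℂ, EuclideanSpace ℂ (Fin n))]
variable (FL : Type*) [NormedAddCommGroup FL] [NormedSpace ℂ FL] [FiniteDimensional ℂ FL]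
  {L : X → Type*} [∀ x, AddCommGroup (L x)] [∀ x, Module ℂ (L x)]
  [TopologicalSpace (Bundle.TotalSpace FL L)] [∀ x, TopologicalSpace (L x)] [FiberBundle FL L]
  [VectorBundle ℂ FL L] [ContMDiffVectorBundle ω FL L 𝓘(ℂ, EuclideanSpace ℂ (Fin n))]

variable {FE FL} {θ : ∀ x, Module.End ℂ (E x) ⊗[ℂ] L x} (hθ : IsHitchinPair n FE FL θ) (r : ℕ)

/-- The extension of the maps `h_N` to words of forms. -/
def traceWords (w : List (FormLetter n FE E FL L)) : SumSymForms n FL L r :=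
  fun k => traceWordForm hθ (k + 1) w

theorem isSymWordFun_traceWords :
    IsSymWordFun (traceWords (n := n) (FE := FE) (E := E) (FL := FL) (L := L) hθ r) where
  add l r' x y z hx hy h := funext fun k =>
    (isSymWordFun_traceWordForm hθ (k + 1)).add l r' x y z hx hy h
  smul l r' c x z hx h := funext fun k =>
    (isSymWordFun_traceWordForm hθ (k + 1)).smul l r' c x z hx h
  swap l x y r' := funext fun k => (isSymWordFun_traceWordForm hθ (k + 1)).swap l x y r'

/-- The maps `h_N`. -/
def hitchinMaps (N : ℕ) : SymPow (shiftGr (hitchinDGLA hθ).gr) N →ₗ[ℂ] SumSymForms n FL L r :=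
  (exists_linearMap_symPow (DGLA.isInternal_shiftGr (hitchinDGLA hθ).isInternal)
    (isSymWordFun_traceWords hθ r) N).choose

theorem hitchinMaps_sprod (N : ℕ) (x : Fin N → FormLetter n FE E FL L) :
    hitchinMaps hθ r N (sprod (shiftGr (hitchinDGLA hθ).gr) fun i => lval (x i)) =
      traceWords hθ r (List.ofFn x) :=
  (exists_linearMap_symPow (DGLA.isInternal_shiftGr (hitchinDGLA hθ).isInternal)
    (isSymWordFun_traceWords hθ r) N).choose_spec x

theorem evalWord₀_hitchinMaps (w : List (FormLetter n FE E FL L)) (hw : w ≠ []) :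
    evalWord₀ (hitchinMaps hθ r) w = traceWords hθ r w :=
  evalWord₀_eq_of_sprod (hitchinMaps_sprod hθ r) hw

/-- The criterion for abelian targets leaves the degree of the traces and the key identity
`conv_traceWordForm`, to be checked in each component. -/
theorem isLInftyMorphism_hitchinMaps :
    IsLInftyMorphism (hitchinDGLA hθ).gr (hitchinDGLA hθ).lInfty
      (abelianTargetDGLA (n := n) (L := L) FL r).gr (abelianTargetDGLA FL r).lInfty
      (hitchinMaps hθ r) := by
  refine DGLA.isLInftyMorphism_of_abelian _ _ rfl _ (fun w => ?_) fun w => ?_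
  · rcases eq_or_ne w [] with rfl | hw
    · rw [evalWord₀_nil]
      exact zero_mem _
    · rw [evalWord₀_hitchinMaps hθ r w hw]
      intro k x
      have h := traceWordAt_mem_gr θ (k + 1) w x
      rw [show wdeg formDeg w = wdeg (ldeg (shiftGr (hitchinDGLA hθ).gr)) w + 0 + 1 - 1 by
        rw [add_zero, add_sub_cancel_right]; rfl] at h
      exact h
  · have h1 : conv (ldeg (shiftGr (hitchinDGLA hθ).gr)) (fun u v => evalWord₀ (hitchinMaps hθ r)
        (opLetter (evalWord₀ (hitchinDGLA hθ).lInfty) 1 (hitchinDGLA hθ).evalWord₀_lInfty_mem u ::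
          v)) w = conv formDeg (fun u v => traceWords hθ r (hitchinOp hθ u :: v)) w :=
      conv_congr fun u v _ _ => evalWord₀_hitchinMaps hθ r _ (List.cons_ne_nil _ _)
    rw [h1]
    -- On the empty word `traceWords` has components `tr θᵏ`, whereas `evalWord₀` is zero by
    -- convention. The left side vanishes too, since the only letter inserted is zero.
    rcases eq_or_ne w [] with rfl | hw
    · rw [evalWord₀_nil, map_zero, neg_zero]
      refine (conv_nil _).trans ?_
      exact (isSymWordFun_traceWords hθ r).eq_zero (l := [])
        (evalWord₀_nil (hitchinDGLA hθ).lInfty)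
    · rw [evalWord₀_hitchinMaps hθ r w hw]
      refine funext fun k => ?_
      refine (map_conv (LinearMap.proj (R := ℂ)
        (φ := fun k : Fin r => SymForms (n := n) FL L (k + 1)) k) _ w).trans ?_
      exact conv_traceWordForm hθ (k + 1) w

/-- The word of the homogeneous components of degrees `m i` of forms `y i`. -/
theorem traceWordAt_proj {N : ℕ} (y : Fin N → EndForms (n := n) FE E FL L) (m : Fin N → ℤ)
    (x : X) (η : Fin N → ExteriorAlgebra ℂ (ConjDual (TSpace n x)))
    (f : Fin N → Module.End ℂ (E x) ⊗[ℂ] ExteriorAlgebra ℂ (L x))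
    (hy : ∀ i, (y i).1 x = formTensor (η i) (f i)) (v : Fin N → FormLetter n FE E FL L)
    (hv : ∀ i, (v i).1 = m i - 1) (hv' : ∀ i, lval (v i) = EndForms.proj FE FL (m i) (y i))
    (k : ℕ) : traceWordAt θ k (List.ofFn v) x =
      (List.ofFn fun i => extComponent (m i - 1) (η i)).prod ⊗ₜ[ℂ]
        polarCoeff k (θ x) fun i => degreeOne (f i) := by
  have h1 : List.ofFn v = (List.ofFn id).map v := by rw [List.map_ofFn]; rfl
  rw [traceWordAt, h1, convPow_map_word]
  rw [← endSymTrace_convPow (d := fun i => formDeg (v i)) (fun i => extComponent (m i - 1) (η i))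
    (fun i => extComponent_mem (m i - 1) (η i)) (fun i => ?_) (θ x) fun i => degreeOne (f i)]
  · congr 2
    funext u
    rw [shortWord_map]
    congr 1
    · exact linPart_formTensor_toExt (θ x)
    · funext i
      rw [hv', ← linPart_gradedProj, ← hy]
      rfl
  -- For negative `m i - 1` the component is zero and its nominal degree is the absolute value,
  -- which has the right parity.
  · rw [formDeg, hv]
    rcases Int.natAbs_eq (m i - 1) with h | h
    · rw [← h, sub_self]
      exact Even.zero
    · exact ⟨((m i - 1).natAbs : ℤ), by omega⟩

/-- The maps are constructed on homogeneous forms, whereas here the forms are arbitrary. Both sides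
are multilinear, so each is expanded over the tuples of degrees in a finite set and compared
component by component. -/
theorem hitchinMaps_isHitchinMaps :
    IsHitchinMaps FE FL θ r (shiftGr (hitchinDGLA hθ).gr) (hitchinMaps hθ r) := by
  classical
  intro N hN y x η f hy k
  obtain ⟨s, hs, hs'⟩ := exists_finset_endFibGr n FE FL
  let Λ : MultilinearMap ℂ (fun _ : Fin N => EndForms (n := n) FE E FL L)
      (SymFib (TSpace n x) (L x)) :=
    (SymForms.evalAt (k + 1) x ∘ₗ LinearMap.proj k ∘ₗ hitchinMaps hθ r N ∘ₗ
      (koszulRel (shiftGr (hitchinDGLA hθ).gr) N).mkQ).compMultilinearMap (PiTensorProduct.tprod ℂ)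
  have hΛ : ∀ m : Fin N → ℤ, Λ (fun i => EndForms.proj FE FL (m i) (y i)) =
      (List.ofFn fun i => extComponent (m i - 1) (η i)).prod ⊗ₜ[ℂ]
        polarCoeff (k + 1) (θ x) fun i => degreeOne (f i) := by
    intro m
    let v : Fin N → FormLetter n FE E FL L := fun i =>
      ⟨m i - 1, EndForms.proj FE FL (m i) (y i), by
        rw [shiftGr, sub_add_cancel]
        exact fun p => gradedProj_mem _ _ _⟩
    rw [← traceWordAt_proj y m x η f hy v (fun _ => rfl) (fun _ => rfl)]
    exact congrArg (fun β : SumSymForms n FL L r => (β k).1 x) (hitchinMaps_sprod hθ r N v)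
  have h1 : Λ y = ∑ m ∈ Fintype.piFinset fun _ : Fin N => s,
      Λ (fun i => EndForms.proj FE FL (m i) (y i)) := by
    refine Eq.trans ?_ (Λ.map_sum_finset (fun i m => EndForms.proj FE FL m (y i)) fun _ => s)
    exact congrArg Λ (funext fun i => (EndForms.sum_proj FE FL hs (y i)).symm)
  -- Only the form parts `η i` are decomposed: the arguments enter through their values in `End E ⊗
  -- L`, so total degree `m i` selects form degree `m i - 1`.
  have h2 : (List.ofFn η).prod = ∑ m ∈ Fintype.piFinset fun _ : Fin N => s,
      (List.ofFn fun i => extComponent (m i - 1) (η i)).prod := by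
    have h3 := MultilinearMap.map_sum_finset (MultilinearMap.mkPiAlgebraFin ℂ N
      (ExteriorAlgebra ℂ (ConjDual (TSpace n x)))) (fun i m => extComponent (m - 1) (η i))
      (fun _ : Fin N => s)
    simp only [MultilinearMap.mkPiAlgebraFin_apply] at h3
    rw [← h3]
    congr 2
    funext i
    rw [← Finset.sum_image (f := fun m => extComponent m (η i)) (g := fun m : ℤ => m - 1)
      (fun a _ b _ hab => by simpa using hab)]
    refine (sum_extComponent (fun p hp => extGr_conjDual_eq_bot x (hs' p fun hps => hp ?_)) _).symm
    exact Finset.mem_image.2 ⟨_, hps, by ring⟩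
  refine h1.trans ?_
  rw [h2, TensorProduct.sum_tmul]
  exact Finset.sum_congr rfl fun m _ => hΛ m

end HitchinMaps

end

theorem proposition7p5 {n : ℕ} {X : Type*} [TopologicalSpace X] [T2Space X] [CompactSpace X]
    [ChartedSpace (EuclideanSpace ℂ (Fin n)) X]
    [IsManifold 𝓘(ℂ, EuclideanSpace ℂ (Fin n)) ω X]
    (FE : Type*) [NormedAddCommGroup FE] [NormedSpace ℂ FE] [FiniteDimensional ℂ FE]
    (E : X → Type*) [∀ x, AddCommGroup (E x)] [∀ x, Module ℂ (E x)]
    [TopologicalSpace (Bundle.TotalSpace FE E)] [∀ x, TopologicalSpace (E x)]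
    [FiberBundle FE E] [VectorBundle ℂ FE E]
    [ContMDiffVectorBundle ω FE E 𝓘(ℂ, EuclideanSpace ℂ (Fin n))]
    (FL : Type*) [NormedAddCommGroup FL] [NormedSpace ℂ FL] [FiniteDimensional ℂ FL]
    (L : X → Type*) [∀ x, AddCommGroup (L x)] [∀ x, Module ℂ (L x)]
    [TopologicalSpace (Bundle.TotalSpace FL L)] [∀ x, TopologicalSpace (L x)]
    [FiberBundle FL L] [VectorBundle ℂ FL L]
    [ContMDiffVectorBundle ω FL L 𝓘(ℂ, EuclideanSpace ℂ (Fin n))]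
    (r : ℕ) (hr : Module.finrank ℂ FE = r)
    (θ : ∀ x, Module.End ℂ (E x) ⊗[ℂ] L x) (hθ : IsHitchinPair n FE FL θ) :
    ∃ (𝔐 : DGLA (EndForms (n := n) FE E FL L)) (𝔑 : DGLA (SumSymForms n FL L r))
      (h : ∀ N : ℕ, SymPow (shiftGr 𝔐.gr) N →ₗ[ℂ] SumSymForms n FL L r),
      IsHitchinDGLA FE FL θ 𝔐 ∧ IsAbelianTargetDGLA FL r 𝔑 ∧
      IsHitchinMaps FE FL θ r (shiftGr 𝔐.gr) h ∧
      IsLInftyMorphism 𝔐.gr 𝔐.lInfty 𝔑.gr 𝔑.lInfty h :=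
  ⟨hitchinDGLA hθ, abelianTargetDGLA FL r, hitchinMaps hθ r, hitchinDGLA_isHitchinDGLA hθ,
    abelianTargetDGLA_isAbelianTargetDGLA FL r, hitchinMaps_isHitchinMaps hθ r,
    isLInftyMorphism_hitchinMaps hθ r⟩
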